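/- **Setting.** Consider Fuchsian systems $\frac{dY}{dx}=A(x)Y$, $A(x)=\frac{A_1}{x-u_1}+\frac{A_2}{x-u_2}$, of size $3\times3$ with $u_1=0$, $u_2=1$, where $A_i=B_iC_i^{\dagger}$, $B_i=[\mathbf b_{i,1}\ \mathbf b_{i,2}]$ is $3\times 2$, $C_i^\dagger$ is $2\times3$ with rows $\mathbf c_i^{1\dagger},\mathbf c_i^{2\dagger}$, $C_i^{\dagger}B_i=\operatorname{diag}(\theta_i^1,\theta_i^2)$, and $A_\infty=-A_1-A_2$ has eigenvalues $\kappa_1,\kappa_2,\kappa_3$; thus $\sum_{i,j}\theta_i^j+\sum_j\kappa_j=0$ and the spectral type is $111,111,111$. Write $s=(\theta_i^j;\kappa_j)$. "Generic" means: outside the zero set of a polynomial that does not vanish identically. *Transformations.* The elementary Schlesinger transformation $\left\{\begin{smallmatrix}\alpha&\beta\\ \mu&\nu\end{smallmatrix}\right\}$ ($\alpha\ne\beta$) replaces $\theta_\alpha^\mu,\theta_\beta^\nu$ by $\theta_\alpha^\mu-1,\theta_\beta^\nu+1$ and $A(x)$ by $\bar A(x)$ with $\bar A(x)R(x)=R(x)A(x)+R'(x)$,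 where $R(x)=I+\frac{u_\alpha-u_\beta}{x-u_\alpha}\,\frac{\mathbf b_{\beta,\nu}\mathbf c_\alpha^{\mu\dagger}}{\mathbf c_\alpha^{\mu\dagger}\mathbf b_{\beta,\nu}}$. The map $\Sigma_1(1,3)$ replaces $A_1$ by $A_1-\theta_1^1I$ and exchanges the first and third eigenvectors: $(\theta_1^1,\theta_1^2;\theta_2^1,\theta_2^2;\kappa_j)\mapsto(-\theta_1^1,\theta_1^2-\theta_1^1;\theta_2^1,\theta_2^2;\kappa_j+\theta_1^1)$, $\mathbf b_{1,1}\mapsto(\mathbf c_1^{1\dagger}\times\mathbf c_1^{2\dagger})^t$, $\mathbf c_1^{1\dagger}\mapsto\frac{-\theta_1^1(\mathbf b_{1,1}\times\mathbf b_{1,2})^t}{(\mathbf c_1^{1\dagger}\times\mathbf c_1^{2\dagger})(\mathbf b_{1,1}\times\mathbf b_{1,2})}$, $\mathbf c_1^{2\dagger}\mapsto\frac{\theta_1^2-\theta_1^1}{\theta_1^2}\mathbf c_1^{2\dagger}$, the other vectors being unchanged. *Coordinates.* By a similarity $B_i\mapsto PB_i$, $C_i^\dagger\mapsto C_i^\dagger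 P^{-1}$ and rescalings $B_i\mapsto B_iQ_i$, $C_i^\dagger\mapsto Q_i^{-1}C_i^\dagger$ with $Q_i$ diagonal, a generic system is brought to $$B_1=\begin{bmatrix}1&0\\0&1\\0&0\end{bmatrix},\ C_1^\dagger=\begin{bmatrix}\theta_1^1&0&\alpha\\0&\theta_1^2&\beta\end{bmatrix},\ B_2=\begin{bmatrix}0&1\\0&1\\1&1\end{bmatrix},\ C_2^\dagger=\begin{bmatrix}x-\theta_2^1&-x&\theta_2^1\\-y&y+\theta_2^2&0\end{bmatrix},$$ and its coordinates are $f=\frac{(\theta_1^1-\theta_1^2)(x-y-\theta_2^2)}{\theta_2^2-\theta_2^1}$, $g=\frac{\theta_2^2(x-\theta_2^1)-\theta_2^1y}{x-y-\theta_2^1}$. Attach to $s$ the parameters $\mathbf b(s)$: $b_j=\theta_1^2+\kappa_j$ $(j=1,2,3)$, $b_4=0$, $b_5=\theta_2^1$, $b_6=\theta_2^2$, $b_7=\theta_1^1-\theta_1^2$, $b_8=-\theta_1^2-1$. *Surfaces.* $X_{\mathbf b}$ is the blow-up of $\mathbb P^1\times\mathbb P^1$ at $(b_i,-b_i)$ $(i\le4)$,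 $(\infty,b_5)$, $(\infty,b_6)$, $(-b_7,\infty)$, $(-b_8,\infty)$, with $\operatorname{Pic}X_{\mathbf b}=\mathbb ZH_f\oplus\mathbb ZH_g\oplus\bigoplus_{i=1}^{8}\mathbb ZE_i$. It has type $A_2^{(1)*}$ if the eight points are distinct and its anticanonical divisor is unique and is a sum of three irreducible curves with intersection matrix minus the Cartan matrix of type $A_2^{(1)}$, any two of which meet only in one and the same point. Put $\delta=-K=2H_f+2H_g-\sum E_i$ and $(\alpha_0,\dots,\alpha_6)=(E_3-E_4,\,E_2-E_3,\,E_1-E_2,\,H_f-E_1-E_7,\,E_7-E_8,\,H_g-E_1-E_5,\,E_5-E_6)$, simple roots of type $E_6^{(1)}$. *Standard equation.* With $\delta_{\mathbf b}=b_1+\dots+b_8$, the standard d-$P(A_2^{(1)*})$ is the birational map $\varphi_{\mathbf b}:(f,g)\mapsto(\bar f,\bar g)$, $\bar b_i=b_i$ $(i\le4)$, $\bar b_i=b_i+\delta_{\mathbf b}$ $(i=5,6)$, $\bar b_i=b_i-\delta_{\mathbf b}$ $(i=7,8)$, $$(f+g)(\bar f+g)=\frac{\prod_{i=1}^4(g+b_i)}{(g-b_5)(g-b_6)},\qquad(\bar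 f+g)(\bar f+\bar g)=\frac{\prod_{i=1}^4(\bar f-b_i)}{(\bar f+b_7-\delta_{\mathbf b})(\bar f+b_8-\delta_{\mathbf b})}.$$ **Statement.** 1. For generic $s$, the elementary Schlesinger transformation $\left\{\begin{smallmatrix}1&2\\1&1\end{smallmatrix}\right\}$, with $s\mapsto\bar s$, is in the coordinates $(f,g)$ a birational map $\psi_s$; it lifts to an isomorphism $X_{\mathbf b(s)}\to X_{\mathbf b(\bar s)}$ of surfaces of type $A_2^{(1)*}$. Its push-forward on the Picard lattice is $H_f\mapsto 2H_f+3H_g-E_1-E_2-E_3-E_4-2E_5-2E_8$, $H_g\mapsto3H_f+5H_g-2(E_1+E_2+E_3+E_4)-3E_5-E_6-2E_8$, $E_i\mapsto H_f+2H_g-\sum_{j\le4,j\ne i}E_j-E_5-E_8$ $(i\le4)$, $E_5\mapsto E_7$, $E_6\mapsto2H_f+2H_g-\sum_{j\le4}E_j-2E_5-E_8$, $E_7\mapsto2H_f+3H_g-\sum_{j\le4}E_j-2E_5-E_6-2E_8$, $E_8\mapsto H_g-E_5$; it acts on the roots by the translation $\alpha\mapsto\alpha+(0,0,0,-1,1,1,-1)\delta$.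 2. For every $s$ one has $\delta_{\mathbf b(s)}=-1$, and the composition $$\Sigma_1(1,3)\circ\left\{\begin{smallmatrix}2&1\\2&1\end{smallmatrix}\right\}\circ\Sigma_1(1,3)\circ\left\{\begin{smallmatrix}2&1\\1&1\end{smallmatrix}\right\}$$ sends $\mathbf b(s)$ to $\bar{\mathbf b}(s)$. For generic $s$ this composition is, in the coordinates $(f,g)$, the standard map $\varphi_{\mathbf b(s)}$; it lifts to an isomorphism $X_{\mathbf b(s)}\to X_{\bar{\mathbf b}(s)}$ with push-forward $H_f\mapsto6H_f+3H_g-2(E_1+E_2+E_3+E_4)-E_5-E_6-3E_7-3E_8$, $H_g\mapsto3H_f+H_g-\sum_{j\le4}E_j-E_7-E_8$, $E_i\mapsto2H_f+H_g-\sum_{j\le4,j\ne i}E_j-E_7-E_8$ $(i\le4)$, $E_5\mapsto3H_f+H_g-\sum_{j\le4}E_j-E_6-E_7-E_8$, $E_6\mapsto3H_f+H_g-\sum_{j\le4}E_j-E_5-E_7-E_8$, $E_7\mapsto H_f-E_8$, $E_8\mapsto H_f-E_7$; it acts on the roots by the translation $\alpha\mapsto\alpha+(0,0,0,1,0,-1,0)\delta$.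 3. The two dynamics are translations in different directions, and are not equivalent over the common parameters $s$: for no $m,n\ge1$ is there a family of birational changes of coordinates $\chi_s$ of the $(f,g)$-plane, depending on $s$ and leaving $s$ fixed, that conjugates the $m$-th iterate of $\left\{\begin{smallmatrix}1&2\\1&1\end{smallmatrix}\right\}$ to the $n$-th iterate of the standard dynamics, for generic $s$. -/

import Mathlib

open scoped BigOperators Matrix

noncomputable section

namespace SchlesingerA2

/-! ### Fuchsian systems of spectral type 111,111,111 with poles `0`, `1`, `∞` -/

/-- Characteristic indices: the nonzero eigenvalues `θ i j` of the residues at the two finite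
poles (the third eigenvalue is `0`) and the eigenvalues `κ j` of the residue at infinity. -/
structure RiemannScheme where
  θ : Fin 2 → Fin 2 → ℂ
  κ : Fin 3 → ℂ
  fuchs : ∑ i, ∑ j, θ i j + ∑ j, κ j = 0

/-- All seven characteristic indices as one tuple. -/
def RiemannScheme.indices (s : RiemannScheme) : (Fin 2 × Fin 2) ⊕ Fin 3 → ℂ :=
  Sum.elim (fun ij => s.θ ij.1 ij.2) s.κ

/-- `Q` holds on a nonempty Zariski open subset of the hyperplane of Riemann schemes. -/
def ForGenericScheme (Q : RiemannScheme → Prop) : Prop :=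
  ∃ P : MvPolynomial ((Fin 2 × Fin 2) ⊕ Fin 3) ℂ,
    (∃ s : RiemannScheme, MvPolynomial.eval s.indices P ≠ 0) ∧
    ∀ s : RiemannScheme, MvPolynomial.eval s.indices P ≠ 0 → Q s

/-- A point of the decomposition space: column `j` of `B i` is the right eigenvector `b_{i,j}`,
row `j` of `C i` is the left eigenvector `c_i^j`. -/
structure Decomposition where
  B : Fin 2 → Matrix (Fin 3) (Fin 2) ℂ
  C : Fin 2 → Matrix (Fin 2) (Fin 3) ℂ

/-- Residue matrix at the `i`-th finite pole. -/
def Decomposition.residue (p : Decomposition) (i : Fin 2) : Matrix (Fin 3) (Fin 3) ℂ :=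
  p.B i * p.C i

/-- Residue matrix at infinity. -/
def Decomposition.residueInfty (p : Decomposition) : Matrix (Fin 3) (Fin 3) ℂ :=
  -∑ i, p.residue i

/-- The point `p` has characteristic indices `s`. -/
def Decomposition.IsOver (s : RiemannScheme) (p : Decomposition) : Prop :=
  (∀ i, p.C i * p.B i = Matrix.diagonal (s.θ i)) ∧
    p.residueInfty.charpoly = ∏ j, (Polynomial.X - Polynomial.C (s.κ j))

/-- The finite poles `u₁ = 0`, `u₂ = 1`. -/
def pole : Fin 2 → ℂ := ![0, 1]

/-- The coefficient matrix `A(x) = A₁ / (x - u₁) + A₂ / (x - u₂)`. -/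
def Decomposition.system (p : Decomposition) (x : ℂ) : Matrix (Fin 3) (Fin 3) ℂ :=
  ∑ i, (x - pole i)⁻¹ • p.residue i

/-- Similarity transformations combined with trivial transformations. -/
def GaugeEquivalent (p q : Decomposition) : Prop :=
  ∃ (P : GL (Fin 3) ℂ) (D : Fin 2 → Fin 2 → ℂˣ), ∀ i,
    q.B i = (P : Matrix (Fin 3) (Fin 3) ℂ) * p.B i * Matrix.diagonal (fun j => (D i j : ℂ)) ∧
    q.C i = Matrix.diagonal (fun j => ((D i j)⁻¹ : ℂ)) * p.C i *
      ((P⁻¹ : GL (Fin 3) ℂ) : Matrix (Fin 3) (Fin 3) ℂ)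

/-- The normal form: `b_{1,1}, b_{1,2}, b_{2,1}` are the standard basis vectors and all components
of `b_{2,2}` are `1`. -/
def normalForm (s : RiemannScheme) (x y α β : ℂ) : Decomposition where
  B := ![!![1, 0; 0, 1; 0, 0], !![0, 1; 0, 1; 1, 1]]
  C := ![!![s.θ 0 0, 0, α; 0, s.θ 0 1, β],
    !![x - s.θ 1 0, -x, s.θ 1 0; -y, y + s.θ 1 1, 0]]

/-- The accessory parameters of `p` are `(f, g) = (a, b)`. -/
def HasCoordinates (s : RiemannScheme) (p : Decomposition) (a b : ℂ) : Prop :=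
  ∃ x y α β : ℂ, GaugeEquivalent p (normalForm s x y α β) ∧
    s.θ 1 1 - s.θ 1 0 ≠ 0 ∧ x - y - s.θ 1 0 ≠ 0 ∧
    a = (s.θ 0 0 - s.θ 0 1) * (x - y - s.θ 1 1) / (s.θ 1 1 - s.θ 1 0) ∧
    b = (s.θ 1 1 * (x - s.θ 1 0) - s.θ 1 0 * y) / (x - y - s.θ 1 0)

/-! ### Transformations of Fuchsian systems -/

/-- A transformation of Fuchsian systems: its action on Riemann schemes, and its graph between
the decomposition points over `s` and those over `target s`. -/
structure Transformation where
  target : RiemannScheme → RiemannScheme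
  graph : RiemannScheme → Decomposition → Decomposition → Prop

/-- The composition `S ∘ T`: first `T`, then `S`. -/
def Transformation.comp (S T : Transformation) : Transformation where
  target s := S.target (T.target s)
  graph s p r := ∃ q, T.graph s p q ∧ S.graph (T.target s) q r

/-- `θ_α^μ ↦ θ_α^μ - 1`, `θ_β^ν ↦ θ_β^ν + 1`. -/
def RiemannScheme.shift (α β μ ν : Fin 2) (s : RiemannScheme) : RiemannScheme where
  θ i j := s.θ i j - (if i = α ∧ j = μ then 1 else 0) + (if i = β ∧ j = ν then 1 else 0)
  κ := s.κ
  fuchs := by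
    have h := s.fuchs
    simp only [Fin.sum_univ_two] at h ⊢
    fin_cases α <;> fin_cases β <;> fin_cases μ <;> fin_cases ν <;> simp <;>
      linear_combination h

/-- The multiplier
`R(x) = I + (u_α - u_β) / (x - u_α) * b_{β,ν} c_α^μ / (c_α^μ b_{β,ν})`. -/
def multiplier (α β μ ν : Fin 2) (p : Decomposition) (x : ℂ) : Matrix (Fin 3) (Fin 3) ℂ :=
  1 + ((pole α - pole β) / (x - pole α) * (p.C α μ ⬝ᵥ (p.B β).col ν)⁻¹) •
    Matrix.vecMulVec ((p.B β).col ν) (p.C α μ)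

/-- The elementary Schlesinger transformation with `θ_α^μ` lowered and `θ_β^ν` raised:
`Ā(x) R(x) = R(x) A(x) + R'(x)`. -/
def schlesinger (α β μ ν : Fin 2) : Transformation where
  target := RiemannScheme.shift α β μ ν
  graph s p q := p.IsOver s ∧ q.IsOver (s.shift α β μ ν) ∧
    p.C α μ ⬝ᵥ (p.B β).col ν ≠ 0 ∧
    ∀ x : ℂ, (∀ i, x ≠ pole i) →
      q.system x * multiplier α β μ ν p x = multiplier α β μ ν p x * p.system x +
        Matrix.of (fun i j => deriv (fun t => multiplier α β μ ν p t i j) x)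

/-- The action of `Σ₁(1,3)` on Riemann schemes. -/
def RiemannScheme.exchange (s : RiemannScheme) : RiemannScheme where
  θ := ![![-s.θ 0 0, s.θ 0 1 - s.θ 0 0], s.θ 1]
  κ j := s.κ j + s.θ 0 0
  fuchs := by
    have h := s.fuchs
    simp only [Fin.sum_univ_two, Fin.sum_univ_three] at h ⊢
    simp
    linear_combination h

/-- The action of `Σ₁(1,3)` on decomposition points: `A₁` becomes `A₁ - θ_1^1 I`, the first
eigenvector becomes the one in the kernel of `A₁`, and the left eigenvectors are rescaled so
that `C₁ B₁` is again the diagonal matrix of the new indices. -/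
def Decomposition.exchange (s : RiemannScheme) (p : Decomposition) : Decomposition :=
  let cc : Fin 3 → ℂ := crossProduct (p.C 0 0) (p.C 0 1)
  let bb : Fin 3 → ℂ := crossProduct ((p.B 0).col 0) ((p.B 0).col 1)
  { B := ![Matrix.of (fun k => ![cc k, p.B 0 k 1]), p.B 1]
    C := ![Matrix.of ![(-s.θ 0 0 / (cc ⬝ᵥ bb)) • bb,
      ((s.θ 0 1 - s.θ 0 0) / s.θ 0 1) • p.C 0 1], p.C 1] }

/-- `Σ₁(1,3)`: exchange of the first and third eigenvectors of `A₁`, followed by the scalar gauge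
transformation `Y ↦ (x - u₁) ^ (-θ_1^1) Y`. -/
def exchange13 : Transformation where
  target := RiemannScheme.exchange
  graph s p q := p.IsOver s ∧ s.θ 0 0 ≠ 0 ∧ s.θ 0 1 ≠ 0 ∧ q = p.exchange s

/-! ### Birational maps of the `(f, g)`-plane -/

/-- The field `ℂ(f, g)`. -/
abbrev K : Type := FractionRing (MvPolynomial (Fin 2) ℂ)

/-- The coordinate function `f`. -/
def f : K := algebraMap (MvPolynomial (Fin 2) ℂ) K (MvPolynomial.X 0)

/-- The coordinate function `g`. -/
def g : K := algebraMap (MvPolynomial (Fin 2) ℂ) K (MvPolynomial.X 1)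

/-- Constants. -/
def const (c : ℂ) : K := algebraMap ℂ K c

/-- The `n`-th power of the maximal ideal of the local ring, inside `ℂ(f, g)`, of the point with
local parameters `u`, `v` (where `u`, `v` generate the field); for `n = 0` the local ring. -/
def localPower (u v : K) (n : ℕ) : Set K :=
  {h | ∃ F G : MvPolynomial (Fin 2) ℂ, MvPolynomial.eval 0 G ≠ 0 ∧
    F ∈ MvPolynomial.idealOfVars (Fin 2) ℂ ^ n ∧
    h = MvPolynomial.aeval ![u, v] F / MvPolynomial.aeval ![u, v] G}

/-- The rational function `h` is regular at `(f, g) = (a, b)` and has the value `c` there. -/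
def HasValue (h : K) (a b c : ℂ) : Prop :=
  h - const c ∈ localPower (f - const a) (g - const b) 1

/-- In the coordinates `(f, g)`, the transformation `T` over `s` is the birational map with
pull-back `Ψ`: over a general point `(a, b)` there are systems on which `T` is defined, and `T`
sends every system with coordinates `(a, b)` to one with coordinates `(Ψ f, Ψ g) (a, b)`. -/
def IsCoordinateFormOf (T : Transformation) (s : RiemannScheme) (Ψ : K ≃ₐ[ℂ] K) : Prop :=
  ∃ N : MvPolynomial (Fin 2) ℂ, N ≠ 0 ∧ ∀ a b : ℂ, MvPolynomial.eval ![a, b] N ≠ 0 →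
    (∃ p q, HasCoordinates s p a b ∧ T.graph s p q) ∧
    ∀ p q, HasCoordinates s p a b → T.graph s p q →
      ∃ a' b', HasCoordinates (T.target s) q a' b' ∧
        HasValue (Ψ f) a b a' ∧ HasValue (Ψ g) a b b'

/-- The composition `Σ₁(1,3) ∘ {2 1; 2 1} ∘ Σ₁(1,3) ∘ {2 1; 1 1}`. -/
def composition : Transformation :=
  exchange13.comp ((schlesinger 1 0 1 0).comp (exchange13.comp (schlesinger 1 0 0 0)))

/-! ### The standard difference Painlevé equation -/

/-- The parameters `b₁, …, b₈` attached to a Riemann scheme. -/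
def parameters (s : RiemannScheme) : Fin 8 → ℂ :=
  ![s.θ 0 1 + s.κ 0, s.θ 0 1 + s.κ 1, s.θ 0 1 + s.κ 2, 0,
    s.θ 1 0, s.θ 1 1, s.θ 0 0 - s.θ 0 1, -s.θ 0 1 - 1]

/-- `δ = b₁ + ⋯ + b₈`. -/
def delta (b : Fin 8 → ℂ) : ℂ := ∑ i, b i

/-- Evolution of the parameters under the standard equation. -/
def evolve (b : Fin 8 → ℂ) : Fin 8 → ℂ :=
  ![b 0, b 1, b 2, b 3, b 4 + delta b, b 5 + delta b, b 6 - delta b, b 7 - delta b]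

/-- `Φ` is the pull-back of the standard map `(f, g) ↦ (f̄, ḡ) = (Φ f, Φ g)`. -/
def IsStandardDP (b : Fin 8 → ℂ) (Φ : K ≃ₐ[ℂ] K) : Prop :=
  (f + g) * (Φ f + g) =
      (g + const (b 0)) * (g + const (b 1)) * (g + const (b 2)) * (g + const (b 3)) /
        ((g - const (b 4)) * (g - const (b 5))) ∧
  (Φ f + g) * (Φ f + Φ g) =
      (Φ f - const (b 0)) * (Φ f - const (b 1)) * (Φ f - const (b 2)) * (Φ f - const (b 3)) /
        ((Φ f + const (b 6 - delta b)) * (Φ f + const (b 7 - delta b)))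

/-! ### The surface `X_b`: the blow-up of `ℙ¹ × ℙ¹` at eight points -/

/-- The blow-up centres `(b_i, -b_i)` for `i ≤ 4`, `(∞, b₅)`, `(∞, b₆)`, `(-b₇, ∞)`, `(-b₈, ∞)`. -/
def center (b : Fin 8 → ℂ) : Fin 8 → OnePoint ℂ × OnePoint ℂ :=
  ![(↑(b 0), ↑(-b 0)), (↑(b 1), ↑(-b 1)), (↑(b 2), ↑(-b 2)), (↑(b 3), ↑(-b 3)),
    (OnePoint.infty, ↑(b 4)), (OnePoint.infty, ↑(b 5)),
    (↑(-b 6), OnePoint.infty), (↑(-b 7), OnePoint.infty)]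

/-- Local parameter at a point of `ℙ¹` with affine coordinate `h`. -/
def lineParameter (h : K) (t : OnePoint ℂ) : K :=
  t.elim h⁻¹ (fun c => h - const c)

/-- Local parameters at a point of `ℙ¹ × ℙ¹`. -/
def baseParameters (q : OnePoint ℂ × OnePoint ℂ) : K × K :=
  (lineParameter f q.1, lineParameter g q.2)

/-- Points of `X_b`: the points of `ℙ¹ × ℙ¹` other than the centres, and the points of the
exceptional curves `E_i`, that is, the directions `v = t u` (`t ∈ ℙ¹`) at the centres, with
`u`, `v` the local parameters of `baseParameters`. -/
def SurfacePoint (b : Fin 8 → ℂ) : Type :=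
  {q : OnePoint ℂ × OnePoint ℂ // q ∉ Set.range (center b)} ⊕ (Fin 8 × OnePoint ℂ)

/-- Local parameters on the blow-up of a point with local parameters `w`, in the direction `t`. -/
def blowUpParameters (w : K × K) (t : OnePoint ℂ) : K × K :=
  t.elim (w.1 / w.2, w.2) (fun c => (w.1, w.2 / w.1 - const c))

/-- Local equation of the exceptional curve at the direction `t`. -/
def exceptionalEquation (w : K × K) (t : OnePoint ℂ) : K :=
  t.elim w.2 (fun _ => w.1)

/-- Local parameters at a point of `X_b`. -/
def surfaceParameters (b : Fin 8 → ℂ) : SurfacePoint b → K × K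
  | .inl q => baseParameters q.1
  | .inr it => blowUpParameters (baseParameters (center b it.1)) it.2

/-- Local ring of a point of `X_b`, inside the function field. -/
def localRing (b : Fin 8 → ℂ) (x : SurfacePoint b) : Set K :=
  localPower (surfaceParameters b x).1 (surfaceParameters b x).2 0

/-- Maximal ideal of the local ring of a point of `X_b`. -/
def maximalIdeal (b : Fin 8 → ℂ) (x : SurfacePoint b) : Set K :=
  localPower (surfaceParameters b x).1 (surfaceParameters b x).2 1

/-- The birational map with pull-back `Ψ` lifts to an isomorphism `X_b → X_{b'}`: `Ψ` maps the
local rings of the points of `X_{b'}` onto the local rings of the points of `X_b`. -/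
def LiftsToIsomorphism (b b' : Fin 8 → ℂ) (Ψ : K ≃ₐ[ℂ] K) : Prop :=
  (fun O : Set K => Ψ '' O) '' Set.range (localRing b') = Set.range (localRing b)

/-! ### The Picard lattice -/

/-- `Pic X_b`; the triple `(d, e, c)` is the class `d H_f + e H_g + ∑ c_i E_i`. -/
abbrev Pic : Type := ℤ × ℤ × (Fin 8 → ℤ)

/-- The class of the total transform of a line `f = const`. -/
def Hf : Pic := (1, 0, 0)

/-- The class of the total transform of a line `g = const`. -/
def Hg : Pic := (0, 1, 0)

/-- The class of the `i`-th exceptional curve (indices start at `0`). -/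
def E (i : Fin 8) : Pic := (0, 0, Pi.single i 1)

/-- The intersection form. -/
def inter (D D' : Pic) : ℤ :=
  D.1 * D'.2.1 + D.2.1 * D'.1 - ∑ i, D.2.2 i * D'.2.2 i

/-- The anticanonical class `-K = 2 H_f + 2 H_g - E₁ - ⋯ - E₈`. -/
def antiCanonical : Pic := 2 • Hf + 2 • Hg - ∑ i, E i

/-- Local equation, at a point of `ℙ¹ × ℙ¹`, of the divisor `d {f = ∞} + e {g = ∞}`. -/
def baseEquation (D : Pic) (q : OnePoint ℂ × OnePoint ℂ) : K :=
  q.1.elim (f⁻¹ ^ D.1) (fun _ => 1) * q.2.elim (g⁻¹ ^ D.2.1) (fun _ => 1)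

/-- Local equation, at a point of `X_b`, of the divisor `d {f = ∞} + e {g = ∞} + ∑ c_i E_i` of
class `D = (d, e, c)`. -/
def localEquation (b : Fin 8 → ℂ) (D : Pic) : SurfacePoint b → K
  | .inl q => baseEquation D q.1
  | .inr it => baseEquation D (center b it.1) *
      exceptionalEquation (baseParameters (center b it.1)) it.2 ^ D.2.2 it.1

/-- `F` is a global section of the line bundle `O(D)` on `X_b` (all global sections are
polynomials, being regular on the affine plane outside at most four points). The local equation
of its divisor at `x` is `F * localEquation b D x`. -/
def IsSection (b : Fin 8 → ℂ) (D : Pic) (F : MvPolynomial (Fin 2) ℂ) : Prop :=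
  ∀ x, algebraMap (MvPolynomial (Fin 2) ℂ) K F * localEquation b D x ∈ localRing b x

/-- The point `x` lies on the divisor of the section `F` of `O(D)`. -/
def LiesOn (b : Fin 8 → ℂ) (D : Pic) (F : MvPolynomial (Fin 2) ℂ) (x : SurfacePoint b) : Prop :=
  algebraMap (MvPolynomial (Fin 2) ℂ) K F * localEquation b D x ∈ maximalIdeal b x

/-- The divisor of the section `F` of `O(D)` is an irreducible reduced curve: it is nonzero and not
a sum of two nonzero effective divisors. -/
def IsPrimeCurve (b : Fin 8 → ℂ) (D : Pic) (F : MvPolynomial (Fin 2) ℂ) : Prop :=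
  F ≠ 0 ∧ IsSection b D F ∧ (∃ x, LiesOn b D F x) ∧
    ∀ D₁ D₂ F₁ F₂, D = D₁ + D₂ → F = F₁ * F₂ → IsSection b D₁ F₁ → IsSection b D₂ F₂ →
      (∀ x, ¬ LiesOn b D₁ F₁ x) ∨ (∀ x, ¬ LiesOn b D₂ F₂ x)

/-- `X_b` has type `A₂⁽¹⁾*`: the eight centres are distinct, the anticanonical divisor is unique,
it is the sum of three irreducible curves whose intersection matrix is minus the Cartan matrix of
type `A₂⁽¹⁾`, and all three curves meet in one point. -/
def HasTypeA2Star (b : Fin 8 → ℂ) : Prop :=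
  Function.Injective (center b) ∧
  ∃ (D : Fin 3 → Pic) (G : Fin 3 → MvPolynomial (Fin 2) ℂ),
    (∀ k, IsPrimeCurve b (D k) (G k)) ∧
    ∑ k, D k = antiCanonical ∧
    (∀ F, IsSection b antiCanonical F ↔ ∃ c : ℂ, F = MvPolynomial.C c * ∏ k, G k) ∧
    (∀ k l, inter (D k) (D l) = if k = l then -2 else 1) ∧
    ∃ x₀ : SurfacePoint b, ∀ k l, k ≠ l →
      ∀ x, (LiesOn b (D k) (G k) x ∧ LiesOn b (D l) (G l) x) ↔ x = x₀

/-- The isomorphism `X_b → X_{b'}` with pull-back `Ψ` has push-forward `M` on Picard lattices: for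
every class `D`, the pull-back of the divisor of class `M D` on `X_{b'}` and the divisor of class
`D` on `X_b` differ by the divisor of a rational function `k`. -/
def HasPushForward (b b' : Fin 8 → ℂ) (Ψ : K ≃ₐ[ℂ] K) (M : Pic → Pic) : Prop :=
  ∀ D : Pic, ∃ k : K, k ≠ 0 ∧ ∀ (x : SurfacePoint b) (x' : SurfacePoint b'),
    Ψ '' localRing b' x' = localRing b x →
      Ψ (localEquation b' (M D) x') / (k * localEquation b D x) ∈ localRing b x ∧
      k * localEquation b D x / Ψ (localEquation b' (M D) x') ∈ localRing b x

/-- The additive map with given values on `H_f`, `H_g`, `E₁, …, E₈`. -/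
def extend (hf hg : Pic) (e : Fin 8 → Pic) (D : Pic) : Pic :=
  D.1 • hf + D.2.1 • hg + ∑ i, D.2.2 i • e i

/-- The action of the elementary Schlesinger transformation on the Picard lattice. -/
def schlesingerAction : Pic → Pic :=
  extend (2, 3, ![-1, -1, -1, -1, -2, 0, 0, -2]) (3, 5, ![-2, -2, -2, -2, -3, -1, 0, -2])
    ![(1, 2, ![0, -1, -1, -1, -1, 0, 0, -1]), (1, 2, ![-1, 0, -1, -1, -1, 0, 0, -1]),
      (1, 2, ![-1, -1, 0, -1, -1, 0, 0, -1]), (1, 2, ![-1, -1, -1, 0, -1, 0, 0, -1]),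
      E 6, (2, 2, ![-1, -1, -1, -1, -2, 0, 0, -1]),
      (2, 3, ![-1, -1, -1, -1, -2, -1, 0, -2]), Hg - E 4]

/-- The action of the standard equation on the Picard lattice. -/
def standardAction : Pic → Pic :=
  extend (6, 3, ![-2, -2, -2, -2, -1, -1, -3, -3]) (3, 1, ![-1, -1, -1, -1, 0, 0, -1, -1])
    ![(2, 1, ![0, -1, -1, -1, 0, 0, -1, -1]), (2, 1, ![-1, 0, -1, -1, 0, 0, -1, -1]),
      (2, 1, ![-1, -1, 0, -1, 0, 0, -1, -1]), (2, 1, ![-1, -1, -1, 0, 0, 0, -1, -1]),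
      (3, 1, ![-1, -1, -1, -1, 0, -1, -1, -1]), (3, 1, ![-1, -1, -1, -1, -1, 0, -1, -1]),
      Hf - E 7, Hf - E 6]

/-- The simple roots of type `E₆⁽¹⁾` spanning the symmetry sub-lattice. -/
def simpleRoot : Fin 7 → Pic :=
  ![E 2 - E 3, E 1 - E 2, E 0 - E 1, Hf - E 0 - E 6, E 6 - E 7, Hg - E 0 - E 4, E 4 - E 5]

/-- `M` acts on the symmetry sub-lattice as the translation `α_i ↦ α_i + n_i δ`, `δ = -K`. -/
def IsTranslation (M : Pic → Pic) (n : Fin 7 → ℤ) : Prop :=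
  ∀ i, M (simpleRoot i) = simpleRoot i + n i • antiCanonical

/-! ### Families of birational maps over the space of Riemann schemes -/

/-- A discrete dynamical system on the `(f, g)`-planes over the Riemann schemes: over `s` a pair of
the new Riemann scheme and the pull-back of the birational map to the plane over it. -/
abbrev DiscreteSystem : Type := RiemannScheme → RiemannScheme × (K ≃ₐ[ℂ] K)

/-- The `n`-th iterate. -/
def DiscreteSystem.iterate (S : DiscreteSystem) : ℕ → DiscreteSystem
  | 0 => fun s => (s, AlgEquiv.refl)
  | n + 1 => fun s =>
      ((S (DiscreteSystem.iterate S n s).1).1,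
        (S (DiscreteSystem.iterate S n s).1).2.trans (DiscreteSystem.iterate S n s).2)

/-- `S` and `T` are conjugate by a birational change of the coordinates `(f, g)`, with
coefficients depending on the characteristic indices: `χ ∘ S = T ∘ χ`. -/
def ConjugateByCoordinateChange (S T : DiscreteSystem) : Prop :=
  ∃ χ : RiemannScheme → (K ≃ₐ[ℂ] K), ForGenericScheme fun s =>
    ((S s).1, (χ (S s).1).trans (S s).2) = ((T s).1, (T s).2.trans (χ s))

end SchlesingerA2

end

/-! ### Rational functions on the plane: generators, automorphisms and values at points. -/

noncomputable section

namespace SchlesingerA2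

open MvPolynomial

/-! ### Systems of coordinates of the field `ℂ(f, g)` -/

/-! Geometry and linear algebra are settled separately and then compared as rational functions of f
and g.

Geometry. Every map involved is built from one involution, (f, g) ↦ (f, g') with (f + g)(f + g') =
(f - b_i)(f - b_j), where i, j are two of the first four labels. It preserves the pencil of lines f
= const, trades each of the two centres for the fibre through it, and exchanges the curves f + g = 0
and g = ∞ together with the two remaining centres on each. Hence it lifts to an isomorphism between
blow-ups, with an explicit action on the Picard lattice (`quad_isomorphism`, proved point by point).
With the exchange of the factors and the relabelling of centres it yields steps that can be composed
(`QuadStep`, `Stage`). The standard map is a word of three such steps fixing g followed by three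
fixing f. The transformation {2 1; 1 1} is a word of seven steps followed by the exchange of the
factors and a translation, and {1 2; 1 1} is its inverse. Lifting and push-forward are then formal,
up to finite computations on a basis of the lattice (`standard_action`,
`elementaryAction_schlesingerAction`).

Systems. A Schlesinger transformation amounts to three linear relations between the old and the new
residues (`schlesinger_graph_iff`), which determine the new ones; so the transformations act on
gauge classes. The characteristic polynomial at infinity, evaluated at f - θ_1^2 and at -g - θ_1^2,
yields two linear equations for the last column of A₁; so (f, g) determines the gauge class
(`gaugeEquivalent_of_hasCoordinates`). It therefore suffices to exhibit one system over a general
point whose image has the right coordinates (`isCoordinateFormOf_of_exists`). This is done with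
explicit eigenvectors. The first coordinate h of the standard image already parametrises the normal
form, and one intermediate system serves both {2 1; 1 1} (`hasCoordinates_schlesinger`) and the
composition (`exists_composition`).

Comparison. For the standard map the product formulas are read off the word
(`standard_isStandardDP`) and supply the identity needed for the second coordinate. For {2 1; 1 1},
eliminating the intermediate coordinates of the word leaves two symmetric relations
(`elementary_relations`); they make the new first coordinate a root of a quadratic polynomial whose
other root is -g (`elementary_first_coordinate`), which is what the eigenvectors require.

The anticanonical divisor consists of f + g = 0, f = ∞ and g = ∞, all through (∞, ∞). A section of
-K has bidegree at most (2, 2), and its values at the centres force the coefficient of f²g²,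
multiplied by δ, to vanish; as δ = -1 the divisor is unique. All genericity conditions are
polynomial inequations in the indices, so one sample scheme suffices. Finally, conjugate systems
over fixed s move s in the same way, whereas θ_1^2 is preserved by the first dynamics and drops by
one at each step of the second. -/

lemma algebraMap_eq_aeval (F : MvPolynomial (Fin 2) ℂ) :
    algebraMap (MvPolynomial (Fin 2) ℂ) K F = aeval ![f, g] F := by
  have h : (IsScalarTower.toAlgHom ℂ (MvPolynomial (Fin 2) ℂ) K) = aeval ![f, g] := by
    apply MvPolynomial.algHom_ext
    intro i
    fin_cases i <;> simp [f, g]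
  exact DFunLike.congr_fun h F

lemma algebraMap_K_injective :
    Function.Injective (algebraMap (MvPolynomial (Fin 2) ℂ) K) :=
  IsFractionRing.injective _ _

lemma intermediateField_eq_top_of_mem {L : IntermediateField ℂ K} (hf : f ∈ L) (hg : g ∈ L) :
    L = ⊤ := by
  have hp : ∀ F : MvPolynomial (Fin 2) ℂ, algebraMap (MvPolynomial (Fin 2) ℂ) K F ∈ L := by
    intro F
    rw [algebraMap_eq_aeval]
    induction F using MvPolynomial.induction_on with
    | C a => rw [aeval_C]; exact L.algebraMap_mem a
    | add p q hp hq => rw [map_add]; exact L.add_mem hp hq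
    | mul_X p i hp =>
      rw [map_mul, aeval_X]
      refine L.mul_mem hp ?_
      fin_cases i
      · exact hf
      · exact hg
  rw [eq_top_iff]
  intro z _
  obtain ⟨a, b, -, rfl⟩ := IsFractionRing.div_surjective (A := MvPolynomial (Fin 2) ℂ) z
  exact L.div_mem (hp a) (hp b)

/-- `u` and `v` are algebraically independent. -/
def IsCoord (u v : K) : Prop := AlgebraicIndependent ℂ ![u, v]

lemma IsCoord.injective {u v : K} (h : IsCoord u v) :
    Function.Injective (aeval ![u, v] : MvPolynomial (Fin 2) ℂ →ₐ[ℂ] K) := h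

lemma IsCoord.aeval_ne_zero {u v : K} (h : IsCoord u v) {F : MvPolynomial (Fin 2) ℂ}
    (hF : F ≠ 0) : aeval ![u, v] F ≠ 0 := fun h0 =>
  hF (h.injective (by rw [h0, map_zero]))

lemma isCoord_f_g : IsCoord f g := by
  intro F G hFG
  have : aeval ![f, g] F = aeval ![f, g] G := hFG
  rw [← algebraMap_eq_aeval, ← algebraMap_eq_aeval] at this
  exact algebraMap_K_injective this

/-- Two generators of the field are algebraically independent. -/
lemma isCoord_of_mem_adjoin {u v : K} (hf : f ∈ IntermediateField.adjoin ℂ {u, v})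
    (hg : g ∈ IntermediateField.adjoin ℂ {u, v}) : IsCoord u v := by
  have htop := intermediateField_eq_top_of_mem hf hg
  have hr : Set.range ![u, v] = {u, v} := by
    ext z; simp [eq_comm, or_comm]
  have halg : Algebra.IsAlgebraic (Algebra.adjoin ℂ (Set.range ![u, v])) K := by
    constructor
    intro z
    have hz : z ∈ IntermediateField.adjoin ℂ {u, v} := by rw [htop]; trivial
    obtain ⟨r, hr', s, hs, rfl⟩ := IntermediateField.mem_adjoin_iff_div.mp hz
    rw [← hr] at hr' hs
    rw [div_eq_mul_inv]
    exact (isAlgebraic_algebraMap (⟨r, hr'⟩ : Algebra.adjoin ℂ (Set.range ![u, v]))).mul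
      (isAlgebraic_algebraMap (⟨s, hs⟩ : Algebra.adjoin ℂ (Set.range ![u, v]))).inv
  -- The transcendence degree is at least two, so a pair over which the field is algebraic cannot be
  -- dependent.
  have hle : Cardinal.mk (Fin 2) ≤ Algebra.trdeg ℂ K :=
    AlgebraicIndependent.cardinalMk_le_trdeg (x := ![f, g]) isCoord_f_g
  exact (Algebra.IsAlgebraic.isTranscendenceBasis_of_le_trdeg_of_finite ℂ ![u, v] hle).1

lemma const_mem (L : IntermediateField ℂ K) (c : ℂ) : const c ∈ L := L.algebraMap_mem c

@[simp] lemma const_zero : const 0 = 0 := map_zero _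
@[simp] lemma const_one : const 1 = 1 := map_one _
lemma const_add (a b : ℂ) : const (a + b) = const a + const b := map_add _ _ _
lemma const_sub (a b : ℂ) : const (a - b) = const a - const b := map_sub _ _ _
lemma const_mul (a b : ℂ) : const (a * b) = const a * const b := map_mul _ _ _
lemma const_neg (a : ℂ) : const (-a) = -const a := map_neg _ _
lemma map_const (Ψ : K ≃ₐ[ℂ] K) (c : ℂ) : Ψ (const c) = const c := Ψ.commutes c

/-- The endomorphism of `ℂ(f, g)` with given values on `f` and `g`. -/
def homOfCoord {u v : K} (h : IsCoord u v) : K →ₐ[ℂ] K :=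
  IsFractionRing.liftAlgHom (R := ℂ) (A := MvPolynomial (Fin 2) ℂ) (K := K) (L := K)
    (g := aeval ![u, v]) h.injective

lemma homOfCoord_aeval {u v : K} (h : IsCoord u v) (F : MvPolynomial (Fin 2) ℂ) :
    homOfCoord h (aeval ![f, g] F) = aeval ![u, v] F := by
  rw [← algebraMap_eq_aeval]
  rw [homOfCoord, IsFractionRing.liftAlgHom_apply]
  exact IsFractionRing.lift_algebraMap (A := MvPolynomial (Fin 2) ℂ) (K := K) (L := K)
    (g := ((aeval ![u, v] : MvPolynomial (Fin 2) ℂ →ₐ[ℂ] K) : MvPolynomial (Fin 2) ℂ →+* K)) _ F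

lemma homOfCoord_f {u v : K} (h : IsCoord u v) : homOfCoord h f = u := by
  have := homOfCoord_aeval h (X 0)
  simpa using this

lemma homOfCoord_g {u v : K} (h : IsCoord u v) : homOfCoord h g = v := by
  have := homOfCoord_aeval h (X 1)
  simpa using this

/-- The set where two endomorphisms agree is closed under inverses, hence is an intermediate field;
containing f and g, it is everything. -/
lemma algHom_ext_f_g {σ τ : K →ₐ[ℂ] K} (hf : σ f = τ f) (hg : σ g = τ g) : σ = τ := by
  have : AlgHom.equalizer σ τ = ⊤ := by
    have hL := intermediateField_eq_top_of_mem (L :=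
      { AlgHom.equalizer σ τ with
        inv_mem' := fun x hx => by
          have hx' : σ x = τ x := hx
          change σ x⁻¹ = τ x⁻¹
          rw [map_inv₀, map_inv₀, hx'] }) hf hg
    rw [eq_top_iff]
    intro z _
    have hz : z ∈ (⊤ : IntermediateField ℂ K) := trivial
    rw [← hL] at hz
    exact hz
  refine AlgHom.ext fun z => ?_
  have hz : z ∈ AlgHom.equalizer σ τ := by rw [this]; trivial
  exact hz

lemma algEquiv_ext_f_g {σ τ : K ≃ₐ[ℂ] K} (hf : σ f = τ f) (hg : σ g = τ g) : σ = τ := by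
  have := algHom_ext_f_g (σ := (σ : K →ₐ[ℂ] K)) (τ := (τ : K →ₐ[ℂ] K)) hf hg
  refine AlgEquiv.ext fun z => ?_
  exact DFunLike.congr_fun this z

/-- The automorphism of `ℂ(f, g)` given by an involution `(f, g) ↦ (u, v)`. -/
def equivOfInvolution {u v : K} (h : IsCoord u v) (hu : homOfCoord h u = f)
    (hv : homOfCoord h v = g) : K ≃ₐ[ℂ] K :=
  AlgEquiv.ofAlgHom (homOfCoord h) (homOfCoord h)
    (algHom_ext_f_g (by simp [homOfCoord_f, hu]) (by simp [homOfCoord_g, hv]))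
    (algHom_ext_f_g (by simp [homOfCoord_f, hu]) (by simp [homOfCoord_g, hv]))

lemma isCoord_map {u v : K} (h : IsCoord u v) (Ψ : K ≃ₐ[ℂ] K) : IsCoord (Ψ u) (Ψ v) := by
  have := AlgebraicIndependent.map' (f := (Ψ : K →ₐ[ℂ] K)) h Ψ.injective
  have h2 : (⇑(Ψ : K →ₐ[ℂ] K) ∘ ![u, v]) = ![Ψ u, Ψ v] := by
    funext i; fin_cases i <;> simp
  rw [h2] at this
  exact this

/-! ### Regular functions and their values -/

/-- The rational function `h` is regular, with value `c`, at the point with local parameters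
`u`, `v`. -/
def Val (u v h : K) (c : ℂ) : Prop :=
  ∃ F G : MvPolynomial (Fin 2) ℂ, eval 0 G = 1 ∧ eval 0 F = c ∧
    h * aeval ![u, v] G = aeval ![u, v] F

section
variable {u v h h₁ h₂ : K} {c c₁ c₂ : ℂ}

lemma ne_zero_of_eval {F : MvPolynomial (Fin 2) ℂ} (h : eval 0 F ≠ 0) : F ≠ 0 := by
  rintro rfl; simp at h

lemma Val.cast (H : Val u v h₁ c₁) (hh : h₁ = h₂) (hc : c₁ = c₂) : Val u v h₂ c₂ := by
  subst hh; subst hc; exact H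

lemma val_const (u v : K) (c : ℂ) : Val u v (const c) c :=
  ⟨C c, 1, by simp, by simp, by simp [const]⟩

lemma val_zero (u v : K) : Val u v 0 0 := by simpa using val_const u v 0

lemma val_one (u v : K) : Val u v 1 1 := by simpa using val_const u v 1

lemma val_left (u v : K) : Val u v u 0 := ⟨X 0, 1, by simp, by simp, by simp⟩

lemma val_right (u v : K) : Val u v v 0 := ⟨X 1, 1, by simp, by simp, by simp⟩

lemma Val.add (H₁ : Val u v h₁ c₁) (H₂ : Val u v h₂ c₂) : Val u v (h₁ + h₂) (c₁ + c₂) := by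
  obtain ⟨F₁, G₁, a₁, b₁, e₁⟩ := H₁
  obtain ⟨F₂, G₂, a₂, b₂, e₂⟩ := H₂
  refine ⟨F₁ * G₂ + F₂ * G₁, G₁ * G₂, by simp [-MvPolynomial.eval_zero, a₁, a₂],
      by simp [-MvPolynomial.eval_zero, a₁, a₂, b₁, b₂], ?_⟩
  simp only [map_mul, map_add]
  rw [← e₁, ← e₂]; ring

lemma Val.mul (H₁ : Val u v h₁ c₁) (H₂ : Val u v h₂ c₂) : Val u v (h₁ * h₂) (c₁ * c₂) := by
  obtain ⟨F₁, G₁, a₁, b₁, e₁⟩ := H₁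
  obtain ⟨F₂, G₂, a₂, b₂, e₂⟩ := H₂
  refine ⟨F₁ * F₂, G₁ * G₂, by simp [-MvPolynomial.eval_zero, a₁, a₂],
      by simp [-MvPolynomial.eval_zero, b₁, b₂], ?_⟩
  simp only [map_mul]
  rw [← e₁, ← e₂]; ring

lemma Val.neg (H : Val u v h c) : Val u v (-h) (-c) := by
  have := (val_const u v (-1)).mul H
  exact this.cast (by rw [const_neg, const_one]; ring) (by ring)

lemma Val.sub (H₁ : Val u v h₁ c₁) (H₂ : Val u v h₂ c₂) : Val u v (h₁ - h₂) (c₁ - c₂) :=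
  (H₁.add H₂.neg).cast (by ring) (by ring)

lemma Val.pow (H : Val u v h c) (n : ℕ) : Val u v (h ^ n) (c ^ n) := by
  induction n with
  | zero => simpa using val_one u v
  | succ n ih => exact (ih.mul H).cast (by ring) (by ring)

/-- Independence of u, v turns the cross-multiplied equation into an identity of polynomials, to be
evaluated at the origin; the denominators are normalised to take the value 1 there. -/
lemma Val.unique (huv : IsCoord u v) (H₁ : Val u v h c₁) (H₂ : Val u v h c₂) : c₁ = c₂ := by
  obtain ⟨F₁, G₁, a₁, b₁, e₁⟩ := H₁
  obtain ⟨F₂, G₂, a₂, b₂, e₂⟩ := H₂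
  have : F₁ * G₂ = F₂ * G₁ := huv.injective (by
    simp only [map_mul]; rw [← e₁, ← e₂]; ring)
  have := congrArg (eval 0) this
  simpa [-MvPolynomial.eval_zero, a₁, a₂, b₁, b₂] using this

lemma Val.ne_zero (huv : IsCoord u v) (H : Val u v h c) (hc : c ≠ 0) : h ≠ 0 := by
  rintro rfl
  exact hc (H.unique huv (val_zero u v))

lemma Val.inv (huv : IsCoord u v) (H : Val u v h c) (hc : c ≠ 0) : Val u v h⁻¹ c⁻¹ := by
  have h0 := H.ne_zero huv hc
  obtain ⟨F, G, a, b, e⟩ := H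
  refine ⟨C c⁻¹ * G, C c⁻¹ * F, by simp [-MvPolynomial.eval_zero, b, hc],
      by simp [-MvPolynomial.eval_zero, a], ?_⟩
  simp only [map_mul]
  rw [← e]; field_simp

lemma Val.div (huv : IsCoord u v) (H₁ : Val u v h₁ c₁) (H₂ : Val u v h₂ c₂) (hc : c₂ ≠ 0) :
    Val u v (h₁ / h₂) (c₁ / c₂) := by
  rw [div_eq_mul_inv, div_eq_mul_inv]; exact H₁.mul (H₂.inv huv hc)

lemma Val.zpow (huv : IsCoord u v) (H : Val u v h c) (hc : c ≠ 0) (n : ℤ) :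
    Val u v (h ^ n) (c ^ n) := by
  cases n with
  | ofNat n => simpa using H.pow n
  | negSucc n =>
    rw [_root_.zpow_negSucc, _root_.zpow_negSucc]
    exact (H.pow _).inv huv (pow_ne_zero _ hc)

lemma Val.aeval_eval {w : Fin 2 → K} {a : Fin 2 → ℂ} (H : ∀ i, Val u v (w i) (a i))
    (F : MvPolynomial (Fin 2) ℂ) : Val u v (aeval w F) (eval a F) := by
  induction F using MvPolynomial.induction_on with
  | C c => simpa [const] using val_const u v c
  | add p q hp hq => simpa using hp.add hq
  | mul_X p i hp => simpa using hp.mul (H i)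

/-- Values can be computed in any other local parameters. -/
lemma Val.trans {u' v' : K} (huv : IsCoord u v) (hu : Val u v u' 0) (hv : Val u v v' 0)
    (H : Val u' v' h c) : Val u v h c := by
  obtain ⟨F, G, a, b, e⟩ := H
  have hw : ∀ i, Val u v (![u', v'] i) ((0 : Fin 2 → ℂ) i) := by
    intro i; fin_cases i
    · exact hu
    · exact hv
  have HF := Val.aeval_eval hw F
  have HG := Val.aeval_eval hw G
  rw [a] at HG
  rw [b] at HF
  have h0 := HG.ne_zero huv one_ne_zero
  exact (HF.div huv HG one_ne_zero).cast (by rw [← e]; field_simp) (by simp)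

lemma Val.map (Ψ : K ≃ₐ[ℂ] K) (H : Val u v h c) : Val (Ψ u) (Ψ v) (Ψ h) c := by
  obtain ⟨F, G, a, b, e⟩ := H
  have key : ∀ F : MvPolynomial (Fin 2) ℂ, Ψ (aeval ![u, v] F) = aeval ![Ψ u, Ψ v] F := by
    intro F
    have h2 : (⇑(Ψ : K →ₐ[ℂ] K) ∘ ![u, v]) = ![Ψ u, Ψ v] := by
      funext i; fin_cases i <;> simp
    have := MvPolynomial.comp_aeval_apply (φ := (Ψ : K →ₐ[ℂ] K)) (f := ![u, v]) F
    rw [← h2]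
    exact this
  refine ⟨F, G, a, b, ?_⟩
  rw [← key, ← key, ← map_mul, e]

/-- Dividing numerator and denominator by G(0) identifies the local ring with the functions that
have a value. From here on all local algebra is a calculus of values. -/
lemma mem_localPower_zero (huv : IsCoord u v) : h ∈ localPower u v 0 ↔ ∃ c, Val u v h c := by
  constructor
  · rintro ⟨F, G, hG, -, rfl⟩
    refine ⟨eval 0 F / eval 0 G, C (eval 0 G)⁻¹ * F, C (eval 0 G)⁻¹ * G,
        by simp [-MvPolynomial.eval_zero, hG],
      by simp [-MvPolynomial.eval_zero]; ring, ?_⟩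
    have := huv.aeval_ne_zero (ne_zero_of_eval hG)
    simp only [map_mul]; field_simp
  · rintro ⟨c, F, G, hG, hF, e⟩
    have := huv.aeval_ne_zero (F := G) (ne_zero_of_eval (by simp [-MvPolynomial.eval_zero, hG]))
    exact ⟨F, G, by simp [-MvPolynomial.eval_zero, hG], by simp, by rw [← e]; field_simp⟩

lemma mem_idealOfVars_pow_one (F : MvPolynomial (Fin 2) ℂ) :
    F ∈ idealOfVars (Fin 2) ℂ ^ 1 ↔ eval 0 F = 0 := by
  rw [mem_pow_idealOfVars_iff', MvPolynomial.eval_zero, MvPolynomial.constantCoeff_eq]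
  constructor
  · intro h; exact h 0 (by simp)
  · intro h x hx
    have : x = 0 := by
      have : x.degree = 0 := by omega
      exact (Finsupp.degree_eq_zero_iff x).1 this
    rw [this]; exact h

lemma mem_localPower_one (huv : IsCoord u v) : h ∈ localPower u v 1 ↔ Val u v h 0 := by
  constructor
  · rintro ⟨F, G, hG, hF, rfl⟩
    rw [mem_idealOfVars_pow_one] at hF
    refine ⟨C (eval 0 G)⁻¹ * F, C (eval 0 G)⁻¹ * G, by simp [-MvPolynomial.eval_zero, hG],
        by simp [-MvPolynomial.eval_zero, hF], ?_⟩
    have := huv.aeval_ne_zero (ne_zero_of_eval hG)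
    simp only [map_mul]; field_simp
  · rintro ⟨F, G, hG, hF, e⟩
    have := huv.aeval_ne_zero (F := G) (ne_zero_of_eval (by simp [-MvPolynomial.eval_zero, hG]))
    exact ⟨F, G, by simp [-MvPolynomial.eval_zero, hG], (mem_idealOfVars_pow_one F).2 hF,
        by rw [← e]; field_simp⟩

end

end SchlesingerA2

end

/-! ### Points of X_b through their local parameters; criteria for isomorphisms and for
push-forwards. -/

noncomputable section

namespace SchlesingerA2

open MvPolynomial

/-! ### Local parameters at the points of the surfaces -/

/-- `u` and `v` generate the field `ℂ(f, g)`. -/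
def Generate (u v : K) : Prop :=
  f ∈ IntermediateField.adjoin ℂ {u, v} ∧ g ∈ IntermediateField.adjoin ℂ {u, v}

lemma Generate.isCoord {u v : K} (h : Generate u v) : IsCoord u v :=
  isCoord_of_mem_adjoin h.1 h.2

lemma Generate.of_mem {u v u' v' : K} (h : Generate u v)
    (hu : u ∈ IntermediateField.adjoin ℂ {u', v'})
    (hv : v ∈ IntermediateField.adjoin ℂ {u', v'}) : Generate u' v' := by
  have hle : IntermediateField.adjoin ℂ {u, v} ≤ IntermediateField.adjoin ℂ {u', v'} := by
    rw [IntermediateField.adjoin_le_iff]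
    rintro z (rfl | rfl)
    · exact hu
    · exact hv
  exact ⟨hle h.1, hle h.2⟩

lemma mem_adjoin_left (u v : K) : u ∈ IntermediateField.adjoin ℂ {u, v} :=
  IntermediateField.subset_adjoin ℂ _ (by simp)

lemma mem_adjoin_right (u v : K) : v ∈ IntermediateField.adjoin ℂ {u, v} :=
  IntermediateField.subset_adjoin ℂ _ (by simp)

lemma generate_f_g : Generate f g := ⟨mem_adjoin_left _ _, mem_adjoin_right _ _⟩

@[simp] lemma lineParameter_coe (h : K) (c : ℂ) : lineParameter h (c : OnePoint ℂ) = h - const c :=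
  rfl

@[simp] lemma lineParameter_infty (h : K) : lineParameter h OnePoint.infty = h⁻¹ := rfl

@[simp] lemma blowUpParameters_coe (w : K × K) (c : ℂ) :
    blowUpParameters w (c : OnePoint ℂ) = (w.1, w.2 / w.1 - const c) := rfl

@[simp] lemma blowUpParameters_infty (w : K × K) :
    blowUpParameters w OnePoint.infty = (w.1 / w.2, w.2) := rfl

@[simp] lemma exceptionalEquation_coe (w : K × K) (c : ℂ) :
    exceptionalEquation w (c : OnePoint ℂ) = w.1 := rfl

@[simp] lemma exceptionalEquation_infty (w : K × K) :
    exceptionalEquation w OnePoint.infty = w.2 := rfl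

lemma mem_of_lineParameter_mem {L : IntermediateField ℂ K} {h : K} {t : OnePoint ℂ}
    (hm : lineParameter h t ∈ L) : h ∈ L := by
  induction t using OnePoint.rec with
  | infty => simpa using L.inv_mem hm
  | coe c =>
    have := L.add_mem hm (const_mem L c)
    simpa using this

lemma generate_baseParameters (q : OnePoint ℂ × OnePoint ℂ) :
    Generate (baseParameters q).1 (baseParameters q).2 :=
  generate_f_g.of_mem (mem_of_lineParameter_mem (mem_adjoin_left _ _))
    (mem_of_lineParameter_mem (mem_adjoin_right _ _))

lemma IsCoord.left_ne_zero {u v : K} (h : IsCoord u v) : u ≠ 0 := by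
  have := h.aeval_ne_zero (F := X 0) (X_ne_zero _)
  simpa using this

lemma IsCoord.right_ne_zero {u v : K} (h : IsCoord u v) : v ≠ 0 := by
  have := h.aeval_ne_zero (F := X 1) (X_ne_zero _)
  simpa using this

lemma Generate.blowUp {w : K × K} (h : Generate w.1 w.2) (t : OnePoint ℂ) :
    Generate (blowUpParameters w t).1 (blowUpParameters w t).2 := by
  have h1 := h.isCoord.left_ne_zero
  have h2 := h.isCoord.right_ne_zero
  set L := IntermediateField.adjoin ℂ {(blowUpParameters w t).1, (blowUpParameters w t).2} with hL
  have m1 : (blowUpParameters w t).1 ∈ L := mem_adjoin_left _ _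
  have m2 : (blowUpParameters w t).2 ∈ L := mem_adjoin_right _ _
  induction t using OnePoint.rec with
  | infty =>
    simp only [blowUpParameters_infty] at m1 m2
    refine h.of_mem ?_ m2
    have := L.mul_mem m1 m2
    rwa [div_mul_cancel₀ _ h2] at this
  | coe c =>
    simp only [blowUpParameters_coe] at m1 m2
    refine h.of_mem m1 ?_
    have := L.mul_mem (L.add_mem m2 (const_mem L c)) m1
    rwa [sub_add_cancel, div_mul_cancel₀ _ h1] at this

lemma generate_surfaceParameters (b : Fin 8 → ℂ) (x : SurfacePoint b) :
    Generate (surfaceParameters b x).1 (surfaceParameters b x).2 := by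
  cases x with
  | inl q => exact generate_baseParameters _
  | inr it => exact (generate_baseParameters _).blowUp _

lemma isCoord_surfaceParameters (b : Fin 8 → ℂ) (x : SurfacePoint b) :
    IsCoord (surfaceParameters b x).1 (surfaceParameters b x).2 :=
  (generate_surfaceParameters b x).isCoord

/-- The rational function `h` is regular at the point `x` of the surface, with value `c`. -/
abbrev ValAt (b : Fin 8 → ℂ) (x : SurfacePoint b) (h : K) (c : ℂ) : Prop :=
  Val (surfaceParameters b x).1 (surfaceParameters b x).2 h c

lemma mem_localRing {b : Fin 8 → ℂ} {x : SurfacePoint b} {h : K} :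
    h ∈ localRing b x ↔ ∃ c, ValAt b x h c :=
  mem_localPower_zero (isCoord_surfaceParameters b x)

lemma mem_maximalIdeal {b : Fin 8 → ℂ} {x : SurfacePoint b} {h : K} :
    h ∈ maximalIdeal b x ↔ ValAt b x h 0 :=
  mem_localPower_one (isCoord_surfaceParameters b x)

/-- A function with a finite value at a point cannot have an inverse that vanishes there, and finite
values are unique; so a function takes at most one value in ℙ¹. -/
lemma lineParameter_unique {u v h : K} (huv : IsCoord u v) (h0 : h ≠ 0) {t t' : OnePoint ℂ}
    (H : Val u v (lineParameter h t) 0) (H' : Val u v (lineParameter h t') 0) : t = t' := by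
  have aux : ∀ c : ℂ, Val u v (h - const c) 0 → Val u v h⁻¹ 0 → False := by
    intro c h1 h2
    have h3 := ((h1.add (val_const u v c)).mul h2).cast (h₂ := 1) (c₂ := 0)
      (by rw [sub_add_cancel, mul_inv_cancel₀ h0]) (by ring)
    exact one_ne_zero ((val_one u v).unique huv h3)
  induction t using OnePoint.rec with
  | infty =>
    induction t' using OnePoint.rec with
    | infty => rfl
    | coe c => exact (aux c H' H).elim
  | coe c =>
    induction t' using OnePoint.rec with
    | infty => exact (aux c H H').elim
    | coe c' =>
      have h1 : Val u v h c := (H.add (val_const u v c)).cast (by simp) (by simp)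
      have h2 : Val u v h c' := (H'.add (val_const u v c')).cast (by simp) (by simp)
      rw [h1.unique huv h2]

/-- The image of a point of `X_b` in `ℙ¹ × ℙ¹`. -/
def basePoint (b : Fin 8 → ℂ) : SurfacePoint b → OnePoint ℂ × OnePoint ℂ
  | .inl q => q.1
  | .inr it => center b it.1

lemma valAt_baseParameters (b : Fin 8 → ℂ) (x : SurfacePoint b) :
    ValAt b x (baseParameters (basePoint b x)).1 0 ∧
      ValAt b x (baseParameters (basePoint b x)).2 0 := by
  have hx := isCoord_surfaceParameters b x
  cases x with
  | inl q => exact ⟨val_left _ _, val_right _ _⟩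
  | inr it =>
    obtain ⟨i, t⟩ := it
    have hc := (generate_baseParameters (center b i)).isCoord
    have h1 := hc.left_ne_zero
    have h2 := hc.right_ne_zero
    simp only [basePoint, surfaceParameters] at *
    induction t using OnePoint.rec with
    | infty =>
      simp only [blowUpParameters_infty] at *
      exact ⟨((val_left _ _).mul (val_right _ _)).cast (div_mul_cancel₀ _ h2) (by simp),
        val_right _ _⟩
    | coe c =>
      simp only [blowUpParameters_coe] at *
      refine ⟨val_left _ _, ?_⟩
      have e : ((baseParameters (center b i)).2 / (baseParameters (center b i)).1 - const c +
          const c) * (baseParameters (center b i)).1 = (baseParameters (center b i)).2 := by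
        rw [sub_add_cancel, div_mul_cancel₀ _ h1]
      exact (((val_right _ _).add (val_const _ _ c)).mul (val_left _ _)).cast e (by simp)

lemma valAt_slope (b : Fin 8 → ℂ) (i : Fin 8) (t : OnePoint ℂ) :
    ValAt b (.inr (i, t)) (lineParameter
      ((baseParameters (center b i)).2 / (baseParameters (center b i)).1) t) 0 := by
  simp only [ValAt, surfaceParameters]
  induction t using OnePoint.rec with
  | infty => simpa using val_left _ _
  | coe c => exact val_right _ _

lemma f_ne_zero : f ≠ 0 := isCoord_f_g.left_ne_zero

lemma g_ne_zero : g ≠ 0 := isCoord_f_g.right_ne_zero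

/-- A point is determined by the vanishing of its local parameters. -/
lemma eq_of_valAt_parameters {b : Fin 8 → ℂ} (hb : Function.Injective (center b))
    {x y : SurfacePoint b} (h1 : ValAt b x (surfaceParameters b y).1 0)
    (h2 : ValAt b x (surfaceParameters b y).2 0) : x = y := by
  have hx := isCoord_surfaceParameters b x
  have tr : ∀ {h c}, ValAt b y h c → ValAt b x h c := fun H => Val.trans hx h1 h2 H
  have bx := valAt_baseParameters b x
  have byy := valAt_baseParameters b y
  have e : basePoint b x = basePoint b y := Prod.ext
    (lineParameter_unique hx f_ne_zero bx.1 (tr byy.1))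
    (lineParameter_unique hx g_ne_zero bx.2 (tr byy.2))
  rcases x with ⟨q, hq⟩ | ⟨i, t⟩ <;> rcases y with ⟨q', hq'⟩ | ⟨i', t'⟩
  · simp only [basePoint] at e
    subst e; rfl
  · simp only [basePoint] at e
    exact (hq ⟨i', e.symm⟩).elim
  · simp only [basePoint] at e
    exact (hq' ⟨i, e⟩).elim
  · simp only [basePoint] at e
    obtain rfl := hb e
    have hc := (generate_baseParameters (center b i)).isCoord
    have := lineParameter_unique hx (div_ne_zero hc.right_ne_zero hc.left_ne_zero)
      (valAt_slope b i t) (tr (valAt_slope b i t'))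
    rw [this]

/-- Equal local rings have equal maximal ideals: a function with nonzero value at x is invertible in
the common ring, so it cannot vanish at y. Hence the parameters of y vanish at x. -/
lemma eq_of_localRing_eq {b : Fin 8 → ℂ} (hb : Function.Injective (center b))
    {x y : SurfacePoint b} (h : localRing b x = localRing b y) : x = y := by
  have aux : ∀ p, ValAt b y p 0 → ValAt b x p 0 := by
    intro p hp
    have hm : p ∈ localRing b x := by rw [h]; exact mem_localRing.2 ⟨0, hp⟩
    obtain ⟨c, hc⟩ := mem_localRing.1 hm
    by_cases h0 : c = 0
    · rwa [h0] at hc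
    · exfalso
      have hinv := hc.inv (isCoord_surfaceParameters b x) h0
      have hm' : p⁻¹ ∈ localRing b y := by rw [← h]; exact mem_localRing.2 ⟨_, hinv⟩
      obtain ⟨d, hd⟩ := mem_localRing.1 hm'
      have hne := hc.ne_zero (isCoord_surfaceParameters b x) h0
      have := (hp.mul hd).cast (h₂ := 1) (c₂ := 0) (mul_inv_cancel₀ hne) (by ring)
      exact one_ne_zero ((val_one _ _).unique (isCoord_surfaceParameters b y) this)
  exact eq_of_valAt_parameters hb (aux _ (val_left _ _)) (aux _ (val_right _ _))

/-! ### Isomorphisms of surfaces -/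

/-- The birational map with pull-back `Ψ` is regular at `x`, with value `x'`. -/
def MapsTo (b b' : Fin 8 → ℂ) (Ψ : K ≃ₐ[ℂ] K) (x : SurfacePoint b) (x' : SurfacePoint b') : Prop :=
  ValAt b x (Ψ (surfaceParameters b' x').1) 0 ∧ ValAt b x (Ψ (surfaceParameters b' x').2) 0

lemma MapsTo.valAt {b b' : Fin 8 → ℂ} {Ψ : K ≃ₐ[ℂ] K} {x : SurfacePoint b} {x' : SurfacePoint b'}
    (H : MapsTo b b' Ψ x x') {h : K} {c : ℂ} (hv : ValAt b' x' h c) : ValAt b x (Ψ h) c :=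
  Val.trans (isCoord_surfaceParameters b x) H.1 H.2 (hv.map Ψ)

/-- The inverse sends x' to some point y. Composing both maps shows that the parameters of y vanish
at x, so y = x. -/
lemma MapsTo.symm {b b' : Fin 8 → ℂ} (hb : Function.Injective (center b)) {Ψ : K ≃ₐ[ℂ] K}
    {x : SurfacePoint b} {x' : SurfacePoint b'} (H : MapsTo b b' Ψ x x')
    (H' : ∀ x', ∃ x, MapsTo b' b Ψ.symm x' x) : MapsTo b' b Ψ.symm x' x := by
  obtain ⟨y, hy⟩ := H' x'
  have h1 := H.valAt hy.1
  have h2 := H.valAt hy.2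
  rw [AlgEquiv.apply_symm_apply] at h1 h2
  rwa [eq_of_valAt_parameters hb h1 h2]

lemma MapsTo.image_localRing {b b' : Fin 8 → ℂ} {Ψ : K ≃ₐ[ℂ] K} {x : SurfacePoint b}
    {x' : SurfacePoint b'} (H : MapsTo b b' Ψ x x') (H' : MapsTo b' b Ψ.symm x' x) :
    Ψ '' localRing b' x' = localRing b x := by
  ext h
  constructor
  · rintro ⟨k, hk, rfl⟩
    obtain ⟨c, hc⟩ := mem_localRing.1 hk
    exact mem_localRing.2 ⟨c, H.valAt hc⟩
  · intro hh
    obtain ⟨c, hc⟩ := mem_localRing.1 hh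
    exact ⟨Ψ.symm h, mem_localRing.2 ⟨c, H'.valAt hc⟩, Ψ.apply_symm_apply h⟩

/-- Being defined at every point in both directions is enough: the two point maps are then mutually
inverse, and the pull-backs along them identify the local rings. -/
lemma liftsToIsomorphism_of_mapsTo {b b' : Fin 8 → ℂ} (hb : Function.Injective (center b))
    (hb' : Function.Injective (center b')) {Ψ : K ≃ₐ[ℂ] K}
    (H : ∀ x, ∃ x', MapsTo b b' Ψ x x') (H' : ∀ x', ∃ x, MapsTo b' b Ψ.symm x' x) :
    LiftsToIsomorphism b b' Ψ := by
  ext O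
  constructor
  · rintro ⟨_, ⟨x', rfl⟩, rfl⟩
    obtain ⟨x, hx⟩ := H' x'
    exact ⟨x, ((hx.symm hb' H).image_localRing hx).symm⟩
  · rintro ⟨x, rfl⟩
    obtain ⟨x', hx'⟩ := H x
    exact ⟨_, ⟨x', rfl⟩, hx'.image_localRing (hx'.symm hb H')⟩

/-- The rational function `h` is regular and nonzero at the point `x`. -/
def IsUnitAt (b : Fin 8 → ℂ) (x : SurfacePoint b) (h : K) : Prop := ∃ c, c ≠ 0 ∧ ValAt b x h c

section
variable {b : Fin 8 → ℂ} {x : SurfacePoint b} {h h' : K}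

lemma ValAt.isUnitAt {c : ℂ} (H : ValAt b x h c) (hc : c ≠ 0) : IsUnitAt b x h := ⟨c, hc, H⟩

lemma isUnitAt_one : IsUnitAt b x 1 := ⟨1, one_ne_zero, val_one _ _⟩

lemma IsUnitAt.mul (H : IsUnitAt b x h) (H' : IsUnitAt b x h') : IsUnitAt b x (h * h') := by
  obtain ⟨c, hc, H⟩ := H
  obtain ⟨c', hc', H'⟩ := H'
  exact ⟨_, mul_ne_zero hc hc', H.mul H'⟩

lemma IsUnitAt.inv (H : IsUnitAt b x h) : IsUnitAt b x h⁻¹ := by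
  obtain ⟨c, hc, H⟩ := H
  exact ⟨_, inv_ne_zero hc, H.inv (isCoord_surfaceParameters b x) hc⟩

lemma IsUnitAt.div (H : IsUnitAt b x h) (H' : IsUnitAt b x h') : IsUnitAt b x (h / h') := by
  rw [div_eq_mul_inv]; exact H.mul H'.inv

lemma IsUnitAt.zpow (H : IsUnitAt b x h) (n : ℤ) : IsUnitAt b x (h ^ n) := by
  obtain ⟨c, hc, H⟩ := H
  exact ⟨_, zpow_ne_zero n hc, H.zpow (isCoord_surfaceParameters b x) hc n⟩

lemma IsUnitAt.mem (H : IsUnitAt b x h) : h ∈ localRing b x := by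
  obtain ⟨c, -, H⟩ := H
  exact mem_localRing.2 ⟨c, H⟩

end

/-- The target point in `HasPushForward` is specified only by its local ring. As points are
determined by local rings, it must be the image point for which the comparison of divisors was made.
-/
lemma hasPushForward_of_mapsTo {b b' : Fin 8 → ℂ} (hb : Function.Injective (center b))
    (hb' : Function.Injective (center b')) {Ψ : K ≃ₐ[ℂ] K} {M : Pic → Pic} (k : Pic → K)
    (hk : ∀ D, k D ≠ 0)
    (H : ∀ x, ∃ x', MapsTo b b' Ψ x x' ∧
      ∀ D, IsUnitAt b x (Ψ (localEquation b' (M D) x') / (k D * localEquation b D x)))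
    (H' : ∀ x', ∃ x, MapsTo b' b Ψ.symm x' x) : HasPushForward b b' Ψ M := by
  intro D
  refine ⟨k D, hk D, fun x x' hxx' => ?_⟩
  obtain ⟨y', hy', hu⟩ := H x
  have e := hy'.image_localRing (hy'.symm hb H')
  rw [← e] at hxx'
  obtain rfl := eq_of_localRing_eq hb' (Ψ.injective.image_injective hxx')
  refine ⟨(hu D).mem, ?_⟩
  have := (hu D).inv.mem
  rwa [inv_div] at this

lemma lineParameter_ne_zero_f (t : OnePoint ℂ) : lineParameter f t ≠ 0 :=
  (generate_baseParameters (t, OnePoint.infty)).isCoord.left_ne_zero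

lemma lineParameter_ne_zero_g (t : OnePoint ℂ) : lineParameter g t ≠ 0 :=
  (generate_baseParameters (OnePoint.infty, t)).isCoord.right_ne_zero

lemma baseEquation_ne_zero (D : Pic) (q : OnePoint ℂ × OnePoint ℂ) : baseEquation D q ≠ 0 := by
  obtain ⟨p, q⟩ := q
  unfold baseEquation
  refine mul_ne_zero ?_ ?_
  · induction p using OnePoint.rec with
    | infty => exact zpow_ne_zero _ (inv_ne_zero f_ne_zero)
    | coe c => exact one_ne_zero
  · induction q using OnePoint.rec with
    | infty => exact zpow_ne_zero _ (inv_ne_zero g_ne_zero)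
    | coe c => exact one_ne_zero

lemma exceptionalEquation_ne_zero (q : OnePoint ℂ × OnePoint ℂ) (t : OnePoint ℂ) :
    exceptionalEquation (baseParameters q) t ≠ 0 := by
  have hc := (generate_baseParameters q).isCoord
  induction t using OnePoint.rec with
  | infty => exact hc.right_ne_zero
  | coe c => exact hc.left_ne_zero

lemma localEquation_ne_zero (b : Fin 8 → ℂ) (D : Pic) (x : SurfacePoint b) :
    localEquation b D x ≠ 0 := by
  cases x with
  | inl q => exact baseEquation_ne_zero _ _
  | inr it =>
    exact mul_ne_zero (baseEquation_ne_zero D (center b it.1))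
      (zpow_ne_zero (D.2.2 it.1) (exceptionalEquation_ne_zero (center b it.1) it.2))

lemma mul_mem_localRing {b : Fin 8 → ℂ} {x : SurfacePoint b} {h h' : K} (H : h ∈ localRing b x)
    (H' : h' ∈ localRing b x) : h * h' ∈ localRing b x := by
  obtain ⟨c, hc⟩ := mem_localRing.1 H
  obtain ⟨c', hc'⟩ := mem_localRing.1 H'
  exact mem_localRing.2 ⟨_, hc.mul hc'⟩

lemma LiftsToIsomorphism.trans {b b' b'' : Fin 8 → ℂ} {Ψ Ψ' : K ≃ₐ[ℂ] K}
    (H : LiftsToIsomorphism b b' Ψ) (H' : LiftsToIsomorphism b' b'' Ψ') :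
    LiftsToIsomorphism b b'' (Ψ'.trans Ψ) := by
  unfold LiftsToIsomorphism at *
  rw [← H, ← H', Set.image_image]
  congr 1
  funext O
  rw [Set.image_image]
  rfl

lemma LiftsToIsomorphism.symm {b b' : Fin 8 → ℂ} {Ψ : K ≃ₐ[ℂ] K}
    (H : LiftsToIsomorphism b b' Ψ) : LiftsToIsomorphism b' b Ψ.symm := by
  unfold LiftsToIsomorphism at *
  rw [← H, Set.image_image]
  convert Set.image_id _ using 2
  funext O
  simp [Set.image_image]

lemma LiftsToIsomorphism.exists_point {b b' : Fin 8 → ℂ} {Ψ : K ≃ₐ[ℂ] K}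
    (H : LiftsToIsomorphism b b' Ψ) (x : SurfacePoint b) :
    ∃ x', Ψ '' localRing b' x' = localRing b x := by
  have : localRing b x ∈ Set.range (localRing b) := ⟨x, rfl⟩
  rw [← H] at this
  obtain ⟨_, ⟨x', rfl⟩, h⟩ := this
  exact ⟨x', h⟩

/-- The correcting functions multiply, the second one being pulled back first. The intermediate
point at which the two comparisons are joined exists because the first map lifts. -/
lemma HasPushForward.trans {b b' b'' : Fin 8 → ℂ} {Ψ Ψ' : K ≃ₐ[ℂ] K} {M M' : Pic → Pic}
    (HL : LiftsToIsomorphism b b' Ψ) (H : HasPushForward b b' Ψ M)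
    (H' : HasPushForward b' b'' Ψ' M') :
    HasPushForward b b'' (Ψ'.trans Ψ) (fun D => M' (M D)) := by
  intro D
  obtain ⟨k, hk, hD⟩ := H D
  obtain ⟨k', hk', hD'⟩ := H' (M D)
  refine ⟨Ψ k' * k, mul_ne_zero (by simpa using hk') hk, fun x x'' hx => ?_⟩
  obtain ⟨x', hx'⟩ := HL.exists_point x
  have hx2 : Ψ' '' localRing b'' x'' = localRing b' x' := by
    apply Ψ.injective.image_injective
    rw [hx', ← hx, Set.image_image]; rfl
  obtain ⟨p1, p2⟩ := hD x x' hx'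
  obtain ⟨q1, q2⟩ := hD' x' x'' hx2
  have r1 : Ψ (Ψ' (localEquation b'' (M' (M D)) x'') / (k' * localEquation b' (M D) x')) ∈
      localRing b x := by rw [← hx']; exact ⟨_, q1, rfl⟩
  have r2 : Ψ (k' * localEquation b' (M D) x' / Ψ' (localEquation b'' (M' (M D)) x'')) ∈
      localRing b x := by rw [← hx']; exact ⟨_, q2, rfl⟩
  have n1 : Ψ (localEquation b' (M D) x') ≠ 0 := by simpa using localEquation_ne_zero _ _ _
  have n2 : Ψ k' ≠ 0 := by simpa using hk'
  have n3 := localEquation_ne_zero b D x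
  have n4 : Ψ (Ψ' (localEquation b'' (M' (M D)) x'')) ≠ 0 := by
    simpa using localEquation_ne_zero _ _ _
  constructor
  · convert mul_mem_localRing r1 p1 using 1
    simp only [map_div₀, map_mul, AlgEquiv.trans_apply]
    field_simp
  · convert mul_mem_localRing r2 p2 using 1
    simp only [map_div₀, map_mul, AlgEquiv.trans_apply]
    field_simp

lemma HasPushForward.symm {b b' : Fin 8 → ℂ} {Ψ : K ≃ₐ[ℂ] K} {M M' : Pic → Pic}
    (H : HasPushForward b b' Ψ M) (hM : ∀ D, M (M' D) = D) : HasPushForward b' b Ψ.symm M' := by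
  intro D
  obtain ⟨k, hk, hD⟩ := H (M' D)
  refine ⟨(Ψ.symm k)⁻¹, inv_ne_zero (by simpa using hk), fun x' x hx => ?_⟩
  have hx' : Ψ '' localRing b' x' = localRing b x := by
    rw [← hx, Set.image_image]; simp
  obtain ⟨p1, p2⟩ := hD x x' hx'
  rw [hM] at p1 p2
  have n1 : Ψ.symm k ≠ 0 := by simpa using hk
  have n2 := localEquation_ne_zero b' D x'
  have n3 : Ψ.symm (localEquation b (M' D) x) ≠ 0 := by simpa using localEquation_ne_zero _ _ _
  constructor
  · rw [← hx]
    refine ⟨_, p2, ?_⟩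
    simp only [map_div₀, map_mul, AlgEquiv.symm_apply_apply]
    field_simp
  · rw [← hx]
    refine ⟨_, p1, ?_⟩
    simp only [map_div₀, map_mul, AlgEquiv.symm_apply_apply]
    field_simp

end SchlesingerA2

end

/-! ### Lifting to exceptional curves; relabelling, exchange of the factors, translation. -/

noncomputable section

namespace SchlesingerA2

open MvPolynomial

/-- A point of `X_b` off the exceptional curves. -/
def pointOff (b : Fin 8 → ℂ) (q : OnePoint ℂ × OnePoint ℂ) (h : q ∉ Set.range (center b)) :
    SurfacePoint b := .inl ⟨q, h⟩

/-- A point of the exceptional curve `E_i`. -/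
def pointOn (b : Fin 8 → ℂ) (i : Fin 8) (t : OnePoint ℂ) : SurfacePoint b := .inr (i, t)

lemma surfacePoint_cases {b : Fin 8 → ℂ} {P : SurfacePoint b → Prop}
    (h1 : ∀ q h, P (pointOff b q h)) (h2 : ∀ i t, P (pointOn b i t)) (x : SurfacePoint b) : P x :=
        by
  cases x with
  | inl q => exact h1 q.1 q.2
  | inr it => exact h2 it.1 it.2

@[simp] lemma surfaceParameters_pointOff (b : Fin 8 → ℂ) (q h) :
    surfaceParameters b (pointOff b q h) = baseParameters q := rfl

@[simp] lemma surfaceParameters_pointOn (b : Fin 8 → ℂ) (i t) :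
    surfaceParameters b (pointOn b i t) = blowUpParameters (baseParameters (center b i)) t := rfl

@[simp] lemma localEquation_pointOff (b : Fin 8 → ℂ) (D q h) :
    localEquation b D (pointOff b q h) = baseEquation D q := rfl

@[simp] lemma localEquation_pointOn (b : Fin 8 → ℂ) (D i t) :
    localEquation b D (pointOn b i t) = baseEquation D (center b i) *
      exceptionalEquation (baseParameters (center b i)) t ^ D.2.2 i := rfl

@[simp] lemma basePoint_pointOff (b : Fin 8 → ℂ) (q h) :
    basePoint b (pointOff b q h) = q := rfl

@[simp] lemma basePoint_pointOn (b : Fin 8 → ℂ) (i t) :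
    basePoint b (pointOn b i t) = center b i := rfl

@[simp] lemma baseParameters_fst (q : OnePoint ℂ × OnePoint ℂ) :
    (baseParameters q).1 = lineParameter f q.1 := rfl

@[simp] lemma baseParameters_snd (q : OnePoint ℂ × OnePoint ℂ) :
    (baseParameters q).2 = lineParameter g q.2 := rfl

/-- A map whose components are `e P` and `e Q`, with `e` vanishing at `x` and `P`, `Q` not both
vanishing there, sends `x` to a point of the exceptional curve. -/
lemma mapsTo_pointOn {b b' : Fin 8 → ℂ} {Ψ : K ≃ₐ[ℂ] K} {x : SurfacePoint b} {j : Fin 8}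
    {e P Q : K} {p q : ℂ} (he : ValAt b x e 0) (he0 : e ≠ 0) (hP : ValAt b x P p)
    (hQ : ValAt b x Q q) (h1 : Ψ (baseParameters (center b' j)).1 = e * P)
    (h2 : Ψ (baseParameters (center b' j)).2 = e * Q) (hpq : p ≠ 0 ∨ q ≠ 0) :
    ∃ t', MapsTo b b' Ψ x (pointOn b' j t') ∧
      IsUnitAt b x (Ψ (exceptionalEquation (baseParameters (center b' j)) t') / e) := by
  have hx := isCoord_surfaceParameters b x
  -- The image direction is Q / P, read in the chart at infinity when P vanishes.
  by_cases hp : p = 0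
  · have hq : q ≠ 0 := hpq.resolve_left (fun h => h hp)
    have hQ0 := hQ.ne_zero hx hq
    refine ⟨OnePoint.infty, ⟨?_, ?_⟩, ?_⟩
    · simp only [surfaceParameters_pointOn, blowUpParameters_infty, map_div₀, h1, h2]
      exact (hP.div hx hQ hq).cast (by field_simp) (by simp [hp])
    · simp only [surfaceParameters_pointOn, blowUpParameters_infty, h2]
      exact (he.mul hQ).cast rfl (by simp)
    · simp only [exceptionalEquation_infty, h2]
      exact ⟨q, hq, hQ.cast (by field_simp) rfl⟩
  · have hP0 := hP.ne_zero hx hp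
    refine ⟨((q / p : ℂ) : OnePoint ℂ), ⟨?_, ?_⟩, ?_⟩
    · simp only [surfaceParameters_pointOn, blowUpParameters_coe, h1]
      exact (he.mul hP).cast rfl (by simp)
    · simp only [surfaceParameters_pointOn, blowUpParameters_coe, map_sub, map_div₀, h1, h2,
        map_const]
      exact ((hQ.div hx hP hp).sub (val_const _ _ _)).cast (by field_simp) (by simp)
    · simp only [exceptionalEquation_coe, h1]
      exact ⟨p, hp, hP.cast (by field_simp) rfl⟩

/-- A map that is locally invertible at the centres lifts to the exceptional curves. -/
lemma mapsTo_pointOn_of_linear {b b' : Fin 8 → ℂ} {Ψ : K ≃ₐ[ℂ] K} {i j : Fin 8} (t : OnePoint ℂ)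
    {A B C D : K} {α β γ δ : ℂ}
    (hA : ValAt b (pointOn b i t) A α) (hB : ValAt b (pointOn b i t) B β)
    (hC : ValAt b (pointOn b i t) C γ) (hD : ValAt b (pointOn b i t) D δ)
    (h1 : Ψ (baseParameters (center b' j)).1 =
      A * (baseParameters (center b i)).1 + B * (baseParameters (center b i)).2)
    (h2 : Ψ (baseParameters (center b' j)).2 =
      C * (baseParameters (center b i)).1 + D * (baseParameters (center b i)).2)
    (hdet : α * δ - β * γ ≠ 0) :
    ∃ t', MapsTo b b' Ψ (pointOn b i t) (pointOn b' j t') ∧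
      IsUnitAt b (pointOn b i t) (Ψ (exceptionalEquation (baseParameters (center b' j)) t') /
        exceptionalEquation (baseParameters (center b i)) t) := by
  have hc := (generate_baseParameters (center b i)).isCoord
  have n1 := hc.left_ne_zero
  have n2 := hc.right_ne_zero
  have hbase := valAt_baseParameters b (pointOn b i t)
  have hs := valAt_slope b i t
  rw [basePoint_pointOn] at hbase
  change ValAt b (pointOn b i t) _ 0 at hs
  generalize baseParameters (center b i) = w at *
  -- Factor out the local equation of E_i in the chart of t. What remains are the two rows of the
  -- matrix applied to the direction, and they cannot both vanish because the determinant does not.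
  induction t using OnePoint.rec with
  | infty =>
    simp only [lineParameter_infty, inv_div, exceptionalEquation_infty] at *
    refine mapsTo_pointOn hbase.2 n2 ((hA.mul hs).add hB) ((hC.mul hs).add hD)
      (by rw [h1]; field_simp) (by rw [h2]; field_simp) ?_
    by_contra! h
    apply hdet
    have e1 : β = 0 := by simpa using h.1
    have e2 : δ = 0 := by simpa using h.2
    rw [e1, e2]; ring
  | coe c =>
    simp only [lineParameter_coe, exceptionalEquation_coe] at *
    have hs' := (hs.add (val_const _ _ c)).cast (sub_add_cancel _ _) (zero_add _)
    refine mapsTo_pointOn hbase.1 n1 (hA.add (hB.mul hs')) (hC.add (hD.mul hs'))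
      (by rw [h1]; field_simp) (by rw [h2]; field_simp) ?_
    by_contra! h
    apply hdet
    linear_combination δ * h.1 - β * h.2

/-- Maps that act linearly on the local parameters of `ℙ¹ × ℙ¹` and permute the centres. -/
lemma exists_mapsTo_of_linear {b b' : Fin 8 → ℂ} {Ψ : K ≃ₐ[ℂ] K} {M : Pic → Pic}
    (π : OnePoint ℂ × OnePoint ℂ → OnePoint ℂ × OnePoint ℂ) (hπ : Function.Injective π)
    (σ : Fin 8 → Fin 8) (hσ : Function.Surjective σ)
    (hcenter : ∀ i, center b' (σ i) = π (center b i))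
    (hlin : ∀ x : SurfacePoint b, ∃ (A B C D : K) (α β γ δ : ℂ),
      ValAt b x A α ∧ ValAt b x B β ∧ ValAt b x C γ ∧ ValAt b x D δ ∧
      Ψ (baseParameters (π (basePoint b x))).1 =
        A * (baseParameters (basePoint b x)).1 + B * (baseParameters (basePoint b x)).2 ∧
      Ψ (baseParameters (π (basePoint b x))).2 =
        C * (baseParameters (basePoint b x)).1 + D * (baseParameters (basePoint b x)).2 ∧
      α * δ - β * γ ≠ 0)
    (hbase : ∀ D x, IsUnitAt b x (Ψ (baseEquation (M D) (π (basePoint b x))) /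
      baseEquation D (basePoint b x)))
    (hM : ∀ D i, (M D).2.2 (σ i) = D.2.2 i) (x : SurfacePoint b) :
    ∃ x', MapsTo b b' Ψ x x' ∧
      ∀ D, IsUnitAt b x (Ψ (localEquation b' (M D) x') / (1 * localEquation b D x)) := by
  refine surfacePoint_cases (P := fun x => ∃ x', MapsTo b b' Ψ x x' ∧
      ∀ D, IsUnitAt b x (Ψ (localEquation b' (M D) x') / (1 * localEquation b D x))) ?_ ?_ x
  · intro q hq
    have hq' : π q ∉ Set.range (center b') := by
      rintro ⟨j, hj⟩
      obtain ⟨i, rfl⟩ := hσ j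
      rw [hcenter] at hj
      exact hq ⟨i, hπ hj⟩
    obtain ⟨A, B, C, D, α, β, γ, δ, hA, hB, hC, hD, h1, h2, -⟩ := hlin (pointOff b q hq)
    rw [basePoint_pointOff] at h1 h2
    refine ⟨pointOff b' (π q) hq', ⟨?_, ?_⟩, fun D => ?_⟩
    · rw [surfaceParameters_pointOff, h1]
      exact ((hA.mul (val_left _ _)).add (hB.mul (val_right _ _))).cast rfl (by simp)
    · rw [surfaceParameters_pointOff, h2]
      exact ((hC.mul (val_left _ _)).add (hD.mul (val_right _ _))).cast rfl (by simp)
    · have := hbase D (pointOff b q hq)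
      simpa using this
  · intro i t
    obtain ⟨A, B, C, D, α, β, γ, δ, hA, hB, hC, hD, h1, h2, hdet⟩ := hlin (pointOn b i t)
    rw [basePoint_pointOn, ← hcenter] at h1 h2
    obtain ⟨t', ht', hu⟩ := mapsTo_pointOn_of_linear t hA hB hC hD h1 h2 hdet
    refine ⟨_, ht', fun D => ?_⟩
    have hb := hbase D (pointOn b i t)
    have := hb.mul (hu.zpow (D.2.2 i))
    convert this using 1
    simp only [localEquation_pointOn, hM, map_mul, map_zpow₀, basePoint_pointOn, one_mul, hcenter]
    rw [div_zpow, mul_div_mul_comm]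

/-- The isomorphism that only renames the centres. -/
lemma permutation_isomorphism {b : Fin 8 → ℂ} (hb : Function.Injective (center b))
    (σ : Equiv.Perm (Fin 8)) (hσ : ∀ i, center (b ∘ σ.symm) (σ i) = center b i) :
    Function.Injective (center (b ∘ σ.symm)) ∧
    LiftsToIsomorphism b (b ∘ σ.symm) AlgEquiv.refl ∧
    HasPushForward b (b ∘ σ.symm) AlgEquiv.refl (fun D => (D.1, D.2.1, D.2.2 ∘ σ.symm)) := by
  have hb' : Function.Injective (center (b ∘ σ.symm)) := by
    intro i j hij
    have h := hσ (σ.symm i)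
    have h' := hσ (σ.symm j)
    rw [Equiv.apply_symm_apply] at h h'
    rw [h, h'] at hij
    exact σ.symm.injective (hb hij)
  have F := exists_mapsTo_of_linear (b := b) (b' := b ∘ σ.symm) (Ψ := AlgEquiv.refl)
    (M := fun D => (D.1, D.2.1, D.2.2 ∘ σ.symm)) id Function.injective_id σ σ.surjective hσ
    (fun x => ⟨1, 0, 0, 1, 1, 0, 0, 1, val_one _ _, val_zero _ _, val_zero _ _, val_one _ _,
      by simp, by simp, by simp⟩)
    (fun D x => by
      have : baseEquation (D.1, D.2.1, D.2.2 ∘ σ.symm) (basePoint b x) =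
        baseEquation D (basePoint b x) := rfl
      simp only [id, this, AlgEquiv.coe_refl]
      rw [div_self (baseEquation_ne_zero _ _)]; exact isUnitAt_one)
    (by simp)
  have F' := exists_mapsTo_of_linear (b := b ∘ σ.symm) (b' := b) (Ψ := AlgEquiv.refl)
    (M := fun D => (D.1, D.2.1, D.2.2 ∘ σ)) id Function.injective_id σ.symm σ.symm.surjective
    (fun i => by rw [← hσ]; simp)
    (fun x => ⟨1, 0, 0, 1, 1, 0, 0, 1, val_one _ _, val_zero _ _, val_zero _ _, val_one _ _,
      by simp, by simp, by simp⟩)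
    (fun D x => by
      have : baseEquation (D.1, D.2.1, D.2.2 ∘ σ) (basePoint (b ∘ σ.symm) x) =
        baseEquation D (basePoint (b ∘ σ.symm) x) := rfl
      simp only [id, this, AlgEquiv.coe_refl]
      rw [div_self (baseEquation_ne_zero _ _)]; exact isUnitAt_one)
    (by simp)
  refine ⟨hb', liftsToIsomorphism_of_mapsTo hb hb' (fun x => ?_) (fun x => ?_),
    hasPushForward_of_mapsTo hb hb' (fun _ => 1) (fun _ => one_ne_zero) F (fun x => ?_)⟩
  · obtain ⟨y, h, -⟩ := F x
    exact ⟨y, h⟩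
  · obtain ⟨y, h, -⟩ := F' x
    exact ⟨y, h⟩
  · obtain ⟨y, h, -⟩ := F' x
    exact ⟨y, h⟩

/-! ### The exchange of the two factors -/

lemma isCoord_g_f : IsCoord g f :=
  (generate_f_g.of_mem (mem_adjoin_right _ _) (mem_adjoin_left _ _)).isCoord

/-- The automorphism exchanging `f` and `g`. -/
def swapEquiv : K ≃ₐ[ℂ] K :=
  equivOfInvolution isCoord_g_f (homOfCoord_g _) (homOfCoord_f _)

@[simp] lemma swapEquiv_f : swapEquiv f = g := homOfCoord_f isCoord_g_f
@[simp] lemma swapEquiv_g : swapEquiv g = f := homOfCoord_g isCoord_g_f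

/-- The parameters after the exchange of the two factors. -/
def swapParameters (b : Fin 8 → ℂ) : Fin 8 → ℂ :=
  ![-b 0, -b 1, -b 2, -b 3, -b 6, -b 7, -b 4, -b 5]

lemma swapParameters_swapParameters (b : Fin 8 → ℂ) : swapParameters (swapParameters b) = b := by
  funext i
  fin_cases i <;> simp [swapParameters]

/-- The permutation of the exceptional curves under the exchange of the two factors. -/
def swapIndex : Fin 8 → Fin 8 := ![0, 1, 2, 3, 6, 7, 4, 5]

/-- The action of the exchange of the two factors on the Picard lattice. -/
def swapAction (D : Pic) : Pic := (D.2.1, D.1, D.2.2 ∘ swapIndex)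

lemma swapIndex_swapIndex (i : Fin 8) : swapIndex (swapIndex i) = i := by
  fin_cases i <;> rfl

lemma center_swapParameters (b : Fin 8 → ℂ) (i : Fin 8) :
    center (swapParameters b) (swapIndex i) = (center b i).swap := by
  fin_cases i <;> simp [center, swapParameters, swapIndex]

lemma swap_lineParameter_f (t : OnePoint ℂ) : swapEquiv (lineParameter f t) = lineParameter g t :=
    by
  induction t using OnePoint.rec with
  | infty => simp
  | coe c => simp [map_const]

lemma swap_lineParameter_g (t : OnePoint ℂ) : swapEquiv (lineParameter g t) = lineParameter f t :=
    by
  induction t using OnePoint.rec with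
  | infty => simp
  | coe c => simp [map_const]

lemma exists_mapsTo_swap (b : Fin 8 → ℂ) (x : SurfacePoint b) :
    ∃ x', MapsTo b (swapParameters b) swapEquiv x x' ∧ ∀ D, IsUnitAt b x
      (swapEquiv (localEquation (swapParameters b) (swapAction D) x') /
        (1 * localEquation b D x)) := by
  refine exists_mapsTo_of_linear (M := swapAction) Prod.swap Prod.swap_injective swapIndex
    (fun j => ⟨swapIndex j, swapIndex_swapIndex j⟩) (center_swapParameters b)
    (fun x => ⟨0, 1, 1, 0, 0, 1, 1, 0, val_zero _ _, val_one _ _, val_one _ _, val_zero _ _,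
      by simp [swap_lineParameter_f], by simp [swap_lineParameter_g], by simp⟩)
    (fun D x => ?_) (fun D i => ?_) x
  · have : swapEquiv (baseEquation (swapAction D) (basePoint b x).swap) =
        baseEquation D (basePoint b x) := by
      obtain ⟨p, q⟩ := basePoint b x
      induction p using OnePoint.rec <;> induction q using OnePoint.rec <;>
        simp [baseEquation, swapAction, mul_comm]
    rw [this, div_self (baseEquation_ne_zero _ _)]
    exact isUnitAt_one
  · simp [swapAction, swapIndex_swapIndex]

lemma swap_isomorphism {b : Fin 8 → ℂ} (hb : Function.Injective (center b)) :
    Function.Injective (center (swapParameters b)) ∧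
    LiftsToIsomorphism b (swapParameters b) swapEquiv ∧
    HasPushForward b (swapParameters b) swapEquiv swapAction := by
  have hb' : Function.Injective (center (swapParameters b)) := by
    intro i j hij
    have h := center_swapParameters b (swapIndex i)
    have h' := center_swapParameters b (swapIndex j)
    rw [swapIndex_swapIndex] at h h'
    rw [h, h'] at hij
    have := hb (Prod.swap_injective hij)
    rw [← swapIndex_swapIndex i, this, swapIndex_swapIndex]
  have F := exists_mapsTo_swap b
  have F' : ∀ x', ∃ x, MapsTo (swapParameters b) b swapEquiv.symm x' x := by
    intro x'
    have := exists_mapsTo_swap (swapParameters b) x'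
    rw [swapParameters_swapParameters] at this
    obtain ⟨x, h, -⟩ := this
    exact ⟨x, h⟩
  refine ⟨hb', liftsToIsomorphism_of_mapsTo hb hb' (fun x => ?_) F',
    hasPushForward_of_mapsTo hb hb' (fun _ => 1) (fun _ => one_ne_zero) F F'⟩
  obtain ⟨y, h, -⟩ := F x
  exact ⟨y, h⟩

/-! ### Translations of the coordinates -/

lemma isCoord_shift (c : ℂ) : IsCoord (f + const c) (g - const c) := by
  refine (generate_f_g.of_mem ?_ ?_).isCoord
  · have := IntermediateField.sub_mem _ (mem_adjoin_left (f + const c) (g - const c))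
      (const_mem _ c)
    simpa using this
  · have := IntermediateField.add_mem _ (mem_adjoin_right (f + const c) (g - const c))
      (const_mem _ c)
    simpa using this

lemma homOfCoord_const {u v : K} (h : IsCoord u v) (c : ℂ) : homOfCoord h (const c) = const c :=
  (homOfCoord h).commutes c

/-- The automorphism `(f, g) ↦ (f + c, g - c)`. -/
def shiftEquiv (c : ℂ) : K ≃ₐ[ℂ] K :=
  AlgEquiv.ofAlgHom (homOfCoord (isCoord_shift c)) (homOfCoord (isCoord_shift (-c)))
    (algHom_ext_f_g (by simp [homOfCoord_f, homOfCoord_const, const_neg])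
      (by simp [homOfCoord_g, homOfCoord_const, const_neg]))
    (algHom_ext_f_g (by simp [homOfCoord_f, homOfCoord_const, const_neg])
      (by simp [homOfCoord_g, homOfCoord_const, const_neg]))

@[simp] lemma shiftEquiv_f (c : ℂ) : shiftEquiv c f = f + const c := homOfCoord_f (isCoord_shift c)
@[simp] lemma shiftEquiv_g (c : ℂ) : shiftEquiv c g = g - const c := homOfCoord_g (isCoord_shift c)

lemma shiftEquiv_symm (c : ℂ) : (shiftEquiv c).symm = shiftEquiv (-c) :=
  algEquiv_ext_f_g rfl rfl

/-- The parameters after a translation of the coordinates. -/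
def shiftParameters (c : ℂ) (b : Fin 8 → ℂ) : Fin 8 → ℂ :=
  ![b 0 + c, b 1 + c, b 2 + c, b 3 + c, b 4 - c, b 5 - c, b 6 - c, b 7 - c]

/-- Translation of `ℙ¹`. -/
def shiftPoint (c : ℂ) (t : OnePoint ℂ) : OnePoint ℂ :=
  t.elim OnePoint.infty (fun a => ((a + c : ℂ) : OnePoint ℂ))

@[simp] lemma shiftPoint_infty (c : ℂ) : shiftPoint c OnePoint.infty = OnePoint.infty := rfl
@[simp] lemma shiftPoint_coe (c a : ℂ) :
    shiftPoint c (a : OnePoint ℂ) = ((a + c : ℂ) : OnePoint ℂ) := rfl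

lemma shiftPoint_shiftPoint (c : ℂ) (t : OnePoint ℂ) : shiftPoint (-c) (shiftPoint c t) = t := by
  induction t using OnePoint.rec <;> simp

lemma center_shiftParameters (c : ℂ) (b : Fin 8 → ℂ) (i : Fin 8) :
    center (shiftParameters c b) i =
      (shiftPoint c (center b i).1, shiftPoint (-c) (center b i).2) := by
  fin_cases i <;> simp [center, shiftParameters] <;> ring_nf <;> simp

lemma shift_injective (c : ℂ) : Function.Injective
    (fun q : OnePoint ℂ × OnePoint ℂ => (shiftPoint c q.1, shiftPoint (-c) q.2)) := by
  intro q q' h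
  have h1 := congrArg (fun r : OnePoint ℂ × OnePoint ℂ => shiftPoint (-c) r.1) h
  have h2 := congrArg (fun r : OnePoint ℂ × OnePoint ℂ => shiftPoint (- -c) r.2) h
  simp only [shiftPoint_shiftPoint] at h1 h2
  exact Prod.ext h1 h2

/-- Only infinity needs an argument: 1 / (f + c) is 1 / f times the inverse of 1 + c / f, which has
value 1 there. -/
lemma isUnitAt_shift_f {b : Fin 8 → ℂ} {x : SurfacePoint b} {t : OnePoint ℂ} (c : ℂ)
    (ht : ValAt b x (lineParameter f t) 0) :
    ∃ A : K, IsUnitAt b x A ∧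
      shiftEquiv c (lineParameter f (shiftPoint c t)) = A * lineParameter f t := by
  have hx := isCoord_surfaceParameters b x
  induction t using OnePoint.rec with
  | infty =>
    have h := ((val_one _ _).add ((val_const _ _ c).mul ht)).cast (c₂ := 1) rfl (by simp)
    refine ⟨_, (ValAt.isUnitAt h one_ne_zero).inv, ?_⟩
    have h0 := h.ne_zero hx one_ne_zero
    have := f_ne_zero
    simp only [shiftPoint_infty, lineParameter_infty, map_inv₀, shiftEquiv_f] at *
    rw [← mul_inv]
    congr 1
    field_simp
  | coe a => exact ⟨1, isUnitAt_one, by simp [map_const, const_add]⟩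

lemma isUnitAt_shift_g {b : Fin 8 → ℂ} {x : SurfacePoint b} {t : OnePoint ℂ} (c : ℂ)
    (ht : ValAt b x (lineParameter g t) 0) :
    ∃ A : K, IsUnitAt b x A ∧
      shiftEquiv c (lineParameter g (shiftPoint (-c) t)) = A * lineParameter g t := by
  have hx := isCoord_surfaceParameters b x
  induction t using OnePoint.rec with
  | infty =>
    have h := ((val_one _ _).sub ((val_const _ _ c).mul ht)).cast (c₂ := 1) rfl (by simp)
    refine ⟨_, (ValAt.isUnitAt h one_ne_zero).inv, ?_⟩
    have h0 := h.ne_zero hx one_ne_zero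
    have := g_ne_zero
    simp only [shiftPoint_infty, lineParameter_infty, map_inv₀, shiftEquiv_g] at *
    rw [← mul_inv]
    congr 1
    field_simp
  | coe a => exact ⟨1, isUnitAt_one, by simp [map_const, const_add, const_neg]; ring⟩

lemma exists_mapsTo_shift (c : ℂ) (b : Fin 8 → ℂ) (x : SurfacePoint b) :
    ∃ x', MapsTo b (shiftParameters c b) (shiftEquiv c) x x' ∧ ∀ D, IsUnitAt b x
      (shiftEquiv c (localEquation (shiftParameters c b) D x') / (1 * localEquation b D x)) := by
  refine exists_mapsTo_of_linear (M := fun D => D)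
    (fun q => (shiftPoint c q.1, shiftPoint (-c) q.2)) (shift_injective c) id
    Function.surjective_id (center_shiftParameters c b) (fun x => ?_) (fun D x => ?_)
    (fun D i => rfl) x
  · have hx := valAt_baseParameters b x
    obtain ⟨A, ⟨a, ha, hA⟩, eA⟩ := isUnitAt_shift_f c hx.1
    obtain ⟨B, ⟨β, hβ, hB⟩, eB⟩ := isUnitAt_shift_g c hx.2
    exact ⟨A, 0, 0, B, a, 0, 0, β, hA, val_zero _ _, val_zero _ _, hB, by simpa using eA,
      by simpa using eB, by simp [ha, hβ]⟩
  · have hx := valAt_baseParameters b x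
    obtain ⟨A, hA, eA⟩ := isUnitAt_shift_f c hx.1
    obtain ⟨B, hB, eB⟩ := isUnitAt_shift_g c hx.2
    have key : ∃ m n : ℤ, shiftEquiv c (baseEquation D ((shiftPoint c (basePoint b x).1),
        shiftPoint (-c) (basePoint b x).2)) = A ^ m * B ^ n * baseEquation D (basePoint b x) := by
      clear hx
      generalize basePoint b x = r at *
      obtain ⟨p, q⟩ := r
      induction p using OnePoint.rec with
      | infty =>
        induction q using OnePoint.rec with
        | infty =>
          refine ⟨D.1, D.2.1, ?_⟩
          simp only [shiftPoint_infty, lineParameter_infty] at eA eB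
          simp only [baseEquation, shiftPoint_infty, OnePoint.elim_infty, map_mul, map_zpow₀, eA,
            eB, mul_zpow]
          ring
        | coe a =>
          refine ⟨D.1, 0, ?_⟩
          simp only [shiftPoint_infty, lineParameter_infty] at eA
          simp only [baseEquation, shiftPoint_infty, shiftPoint_coe, OnePoint.elim_infty,
            OnePoint.elim_some, map_mul, map_zpow₀, map_one, eA, mul_zpow]
          simp
      | coe a =>
        induction q using OnePoint.rec with
        | infty =>
          refine ⟨0, D.2.1, ?_⟩
          simp only [shiftPoint_infty, lineParameter_infty] at eB
          simp only [baseEquation, shiftPoint_infty, shiftPoint_coe, OnePoint.elim_infty,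
            OnePoint.elim_some, map_mul, map_zpow₀, map_one, eB, mul_zpow]
          simp
        | coe a' => exact ⟨0, 0, by simp [baseEquation]⟩
    obtain ⟨m, n, e⟩ := key
    rw [e, mul_div_cancel_right₀ _ (baseEquation_ne_zero _ _)]
    exact (hA.zpow m).mul (hB.zpow n)

lemma shiftParameters_shiftParameters (c : ℂ) (b : Fin 8 → ℂ) :
    shiftParameters (-c) (shiftParameters c b) = b := by
  funext i
  fin_cases i <;> simp [shiftParameters]

lemma shift_isomorphism (c : ℂ) {b : Fin 8 → ℂ} (hb : Function.Injective (center b)) :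
    Function.Injective (center (shiftParameters c b)) ∧
    LiftsToIsomorphism b (shiftParameters c b) (shiftEquiv c) ∧
    HasPushForward b (shiftParameters c b) (shiftEquiv c) (fun D => D) := by
  have hb' : Function.Injective (center (shiftParameters c b)) := by
    intro i j hij
    rw [center_shiftParameters, center_shiftParameters] at hij
    exact hb (shift_injective c hij)
  have F := exists_mapsTo_shift c b
  have F' : ∀ x', ∃ x, MapsTo (shiftParameters c b) b (shiftEquiv c).symm x' x := by
    intro x'
    have := exists_mapsTo_shift (-c) (shiftParameters c b) x'
    rw [shiftParameters_shiftParameters, ← shiftEquiv_symm] at this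
    obtain ⟨x, h, -⟩ := this
    exact ⟨x, h⟩
  refine ⟨hb', liftsToIsomorphism_of_mapsTo hb hb' (fun x => ?_) F',
    hasPushForward_of_mapsTo hb hb' (fun _ => 1) (fun _ => one_ne_zero) F F'⟩
  obtain ⟨y, h, -⟩ := F x
  exact ⟨y, h⟩

end SchlesingerA2

end

/-! ### The quadratic involution: formulas, and orders along the boundary curves. -/

noncomputable section

namespace SchlesingerA2

open MvPolynomial

/-! ### The quadratic map `(f + g) (f + g') = (f - b₁) (f - b₂)` -/

lemma f_sub_const_ne_zero (c : ℂ) : f - const c ≠ 0 := lineParameter_ne_zero_f (c : OnePoint ℂ)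

lemma f_add_g_ne_zero : f + g ≠ 0 := by
  have := isCoord_f_g.aeval_ne_zero (F := X 0 + X 1) (fun h => by
    have := congrArg (eval ![1, 0]) h
    simp at this)
  simpa using this

/-- The image of `g` under the quadratic map. -/
def quadImage (β β' : ℂ) : K := -f + (f - const β) * (f - const β') / (f + g)

lemma f_add_quadImage (β β' : ℂ) :
    f + quadImage β β' = (f - const β) * (f - const β') / (f + g) := by
  rw [quadImage]; ring

/-- The defining relation is symmetric in g and its image, so the map is an involution. -/
lemma quad_inverse (β β' : ℂ) :
    -f + (f - const β) * (f - const β') / (f + quadImage β β') = g := by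
  have h1 := f_sub_const_ne_zero β
  have h2 := f_sub_const_ne_zero β'
  have h3 := f_add_g_ne_zero
  rw [f_add_quadImage]
  field_simp
  ring

lemma isCoord_quad (β β' : ℂ) : IsCoord f (quadImage β β') := by
  refine (generate_f_g.of_mem (mem_adjoin_left _ _) ?_).isCoord
  set L := IntermediateField.adjoin ℂ {f, quadImage β β'}
  have m1 : f ∈ L := mem_adjoin_left _ _
  have m2 : quadImage β β' ∈ L := mem_adjoin_right _ _
  rw [← quad_inverse β β']
  exact L.add_mem (L.neg_mem m1) (L.div_mem (L.mul_mem (L.sub_mem m1 (const_mem L _))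
    (L.sub_mem m1 (const_mem L _))) (L.add_mem m1 m2))

/-- The automorphism `(f, g) ↦ (f, g')` with `(f + g) (f + g') = (f - β) (f - β')`. -/
def quadEquiv (β β' : ℂ) : K ≃ₐ[ℂ] K :=
  equivOfInvolution (isCoord_quad β β') (homOfCoord_f _) (by
    change homOfCoord (isCoord_quad β β')
      (-f + (f - const β) * (f - const β') / (f + g)) = g
    simp only [map_add, map_neg, map_div₀, map_mul, map_sub, homOfCoord_f, homOfCoord_g,
      homOfCoord_const]
    exact quad_inverse β β')

@[simp] lemma quadEquiv_f (β β' : ℂ) : quadEquiv β β' f = f := homOfCoord_f (isCoord_quad β β')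
lemma quadEquiv_g (β β' : ℂ) :
    quadEquiv β β' g = -f + (f - const β) * (f - const β') / (f + g) :=
  homOfCoord_g (isCoord_quad β β')

lemma quadEquiv_comm (β β' : ℂ) : quadEquiv β β' = quadEquiv β' β :=
  algEquiv_ext_f_g (by simp) (by rw [quadEquiv_g, quadEquiv_g]; ring)

lemma quadEquiv_g_inv (β β' : ℂ) :
    (quadEquiv β β' g)⁻¹ = (f + g) / ((f - const β) * (f - const β') - f * (f + g)) := by
  have h := f_add_g_ne_zero
  rw [quadEquiv_g, ← inv_div]
  congr 1
  field_simp
  ring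

/-- The parameters after the quadratic map. -/
def quadParameters (b : Fin 8 → ℂ) : Fin 8 → ℂ :=
  ![b 0, b 1, -b 6, -b 7, -b 0 - b 1 - b 4, -b 0 - b 1 - b 5, -b 2, -b 3]

lemma quadParameters_quadParameters (b : Fin 8 → ℂ) : quadParameters (quadParameters b) = b := by
  funext i
  fin_cases i <;> simp [quadParameters]

/-- The action of the quadratic map on the Picard lattice. -/
def quadAction (D : Pic) : Pic :=
  (D.1 + D.2.1 + D.2.2 0 + D.2.2 1, D.2.1,
    ![-D.2.1 - D.2.2 0, -D.2.1 - D.2.2 1, D.2.2 6, D.2.2 7, D.2.2 4, D.2.2 5, D.2.2 2, D.2.2 3])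

/-- The function relating the divisors before and after the quadratic map. -/
def quadFactor (β β' : ℂ) (e m n : ℤ) : K :=
  ((f + g) / ((f - const β) * (f - const β'))) ^ e * (f - const β) ^ (-m) * (f - const β') ^ (-n)

/-- With g' the image of g, the factor is (f + g')^(-e) (f - β)^(-m) (f - β')^(-n), since f + g' =
(f - β)(f - β') / (f + g). Here e is the coefficient of g = ∞, and m, n are those of the exceptional
curves over the two base points, which play symmetric roles. -/
lemma quadFactor_comm (β β' : ℂ) (e m n : ℤ) : quadFactor β β' e m n = quadFactor β' β e n m := by
  rw [quadFactor, quadFactor, mul_comm (f - const β) (f - const β')]; ring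

lemma quadFactor_ne_zero (β β' : ℂ) (e m n : ℤ) : quadFactor β β' e m n ≠ 0 :=
  mul_ne_zero (mul_ne_zero (zpow_ne_zero _ (div_ne_zero f_add_g_ne_zero
    (mul_ne_zero (f_sub_const_ne_zero _) (f_sub_const_ne_zero _))))
    (zpow_ne_zero _ (f_sub_const_ne_zero _))) (zpow_ne_zero _ (f_sub_const_ne_zero _))

lemma valAt_f_of_lineParameter {b : Fin 8 → ℂ} {x : SurfacePoint b} {a : ℂ}
    (h : ValAt b x (f - const a) 0) : ValAt b x f a :=
  (h.add (val_const _ _ a)).cast (sub_add_cancel _ _) (zero_add _)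

section
variable {b : Fin 8 → ℂ} {x : SurfacePoint b} {β β' : ℂ} {e m n : ℤ}

/-- Where `f - β`, `f - β'` and `f + g` are units, so is the factor. -/
lemma isUnitAt_quadFactor (h1 : IsUnitAt b x (f - const β)) (h2 : IsUnitAt b x (f - const β'))
    (h3 : IsUnitAt b x (f + g)) : IsUnitAt b x (1 / (quadFactor β β' e m n * 1)) := by
  rw [mul_one]
  exact isUnitAt_one.div ((((h3.div (h1.mul h2)).zpow e).mul (h1.zpow (-m))).mul (h2.zpow (-n)))

/-- For points sent to g = ∞: the pole of the image of g has numerator (f - β)(f - β') - f (f + g),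
a unit there, and its denominator f + g cancels against the factor. -/
lemma isUnitAt_quadFactor_target_infty (h1 : IsUnitAt b x (f - const β))
    (h2 : IsUnitAt b x (f - const β'))
    (h3 : IsUnitAt b x ((f - const β) * (f - const β') - f * (f + g))) :
    IsUnitAt b x (quadEquiv β β' (g⁻¹ ^ e) / (quadFactor β β' e m n * 1)) := by
  have n1 := f_sub_const_ne_zero β
  have n2 := f_sub_const_ne_zero β'
  have n3 := f_add_g_ne_zero
  have := ((((h1.mul h2).div h3).zpow e).mul (h1.zpow m)).mul (h2.zpow n)
  convert this using 1
  simp only [map_zpow₀, map_inv₀, quadEquiv_g_inv, quadFactor, div_zpow, mul_zpow, zpow_neg]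
  have := zpow_ne_zero e n1
  have := zpow_ne_zero e n2
  have := zpow_ne_zero e n3
  have := zpow_ne_zero m n1
  have := zpow_ne_zero n n2
  field_simp

lemma isUnitAt_quadFactor_source_infty (h1 : IsUnitAt b x (f - const β))
    (h2 : IsUnitAt b x (f - const β')) (h3 : IsUnitAt b x (1 + f * g⁻¹)) :
    IsUnitAt b x (1 / (quadFactor β β' e m n * g⁻¹ ^ e)) := by
  have n1 := f_sub_const_ne_zero β
  have n2 := f_sub_const_ne_zero β'
  have n3 := f_add_g_ne_zero
  have n4 := g_ne_zero
  have := ((((h1.mul h2).div h3).zpow e).mul (h1.zpow m)).mul (h2.zpow n)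
  convert this using 1
  have e1 : 1 + f * g⁻¹ = (f + g) * g⁻¹ := by field_simp; ring
  rw [e1]
  simp only [quadFactor, div_zpow, mul_zpow, zpow_neg, inv_zpow]
  have := zpow_ne_zero e n1
  have := zpow_ne_zero e n2
  have := zpow_ne_zero e n3
  have := zpow_ne_zero e n4
  have := zpow_ne_zero m n1
  have := zpow_ne_zero n n2
  field_simp

lemma isUnitAt_f_inv_mul (h : ValAt b x f⁻¹ 0) (c : ℂ) :
    IsUnitAt b x (f⁻¹ * (f - const c)) :=
  ValAt.isUnitAt (((val_one _ _).sub ((val_const _ _ c).mul h)).cast (c₂ := 1)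
    (by have := f_ne_zero; field_simp) (by simp)) one_ne_zero

/-- Along f = ∞ each of f - β, f - β', f + g has a simple pole, so the factor has order e + m + n;
this is the increment of the first coordinate in `quadAction`. -/
lemma isUnitAt_quadFactor_f_infty {d : ℤ} (hf : ValAt b x f⁻¹ 0)
    (h3 : IsUnitAt b x (f⁻¹ * (f + g))) :
    IsUnitAt b x (quadEquiv β β' (f⁻¹ ^ (d + e + m + n)) /
      (quadFactor β β' e m n * f⁻¹ ^ d)) := by
  have h1 := isUnitAt_f_inv_mul hf β
  have h2 := isUnitAt_f_inv_mul hf β'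
  have n0 := f_ne_zero
  have n1 := f_sub_const_ne_zero β
  have n2 := f_sub_const_ne_zero β'
  have n3 := f_add_g_ne_zero
  have := ((((h1.mul h2).div h3).zpow e).mul (h1.zpow m)).mul (h2.zpow n)
  convert this using 1
  have n0' := inv_ne_zero n0
  rw [map_zpow₀, map_inv₀, quadEquiv_f]
  simp only [quadFactor, div_zpow, mul_zpow, zpow_neg, zpow_add₀ n0']
  have := zpow_ne_zero d n0'
  have := zpow_ne_zero e n0'
  have := zpow_ne_zero m n0'
  have := zpow_ne_zero n n0'
  have := zpow_ne_zero e n1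
  have := zpow_ne_zero e n2
  have := zpow_ne_zero e n3
  have := zpow_ne_zero m n1
  have := zpow_ne_zero n n2
  generalize (f⁻¹ : K) ^ d = w1 at *
  generalize (f⁻¹ : K) ^ e = w2 at *
  generalize (f⁻¹ : K) ^ m = w3 at *
  generalize (f⁻¹ : K) ^ n = w4 at *
  field_simp

end

end SchlesingerA2

end

/-! ### The quadratic involution at points off the exceptional curves. -/

noncomputable section

namespace SchlesingerA2

open MvPolynomial

/-- The quadratic map is regular at `x`, with the expected behaviour of divisors. -/
def QuadRegularAt (b : Fin 8 → ℂ) (x : SurfacePoint b) : Prop :=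
  ∃ x', MapsTo b (quadParameters b) (quadEquiv (b 0) (b 1)) x x' ∧
    ∀ D, IsUnitAt b x (quadEquiv (b 0) (b 1) (localEquation (quadParameters b) (quadAction D) x') /
      (quadFactor (b 0) (b 1) D.2.1 (D.2.2 0) (D.2.2 1) * localEquation b D x))

lemma isUnitAt_f_sub {b : Fin 8 → ℂ} {x : SurfacePoint b} {a β : ℂ} (h : ValAt b x f a)
    (hne : a ≠ β) : IsUnitAt b x (f - const β) :=
  ⟨a - β, sub_ne_zero.2 hne, h.sub (val_const _ _ β)⟩

lemma valAt_g_of_lineParameter {b : Fin 8 → ℂ} {x : SurfacePoint b} {a : ℂ}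
    (h : ValAt b x (g - const a) 0) : ValAt b x g a :=
  (h.add (val_const _ _ a)).cast (sub_add_cancel _ _) (zero_add _)

lemma baseEquation_coe_coe (D : Pic) (a c : ℂ) :
    baseEquation D ((a : OnePoint ℂ), (c : OnePoint ℂ)) = 1 := by simp [baseEquation]

lemma baseEquation_coe_infty (D : Pic) (a : ℂ) :
    baseEquation D ((a : OnePoint ℂ), OnePoint.infty) = g⁻¹ ^ D.2.1 := by simp [baseEquation]

lemma baseEquation_infty_coe (D : Pic) (a : ℂ) :
    baseEquation D (OnePoint.infty, (a : OnePoint ℂ)) = f⁻¹ ^ D.1 := by simp [baseEquation]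

lemma baseEquation_infty_infty (D : Pic) :
    baseEquation D (OnePoint.infty, OnePoint.infty) = f⁻¹ ^ D.1 * g⁻¹ ^ D.2.1 := by
  simp [baseEquation]

lemma coe_coe_notMem (b : Fin 8 → ℂ) {a c : ℂ} (h : a + c ≠ 0) :
    ((a : OnePoint ℂ), (c : OnePoint ℂ)) ∉ Set.range (center b) := by
  rintro ⟨i, hi⟩
  fin_cases i <;> simp [center] at hi <;> apply h <;> rw [← hi.1, ← hi.2] <;> ring

lemma coe_neg_notMem (b : Fin 8 → ℂ) {a : ℂ} (h0 : a ≠ b 0) (h1 : a ≠ b 1) (h2 : a ≠ b 2)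
    (h3 : a ≠ b 3) : ((a : OnePoint ℂ), ((-a : ℂ) : OnePoint ℂ)) ∉ Set.range (center b) := by
  rintro ⟨i, hi⟩
  fin_cases i <;> simp [center] at hi
  · exact h0 hi.symm
  · exact h1 hi.symm
  · exact h2 hi.symm
  · exact h3 hi.symm

lemma coe_infty_notMem (b : Fin 8 → ℂ) {a : ℂ} (h6 : a ≠ -b 6) (h7 : a ≠ -b 7) :
    ((a : OnePoint ℂ), (OnePoint.infty : OnePoint ℂ)) ∉ Set.range (center b) := by
  rintro ⟨i, hi⟩
  fin_cases i <;> simp [center] at hi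
  · exact h6 hi.symm
  · exact h7 hi.symm

lemma infty_coe_notMem (b : Fin 8 → ℂ) {a : ℂ} (h4 : a ≠ b 4) (h5 : a ≠ b 5) :
    ((OnePoint.infty : OnePoint ℂ), (a : OnePoint ℂ)) ∉ Set.range (center b) := by
  rintro ⟨i, hi⟩
  fin_cases i <;> simp [center] at hi
  · exact h4 hi.symm
  · exact h5 hi.symm

lemma infty_infty_notMem (b : Fin 8 → ℂ) :
    ((OnePoint.infty : OnePoint ℂ), (OnePoint.infty : OnePoint ℂ)) ∉ Set.range (center b) := by
  rintro ⟨i, hi⟩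
  fin_cases i <;> simp [center] at hi

variable {b : Fin 8 → ℂ}

lemma quadRegularAt_generic {a c : ℂ} (h) (h0 : a ≠ b 0) (h1 : a ≠ b 1) (hs : a + c ≠ 0) :
    QuadRegularAt b (pointOff b ((a : OnePoint ℂ), (c : OnePoint ℂ)) h) := by
  set x := pointOff b ((a : OnePoint ℂ), (c : OnePoint ℂ)) h with hx
  have hX := isCoord_surfaceParameters b x
  have hf : ValAt b x f a := valAt_f_of_lineParameter (val_left _ _)
  have hg : ValAt b x g c := valAt_g_of_lineParameter (val_right _ _)
  have u0 := isUnitAt_f_sub hf h0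
  have u1 := isUnitAt_f_sub hf h1
  have us : IsUnitAt b x (f + g) := ⟨_, hs, hf.add hg⟩
  have hs' : a + (-a + (a - b 0) * (a - b 1) / (a + c)) ≠ 0 := by
    rw [add_neg_cancel_left]
    exact div_ne_zero (mul_ne_zero (sub_ne_zero.2 h0) (sub_ne_zero.2 h1)) hs
  refine ⟨pointOff _ ((a : OnePoint ℂ), ((-a + (a - b 0) * (a - b 1) / (a + c) : ℂ) : OnePoint ℂ))
    (coe_coe_notMem _ hs'), ⟨?_, ?_⟩, fun D => ?_⟩
  · simp only [surfaceParameters_pointOff, baseParameters_fst, lineParameter_coe, map_sub,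
      quadEquiv_f, map_const]
    exact val_left _ _
  · simp only [surfaceParameters_pointOff, baseParameters_snd, lineParameter_coe, map_sub,
      quadEquiv_g, map_const]
    exact ((hf.neg.add (((hf.sub (val_const _ _ _)).mul (hf.sub (val_const _ _ _))).div hX
      (hf.add hg) hs)).sub (val_const _ _ _)).cast rfl (by ring)
  · simp only [localEquation_pointOff, baseEquation_coe_coe, hx, map_one]
    exact isUnitAt_quadFactor u0 u1 us

/-- The curve f + g = 0 goes to g = ∞. The excluded centres 3 and 4 on it become the centres 7 and
8. -/
lemma quadRegularAt_antidiagonal {a : ℂ} (h) (h0 : a ≠ b 0) (h1 : a ≠ b 1) (h2 : a ≠ b 2)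
    (h3 : a ≠ b 3) :
    QuadRegularAt b (pointOff b ((a : OnePoint ℂ), ((-a : ℂ) : OnePoint ℂ)) h) := by
  set x := pointOff b ((a : OnePoint ℂ), ((-a : ℂ) : OnePoint ℂ)) h with hx
  have hX := isCoord_surfaceParameters b x
  have hf : ValAt b x f a := valAt_f_of_lineParameter (val_left _ _)
  have hg : ValAt b x g (-a) := valAt_g_of_lineParameter (val_right _ _)
  have u0 := isUnitAt_f_sub hf h0
  have u1 := isUnitAt_f_sub hf h1
  have hn : (a - b 0) * (a - b 1) ≠ 0 := mul_ne_zero (sub_ne_zero.2 h0) (sub_ne_zero.2 h1)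
  have vd : ValAt b x ((f - const (b 0)) * (f - const (b 1)) - f * (f + g))
      ((a - b 0) * (a - b 1)) :=
    (((hf.sub (val_const _ _ _)).mul (hf.sub (val_const _ _ _))).sub (hf.mul (hf.add hg))).cast rfl
      (by ring)
  refine ⟨pointOff _ ((a : OnePoint ℂ), OnePoint.infty)
    (coe_infty_notMem _ (by simpa [quadParameters] using h2)
      (by simpa [quadParameters] using h3)), ⟨?_, ?_⟩, fun D => ?_⟩
  · simp only [surfaceParameters_pointOff, baseParameters_fst, lineParameter_coe, map_sub,
      quadEquiv_f, map_const]
    exact val_left _ _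
  · simp only [surfaceParameters_pointOff, baseParameters_snd, lineParameter_infty, map_inv₀,
      quadEquiv_g_inv]
    exact ((hf.add hg).div hX vd hn).cast rfl (by simp)
  · simp only [localEquation_pointOff, baseEquation_coe_coe, baseEquation_coe_infty, hx]
    exact isUnitAt_quadFactor_target_infty u0 u1 ⟨_, hn, vd⟩

/-- Conversely g = ∞ goes to f + g = 0, because 1 / (f + g) vanishes there and the image of g tends
to -f. -/
lemma quadRegularAt_g_infty {a : ℂ} (h) (h0 : a ≠ b 0) (h1 : a ≠ b 1) (h6 : a ≠ -b 6)
    (h7 : a ≠ -b 7) : QuadRegularAt b (pointOff b ((a : OnePoint ℂ), OnePoint.infty) h) := by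
  set x := pointOff b ((a : OnePoint ℂ), OnePoint.infty) h with hx
  have hX := isCoord_surfaceParameters b x
  have hf : ValAt b x f a := valAt_f_of_lineParameter (val_left _ _)
  have hg : ValAt b x g⁻¹ 0 := val_right _ _
  have u0 := isUnitAt_f_sub hf h0
  have u1 := isUnitAt_f_sub hf h1
  have v3 : ValAt b x (1 + f * g⁻¹) 1 := ((val_one _ _).add (hf.mul hg)).cast rfl (by simp)
  have n4 := g_ne_zero
  have n3 := f_add_g_ne_zero
  have e3 : 1 + f * g⁻¹ = (f + g) * g⁻¹ := by field_simp; ring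
  have vs : ValAt b x (f + g)⁻¹ 0 := (hg.div hX v3 one_ne_zero).cast (by rw [e3]; field_simp)
    (by simp)
  refine ⟨pointOff _ ((a : OnePoint ℂ), ((-a : ℂ) : OnePoint ℂ))
    (coe_neg_notMem _ (by simpa [quadParameters] using h0) (by simpa [quadParameters] using h1)
      (by simpa [quadParameters] using h6) (by simpa [quadParameters] using h7)),
    ⟨?_, ?_⟩, fun D => ?_⟩
  · simp only [surfaceParameters_pointOff, baseParameters_fst, lineParameter_coe, map_sub,
      quadEquiv_f, map_const]
    exact val_left _ _
  · simp only [surfaceParameters_pointOff, baseParameters_snd, lineParameter_coe, map_sub,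
      quadEquiv_g, map_const]
    exact ((hf.neg.add (((hf.sub (val_const _ _ (b 0))).mul (hf.sub (val_const _ _ (b 1)))).mul
      vs)).sub (val_const _ _ _)).cast (by rw [div_eq_mul_inv]) (by ring)
  · simp only [localEquation_pointOff, baseEquation_coe_coe, baseEquation_coe_infty, hx, map_one]
    exact isUnitAt_quadFactor_source_infty u0 u1 ⟨1, one_ne_zero, v3⟩

lemma quadEquiv_g_of_f_inv (β β' : ℂ) : quadEquiv β β' g =
    (-const (β + β') + const (β * β') * f⁻¹ - g) / (f⁻¹ * (f + g)) := by
  have := f_ne_zero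
  have := f_add_g_ne_zero
  rw [quadEquiv_g, const_add, const_mul]
  field_simp
  ring

/-- The fibre f = ∞ is preserved, g being reflected to -b 0 - b 1 - g. This is where the new
parameters of the centres 5 and 6 come from. -/
lemma quadRegularAt_f_infty {c : ℂ} (h) (h4 : c ≠ b 4) (h5 : c ≠ b 5) :
    QuadRegularAt b (pointOff b (OnePoint.infty, (c : OnePoint ℂ)) h) := by
  set x := pointOff b (OnePoint.infty, (c : OnePoint ℂ)) h with hx
  have hX := isCoord_surfaceParameters b x
  have hf : ValAt b x f⁻¹ 0 := val_left _ _
  have hg : ValAt b x g c := valAt_g_of_lineParameter (val_right _ _)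
  have n0 := f_ne_zero
  have v3 : ValAt b x (f⁻¹ * (f + g)) 1 := ((val_one _ _).add (hf.mul hg)).cast
    (by field_simp) (by simp)
  refine ⟨pointOff _ (OnePoint.infty, ((-b 0 - b 1 - c : ℂ) : OnePoint ℂ))
    (infty_coe_notMem _ (by simpa [quadParameters] using h4)
      (by simpa [quadParameters] using h5)), ⟨?_, ?_⟩, fun D => ?_⟩
  · simp only [surfaceParameters_pointOff, baseParameters_fst, lineParameter_infty, map_inv₀,
      quadEquiv_f]
    exact val_left _ _
  · simp only [surfaceParameters_pointOff, baseParameters_snd, lineParameter_coe, map_sub,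
      quadEquiv_g_of_f_inv, map_const]
    exact (((((val_const _ _ _).neg.add ((val_const _ _ _).mul hf)).sub hg).div hX v3
      one_ne_zero).sub (val_const _ _ _)).cast rfl (by ring)
  · simp only [localEquation_pointOff, baseEquation_infty_coe, hx]
    exact isUnitAt_quadFactor_f_infty hf ⟨1, one_ne_zero, v3⟩

lemma quadRegularAt_infty_infty (h) :
    QuadRegularAt b (pointOff b (OnePoint.infty, OnePoint.infty) h) := by
  set x := pointOff b (OnePoint.infty, OnePoint.infty) h with hx
  have hX := isCoord_surfaceParameters b x
  have hf : ValAt b x f⁻¹ 0 := val_left _ _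
  have hg : ValAt b x g⁻¹ 0 := val_right _ _
  have n0 := f_ne_zero
  have n1 := g_ne_zero
  have n2 := f_add_g_ne_zero
  have m0 := f_sub_const_ne_zero (b 0)
  have m1 := f_sub_const_ne_zero (b 1)
  -- The factor left in (f - b 0)(f - b 1) - f (f + g) after removing f g; it takes the value -1 at
  -- (∞, ∞), so that point is fixed.
  set W : K := -1 - const (b 0 + b 1) * g⁻¹ + const (b 0 * b 1) * (f⁻¹ * g⁻¹) with hW
  have vW : ValAt b x W (-1) := (((val_one _ _).neg.sub ((val_const _ _ _).mul hg)).add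
    ((val_const _ _ _).mul (hf.mul hg))).cast rfl (by simp)
  have nW := vW.ne_zero hX (by simp)
  have eg : (quadEquiv (b 0) (b 1) g)⁻¹ = (f⁻¹ + g⁻¹) / W := by
    rw [quadEquiv_g_inv]
    have e1 : (f - const (b 0)) * (f - const (b 1)) - f * (f + g) = f * g * W := by
      rw [hW, const_add, const_mul]
      field_simp
      ring
    rw [e1]
    field_simp
    ring
  refine ⟨pointOff _ (OnePoint.infty, OnePoint.infty) (infty_infty_notMem _), ⟨?_, ?_⟩,
    fun D => ?_⟩
  · simp only [surfaceParameters_pointOff, baseParameters_fst, lineParameter_infty, map_inv₀,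
      quadEquiv_f]
    exact val_left _ _
  · simp only [surfaceParameters_pointOff, baseParameters_snd, lineParameter_infty, map_inv₀, eg]
    exact ((hf.add hg).div hX vW (by simp)).cast rfl (by simp)
  · simp only [localEquation_pointOff, baseEquation_infty_infty, hx, map_mul, map_zpow₀, map_inv₀,
      eg, quadEquiv_f, quadAction]
    have h1 := isUnitAt_f_inv_mul hf (b 0)
    have h2 := isUnitAt_f_inv_mul hf (b 1)
    have uW : IsUnitAt b x W := ⟨-1, by simp, vW⟩
    have := ((((h1.mul h2).div uW).zpow D.2.1).mul (h1.zpow (D.2.2 0))).mul (h2.zpow (D.2.2 1))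
    convert this using 1
    have n0' := inv_ne_zero n0
    have n1' := inv_ne_zero n1
    have e2 : f⁻¹ + g⁻¹ = f⁻¹ * g⁻¹ * (f + g) := by field_simp; ring
    rw [e2]
    simp only [quadFactor, div_zpow, mul_zpow, zpow_neg, zpow_add₀ n0']
    generalize D.1 = d
    generalize D.2.1 = e
    generalize D.2.2 0 = m
    generalize D.2.2 1 = n
    have := zpow_ne_zero d n0'
    have := zpow_ne_zero e n0'
    have := zpow_ne_zero m n0'
    have := zpow_ne_zero n n0'
    have := zpow_ne_zero e n1'
    have := zpow_ne_zero e m0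
    have := zpow_ne_zero e m1
    have := zpow_ne_zero e n2
    have := zpow_ne_zero m m0
    have := zpow_ne_zero n m1
    have := zpow_ne_zero e nW
    clear_value W
    generalize (f⁻¹ : K) ^ d = w1 at *
    generalize (f⁻¹ : K) ^ e = w2 at *
    generalize (f⁻¹ : K) ^ m = w3 at *
    generalize (f⁻¹ : K) ^ n = w4 at *
    generalize (g⁻¹ : K) ^ e = w5 at *
    field_simp

end SchlesingerA2

end

/-! ### The quadratic involution along the contracted fibres and the exceptional curves. -/

noncomputable section

namespace SchlesingerA2

open MvPolynomial

variable {b : Fin 8 → ℂ}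

/-- The hypotheses on one of the two first centres `i`, with `j` the other one, that are used in
the local analysis of the quadratic map. -/
structure QuadIndex (b : Fin 8 → ℂ) (i j : Fin 8) : Prop where
  equiv : quadEquiv (b 0) (b 1) = quadEquiv (b i) (b j)
  factor : ∀ D : Pic, quadFactor (b 0) (b 1) D.2.1 (D.2.2 0) (D.2.2 1) =
    quadFactor (b i) (b j) D.2.1 (D.2.2 i) (D.2.2 j)
  center : center b i = ((b i : OnePoint ℂ), ((-b i : ℂ) : OnePoint ℂ))
  center' : SchlesingerA2.center (quadParameters b) i =
    ((b i : OnePoint ℂ), ((-b i : ℂ) : OnePoint ℂ))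
  action : ∀ D : Pic, (quadAction D).2.2 i = -D.2.1 - D.2.2 i
  ne : b i ≠ b j

lemma quadIndex_zero (h : b 0 ≠ b 1) : QuadIndex b 0 1 :=
  ⟨rfl, fun _ => rfl, rfl, rfl, fun _ => rfl, h⟩

lemma quadIndex_one (h : b 0 ≠ b 1) : QuadIndex b 1 0 :=
  ⟨quadEquiv_comm _ _, fun _ => quadFactor_comm _ _ _ _ _, rfl, rfl, fun _ => rfl, h.symm⟩

/-- The fibre through a centre is contracted to the exceptional curve. -/
lemma quadRegularAt_fibre {i j : Fin 8} (hi : QuadIndex b i j) {r : OnePoint ℂ} (h)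
    (hr : r ≠ ((-b i : ℂ) : OnePoint ℂ)) :
    QuadRegularAt b (pointOff b ((b i : OnePoint ℂ), r) h) := by
  set x := pointOff b ((b i : OnePoint ℂ), r) h with hx
  have hX := isCoord_surfaceParameters b x
  have hf0 : ValAt b x (f - const (b i)) 0 := val_left _ _
  have hf : ValAt b x f (b i) := valAt_f_of_lineParameter hf0
  have n0 := f_sub_const_ne_zero (b i)
  have n1 := f_sub_const_ne_zero (b j)
  have n2 := f_add_g_ne_zero
  have n3 := g_ne_zero
  have u1 := isUnitAt_f_sub hf hi.ne
  -- Here w is the local equation of g = ∞ at the point: 1 on the finite part of the fibre and g⁻¹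
  -- at its end. This treats both kinds of points together.
  obtain ⟨w, c, hw, hw0, hws, hwu⟩ : ∃ (w : K) (c : ℂ), ValAt b x (f + g)⁻¹ c ∧ w ≠ 0 ∧
      (∀ D, baseEquation D ((b i : OnePoint ℂ), r) = w ^ D.2.1) ∧ IsUnitAt b x ((f + g) * w) := by
    induction r using OnePoint.rec with
    | infty =>
      have hg : ValAt b x g⁻¹ 0 := val_right _ _
      have e3 : 1 + f * g⁻¹ = (f + g) * g⁻¹ := by field_simp; ring
      have v3 : ValAt b x ((f + g) * g⁻¹) 1 := by
        rw [← e3]; exact ((val_one _ _).add (hf.mul hg)).cast rfl (by simp)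
      exact ⟨g⁻¹, 0, (hg.div hX v3 one_ne_zero).cast (by field_simp) (by simp), inv_ne_zero n3,
        fun D => baseEquation_coe_infty _ _, 1, one_ne_zero, v3⟩
    | coe a =>
      have hg : ValAt b x g a := valAt_g_of_lineParameter (val_right _ _)
      have hs : b i + a ≠ 0 := by
        intro h0
        apply hr
        rw [eq_neg_of_add_eq_zero_right h0]
      exact ⟨1, _, (hf.add hg).inv hX hs, one_ne_zero,
        fun D => by rw [baseEquation_coe_coe, one_zpow], _, hs, (hf.add hg).cast (by simp) rfl⟩
  -- Both image parameters are divisible by f - b i, with quotients 1 and -1 + (f - b j) / (f + g).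
  -- The second quotient, varying with g, is the direction on the new exceptional curve.
  obtain ⟨t', ht', hu⟩ := mapsTo_pointOn (b' := quadParameters b) (Ψ := quadEquiv (b 0) (b 1))
    (j := i) hf0 n0 (val_one _ _)
    ((val_one _ _).neg.add ((hf.sub (val_const _ _ (b j))).mul hw))
    (by rw [hi.center']; simp [map_const])
    (by
      rw [hi.center', hi.equiv]
      simp only [baseParameters_snd, lineParameter_coe, map_sub, quadEquiv_g, map_const]
      rw [const_neg]
      field_simp
      ring)
    (Or.inl one_ne_zero)
  refine ⟨_, ht', fun D => ?_⟩
  rw [hx, localEquation_pointOff, localEquation_pointOn, hws, hi.action, hi.factor, hi.center',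
    baseEquation_coe_coe, one_mul, map_zpow₀]
  have := (((u1.div hwu).zpow D.2.1).mul (u1.zpow (D.2.2 j))).mul
    (hu.zpow (-D.2.1 - D.2.2 i))
  convert this using 1
  rw [hi.center']
  generalize quadEquiv (b 0) (b 1)
    (exceptionalEquation (baseParameters ((b i : OnePoint ℂ), ((-b i : ℂ) : OnePoint ℂ))) t') = z
  generalize D.2.1 = e
  generalize D.2.2 i = m
  generalize D.2.2 j = n
  have e1 : -e - m = -e + -m := by ring
  simp only [quadFactor, div_zpow, mul_zpow, zpow_neg, e1, zpow_add₀ n0]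
  have := zpow_ne_zero e n0
  have := zpow_ne_zero m n0
  have := zpow_ne_zero e n1
  have := zpow_ne_zero n n1
  have := zpow_ne_zero e n2
  have := zpow_ne_zero e hw0
  generalize z ^ (-e + -m) = z'
  field_simp

/-- The exceptional curve over a centre becomes the fibre. -/
lemma quadRegularAt_exceptional {i j : Fin 8} (hi : QuadIndex b i j) (h2 : b i ≠ b 2)
    (h3 : b i ≠ b 3) (t : OnePoint ℂ) : QuadRegularAt b (pointOn b i t) := by
  set x := pointOn b i t with hx
  have hX := isCoord_surfaceParameters b x
  have hbase := valAt_baseParameters b x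
  rw [hx, basePoint_pointOn, hi.center, ← hx] at hbase
  have hs := valAt_slope b i t
  change ValAt b x _ 0 at hs
  rw [hi.center] at hs
  have hf0 : ValAt b x (f - const (b i)) 0 := hbase.1
  have hg0 : ValAt b x (g - const (-b i)) 0 := hbase.2
  have hf : ValAt b x f (b i) := valAt_f_of_lineParameter hf0
  have n0 := f_sub_const_ne_zero (b i)
  have n1 := f_sub_const_ne_zero (b j)
  have n2 := f_add_g_ne_zero
  have n3 : g - const (-b i) ≠ 0 := lineParameter_ne_zero_g ((-b i : ℂ) : OnePoint ℂ)
  have u1 := isUnitAt_f_sub hf hi.ne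
  have v1 : ValAt b x (f - const (b j)) (b i - b j) := hf.sub (val_const _ _ _)
  have hij : b i - b j ≠ 0 := sub_ne_zero.2 hi.ne
  have hLE : ∀ D, localEquation b D x = exceptionalEquation
      (baseParameters ((b i : OnePoint ℂ), ((-b i : ℂ) : OnePoint ℂ))) t ^ D.2.2 i := by
    intro D
    rw [hx, localEquation_pointOn, hi.center, baseEquation_coe_coe, one_mul]
  simp only [baseParameters_fst, baseParameters_snd, lineParameter_coe] at hs
  have esum : f + g = (f - const (b i)) + (g - const (-b i)) := by rw [const_neg]; ring
  induction t using OnePoint.rec with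
  | infty =>
    simp only [lineParameter_infty, inv_div] at hs
    set r : K := (f - const (b i)) / (g - const (-b i)) with hr
    have nr : r ≠ 0 := div_ne_zero n0 n3
    have er : f - const (b i) = r * (g - const (-b i)) := by rw [hr]; field_simp
    have v2 : ValAt b x (1 + r) 1 := ((val_one _ _).add hs).cast rfl (by simp)
    have n4 := v2.ne_zero hX one_ne_zero
    have es : f + g = (g - const (-b i)) * (1 + r) := by rw [esum, er]; ring
    -- The direction of the fibre itself: E_i meets the strict transform of the fibre here, so the
    -- image lies on the new exceptional curve as well.
    obtain ⟨t', ht', hu⟩ := mapsTo_pointOn (b' := quadParameters b) (Ψ := quadEquiv (b 0) (b 1))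
      (j := i) hs nr hg0 (hg0.neg.add (v1.div hX v2 one_ne_zero))
      (by
        rw [hi.center']
        simp only [baseParameters_fst, lineParameter_coe, map_sub, quadEquiv_f, map_const]
        exact er)
      (by
        rw [hi.center', hi.equiv]
        simp only [baseParameters_snd, lineParameter_coe, map_sub, quadEquiv_g, map_const]
        rw [es]
        have : -f - const (-b i) = -(r * (g - const (-b i))) := by rw [← er, const_neg]; ring
        have e5 : (f - const (b i)) * (f - const (b j)) / ((g - const (-b i)) * (1 + r)) =
          r * ((f - const (b j)) / (1 + r)) := by rw [er]; field_simp
        rw [e5]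
        linear_combination this)
      (Or.inr (by simpa using hij))
    refine ⟨_, ht', fun D => ?_⟩
    rw [hLE, localEquation_pointOn, hi.action, hi.factor, hi.center',
      baseEquation_coe_coe, one_mul, map_zpow₀]
    have := (((u1.div ⟨1, one_ne_zero, v2⟩).zpow D.2.1).mul (u1.zpow (D.2.2 j))).mul
      (hu.zpow (-D.2.1 - D.2.2 i))
    convert this using 1
    rw [hi.center', exceptionalEquation_infty, baseParameters_snd, lineParameter_coe]
    generalize quadEquiv (b 0) (b 1)
      (exceptionalEquation (baseParameters ((b i : OnePoint ℂ), ((-b i : ℂ) : OnePoint ℂ))) t') = z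
    generalize D.2.1 = e
    generalize D.2.2 i = m
    generalize D.2.2 j = n
    rw [quadFactor, er, es]
    clear_value r
    have e1 : -e - m = -e + -m := by ring
    simp only [div_zpow, mul_zpow, zpow_neg, e1, zpow_add₀ nr]
    have := zpow_ne_zero e nr
    have := zpow_ne_zero m nr
    have := zpow_ne_zero e n1
    have := zpow_ne_zero n n1
    have := zpow_ne_zero e n3
    have := zpow_ne_zero m n3
    have := zpow_ne_zero e n4
    generalize z ^ (-e + -m) = z'
    field_simp
  | coe c =>
    simp only [lineParameter_coe] at hs
    set r : K := (g - const (-b i)) / (f - const (b i)) with hr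
    have vr : ValAt b x r c := (hs.add (val_const _ _ c)).cast (sub_add_cancel _ _) (zero_add _)
    have er : g - const (-b i) = r * (f - const (b i)) := by rw [hr]; field_simp
    have v2 : ValAt b x (1 + r) (1 + c) := (val_one _ _).add vr
    have es : f + g = (f - const (b i)) * (1 + r) := by rw [esum, er]; ring
    have n4 : 1 + r ≠ 0 := fun h0 => n2 (by rw [es, h0, mul_zero])
    have eF : ∀ D : Pic, quadFactor (b 0) (b 1) D.2.1 (D.2.2 0) (D.2.2 1) * localEquation b D x =
        ((1 + r) / (f - const (b j))) ^ D.2.1 * (f - const (b j)) ^ (-D.2.2 j) := by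
      intro D
      rw [hLE, hi.factor, exceptionalEquation_coe, baseParameters_fst, lineParameter_coe,
        quadFactor, es]
      generalize D.2.1 = e
      generalize D.2.2 i = m
      generalize D.2.2 j = n
      clear_value r
      simp only [div_zpow, mul_zpow, zpow_neg]
      have := zpow_ne_zero e n0
      have := zpow_ne_zero m n0
      have := zpow_ne_zero e n1
      have := zpow_ne_zero n n1
      field_simp
    have eg : quadEquiv (b 0) (b 1) g = -f + (f - const (b j)) / (1 + r) := by
      rw [hi.equiv, quadEquiv_g, es]
      field_simp
    -- The direction -1 is tangent to f + g = 0, the curve that is sent to g = ∞; every other finite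
    -- direction lands in the affine part of the fibre.
    by_cases hc : 1 + c = 0
    · have v5 : ValAt b x ((f - const (b j)) - f * (1 + r)) (b i - b j) :=
        (v1.sub (hf.mul v2)).cast rfl (by rw [hc]; ring)
      have eg' : (quadEquiv (b 0) (b 1) g)⁻¹ = (1 + r) / ((f - const (b j)) - f * (1 + r)) := by
        rw [eg, ← inv_div]
        congr 1
        field_simp
        ring
      refine ⟨pointOff _ ((b i : OnePoint ℂ), OnePoint.infty)
        (coe_infty_notMem _ (by simpa [quadParameters] using h2)
          (by simpa [quadParameters] using h3)), ⟨?_, ?_⟩, fun D => ?_⟩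
      · simpa [map_const] using hf0
      · simp only [surfaceParameters_pointOff, baseParameters_snd, lineParameter_infty, map_inv₀,
          eg']
        exact (v2.div hX v5 hij).cast rfl (by rw [hc]; simp)
      · rw [eF, localEquation_pointOff, baseEquation_coe_infty, map_zpow₀, map_inv₀, eg']
        have := ((u1.div ⟨_, hij, v5⟩).zpow D.2.1).mul (u1.zpow (D.2.2 j))
        convert this using 1
        simp only [quadAction]
        generalize D.2.1 = e
        generalize D.2.2 j = n
        simp only [div_zpow, zpow_neg]
        have := zpow_ne_zero e n4
        have := zpow_ne_zero e n1
        have := zpow_ne_zero n n1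
        field_simp
    · have hs' : b i + (-b i + (b i - b j) / (1 + c)) ≠ 0 := by
        rw [add_neg_cancel_left]
        exact div_ne_zero hij hc
      refine ⟨pointOff _ ((b i : OnePoint ℂ), ((-b i + (b i - b j) / (1 + c) : ℂ) : OnePoint ℂ))
        (coe_coe_notMem _ hs'), ⟨?_, ?_⟩, fun D => ?_⟩
      · simpa [map_const] using hf0
      · simp only [surfaceParameters_pointOff, baseParameters_snd, lineParameter_coe, map_sub, eg,
          map_const]
        exact ((hf.neg.add (v1.div hX v2 hc)).sub (val_const _ _ _)).cast rfl (by ring)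
      · rw [eF, localEquation_pointOff, baseEquation_coe_coe, map_one]
        exact isUnitAt_one.div (((IsUnitAt.div ⟨_, hc, v2⟩ u1).zpow _).mul (u1.zpow _))

/-- The exceptional curves over the other finite centres. -/
lemma quadRegularAt_exceptional_finite {i j : Fin 8}
    (hc : center b i = ((b i : OnePoint ℂ), ((-b i : ℂ) : OnePoint ℂ)))
    (hc' : center (quadParameters b) j = ((b i : OnePoint ℂ), OnePoint.infty))
    (hM : ∀ D, (quadAction D).2.2 j = D.2.2 i) (h0 : b i ≠ b 0) (h1 : b i ≠ b 1) (t : OnePoint ℂ) :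
    QuadRegularAt b (pointOn b i t) := by
  set x := pointOn b i t with hx
  have hX := isCoord_surfaceParameters b x
  have hbase := valAt_baseParameters b x
  rw [hx, basePoint_pointOn, hc, ← hx] at hbase
  have hf : ValAt b x f (b i) := valAt_f_of_lineParameter hbase.1
  have hg : ValAt b x g (-b i) := valAt_g_of_lineParameter hbase.2
  have u0 := isUnitAt_f_sub hf h0
  have u1 := isUnitAt_f_sub hf h1
  have hn : (b i - b 0) * (b i - b 1) ≠ 0 := mul_ne_zero (sub_ne_zero.2 h0) (sub_ne_zero.2 h1)
  have vd : ValAt b x ((f - const (b 0)) * (f - const (b 1)) - f * (f + g))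
      ((b i - b 0) * (b i - b 1)) :=
    (((hf.sub (val_const _ _ _)).mul (hf.sub (val_const _ _ _))).sub (hf.mul (hf.add hg))).cast rfl
      (by ring)
  have vd' := vd.inv hX hn
  obtain ⟨t', ht', hu⟩ := mapsTo_pointOn_of_linear (b' := quadParameters b)
    (Ψ := quadEquiv (b 0) (b 1)) (i := i) (j := j) t (val_one _ _) (val_zero _ _) vd' vd'
    (by rw [hc, hc']; simp [map_const])
    (by
      rw [hc, hc']
      simp only [baseParameters_fst, baseParameters_snd, lineParameter_infty, map_inv₀,
        quadEquiv_g_inv, lineParameter_coe]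
      rw [const_neg, div_eq_mul_inv]
      ring)
    (by simpa using inv_ne_zero hn)
  refine ⟨_, ht', fun D => ?_⟩
  rw [hx, localEquation_pointOn, localEquation_pointOn, hM, hc, hc', baseEquation_coe_coe,
    baseEquation_coe_infty, map_mul, map_zpow₀, ← mul_assoc, mul_div_mul_comm, map_zpow₀,
        ← div_zpow]
  rw [hc, hc'] at hu
  refine IsUnitAt.mul ?_ (hu.zpow _)
  have := isUnitAt_quadFactor_target_infty (e := D.2.1) (m := D.2.2 0) (n := D.2.2 1) u0 u1
    ⟨_, hn, vd⟩
  rwa [map_zpow₀] at this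

/-- The exceptional curves over the centres with `g = ∞`. -/
lemma quadRegularAt_exceptional_g_infty {i j : Fin 8}
    (hc : center b i = (((-b i : ℂ) : OnePoint ℂ), OnePoint.infty))
    (hc' : center (quadParameters b) j = (((-b i : ℂ) : OnePoint ℂ), ((b i : ℂ) : OnePoint ℂ)))
    (hM : ∀ D, (quadAction D).2.2 j = D.2.2 i) (h0 : -b i ≠ b 0) (h1 : -b i ≠ b 1)
    (t : OnePoint ℂ) : QuadRegularAt b (pointOn b i t) := by
  set x := pointOn b i t with hx
  have hX := isCoord_surfaceParameters b x
  have hbase := valAt_baseParameters b x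
  rw [hx, basePoint_pointOn, hc, ← hx] at hbase
  have hf : ValAt b x f (-b i) := valAt_f_of_lineParameter hbase.1
  have hg : ValAt b x g⁻¹ 0 := hbase.2
  have u0 := isUnitAt_f_sub hf h0
  have u1 := isUnitAt_f_sub hf h1
  have n3 := g_ne_zero
  have n4 := f_add_g_ne_zero
  have hn : (-b i - b 0) * (-b i - b 1) ≠ 0 := mul_ne_zero (sub_ne_zero.2 h0) (sub_ne_zero.2 h1)
  have v3 : ValAt b x (1 + f * g⁻¹) 1 := ((val_one _ _).add (hf.mul hg)).cast rfl (by simp)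
  have e3 : 1 + f * g⁻¹ = (f + g) * g⁻¹ := by field_simp; ring
  obtain ⟨t', ht', hu⟩ := mapsTo_pointOn_of_linear (b' := quadParameters b)
    (Ψ := quadEquiv (b 0) (b 1)) (i := i) (j := j) t (val_one _ _) (val_zero _ _)
    (val_one _ _).neg
    (((hf.sub (val_const _ _ (b 0))).mul (hf.sub (val_const _ _ (b 1)))).div hX v3 one_ne_zero)
    (by rw [hc, hc']; simp [map_const])
    (by
      rw [hc, hc', e3]
      simp only [baseParameters_fst, baseParameters_snd, lineParameter_infty, map_sub,
        quadEquiv_g, lineParameter_coe, map_const]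
      rw [const_neg]
      field_simp
      ring)
    (by simpa using hn)
  refine ⟨_, ht', fun D => ?_⟩
  rw [hx, localEquation_pointOn, localEquation_pointOn, hM, hc, hc', baseEquation_coe_coe,
    baseEquation_coe_infty, map_mul, map_zpow₀, map_one, ← mul_assoc, mul_div_mul_comm, ← div_zpow]
  rw [hc, hc'] at hu
  refine IsUnitAt.mul ?_ (hu.zpow _)
  exact isUnitAt_quadFactor_source_infty u0 u1 ⟨1, one_ne_zero, v3⟩

/-- The exceptional curves over the centres with `f = ∞`. -/
lemma quadRegularAt_exceptional_f_infty {i : Fin 8}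
    (hc : center b i = (OnePoint.infty, (b i : OnePoint ℂ)))
    (hc' : center (quadParameters b) i =
      (OnePoint.infty, ((-b 0 - b 1 - b i : ℂ) : OnePoint ℂ)))
    (hM : ∀ D, (quadAction D).2.2 i = D.2.2 i) (t : OnePoint ℂ) :
    QuadRegularAt b (pointOn b i t) := by
  set x := pointOn b i t with hx
  have hX := isCoord_surfaceParameters b x
  have hbase := valAt_baseParameters b x
  rw [hx, basePoint_pointOn, hc, ← hx] at hbase
  have hf : ValAt b x f⁻¹ 0 := hbase.1
  have hg : ValAt b x g (b i) := valAt_g_of_lineParameter hbase.2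
  have n0 := f_ne_zero
  have n4 := f_add_g_ne_zero
  have v3 : ValAt b x (f⁻¹ * (f + g)) 1 := ((val_one _ _).add (hf.mul hg)).cast
    (by field_simp) (by simp)
  obtain ⟨t', ht', hu⟩ := mapsTo_pointOn_of_linear (b' := quadParameters b)
    (Ψ := quadEquiv (b 0) (b 1)) (i := i) (j := i) t (val_one _ _) (val_zero _ _)
    (((val_const _ _ (b 0 * b 1)).add ((val_const _ _ (b 0 + b 1 + b i)).mul hg)).div hX v3
      one_ne_zero)
    ((val_one _ _).neg.div hX v3 one_ne_zero)
    (by rw [hc, hc']; simp)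
    (by
      rw [hc, hc']
      simp only [baseParameters_fst, baseParameters_snd, lineParameter_infty, map_sub,
        quadEquiv_g, lineParameter_coe, map_const]
      simp only [const_add, const_sub, const_neg, const_mul]
      field_simp
      ring)
    (by simp)
  refine ⟨_, ht', fun D => ?_⟩
  rw [hx, localEquation_pointOn, localEquation_pointOn, hM, hc, hc', baseEquation_infty_coe,
    baseEquation_infty_coe, map_mul, ← mul_assoc, mul_div_mul_comm,
        map_zpow₀ _ (exceptionalEquation _ _), ← div_zpow]
  rw [hc, hc'] at hu
  refine IsUnitAt.mul ?_ (hu.zpow _)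
  exact isUnitAt_quadFactor_f_infty hf ⟨1, one_ne_zero, v3⟩

/-- The eight centres are pairwise distinct. -/
def Distinct (b : Fin 8 → ℂ) : Prop :=
  (b 0 ≠ b 1 ∧ b 0 ≠ b 2 ∧ b 0 ≠ b 3 ∧ b 1 ≠ b 2 ∧ b 1 ≠ b 3 ∧ b 2 ≠ b 3) ∧ b 4 ≠ b 5 ∧ b 6 ≠ b 7

lemma Distinct.injective (h : Distinct b) : Function.Injective (center b) := by
  obtain ⟨⟨h01, h02, h03, h12, h13, h23⟩, h45, h67⟩ := h
  intro i j hij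
  fin_cases i <;> fin_cases j <;> simp [center] at hij <;>
    first
      | rfl
      | exact absurd hij ‹_›
      | exact absurd hij.symm ‹_›

/-- The conditions under which the quadratic map is an isomorphism. -/
def QuadAdmissible (b : Fin 8 → ℂ) : Prop :=
  Distinct b ∧ b 0 ≠ -b 6 ∧ b 0 ≠ -b 7 ∧ b 1 ≠ -b 6 ∧ b 1 ≠ -b 7

lemma QuadAdmissible.quadParameters (h : QuadAdmissible b) : QuadAdmissible (quadParameters b) := by
  obtain ⟨⟨⟨h01, h02, h03, h12, h13, h23⟩, h45, h67⟩, h06, h07, h16, h17⟩ := h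
  refine ⟨⟨⟨?_, ?_, ?_, ?_, ?_, ?_⟩, ?_, ?_⟩, ?_, ?_, ?_, ?_⟩ <;>
    simpa [SchlesingerA2.quadParameters]

lemma quadRegularAt (h : QuadAdmissible b) (x : SurfacePoint b) : QuadRegularAt b x := by
  obtain ⟨⟨⟨h01, h02, h03, h12, h13, h23⟩, h45, h67⟩, h06, h07, h16, h17⟩ := h
  refine surfacePoint_cases (P := QuadRegularAt b) ?_ ?_ x
  · rintro ⟨p, r⟩ h
    induction p using OnePoint.rec with
    | infty =>
      induction r using OnePoint.rec with
      | infty => exact quadRegularAt_infty_infty h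
      | coe c =>
        exact quadRegularAt_f_infty h (fun e => h ⟨4, by simp [center, e]⟩)
          (fun e => h ⟨5, by simp [center, e]⟩)
    | coe a =>
      by_cases a0 : a = b 0
      · subst a0
        exact quadRegularAt_fibre (quadIndex_zero h01) h (fun e => h ⟨0, by simp [center, e]⟩)
      by_cases a1 : a = b 1
      · subst a1
        exact quadRegularAt_fibre (quadIndex_one h01) h (fun e => h ⟨1, by simp [center, e]⟩)
      induction r using OnePoint.rec with
      | infty =>
        exact quadRegularAt_g_infty h a0 a1 (fun e => h ⟨6, by simp [center, e]⟩)
          (fun e => h ⟨7, by simp [center, e]⟩)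
      | coe c =>
        by_cases hs : a + c = 0
        · obtain rfl := eq_neg_of_add_eq_zero_right hs
          exact quadRegularAt_antidiagonal h a0 a1 (fun e => h ⟨2, by simp [center, e]⟩)
            (fun e => h ⟨3, by simp [center, e]⟩)
        · exact quadRegularAt_generic h a0 a1 hs
  · intro i t
    fin_cases i
    · exact quadRegularAt_exceptional (quadIndex_zero h01) h02 h03 t
    · exact quadRegularAt_exceptional (quadIndex_one h01) h12 h13 t
    · exact quadRegularAt_exceptional_finite (i := 2) (j := 6) rfl
        (by simp [center, quadParameters]) (fun _ => rfl) h02.symm h12.symm t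
    · exact quadRegularAt_exceptional_finite (i := 3) (j := 7) rfl
        (by simp [center, quadParameters]) (fun _ => rfl) h03.symm h13.symm t
    · exact quadRegularAt_exceptional_f_infty (i := 4) rfl rfl (fun _ => rfl) t
    · exact quadRegularAt_exceptional_f_infty (i := 5) rfl rfl (fun _ => rfl) t
    · exact quadRegularAt_exceptional_g_infty (i := 6) (j := 2) rfl
        (by simp [center, quadParameters]) (fun _ => rfl) h06.symm h16.symm t
    · exact quadRegularAt_exceptional_g_infty (i := 7) (j := 3) rfl
        (by simp [center, quadParameters]) (fun _ => rfl) h07.symm h17.symm t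

/-- Both the map and its action on parameters are involutive and admissibility is preserved, so
regularity on the source, applied again to the target, also gives the inverse. -/
lemma quad_isomorphism (h : QuadAdmissible b) :
    LiftsToIsomorphism b (quadParameters b) (quadEquiv (b 0) (b 1)) ∧
    HasPushForward b (quadParameters b) (quadEquiv (b 0) (b 1)) quadAction := by
  have hb := h.1.injective
  have hb' := h.quadParameters.1.injective
  have F := quadRegularAt h
  have F' : ∀ x', ∃ x, MapsTo (quadParameters b) b (quadEquiv (b 0) (b 1)).symm x' x := by
    intro x'
    have := quadRegularAt h.quadParameters x'
    unfold QuadRegularAt at this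
    rw [quadParameters_quadParameters] at this
    obtain ⟨x, h, -⟩ := this
    exact ⟨x, h⟩
  refine ⟨liftsToIsomorphism_of_mapsTo hb hb' (fun x => ?_) F',
    hasPushForward_of_mapsTo hb hb'
      (fun D => quadFactor (b 0) (b 1) D.2.1 (D.2.2 0) (D.2.2 1))
      (fun _ => quadFactor_ne_zero _ _ _ _ _) F F'⟩
  obtain ⟨x', h, -⟩ := F x
  exact ⟨x', h⟩

end SchlesingerA2

end

/-! ### Gauge classes and their recovery from the residues. -/

noncomputable section

namespace SchlesingerA2

open Matrix

/-! ### Gauge equivalence -/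

lemma gaugeEquivalent_refl (p : Decomposition) : GaugeEquivalent p p :=
  ⟨1, fun _ _ => 1, fun i => by simp⟩

lemma GaugeEquivalent.residue {p q : Decomposition} (h : GaugeEquivalent p q) :
    ∃ P : GL (Fin 3) ℂ, ∀ i, q.residue i * (P : Matrix (Fin 3) (Fin 3) ℂ) =
      (P : Matrix (Fin 3) (Fin 3) ℂ) * p.residue i := by
  obtain ⟨P, D, h⟩ := h
  refine ⟨P, fun i => ?_⟩
  have hD : diagonal (fun j => (D i j : ℂ)) * diagonal (fun j => ((D i j)⁻¹ : ℂ)) = 1 := by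
    rw [diagonal_mul_diagonal]
    simp
  have hP : ((P⁻¹ : GL (Fin 3) ℂ) : Matrix (Fin 3) (Fin 3) ℂ) * (P : Matrix (Fin 3) (Fin 3) ℂ) = 1
      :=
    Units.inv_mul P
  rw [Decomposition.residue, Decomposition.residue, (h i).1, (h i).2]
  calc _ = (P : Matrix (Fin 3) (Fin 3) ℂ) * p.B i * (diagonal (fun j => (D i j : ℂ)) *
        diagonal (fun j => ((D i j)⁻¹ : ℂ))) * p.C i *
        (((P⁻¹ : GL (Fin 3) ℂ) : Matrix (Fin 3) (Fin 3) ℂ) * (P : Matrix (Fin 3) (Fin 3) ℂ)) := by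
        simp only [Matrix.mul_assoc]
    _ = _ := by rw [hD, hP, Matrix.mul_one, Matrix.mul_one, Matrix.mul_assoc]

lemma GaugeEquivalent.trans {p q r : Decomposition} (h : GaugeEquivalent p q)
    (h' : GaugeEquivalent q r) : GaugeEquivalent p r := by
  obtain ⟨P, D, h⟩ := h
  obtain ⟨P', D', h'⟩ := h'
  refine ⟨P' * P, fun i j => D i j * D' i j, fun i => ⟨?_, ?_⟩⟩
  · rw [(h' i).1, (h i).1]
    simp only [Units.val_mul, Matrix.mul_assoc, diagonal_mul_diagonal]
  · rw [(h' i).2, (h i).2]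
    simp only [_root_.mul_inv_rev, Units.val_mul, Matrix.mul_assoc]
    rw [← Matrix.mul_assoc (diagonal _) (diagonal _), diagonal_mul_diagonal]

lemma GaugeEquivalent.symm {p q : Decomposition} (h : GaugeEquivalent p q) :
    GaugeEquivalent q p := by
  obtain ⟨P, D, h⟩ := h
  have hP : ((P⁻¹ : GL (Fin 3) ℂ) : Matrix (Fin 3) (Fin 3) ℂ) * (P : Matrix (Fin 3) (Fin 3) ℂ) = 1
      :=
    Units.inv_mul P
  refine ⟨P⁻¹, fun i j => (D i j)⁻¹, fun i => ⟨?_, ?_⟩⟩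
  · rw [(h i).1, Matrix.mul_assoc, Matrix.mul_assoc, Matrix.mul_assoc, diagonal_mul_diagonal]
    rw [← Matrix.mul_assoc, hP]
    simp
  · rw [(h i).2, Matrix.mul_assoc, Matrix.mul_assoc, Matrix.mul_assoc, inv_inv, hP]
    rw [← Matrix.mul_assoc, diagonal_mul_diagonal]
    simp

lemma charpoly_eq_of_mul_eq {A A' : Matrix (Fin 3) (Fin 3) ℂ} (P : GL (Fin 3) ℂ)
    (h : A' * (P : Matrix (Fin 3) (Fin 3) ℂ) = (P : Matrix (Fin 3) (Fin 3) ℂ) * A) :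
    A'.charpoly = A.charpoly := by
  have : A' = (P : Matrix (Fin 3) (Fin 3) ℂ) * A * ((P⁻¹ : GL (Fin 3) ℂ) : Matrix (Fin 3) (Fin 3)
      ℂ) := by
    rw [← h, Matrix.mul_assoc, Units.mul_inv, Matrix.mul_one]
  rw [this, coe_units_inv, charpoly_units_conj]

lemma residueInfty_mul {p q : Decomposition} {P : Matrix (Fin 3) (Fin 3) ℂ}
    (h : ∀ i, q.residue i * P = P * p.residue i) :
    q.residueInfty * P = P * p.residueInfty := by
  simp only [Decomposition.residueInfty, Fin.sum_univ_two, Matrix.neg_mul, Matrix.mul_neg,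
    Matrix.add_mul, Matrix.mul_add, h]

lemma GaugeEquivalent.isOver {s : RiemannScheme} {p q : Decomposition} (h : GaugeEquivalent p q)
    (hp : p.IsOver s) : q.IsOver s := by
  obtain ⟨P, hP⟩ := h.residue
  refine ⟨fun i => ?_, (charpoly_eq_of_mul_eq P (residueInfty_mul hP)).trans hp.2⟩
  obtain ⟨P, D, h⟩ := h
  have hP : ((P⁻¹ : GL (Fin 3) ℂ) : Matrix (Fin 3) (Fin 3) ℂ) * (P : Matrix (Fin 3) (Fin 3) ℂ) = 1
      :=
    Units.inv_mul P
  rw [(h i).1, (h i).2]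
  calc _ = diagonal (fun j => ((D i j)⁻¹ : ℂ)) * (p.C i * (((P⁻¹ : GL (Fin 3) ℂ) :
        Matrix (Fin 3) (Fin 3) ℂ) * (P : Matrix (Fin 3) (Fin 3) ℂ)) * p.B i) *
        diagonal (fun j => (D i j : ℂ)) := by simp only [Matrix.mul_assoc]
    _ = _ := by
      rw [hP, Matrix.mul_one, hp.1 i, diagonal_mul_diagonal, diagonal_mul_diagonal]
      congr 1
      funext j
      have := (D i j).ne_zero
      field_simp

/-- The nonzero indices at the finite poles are nonzero and distinct. -/
def RiemannScheme.Regular (s : RiemannScheme) : Prop :=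
  (∀ i j, s.θ i j ≠ 0) ∧ ∀ i, s.θ i 0 ≠ s.θ i 1

/-- The matrix X = C' P B commutes with the diagonal matrix of the indices, hence is diagonal since
they differ, and it is invertible since they are nonzero. It measures the rescaling between the two
eigenbases, the factors being θ j / x j. -/
lemma diagonal_gauge {B B' : Matrix (Fin 3) (Fin 2) ℂ} {C C' : Matrix (Fin 2) (Fin 3) ℂ}
    {θ : Fin 2 → ℂ} (h0 : ∀ j, θ j ≠ 0) (hne : θ 0 ≠ θ 1) (h : C * B = diagonal θ)
    (h' : C' * B' = diagonal θ) (P : GL (Fin 3) ℂ)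
    (hP : (B' * C') * (P : Matrix (Fin 3) (Fin 3) ℂ) = (P : Matrix (Fin 3) (Fin 3) ℂ) * (B * C)) :
    ∃ d : Fin 2 → ℂˣ,
      B' = (P : Matrix (Fin 3) (Fin 3) ℂ) * B * diagonal (fun j => (d j : ℂ)) ∧
      C' = diagonal (fun j => ((d j)⁻¹ : ℂ)) * C *
        ((P⁻¹ : GL (Fin 3) ℂ) : Matrix (Fin 3) (Fin 3) ℂ) := by
  set Q : Matrix (Fin 3) (Fin 3) ℂ := (P : Matrix (Fin 3) (Fin 3) ℂ) with hQ
  set Q' : Matrix (Fin 3) (Fin 3) ℂ := ((P⁻¹ : GL (Fin 3) ℂ) : Matrix (Fin 3) (Fin 3) ℂ) with hQ'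
  have hQQ : Q * Q' = 1 := Units.mul_inv P
  have hQQ' : Q' * Q = 1 := Units.inv_mul P
  set X : Matrix (Fin 2) (Fin 2) ℂ := C' * Q * B with hX
  have e1 : B' * X = Q * B * diagonal θ := by
    calc B' * X = (B' * C' * Q) * B := by rw [hX]; simp only [Matrix.mul_assoc]
      _ = Q * B * (C * B) := by rw [hP]; simp only [Matrix.mul_assoc]
      _ = _ := by rw [h]
  have e2 : X * C = diagonal θ * (C' * Q) := by
    calc X * C = C' * (Q * (B * C)) := by rw [hX]; simp only [Matrix.mul_assoc]
      _ = (C' * B') * (C' * Q) := by rw [← hP]; simp only [Matrix.mul_assoc]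
      _ = _ := by rw [h']
  have e3 : diagonal θ * X = X * diagonal θ := by
    calc diagonal θ * X = (diagonal θ * (C' * Q)) * B := by rw [hX]; simp only [Matrix.mul_assoc]
      _ = X * (C * B) := by rw [← e2, Matrix.mul_assoc]
      _ = _ := by rw [h]
  have e4 : (C * Q' * B') * X = diagonal (fun j => θ j * θ j) := by
    calc (C * Q' * B') * X = C * (Q' * (B' * X)) := by simp only [Matrix.mul_assoc]
      _ = C * ((Q' * Q) * B * diagonal θ) := by rw [e1]; simp only [Matrix.mul_assoc]
      _ = _ := by rw [hQQ', Matrix.one_mul, ← Matrix.mul_assoc, h, diagonal_mul_diagonal]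
  have x01 : X 0 1 = 0 := by
    have := congrFun (congrFun e3 0) 1
    rw [diagonal_mul, mul_diagonal] at this
    have h3 : (θ 0 - θ 1) * X 0 1 = 0 := by linear_combination this
    exact (mul_eq_zero.1 h3).resolve_left (sub_ne_zero.2 hne)
  have x10 : X 1 0 = 0 := by
    have := congrFun (congrFun e3 1) 0
    rw [diagonal_mul, mul_diagonal] at this
    have h3 : (θ 0 - θ 1) * X 1 0 = 0 := by linear_combination -this
    exact (mul_eq_zero.1 h3).resolve_left (sub_ne_zero.2 hne)
  obtain ⟨x, hXd⟩ : ∃ x : Fin 2 → ℂ, X = diagonal x := ⟨fun j => X j j, by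
    ext i j
    fin_cases i <;> fin_cases j <;> simp [x01, x10]⟩
  rw [hXd] at e1 e2 e4
  have hx : ∀ j, x j ≠ 0 := by
    intro j h0'
    have := congrFun (congrFun e4 j) j
    rw [mul_diagonal, diagonal_apply_eq, h0', mul_zero] at this
    exact mul_ne_zero (h0 j) (h0 j) this.symm
  refine ⟨fun j => Units.mk0 (θ j / x j) (div_ne_zero (h0 j) (hx j)), ?_, ?_⟩
  · have : (1 : Matrix (Fin 2) (Fin 2) ℂ) = diagonal x * diagonal (fun j => (x j)⁻¹) := by
      rw [diagonal_mul_diagonal, ← diagonal_one]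
      congr 1
      funext j
      rw [mul_inv_cancel₀ (hx j)]
    calc B' = B' * (diagonal x * diagonal (fun j => (x j)⁻¹)) := by rw [← this, Matrix.mul_one]
      _ = Q * B * (diagonal θ * diagonal (fun j => (x j)⁻¹)) := by
        rw [← Matrix.mul_assoc, e1, Matrix.mul_assoc]
      _ = _ := by
        rw [diagonal_mul_diagonal]
        rfl
  · have : (1 : Matrix (Fin 2) (Fin 2) ℂ) = diagonal (fun j => (θ j)⁻¹) * diagonal θ := by
      rw [diagonal_mul_diagonal, ← diagonal_one]
      congr 1
      funext j
      rw [inv_mul_cancel₀ (h0 j)]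
    calc C' = diagonal (fun j => (θ j)⁻¹) * diagonal θ * C' * (Q * Q') := by
          rw [← this, hQQ, Matrix.one_mul, Matrix.mul_one]
      _ = diagonal (fun j => (θ j)⁻¹) * (diagonal θ * (C' * Q)) * Q' := by
        simp only [Matrix.mul_assoc]
      _ = _ := by
        rw [← e2, ← Matrix.mul_assoc, diagonal_mul_diagonal]
        congr 3
        funext j
        simp only [Units.val_mk0]
        rw [inv_div, div_eq_inv_mul]

/-- Decomposition points with conjugate residues are gauge equivalent. -/
lemma gaugeEquivalent_of_residue {s : RiemannScheme} (hs : s.Regular) {p q : Decomposition}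
    (hp : p.IsOver s) (hq : q.IsOver s) (P : GL (Fin 3) ℂ)
    (hP : ∀ i, q.residue i * (P : Matrix (Fin 3) (Fin 3) ℂ) =
      (P : Matrix (Fin 3) (Fin 3) ℂ) * p.residue i) : GaugeEquivalent p q := by
  choose D hD using fun i => diagonal_gauge (hs.1 i) (hs.2 i) (hp.1 i) (hq.1 i) P (hP i)
  exact ⟨P, D, hD⟩

/-! ### Elementary Schlesinger transformations in terms of residues -/

/-- The projector `b_{β,ν} c_α^μ / (c_α^μ b_{β,ν})`. -/
def projector (α β μ ν : Fin 2) (p : Decomposition) : Matrix (Fin 3) (Fin 3) ℂ :=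
  (p.C α μ ⬝ᵥ (p.B β).col ν)⁻¹ • vecMulVec ((p.B β).col ν) (p.C α μ)

lemma projector_mul_self {α β μ ν : Fin 2} {p : Decomposition}
    (h : p.C α μ ⬝ᵥ (p.B β).col ν ≠ 0) :
    projector α β μ ν p * projector α β μ ν p = projector α β μ ν p := by
  rw [projector, Matrix.smul_mul, Matrix.mul_smul, vecMulVec_mul_vecMulVec, smul_smul]
  rw [vecMulVec_smul, smul_smul, mul_assoc, inv_mul_cancel₀ h, mul_one]

lemma row_mul_residue {s : RiemannScheme} {p : Decomposition} (hp : p.IsOver s) (i j : Fin 2) :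
    p.C i j ᵥ* p.residue i = s.θ i j • p.C i j := by
  have h1 : p.C i * p.residue i = diagonal (s.θ i) * p.C i := by
    rw [Decomposition.residue, ← Matrix.mul_assoc, hp.1 i]
  have := congrFun h1 j
  rw [Matrix.mul_apply_eq_vecMul] at this
  rw [this]
  ext k
  simp [diagonal_mul]

lemma residue_mul_col {s : RiemannScheme} {p : Decomposition} (hp : p.IsOver s) (i j : Fin 2) :
    p.residue i *ᵥ (p.B i).col j = s.θ i j • (p.B i).col j := by
  have h1 : p.residue i * p.B i = p.B i * diagonal (s.θ i) := by
    rw [Decomposition.residue, Matrix.mul_assoc, hp.1 i]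
  ext k
  have := congrFun (congrFun h1 k) j
  rw [mul_diagonal] at this
  simpa [Matrix.mul_apply, mulVec, dotProduct, Matrix.col, mul_comm] using this

lemma projector_mul_residue {s : RiemannScheme} {α β μ ν : Fin 2} {p : Decomposition}
    (hp : p.IsOver s) : projector α β μ ν p * p.residue α = s.θ α μ • projector α β μ ν p := by
  rw [projector, Matrix.smul_mul, vecMulVec_mul, row_mul_residue hp, vecMulVec_smul, smul_comm]

lemma residue_mul_projector {s : RiemannScheme} {α β μ ν : Fin 2} {p : Decomposition}
    (hp : p.IsOver s) : p.residue β * projector α β μ ν p = s.θ β ν • projector α β μ ν p := by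
  rw [projector, Matrix.mul_smul, mul_vecMulVec, residue_mul_col hp, smul_vecMulVec, smul_comm]

end SchlesingerA2

end

/-! ### Residues under Schlesinger transformations, and existence of the transforms. -/

noncomputable section

namespace SchlesingerA2

open Matrix

/-! ### Reconstruction of a decomposition from a residue -/

/-- With the three distinct eigenvalues θ 0, θ 1, 0 the matrix is diagonalisable. B collects the
first two eigenvectors, C the corresponding rows of the inverse eigenbasis, scaled by the
eigenvalues. -/
lemma exists_decomposition {A : Matrix (Fin 3) (Fin 3) ℂ} {θ : Fin 2 → ℂ} (h0 : ∀ j, θ j ≠ 0)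
    (hne : θ 0 ≠ θ 1) (h : ∀ j, (A - θ j • (1 : Matrix (Fin 3) (Fin 3) ℂ)).det = 0)
    (hA : A.det = 0) :
    ∃ (B : Matrix (Fin 3) (Fin 2) ℂ) (C : Matrix (Fin 2) (Fin 3) ℂ),
      C * B = diagonal θ ∧ B * C = A := by
  set l : Fin 3 → ℂ := ![θ 0, θ 1, 0] with hl
  have hinj : Function.Injective l := by
    intro i j hij
    have := h0 0
    have := h0 1
    have := hne.symm
    fin_cases i <;> fin_cases j <;> simp_all [eq_comm]
  have hv : ∀ k, ∃ v : Fin 3 → ℂ, v ≠ 0 ∧ A *ᵥ v = l k • v := by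
    intro k
    have hk : (A - l k • (1 : Matrix (Fin 3) (Fin 3) ℂ)).det = 0 := by
      fin_cases k
      · exact h 0
      · exact h 1
      · simpa [hl] using hA
    obtain ⟨v, hv0, hv⟩ := exists_mulVec_eq_zero_iff.2 hk
    refine ⟨v, hv0, ?_⟩
    rw [sub_mulVec, smul_mulVec, one_mulVec] at hv
    exact sub_eq_zero.1 hv
  choose v hv0 hv using hv
  have hlin : LinearIndependent ℂ v := by
    refine Module.End.eigenvectors_linearIndependent' (toLin' A) l hinj v fun k => ?_
    rw [Module.End.hasEigenvector_iff, Module.End.mem_eigenspace_iff]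
    exact ⟨by rw [toLin'_apply]; exact hv k, hv0 k⟩
  set P : Matrix (Fin 3) (Fin 3) ℂ := of fun i j => v j i with hP
  have hPu : IsUnit P := by
    rw [← linearIndependent_cols_iff_isUnit]
    exact hlin
  have hdet : IsUnit P.det := (isUnit_iff_isUnit_det P).1 hPu
  have hPP := mul_nonsing_inv P hdet
  have hPP' := nonsing_inv_mul P hdet
  have hAP : A * P = P * diagonal l := by
    ext i j
    have := congrFun (hv j) i
    rw [mul_diagonal]
    simpa [mulVec, dotProduct, Matrix.mul_apply, hP, mul_comm] using this
  let r : Fin 2 → Fin 3 := ![0, 1]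
  refine ⟨P.submatrix id r, diagonal θ * P⁻¹.submatrix r id, ?_, ?_⟩
  · have := submatrix_mul_equiv P⁻¹ P r (Equiv.refl _) r
    rw [Equiv.coe_refl] at this
    have hr : Function.Injective r := by
      intro i j
      fin_cases i <;> fin_cases j <;> simp [r]
    rw [Matrix.mul_assoc, this, hPP', submatrix_one r hr, Matrix.mul_one]
  · have : A = P * diagonal l * P⁻¹ := by rw [← hAP, Matrix.mul_assoc, hPP, Matrix.mul_one]
    rw [this]
    ext i j
    simp only [Matrix.mul_apply, Fin.sum_univ_two, Fin.sum_univ_three, submatrix_apply, id_eq,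
      mul_diagonal, diagonal_mul, diagonal_apply, hl, r]
    simp
    ring

lemma det_sub_smul_one (A : Matrix (Fin 3) (Fin 3) ℂ) (z : ℂ) :
    (A - z • (1 : Matrix (Fin 3) (Fin 3) ℂ)).det = A.det - z * ((A 0 0 * A 1 1 - A 0 1 * A 1 0) +
      (A 0 0 * A 2 2 - A 0 2 * A 2 0) + (A 1 1 * A 2 2 - A 1 2 * A 2 1)) + z ^ 2 * A.trace - z ^ 3
          := by
  simp [det_fin_three, trace_fin_three, Matrix.one_apply]
  ring

/-- Two distinct eigenvalues and the trace determine the third eigenvalue. -/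
lemma det_third_eigenvalue {A : Matrix (Fin 3) (Fin 3) ℂ} {x y z : ℂ} (hxy : x ≠ y)
    (hx : (A - x • (1 : Matrix (Fin 3) (Fin 3) ℂ)).det = 0)
    (hy : (A - y • (1 : Matrix (Fin 3) (Fin 3) ℂ)).det = 0) (ht : A.trace = x + y + z) :
    (A - z • (1 : Matrix (Fin 3) (Fin 3) ℂ)).det = 0 := by
  rw [det_sub_smul_one, ht] at hx hy ⊢
  apply mul_left_cancel₀ (sub_ne_zero.2 hxy)
  linear_combination (z - y) * hx - (z - x) * hy

lemma det_eq_zero_of_mulVec {A : Matrix (Fin 3) (Fin 3) ℂ} {v : Fin 3 → ℂ} {z : ℂ} (hv : v ≠ 0)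
    (h : A *ᵥ v = z • v) : (A - z • (1 : Matrix (Fin 3) (Fin 3) ℂ)).det = 0 :=
  exists_mulVec_eq_zero_iff.1 ⟨v, hv, by rw [sub_mulVec, smul_mulVec, one_mulVec, h, sub_self]⟩

lemma det_eq_zero_of_vecMul {A : Matrix (Fin 3) (Fin 3) ℂ} {v : Fin 3 → ℂ} {z : ℂ} (hv : v ≠ 0)
    (h : v ᵥ* A = z • v) : (A - z • (1 : Matrix (Fin 3) (Fin 3) ℂ)).det = 0 :=
  exists_vecMul_eq_zero_iff.1 ⟨v, hv, by rw [vecMul_sub, vecMul_smul, vecMul_one, h, sub_self]⟩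

/-! ### The third eigenvectors -/

/-- The right eigenvector of the residue with eigenvalue `0`. -/
def Decomposition.kernelVec (p : Decomposition) (i : Fin 2) : Fin 3 → ℂ :=
  crossProduct (p.C i 0) (p.C i 1)

/-- The left eigenvector of the residue with eigenvalue `0`. -/
def Decomposition.cokernelVec (p : Decomposition) (i : Fin 2) : Fin 3 → ℂ :=
  crossProduct ((p.B i).col 0) ((p.B i).col 1)

section
variable {s : RiemannScheme} {p q : Decomposition}

lemma row_dot_col (hp : p.IsOver s) (i j k : Fin 2) :
    p.C i j ⬝ᵥ (p.B i).col k = if j = k then s.θ i j else 0 := by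
  have := congrFun (congrFun (hp.1 i) j) k
  rw [Matrix.mul_apply', diagonal_apply] at this
  exact this

/-- The Cauchy–Binet identity for cross products expresses this pairing as the determinant of C B.
It shows that the kernel and cokernel vectors pair nontrivially when the indices are nonzero. -/
lemma kernelVec_dot_cokernelVec (hp : p.IsOver s) (i : Fin 2) :
    p.kernelVec i ⬝ᵥ p.cokernelVec i = s.θ i 0 * s.θ i 1 := by
  rw [Decomposition.kernelVec, Decomposition.cokernelVec, cross_dot_cross]
  simp only [row_dot_col hp]
  simp

lemma row_dot_kernelVec (i j : Fin 2) : p.C i j ⬝ᵥ p.kernelVec i = 0 := by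
  rw [Decomposition.kernelVec]
  fin_cases j
  · exact dot_self_cross _ _
  · exact dot_cross_self _ _

lemma cokernelVec_dot_col (i j : Fin 2) : p.cokernelVec i ⬝ᵥ (p.B i).col j = 0 := by
  rw [Decomposition.cokernelVec, dotProduct_comm]
  fin_cases j
  · exact dot_self_cross _ _
  · exact dot_cross_self _ _

lemma residue_mulVec_kernelVec (i : Fin 2) : p.residue i *ᵥ p.kernelVec i = 0 := by
  rw [Decomposition.residue, ← mulVec_mulVec]
  have : p.C i *ᵥ p.kernelVec i = 0 := by
    ext j
    exact row_dot_kernelVec i j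
  rw [this, mulVec_zero]

lemma cokernelVec_vecMul_residue (i : Fin 2) : p.cokernelVec i ᵥ* p.residue i = 0 := by
  rw [Decomposition.residue, ← vecMul_vecMul]
  have : p.cokernelVec i ᵥ* p.B i = 0 := by
    ext j
    exact cokernelVec_dot_col i j
  rw [this, zero_vecMul]

lemma trace_residue (hp : p.IsOver s) (i : Fin 2) :
    (p.residue i).trace = s.θ i 0 + s.θ i 1 := by
  rw [Decomposition.residue, trace_mul_comm, hp.1 i, trace_diagonal, Fin.sum_univ_two]

/-! ### Schlesinger transformations -/

/-- The relation between the residues before and after a Schlesinger transformation. -/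
def SchlesingerRelation (α β : Fin 2) (z : ℂ) (N : Matrix (Fin 3) (Fin 3) ℂ)
    (A A' : Fin 2 → Matrix (Fin 3) (Fin 3) ℂ) : Prop :=
  A' α * N = (z - 1) • N ∧ A' α + A' β = A α + A β ∧ A' β * (1 - N) = (1 - N) * A β

lemma multiplier_eq (α β μ ν : Fin 2) (p : Decomposition) (x : ℂ) :
    multiplier α β μ ν p x = 1 + ((pole α - pole β) / (x - pole α)) • projector α β μ ν p := by
  rw [multiplier, projector, smul_smul]

lemma deriv_multiplier (α β μ ν : Fin 2) (p : Decomposition) {x : ℂ} (hx : x ≠ pole α) :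
    Matrix.of (fun i j => deriv (fun t => multiplier α β μ ν p t i j) x) =
      (-(pole α - pole β) / (x - pole α) ^ 2) • projector α β μ ν p := by
  ext i j
  have h0 : x - pole α ≠ 0 := sub_ne_zero.2 hx
  have hd : HasDerivAt (fun t => multiplier α β μ ν p t i j)
      ((-(pole α - pole β) / (x - pole α) ^ 2) * projector α β μ ν p i j) x := by
    have h1 : HasDerivAt (fun t : ℂ => t - pole α) 1 x := (hasDerivAt_id x).sub_const _
    have h2 := ((h1.inv h0).const_mul (pole α - pole β)).mul_const (projector α β μ ν p i j)
    have h3 := h2.const_add ((1 : Matrix (Fin 3) (Fin 3) ℂ) i j)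
    refine (h3.congr_deriv (by ring)).congr_of_eventuallyEq ?_
    refine Filter.Eventually.of_forall fun t => ?_
    simp only [multiplier_eq, Matrix.add_apply, Matrix.smul_apply, smul_eq_mul]
    simp only [Pi.inv_apply, div_eq_mul_inv]
  simpa using hd.deriv

lemma partial_fractions {α β : Fin 2} (hαβ : α ≠ β) {U V W : Matrix (Fin 3) (Fin 3) ℂ} :
    (∀ x : ℂ, (∀ i, x ≠ pole i) → ((x - pole α)⁻¹) ^ 2 • U + (x - pole α)⁻¹ • V +
      (x - pole β)⁻¹ • W = 0) ↔ U = 0 ∧ V = 0 ∧ W = 0 := by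
  constructor
  · intro h
    have hne : ∀ x : ℂ, x ≠ 0 → x ≠ 1 → ∀ i, x ≠ pole i := by
      intro x h0 h1 i
      fin_cases i
      · simpa [pole] using h0
      · simpa [pole] using h1
    -- Three sample points separate the three functions; the coefficients below invert the resulting
    -- 3 × 3 systems, one for each order of the poles.
    have h2 := h 2 (hne 2 (by norm_num) (by norm_num))
    have h3 := h 3 (hne 3 (by norm_num) (by norm_num))
    have h4 := h (-1) (hne (-1) (by norm_num) (by norm_num))
    have key : ∀ i j, U i j = 0 ∧ V i j = 0 ∧ W i j = 0 := by
      intro i j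
      have e2 := congrFun (congrFun h2 i) j
      have e3 := congrFun (congrFun h3 i) j
      have e4 := congrFun (congrFun h4 i) j
      simp only [Matrix.add_apply, Matrix.smul_apply, smul_eq_mul, Matrix.zero_apply] at e2 e3 e4
      fin_cases α <;> fin_cases β <;> simp [pole] at hαβ e2 e3 e4 <;> norm_num at e2 e3 e4
      · refine ⟨?_, ?_, ?_⟩
        · linear_combination -4 * e2 + 9 * e3 + e4
        · linear_combination -20 / 3 * e2 + 27 / 2 * e3 + 1 / 6 * e4
        · linear_combination 16 / 3 * e2 - 9 * e3 - 1 / 3 * e4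
      · refine ⟨?_, ?_, ?_⟩
        · linear_combination 8 / 3 * e2 - 6 * e3 - 2 / 3 * e4
        · linear_combination -8 / 3 * e2 + 9 * e3 + 5 / 3 * e4
        · linear_combination 2 * e2 - 6 * e3 - 2 * e4
    exact ⟨by ext i j; exact (key i j).1, by ext i j; exact (key i j).2.1,
      by ext i j; exact (key i j).2.2⟩
  · rintro ⟨rfl, rfl, rfl⟩ x _
    simp

/-- The relation is compared through partial fractions in x: the double pole at u_α, where R'
contributes, and the two simple poles each give one matrix identity. As N A_α = z N, these are
equivalent to the three identities of `SchlesingerRelation`. -/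
lemma schlesinger_graph_iff {α β : Fin 2} (hαβ : α ≠ β) (μ ν : Fin 2) :
    (schlesinger α β μ ν).graph s p q ↔ p.IsOver s ∧ q.IsOver (s.shift α β μ ν) ∧
      p.C α μ ⬝ᵥ (p.B β).col ν ≠ 0 ∧
      SchlesingerRelation α β (s.θ α μ) (projector α β μ ν p) p.residue q.residue := by
  refine and_congr_right fun hp => and_congr_right fun hq => and_congr_right fun hc => ?_
  have hk : pole α - pole β ≠ 0 := by
    fin_cases α <;> fin_cases β <;> simp [pole] at hαβ ⊢
  have hsys : ∀ (r : Decomposition) (x : ℂ), r.system x =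
      (x - pole α)⁻¹ • r.residue α + (x - pole β)⁻¹ • r.residue β := by
    intro r x
    rw [Decomposition.system, Fin.sum_univ_two]
    fin_cases α <;> fin_cases β <;> simp at hαβ ⊢
    exact add_comm _ _
  have hN := projector_mul_residue (α := α) (β := β) (μ := μ) (ν := ν) hp
  set N := projector α β μ ν p with hNdef
  set k := pole α - pole β with hkdef
  have hpf := partial_fractions hαβ (U := k • (q.residue α * N - N * p.residue α + N))
    (V := q.residue α + q.residue β * N - p.residue α - N * p.residue β)
    (W := q.residue β - q.residue β * N - p.residue β + N * p.residue β)
  have hiff : (∀ x : ℂ, (∀ i, x ≠ pole i) →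
      q.system x * multiplier α β μ ν p x = multiplier α β μ ν p x * p.system x +
        Matrix.of (fun i j => deriv (fun t => multiplier α β μ ν p t i j) x)) ↔
      (k • (q.residue α * N - N * p.residue α + N) = 0 ∧
      q.residue α + q.residue β * N - p.residue α - N * p.residue β = 0 ∧
      q.residue β - q.residue β * N - p.residue β + N * p.residue β = 0) := by
    rw [← hpf]
    refine forall_congr' fun x => forall_congr' fun hx => ?_
    rw [deriv_multiplier α β μ ν p (hx α), multiplier_eq, hsys, hsys, ← hNdef, ← hkdef,
      ← sub_eq_zero]
    have h1 : x - pole α ≠ 0 := sub_ne_zero.2 (hx α)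
    have h2 : x - pole β ≠ 0 := sub_ne_zero.2 (hx β)
    -- Splits the mixed products of poles into simple ones; the factor u_α - u_β of the multiplier
    -- is exactly what the splitting needs.
    have h3 : k * ((x - pole α)⁻¹ * (x - pole β)⁻¹) = (x - pole α)⁻¹ - (x - pole β)⁻¹ := by
      rw [hkdef]; field_simp; ring
    generalize (x - pole α) = X at *
    generalize (x - pole β) = Y at *
    refine Eq.congr ?_ rfl
    simp only [Matrix.add_mul, Matrix.mul_add, Matrix.smul_mul, Matrix.mul_smul, Matrix.mul_one,
      Matrix.one_mul, div_eq_mul_inv]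
    linear_combination (norm := module) h3 • (q.residue β * N) - h3 • (N * p.residue β)
  rw [hiff, smul_eq_zero_iff_right hk, hN]
  constructor
  · rintro ⟨e1, e2, e3⟩
    refine ⟨?_, ?_, ?_⟩
    · linear_combination (norm := module) e1
    · linear_combination (norm := module) e2 + e3
    · rw [Matrix.mul_sub, Matrix.sub_mul, Matrix.mul_one, Matrix.one_mul]
      linear_combination (norm := module) e3
  · rintro ⟨e1, e2, e3⟩
    rw [Matrix.mul_sub, Matrix.sub_mul, Matrix.mul_one, Matrix.one_mul] at e3
    refine ⟨?_, ?_, ?_⟩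
    · linear_combination (norm := module) e1
    · linear_combination (norm := module) e2 - e3
    · linear_combination (norm := module) e3

/-- The residues after a Schlesinger transformation are determined. -/
lemma SchlesingerRelation.eq {α β : Fin 2} {z : ℂ} {N : Matrix (Fin 3) (Fin 3) ℂ}
    {A A' : Fin 2 → Matrix (Fin 3) (Fin 3) ℂ} (h : SchlesingerRelation α β z N A A') :
    A' β = (1 - N) * A β + (A α + A β) * N - (z - 1) • N ∧
    A' α = A α + A β - ((1 - N) * A β + (A α + A β) * N - (z - 1) • N) := by
  obtain ⟨h1, h2, h3⟩ := h
  have e : A' β = (1 - N) * A β + (A α + A β) * N - (z - 1) • N := by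
    rw [← h2, ← h3, ← h1, Matrix.mul_sub, Matrix.mul_one, Matrix.add_mul]
    abel
  refine ⟨e, ?_⟩
  rw [← e, ← h2]
  abel

/-- The intertwining relation for the residue at the other pole. -/
lemma SchlesingerRelation.intertwine {α β : Fin 2} {z w : ℂ} {N : Matrix (Fin 3) (Fin 3) ℂ}
    {A A' : Fin 2 → Matrix (Fin 3) (Fin 3) ℂ} (h : SchlesingerRelation α β z N A A')
    (hN : N * N = N) (h1 : N * A α = z • N) (h2 : A β * N = w • N) :
    (1 - N) * A' α = A α * (1 - N) := by
  rw [h.eq.2]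
  have e1 : (1 - N) * N = 0 := by rw [Matrix.sub_mul, Matrix.one_mul, hN, sub_self]
  have e2 : (1 - N) * (1 - N) = 1 - N := by rw [Matrix.mul_sub, Matrix.mul_one, e1, sub_zero]
  have e3 : (1 - N) * (A α + A β) * N = (1 - N) * A α * N := by
    rw [Matrix.mul_assoc, Matrix.add_mul, h2, Matrix.mul_add, Matrix.mul_smul, e1, smul_zero,
      add_zero, Matrix.mul_assoc]
  calc _ = (1 - N) * (A α + A β) - ((1 - N) * (1 - N)) * A β - (1 - N) * (A α + A β) * N +
        (z - 1) • ((1 - N) * N) := by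
        generalize 1 - N = L
        simp only [Matrix.mul_sub, Matrix.mul_add, Matrix.mul_smul, Matrix.mul_assoc,
          Matrix.add_mul]
        abel
    _ = (1 - N) * A α * (1 - N) := by
        rw [e2, e1, e3, smul_zero, Matrix.mul_sub, Matrix.mul_one, Matrix.mul_add]
        abel
    _ = _ := by
        rw [Matrix.sub_mul, Matrix.one_mul, h1, Matrix.sub_mul, Matrix.smul_mul, Matrix.mul_sub N,
          Matrix.mul_one, hN, sub_self, smul_zero, sub_zero]

lemma trace_projector {α β μ ν : Fin 2} (h : p.C α μ ⬝ᵥ (p.B β).col ν ≠ 0) :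
    (projector α β μ ν p).trace = 1 := by
  rw [projector, trace_smul, trace_vecMulVec, dotProduct_comm ((p.B β).col ν), smul_eq_mul,
      inv_mul_cancel₀ h]

lemma projector_mulVec {α β μ ν : Fin 2} (v : Fin 3 → ℂ) : ∃ c : ℂ,
    projector α β μ ν p *ᵥ v = c • (p.B β).col ν := by
  refine ⟨(p.C α μ ⬝ᵥ (p.B β).col ν)⁻¹ * (p.C α μ ⬝ᵥ v), ?_⟩
  rw [projector, smul_mulVec, vecMulVec_mulVec, mul_smul]
  simp

lemma vecMul_projector {α β μ ν : Fin 2} (v : Fin 3 → ℂ) : ∃ c : ℂ,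
    v ᵥ* projector α β μ ν p = c • p.C α μ := by
  refine ⟨(p.C α μ ⬝ᵥ (p.B β).col ν)⁻¹ * (v ⬝ᵥ (p.B β).col ν), ?_⟩
  rw [projector, vecMul_smul, vecMul_vecMulVec, mul_smul]

/-- Applying 1 - N changes v only by a multiple of b_{β,ν}, which w annihilates; so the pairing with
w survives. -/
lemma one_sub_projector_mulVec_ne_zero {α β μ ν : Fin 2} {v w : Fin 3 → ℂ}
    (hw : w ⬝ᵥ (p.B β).col ν = 0) (h : w ⬝ᵥ v ≠ 0) : (1 - projector α β μ ν p) *ᵥ v ≠ 0 := by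
  intro h0
  obtain ⟨c, hc⟩ := projector_mulVec (p := p) (α := α) (β := β) (μ := μ) (ν := ν) v
  rw [sub_mulVec, one_mulVec, hc, sub_eq_zero] at h0
  rw [h0, dotProduct_smul, hw, smul_zero] at h
  exact h rfl

lemma vecMul_one_sub_projector_ne_zero {α β μ ν : Fin 2} {v w : Fin 3 → ℂ}
    (hw : p.C α μ ⬝ᵥ w = 0) (h : v ⬝ᵥ w ≠ 0) : v ᵥ* (1 - projector α β μ ν p) ≠ 0 := by
  intro h0
  obtain ⟨c, hc⟩ := vecMul_projector (p := p) (α := α) (β := β) (μ := μ) (ν := ν) v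
  rw [vecMul_sub, vecMul_one, hc, sub_eq_zero] at h0
  rw [h0, smul_dotProduct, hw, smul_zero] at h
  exact h rfl

/-- Besides 0 only the index j changes. The other index is still an eigenvalue, and the trace then
leaves one possibility for the third. -/
lemma det_of_trace {A : Matrix (Fin 3) (Fin 3) ℂ} {θ θ' : Fin 2 → ℂ} {j : Fin 2}
    (hθ : ∀ i, θ i ≠ 0) (h0 : A.det = 0) (hoff : ∀ i, i ≠ j → θ' i = θ i)
    (h : ∀ i, i ≠ j → (A - θ i • (1 : Matrix (Fin 3) (Fin 3) ℂ)).det = 0)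
    (ht : A.trace = θ' 0 + θ' 1) (i : Fin 2) :
    (A - θ' i • (1 : Matrix (Fin 3) (Fin 3) ℂ)).det = 0 := by
  by_cases hij : i = j
  · obtain ⟨k, hk, hs⟩ : ∃ k, k ≠ j ∧ θ' 0 + θ' 1 = θ' k + θ' i := by
      subst hij
      fin_cases i
      · exact ⟨1, by decide, add_comm _ _⟩
      · exact ⟨0, by decide, rfl⟩
    refine det_third_eigenvalue (hθ k) (h k hk) (y := 0) (by simpa using h0) ?_
    rw [ht, hs, hoff k hk, add_zero]
  · rw [hoff i hij]
    exact h i hij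

/-- The relation forces the new residues, so only their spectra need checking. The intertwinings
A'_β (1 - N) = (1 - N) A_β and (1 - N) A'_α = A_α (1 - N) carry over the eigenvectors that survive 1
- N. So 0 and the unshifted index remain eigenvalues at each pole, the trace gives the shifted one,
and distinct eigenvalues allow a decomposition. -/
lemma exists_schlesinger {α β : Fin 2} (hαβ : α ≠ β) (μ ν : Fin 2) (hs : s.Regular)
    (hs' : (s.shift α β μ ν).Regular) (hp : p.IsOver s) (hc : p.C α μ ⬝ᵥ (p.B β).col ν ≠ 0) :
    ∃ q, (schlesinger α β μ ν).graph s p q := by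
  simp only [schlesinger_graph_iff hαβ]
  set N := projector α β μ ν p with hNdef
  have hN := projector_mul_self hc
  have h1 := projector_mul_residue (α := α) (β := β) (μ := μ) (ν := ν) hp
  have h2 := residue_mul_projector (α := α) (β := β) (μ := μ) (ν := ν) hp
  rw [← hNdef] at hN h1 h2
  -- The only possible value, according to `SchlesingerRelation.eq`; the residue at u_α is then
  -- fixed by the invariance of the sum.
  set Ab := (1 - N) * p.residue β + (p.residue α + p.residue β) * N - (s.θ α μ - 1) • N with hAb
  set A' : Fin 2 → Matrix (Fin 3) (Fin 3) ℂ :=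
    fun i => if i = β then Ab else p.residue α + p.residue β - Ab with hA'
  have hA'β : A' β = Ab := if_pos rfl
  have hA'α : A' α = p.residue α + p.residue β - Ab := if_neg hαβ
  have e1 : (1 - N) * N = 0 := by rw [Matrix.sub_mul, Matrix.one_mul, hN, sub_self]
  have hrel : SchlesingerRelation α β (s.θ α μ) N p.residue A' := by
    refine ⟨?_, ?_, ?_⟩
    · rw [hA'α, hAb]
      simp only [Matrix.sub_mul, Matrix.add_mul, Matrix.one_mul, Matrix.mul_assoc, hN, h2,
        Matrix.mul_smul, Matrix.smul_mul]
      module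
    · rw [hA'α, hA'β]
      abel
    · rw [hA'β, hAb]
      have e4 : N * (1 - N) = 0 := by rw [Matrix.mul_sub, Matrix.mul_one, hN, sub_self]
      rw [Matrix.sub_mul, Matrix.add_mul, Matrix.mul_assoc _ N, e4, Matrix.smul_mul, e4,
        Matrix.mul_zero, smul_zero, sub_zero, add_zero, Matrix.mul_assoc, Matrix.mul_sub _ 1 N,
        Matrix.mul_one, h2, Matrix.mul_sub, Matrix.mul_smul, e1, smul_zero, sub_zero]
  have hcomm := hrel.intertwine hN h1 h2
  have htN : N.trace = 1 := trace_projector hc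
  have htβ : (A' β).trace = s.θ β 0 + s.θ β 1 + 1 := by
    rw [hA'β, hAb, trace_sub, trace_add, Matrix.sub_mul, Matrix.one_mul, trace_sub, Matrix.add_mul,
      trace_add, trace_mul_comm N, h2, trace_mul_comm _ N, h1, trace_smul, trace_smul, trace_smul,
      htN, trace_residue hp]
    simp only [smul_eq_mul]
    ring
  have htα : (A' α).trace = s.θ α 0 + s.θ α 1 - 1 := by
    rw [hA'α, ← hA'β, trace_sub, htβ, trace_add, trace_residue hp, trace_residue hp]
    ring
  have hdetβ : ∀ (v : Fin 3 → ℂ) (z : ℂ), p.residue β *ᵥ v = z • v → (1 - N) *ᵥ v ≠ 0 →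
      (A' β - z • (1 : Matrix (Fin 3) (Fin 3) ℂ)).det = 0 := by
    intro v z hv hne
    refine det_eq_zero_of_mulVec hne ?_
    rw [mulVec_mulVec, hrel.2.2, ← mulVec_mulVec, hv, mulVec_smul]
  have hdetα : ∀ (v : Fin 3 → ℂ) (z : ℂ), v ᵥ* p.residue α = z • v → v ᵥ* (1 - N) ≠ 0 →
      (A' α - z • (1 : Matrix (Fin 3) (Fin 3) ℂ)).det = 0 := by
    intro v z hv hne
    refine det_eq_zero_of_vecMul hne ?_
    rw [vecMul_vecMul, hcomm, ← vecMul_vecMul, hv, smul_vecMul]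
  have hprod : ∀ i, s.θ i 0 * s.θ i 1 ≠ 0 := fun i => mul_ne_zero (hs.1 i 0) (hs.1 i 1)
  have dec : ∀ i, ∃ (B : Matrix (Fin 3) (Fin 2) ℂ) (C : Matrix (Fin 2) (Fin 3) ℂ),
      C * B = diagonal ((s.shift α β μ ν).θ i) ∧ B * C = A' i := by
    intro i
    have hi : i = α ∨ i = β := by
      fin_cases α <;> fin_cases β <;> fin_cases i <;> simp at hαβ ⊢
    rcases hi with rfl | rfl
    · have d0 : (A' i).det = 0 := by
        have := hdetα (p.cokernelVec i) 0 (by rw [cokernelVec_vecMul_residue, zero_smul])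
          (vecMul_one_sub_projector_ne_zero (w := p.kernelVec i) (row_dot_kernelVec i μ)
            (by rw [dotProduct_comm, kernelVec_dot_cokernelVec hp]; exact hprod i))
        simpa using this
      refine exists_decomposition (hs'.1 i) (hs'.2 i)
        (det_of_trace (θ := s.θ i) (j := μ) (hs.1 i) d0 ?_ ?_ ?_) d0
      · intro j hj
        simp [RiemannScheme.shift, hj, hαβ]
      · intro j hj
        refine hdetα _ _ (row_mul_residue hp i j)
          (vecMul_one_sub_projector_ne_zero (w := (p.B i).col j) ?_ ?_)
        · rw [row_dot_col hp, if_neg hj.symm]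
        · rw [row_dot_col hp, if_pos rfl]
          exact hs.1 i j
      · rw [htα]
        fin_cases μ <;> simp [RiemannScheme.shift, hαβ] <;> ring
    · have d0 : (A' i).det = 0 := by
        have := hdetβ (p.kernelVec i) 0 (by rw [residue_mulVec_kernelVec, zero_smul])
          (one_sub_projector_mulVec_ne_zero (w := p.cokernelVec i) (cokernelVec_dot_col i ν)
            (by rw [dotProduct_comm, kernelVec_dot_cokernelVec hp]; exact hprod i))
        simpa using this
      refine exists_decomposition (hs'.1 i) (hs'.2 i)
        (det_of_trace (θ := s.θ i) (j := ν) (hs.1 i) d0 ?_ ?_ ?_) d0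
      · intro j hj
        simp [RiemannScheme.shift, hj, hαβ.symm]
      · intro j hj
        refine hdetβ _ _ (residue_mul_col hp i j)
          (one_sub_projector_mulVec_ne_zero (w := p.C i j) ?_ ?_)
        · rw [row_dot_col hp, if_neg hj]
        · rw [row_dot_col hp, if_pos rfl]
          exact hs.1 i j
      · rw [htβ]
        fin_cases ν <;> simp [RiemannScheme.shift, hαβ.symm] <;> ring
  choose B C hCB hBC using dec
  refine ⟨⟨B, C⟩, hp, ⟨hCB, ?_⟩, hc, ?_⟩
  · have : Decomposition.residueInfty ⟨B, C⟩ = p.residueInfty := by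
      have hsum : ∀ X : Fin 2 → Matrix (Fin 3) (Fin 3) ℂ, ∑ i, X i = X α + X β := by
        intro X
        rw [Fin.sum_univ_two]
        fin_cases α <;> fin_cases β <;> simp at hαβ ⊢
        exact add_comm _ _
      simp only [Decomposition.residueInfty, Decomposition.residue, hBC]
      rw [hsum, hsum, hrel.2.1]
      rfl
    rw [this]
    exact hp.2
  · have : Decomposition.residue ⟨B, C⟩ = A' := funext hBC
    rw [this]
    exact hrel

end

end SchlesingerA2

end

/-! ### Invertibility and well-definedness on gauge classes; the exchange of eigenvectors. -/

noncomputable section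

namespace SchlesingerA2

open Matrix

section
variable {s : RiemannScheme} {p q : Decomposition}

/-! ### Inverse of a Schlesinger transformation -/

lemma eq_of_ne_of_regular (hs : s.Regular) {i j k : Fin 2} (h : s.θ i j = s.θ i k) : j = k := by
  by_contra hne
  have := hs.2 i
  fin_cases j <;> fin_cases k <;> simp at hne h
  · exact this h
  · exact this h.symm

/-- Eigenspaces for the nonzero indices are lines: C v is an eigenvector of a diagonal matrix with
distinct entries, hence a multiple of a basis vector, and B brings it back to v up to the factor θ.
-/
lemma eq_smul_col (hs : s.Regular) (hp : p.IsOver s) {i j : Fin 2} {v : Fin 3 → ℂ}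
    (h : p.residue i *ᵥ v = s.θ i j • v) : ∃ c : ℂ, v = c • (p.B i).col j := by
  set y := p.C i *ᵥ v with hy
  have hB : p.B i *ᵥ y = s.θ i j • v := by rw [hy, mulVec_mulVec, ← h]; rfl
  have hD : diagonal (s.θ i) *ᵥ y = s.θ i j • y := by
    rw [← hp.1 i, ← mulVec_mulVec, hB, mulVec_smul]
  have hy0 : ∀ k, k ≠ j → y k = 0 := by
    intro k hk
    have := congrFun hD k
    rw [mulVec_diagonal, Pi.smul_apply, smul_eq_mul] at this
    by_contra h0
    exact hk (eq_of_ne_of_regular hs (mul_right_cancel₀ h0 this))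
  refine ⟨(s.θ i j)⁻¹ * y j, ?_⟩
  have hB' : p.B i *ᵥ y = y j • (p.B i).col j := by
    ext l
    rw [mulVec, dotProduct, Finset.sum_eq_single j]
    · simp [mul_comm]
    · intro k _ hk
      rw [hy0 k hk, mul_zero]
    · simp
  rw [mul_smul, ← hB', hB, smul_smul, inv_mul_cancel₀ (hs.1 i j), one_smul]

lemma eq_smul_row (hs : s.Regular) (hp : p.IsOver s) {i j : Fin 2} {v : Fin 3 → ℂ}
    (h : v ᵥ* p.residue i = s.θ i j • v) : ∃ c : ℂ, v = c • p.C i j := by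
  set y := v ᵥ* p.B i with hy
  have hB : y ᵥ* p.C i = s.θ i j • v := by rw [hy, vecMul_vecMul, ← h]; rfl
  have hD : y ᵥ* diagonal (s.θ i) = s.θ i j • y := by
    rw [← hp.1 i, ← vecMul_vecMul, hB, smul_vecMul]
  have hy0 : ∀ k, k ≠ j → y k = 0 := by
    intro k hk
    have := congrFun hD k
    rw [vecMul_diagonal, Pi.smul_apply, smul_eq_mul, mul_comm] at this
    by_contra h0
    exact hk (eq_of_ne_of_regular hs (mul_right_cancel₀ h0 this))
  refine ⟨(s.θ i j)⁻¹ * y j, ?_⟩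
  have hB' : y ᵥ* p.C i = y j • p.C i j := by
    ext l
    rw [vecMul, dotProduct, Finset.sum_eq_single j]
    · simp
    · intro k _ hk
      rw [hy0 k hk, zero_mul]
    · simp
  rw [mul_smul, ← hB', hB, smul_smul, inv_mul_cancel₀ (hs.1 i j), one_smul]

lemma RiemannScheme.eq_of {s s' : RiemannScheme} (h : ∀ i j, s.θ i j = s'.θ i j)
    (h' : ∀ j, s.κ j = s'.κ j) : s = s' := by
  obtain ⟨θ, κ, _⟩ := s
  obtain ⟨θ', κ', _⟩ := s'
  obtain rfl : θ = θ' := by funext i j; exact h i j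
  obtain rfl : κ = κ' := funext h'
  rfl

lemma shift_shift (s : RiemannScheme) (α β μ ν : Fin 2) :
    (s.shift α β μ ν).shift β α ν μ = s := by
  refine RiemannScheme.eq_of (fun i j => ?_) (fun j => rfl)
  simp only [RiemannScheme.shift]
  ring

lemma shift_θ_source (s : RiemannScheme) {α β : Fin 2} (hαβ : α ≠ β) (μ ν : Fin 2) :
    (s.shift α β μ ν).θ α μ = s.θ α μ - 1 := by
  simp [RiemannScheme.shift, hαβ]

lemma shift_θ_target (s : RiemannScheme) {α β : Fin 2} (hαβ : α ≠ β) (μ ν : Fin 2) :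
    (s.shift α β μ ν).θ β ν = s.θ β ν + 1 := by
  simp [RiemannScheme.shift, hαβ.symm]

/-- The inverse of an elementary Schlesinger transformation is again elementary. -/
lemma schlesinger_graph_symm {α β : Fin 2} (hαβ : α ≠ β) (μ ν : Fin 2) (hs : s.Regular)
    (hs' : (s.shift α β μ ν).Regular) (h : (schlesinger α β μ ν).graph s p q) :
    (schlesinger β α ν μ).graph (s.shift α β μ ν) q p := by
  rw [schlesinger_graph_iff hαβ] at h
  rw [schlesinger_graph_iff hαβ.symm, shift_shift]
  obtain ⟨hp, hq, hc, hrel⟩ := h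
  have hN := projector_mul_self hc
  have h1 := projector_mul_residue (α := α) (β := β) (μ := μ) (ν := ν) hp
  have h2 := residue_mul_projector (α := α) (β := β) (μ := μ) (ν := ν) hp
  have hcomm := hrel.intertwine hN h1 h2
  set b := (p.B β).col ν with hb
  set c := p.C α μ with hcdef
  have hNb : projector α β μ ν p *ᵥ b = b := by
    rw [projector, smul_mulVec, vecMulVec_mulVec, ← hb, ← hcdef]
    ext k
    simp
    field_simp
  have hcN : c ᵥ* projector α β μ ν p = c := by
    rw [projector, vecMul_smul, vecMul_vecMulVec, ← hb, ← hcdef, smul_smul, inv_mul_cancel₀ hc,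
      one_smul]
  -- The vectors b and c defining the projector become eigenvectors of the new residues at the
  -- opposite poles, with the shifted indices. So up to scalars the inverse uses the same two
  -- vectors, and its projector is the same.
  obtain ⟨k, hk⟩ : ∃ k : ℂ, b = k • (q.B α).col μ := by
    refine eq_smul_col hs' hq ?_
    rw [shift_θ_source s hαβ]
    calc q.residue α *ᵥ b = (q.residue α * projector α β μ ν p) *ᵥ b := by
          rw [← mulVec_mulVec, hNb]
      _ = _ := by rw [hrel.1, smul_mulVec, hNb]
  obtain ⟨l, hl⟩ : ∃ l : ℂ, c = l • q.C β ν := by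
    refine eq_smul_row hs' hq ?_
    rw [shift_θ_target s hαβ]
    have e : projector α β μ ν p * q.residue β = (s.θ β ν + 1) • projector α β μ ν p := by
      rw [hrel.eq.1]
      generalize projector α β μ ν p = N at *
      have e1 : N * (1 - N) = 0 := by rw [Matrix.mul_sub, Matrix.mul_one, hN, sub_self]
      rw [Matrix.mul_sub, Matrix.mul_add, ← Matrix.mul_assoc, e1, Matrix.zero_mul, Matrix.add_mul,
        Matrix.mul_add, ← Matrix.mul_assoc N, h1, h2, Matrix.mul_smul, Matrix.mul_smul,
        Matrix.smul_mul, hN]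
      module
    calc c ᵥ* q.residue β = c ᵥ* (projector α β μ ν p * q.residue β) := by
          rw [← vecMul_vecMul, hcN]
      _ = _ := by rw [e, vecMul_smul, hcN]
  have hcb : c ⬝ᵥ b = l * k * (q.C β ν ⬝ᵥ (q.B α).col μ) := by
    rw [hk, hl, smul_dotProduct, dotProduct_smul, smul_eq_mul, smul_eq_mul, mul_assoc]
  have hlk : l * k ≠ 0 := by
    intro h0
    rw [hcb, h0, zero_mul] at hc
    exact hc rfl
  have hqc : q.C β ν ⬝ᵥ (q.B α).col μ ≠ 0 := by
    intro h0
    rw [hcb, h0, mul_zero] at hc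
    exact hc rfl
  have hNN : projector β α ν μ q = projector α β μ ν p := by
    rw [projector, projector, ← hb, ← hcdef, hcb, hk, hl, smul_vecMulVec, vecMulVec_smul, smul_smul,
      smul_smul]
    congr 1
    have hl0 := left_ne_zero_of_mul hlk
    have hk0 := right_ne_zero_of_mul hlk
    field_simp
  refine ⟨hq, hp, hqc, ?_, ?_, ?_⟩
  · rw [hNN, shift_θ_target s hαβ, h2, add_sub_cancel_right]
  · rw [add_comm, ← hrel.2.1, add_comm]
  · rw [hNN, hcomm]

/-! ### Transformations act on gauge equivalence classes -/

/-- Over `s`, the transformation is a map on gauge equivalence classes. -/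
def Transformation.Functional (T : Transformation) (s : RiemannScheme) : Prop :=
  ∀ p p' q q', GaugeEquivalent p p' → T.graph s p q → T.graph s p' q' → GaugeEquivalent q q'

lemma Transformation.Functional.comp {S T : Transformation} {s : RiemannScheme}
    (hT : T.Functional s) (hS : S.Functional (T.target s)) : (S.comp T).Functional s := by
  rintro p p' r r' h ⟨q, h1, h2⟩ ⟨q', h1', h2'⟩
  exact hS q q' r r' (hT p p' q q' h h1 h1') h2 h2'

lemma projector_gauge {α β μ ν : Fin 2} {p p' : Decomposition} {P : GL (Fin 3) ℂ}
    {D : Fin 2 → Fin 2 → ℂˣ} (h : ∀ i,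
    p'.B i = (P : Matrix (Fin 3) (Fin 3) ℂ) * p.B i * Matrix.diagonal (fun j => (D i j : ℂ)) ∧
    p'.C i = Matrix.diagonal (fun j => ((D i j)⁻¹ : ℂ)) * p.C i *
      ((P⁻¹ : GL (Fin 3) ℂ) : Matrix (Fin 3) (Fin 3) ℂ)) :
    projector α β μ ν p' * (P : Matrix (Fin 3) (Fin 3) ℂ) =
      (P : Matrix (Fin 3) (Fin 3) ℂ) * projector α β μ ν p := by
  have hP : ((P⁻¹ : GL (Fin 3) ℂ) : Matrix (Fin 3) (Fin 3) ℂ) * (P : Matrix (Fin 3) (Fin 3) ℂ) = 1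
      :=
    Units.inv_mul P
  have hb : (p'.B β).col ν = (D β ν : ℂ) • ((P : Matrix (Fin 3) (Fin 3) ℂ) *ᵥ (p.B β).col ν) := by
    rw [(h β).1]
    ext k
    change ((P : Matrix (Fin 3) (Fin 3) ℂ) * p.B β * diagonal fun j => (D β j : ℂ)) k ν = _
    rw [mul_diagonal, mul_comm]
    rfl
  have hc : p'.C α μ ᵥ* (P : Matrix (Fin 3) (Fin 3) ℂ) = ((D α μ : ℂ)⁻¹) • p.C α μ := by
    rw [(h α).2, ← Matrix.mul_apply_eq_vecMul, Matrix.mul_assoc, hP, Matrix.mul_one]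
    ext k
    simp [diagonal_mul]
  have hcb : p'.C α μ ⬝ᵥ (p'.B β).col ν =
      (D β ν : ℂ) * (D α μ : ℂ)⁻¹ * (p.C α μ ⬝ᵥ (p.B β).col ν) := by
    rw [hb, dotProduct_smul, dotProduct_mulVec, hc, smul_dotProduct, smul_eq_mul, smul_eq_mul,
      mul_assoc]
  rw [projector, Matrix.smul_mul, vecMulVec_mul, hc, hcb, hb, projector, Matrix.mul_smul,
    mul_vecMulVec, smul_vecMulVec, vecMulVec_smul, smul_smul, smul_smul]
  congr 1
  have := (D β ν).ne_zero
  have := (D α μ).ne_zero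
  rw [mul_inv, mul_inv, inv_inv]
  field_simp

/-- The new residues are expressions in the projector and the old residues, all of which are
conjugated by the same matrix P; conjugate residues give gauge equivalent decompositions. -/
lemma functional_schlesinger {α β : Fin 2} (hαβ : α ≠ β) (μ ν : Fin 2)
    (hs' : (s.shift α β μ ν).Regular) : (schlesinger α β μ ν).Functional s := by
  intro p p' q q' hpp h h'
  rw [schlesinger_graph_iff hαβ] at h h'
  obtain ⟨hp, hq, hc, hrel⟩ := h
  obtain ⟨hp', hq', hc', hrel'⟩ := h'
  obtain ⟨P, D, hD⟩ := hpp
  have hN := projector_gauge (α := α) (β := β) (μ := μ) (ν := ν) hD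
  have hres : ∀ i, p'.residue i * (P : Matrix (Fin 3) (Fin 3) ℂ) =
      (P : Matrix (Fin 3) (Fin 3) ℂ) * p.residue i := by
    intro i
    have hDD : diagonal (fun j => (D i j : ℂ)) * diagonal (fun j => ((D i j)⁻¹ : ℂ)) = 1 := by
      rw [diagonal_mul_diagonal]
      simp
    have hP : ((P⁻¹ : GL (Fin 3) ℂ) : Matrix (Fin 3) (Fin 3) ℂ) *
      (P : Matrix (Fin 3) (Fin 3) ℂ) = 1 := Units.inv_mul P
    rw [Decomposition.residue, Decomposition.residue, (hD i).1, (hD i).2]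
    calc _ = (P : Matrix (Fin 3) (Fin 3) ℂ) * p.B i * (diagonal (fun j => (D i j : ℂ)) *
        diagonal (fun j => ((D i j)⁻¹ : ℂ))) * p.C i *
        (((P⁻¹ : GL (Fin 3) ℂ) : Matrix (Fin 3) (Fin 3) ℂ) * (P : Matrix (Fin 3) (Fin 3) ℂ)) := by
          simp only [Matrix.mul_assoc]
      _ = _ := by rw [hDD, hP, Matrix.mul_one, Matrix.mul_one, Matrix.mul_assoc]
  generalize projector α β μ ν p = N at *
  generalize projector α β μ ν p' = N' at *
  generalize hQ : (P : Matrix (Fin 3) (Fin 3) ℂ) = Q at hN hres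
  have key : q'.residue β * Q = Q * q.residue β ∧ q'.residue α * Q = Q * q.residue α := by
    have e : ((1 - N') * p'.residue β + (p'.residue α + p'.residue β) * N' - (s.θ α μ - 1) • N') * Q
        = Q * ((1 - N) * p.residue β + (p.residue α + p.residue β) * N - (s.θ α μ - 1) • N) := by
      simp only [Matrix.sub_mul, Matrix.add_mul, Matrix.mul_sub, Matrix.mul_add, Matrix.one_mul,
        Matrix.smul_mul, Matrix.mul_smul, Matrix.mul_assoc, hN, hres]
      simp only [← Matrix.mul_assoc, hN, hres]
    rw [hrel'.eq.1, hrel.eq.1, hrel'.eq.2, hrel.eq.2]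
    refine ⟨e, ?_⟩
    rw [Matrix.sub_mul, e, Matrix.add_mul, hres, hres]
    generalize (1 - N) * p.residue β + (p.residue α + p.residue β) * N - (s.θ α μ - 1) • N = Z
    rw [Matrix.mul_sub, Matrix.mul_add]
  refine gaugeEquivalent_of_residue hs' hq hq' P fun i => ?_
  rw [hQ]
  have hi : i = α ∨ i = β := by
    fin_cases α <;> fin_cases β <;> fin_cases i <;> simp at hαβ ⊢
  rcases hi with rfl | rfl
  · exact key.2
  · exact key.1

/-! ### The exchange of eigenvectors -/

/-- The eigenvectors of A₁ give a resolution of the identity into three rank-one projectors.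
Subtracting θ_1^1 times it removes the first one from A₁, introduces the kernel one with coefficient
-θ_1^1, and lowers the second coefficient to θ_1^2 - θ_1^1. -/
lemma residue_exchange_zero (hs : s.Regular) (hp : p.IsOver s) :
    (p.exchange s).residue 0 = p.residue 0 - s.θ 0 0 • (1 : Matrix (Fin 3) (Fin 3) ℂ) := by
  set P : Matrix (Fin 3) (Fin 3) ℂ :=
    of fun k => ![(p.B 0).col 0 k, (p.B 0).col 1 k, p.kernelVec 0 k] with hP
  set Q : Matrix (Fin 3) (Fin 3) ℂ := of ![(s.θ 0 0)⁻¹ • p.C 0 0, (s.θ 0 1)⁻¹ • p.C 0 1,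
    (s.θ 0 0 * s.θ 0 1)⁻¹ • p.cokernelVec 0] with hQ
  have h0 := hs.1 0 0
  have h1 := hs.1 0 1
  have hcol : ∀ j, P.col j = ![(p.B 0).col 0, (p.B 0).col 1, p.kernelVec 0] j := by
    intro j
    ext k
    fin_cases j <;> rfl
  have hQP : Q * P = 1 := by
    ext i j
    rw [Matrix.mul_apply']
    change Q i ⬝ᵥ P.col j = _
    have hrow : Q i = ![(s.θ 0 0)⁻¹ • p.C 0 0, (s.θ 0 1)⁻¹ • p.C 0 1,
      (s.θ 0 0 * s.θ 0 1)⁻¹ • p.cokernelVec 0] i := rfl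
    rw [hcol, hrow]
    have r := row_dot_col hp 0
    have kk := kernelVec_dot_cokernelVec hp 0
    rw [dotProduct_comm] at kk
    fin_cases i <;> fin_cases j <;>
      simp [r, row_dot_kernelVec, cokernelVec_dot_col, kk, h0, h1]
    field_simp
  have hPQ : P * Q = 1 := mul_eq_one_comm.1 hQP
  ext i j
  have e := congrFun (congrFun hPQ i) j
  simp only [Matrix.mul_apply, Fin.sum_univ_three] at e
  simp only [Decomposition.residue, Decomposition.exchange, Matrix.mul_apply, Fin.sum_univ_two,
    Matrix.sub_apply, Matrix.smul_apply]
  have hk : crossProduct (p.C 0 0) (p.C 0 1) = p.kernelVec 0 := rfl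
  have hck : crossProduct ((p.B 0).col 0) ((p.B 0).col 1) = p.cokernelVec 0 := rfl
  rw [hk, hck, kernelVec_dot_cokernelVec hp, ← e]
  simp [hP, hQ]
  field_simp
  ring

lemma residue_exchange_one : (p.exchange s).residue 1 = p.residue 1 := rfl

lemma isOver_exchange (hs : s.Regular) (hp : p.IsOver s) : (p.exchange s).IsOver s.exchange := by
  have h0 := hs.1 0 0
  have h1 := hs.1 0 1
  refine ⟨fun i => ?_, ?_⟩
  · fin_cases i
    · ext j k
      have r := row_dot_col hp 0
      have kk := kernelVec_dot_cokernelVec hp 0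
      have hk : crossProduct (p.C 0 0) (p.C 0 1) = p.kernelVec 0 := rfl
      have hck : crossProduct ((p.B 0).col 0) ((p.B 0).col 1) = p.cokernelVec 0 := rfl
      have c0 : (of fun k => ![p.kernelVec 0 k, p.B 0 k 1]).col 0 = p.kernelVec 0 := rfl
      have c1 : (of fun k => ![p.kernelVec 0 k, p.B 0 k 1]).col 1 = (p.B 0).col 1 := rfl
      have d0 : ∀ u v : Fin 3 → ℂ, (of ![u, v] : Matrix (Fin 2) (Fin 3) ℂ) 0 = u := fun _ _ => rfl
      have d1 : ∀ u v : Fin 3 → ℂ, (of ![u, v] : Matrix (Fin 2) (Fin 3) ℂ) 1 = v := fun _ _ => rfl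
      rw [Matrix.mul_apply']
      change (p.exchange s).C 0 j ⬝ᵥ ((p.exchange s).B 0).col k = _
      simp only [Decomposition.exchange, hk, hck, kk]
      rw [dotProduct_comm] at kk
      fin_cases j <;> fin_cases k <;>
        simp [c0, c1, d0, d1, r, row_dot_kernelVec, cokernelVec_dot_col, kk, h0, h1,
            RiemannScheme.exchange]
    · exact hp.1 1
  · have : (p.exchange s).residueInfty =
        p.residueInfty + s.θ 0 0 • (1 : Matrix (Fin 3) (Fin 3) ℂ) := by
      simp only [Decomposition.residueInfty, Fin.sum_univ_two]
      rw [residue_exchange_zero hs hp, residue_exchange_one]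
      abel
    rw [this]
    have hcp := hp.2
    refine Polynomial.funext fun z => ?_
    have e := congrArg (Polynomial.eval (z - s.θ 0 0)) hcp
    rw [Matrix.eval_charpoly] at e ⊢
    have : scalar (Fin 3) z - (p.residueInfty + s.θ 0 0 • (1 : Matrix (Fin 3) (Fin 3) ℂ)) =
        scalar (Fin 3) (z - s.θ 0 0) - p.residueInfty := by
      rw [map_sub, smul_one_eq_diagonal, ← scalar_apply]
      abel
    rw [this, e]
    simp only [Polynomial.eval_prod, Polynomial.eval_sub, Polynomial.eval_X, Polynomial.eval_C,
      RiemannScheme.exchange]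
    refine Finset.prod_congr rfl fun j _ => ?_
    ring

lemma functional_exchange13 (hs : s.Regular) (hs' : s.exchange.Regular) :
    exchange13.Functional s := by
  rintro p p' q q' h ⟨hp, -, -, rfl⟩ ⟨hp', -, -, rfl⟩
  obtain ⟨P, hP⟩ := h.residue
  refine gaugeEquivalent_of_residue hs' (isOver_exchange hs hp) (isOver_exchange hs hp') P ?_
  intro i
  fin_cases i
  · simp only [Fin.zero_eta]
    rw [residue_exchange_zero hs hp, residue_exchange_zero hs hp', Matrix.sub_mul, hP,
      Matrix.mul_sub]
    simp
  · exact hP 1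

end

end SchlesingerA2

end

/-! ### Normal forms: the coordinates determine the gauge class and are computed from eigenvectors.
-/

noncomputable section

namespace SchlesingerA2

open Matrix

section
variable {s : RiemannScheme} {p q : Decomposition}

/-! ### Normal forms -/

lemma normalForm_C_mul_B (s : RiemannScheme) (x y α β : ℂ) (i : Fin 2) :
    (normalForm s x y α β).C i * (normalForm s x y α β).B i = diagonal (s.θ i) := by
  ext j k
  fin_cases i <;> fin_cases j <;> fin_cases k <;>
    simp [normalForm, Matrix.mul_apply, Fin.sum_univ_three]
  ring

lemma normalForm_residue_zero (s : RiemannScheme) (x y α β : ℂ) :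
    (normalForm s x y α β).residue 0 = !![s.θ 0 0, 0, α; 0, s.θ 0 1, β; 0, 0, 0] := by
  ext j k
  fin_cases j <;> fin_cases k <;>
    simp [normalForm, Decomposition.residue, Matrix.mul_apply, Fin.sum_univ_two]

lemma normalForm_residue_one (s : RiemannScheme) (x y α β : ℂ) :
    (normalForm s x y α β).residue 1 =
      !![-y, y + s.θ 1 1, 0; -y, y + s.θ 1 1, 0;
        x - y - s.θ 1 0, s.θ 1 1 - (x - y), s.θ 1 0] := by
  ext j k
  fin_cases j <;> fin_cases k <;>
    simp [normalForm, Decomposition.residue, Matrix.mul_apply, Fin.sum_univ_two] <;> ring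

/-- The sum of the residues of a normal form. -/
lemma normalForm_residue_add (s : RiemannScheme) (x y α β : ℂ) :
    (normalForm s x y α β).residue 0 + (normalForm s x y α β).residue 1 =
      !![s.θ 0 0 - y, y + s.θ 1 1, α; -y, s.θ 0 1 + y + s.θ 1 1, β;
        x - y - s.θ 1 0, s.θ 1 1 - (x - y), s.θ 1 0] := by
  rw [normalForm_residue_zero, normalForm_residue_one]
  ext j k
  fin_cases j <;> fin_cases k <;> simp <;> ring

lemma charpoly_neg_iff {M : Matrix (Fin 3) (Fin 3) ℂ} {k : Fin 3 → ℂ} :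
    (-M).charpoly = ∏ j, (Polynomial.X - Polynomial.C (k j)) ↔
      ∀ z, (M - (-z) • (1 : Matrix (Fin 3) (Fin 3) ℂ)).det = (z - k 0) * (z - k 1) * (z - k 2) := by
  have e : ∀ z, Polynomial.eval z (-M).charpoly =
      (M - (-z) • (1 : Matrix (Fin 3) (Fin 3) ℂ)).det := by
    intro z
    rw [Matrix.eval_charpoly]
    congr 1
    rw [sub_neg_eq_add, neg_smul, sub_neg_eq_add, smul_one_eq_diagonal, ← scalar_apply, add_comm]
  have heval : ∀ z, Polynomial.eval z (∏ j, (Polynomial.X - Polynomial.C (k j))) =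
      (z - k 0) * (z - k 1) * (z - k 2) := by
    intro z
    simp [Fin.prod_univ_three]
  constructor
  · intro h z
    rw [← e, h, heval]
  · intro h
    refine Polynomial.funext fun z => ?_
    rw [e, heval, h]

/-- A characteristic polynomial is determined by the trace and two values. -/
lemma charpoly_neg_of_two_values {M : Matrix (Fin 3) (Fin 3) ℂ} {k : Fin 3 → ℂ} {u v : ℂ}
    (huv : u ≠ v) (ht : M.trace = -(k 0 + k 1 + k 2))
    (hu : (M - (-u) • (1 : Matrix (Fin 3) (Fin 3) ℂ)).det = (u - k 0) * (u - k 1) * (u - k 2))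
    (hv : (M - (-v) • (1 : Matrix (Fin 3) (Fin 3) ℂ)).det = (v - k 0) * (v - k 1) * (v - k 2)) :
    (-M).charpoly = ∏ j, (Polynomial.X - Polynomial.C (k j)) := by
  rw [charpoly_neg_iff]
  intro z
  rw [det_sub_smul_one, ht] at hu hv ⊢
  apply mul_left_cancel₀ (sub_ne_zero.2 huv)
  linear_combination (z - v) * hu + (u - z) * hv

lemma fuchs_eq (s : RiemannScheme) :
    s.θ 0 0 + s.θ 0 1 + (s.θ 1 0 + s.θ 1 1) + (s.κ 0 + s.κ 1 + s.κ 2) = 0 := by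
  have := s.fuchs
  simpa [Fin.sum_univ_two, Fin.sum_univ_three] using this

/-- The product `∏ (z - b_j)` over `j ≤ 3`. -/
def cubic (s : RiemannScheme) (z : ℂ) : ℂ :=
  (z - (s.θ 0 1 + s.κ 0)) * (z - (s.θ 0 1 + s.κ 1)) * (z - (s.θ 0 1 + s.κ 2))

lemma residueInfty_eq (p : Decomposition) :
    p.residueInfty = -(p.residue 0 + p.residue 1) := by
  rw [Decomposition.residueInfty, Fin.sum_univ_two]

/-- The two equations that determine the last column of the first residue. -/
lemma normalForm_isOver_iff {x y α β a b : ℂ} (h5 : s.θ 1 1 - s.θ 1 0 ≠ 0)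
    (h7 : s.θ 0 0 - s.θ 0 1 ≠ 0) (hab : a + b ≠ 0)
    (hx : x - y - s.θ 1 0 =
      (s.θ 1 1 - s.θ 1 0) * (a + (s.θ 0 0 - s.θ 0 1)) / (s.θ 0 0 - s.θ 0 1))
    (hy : y = (a + (s.θ 0 0 - s.θ 0 1)) * (b - s.θ 1 1) / (s.θ 0 0 - s.θ 0 1)) :
    (normalForm s x y α β).IsOver s ↔
      cubic s (-b) = (a + b) * ((s.θ 1 1 - s.θ 1 0) * β -
        (b - s.θ 1 1) * (b - s.θ 1 0 + s.θ 0 1)) ∧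
      cubic s a = (a + b) * ((a + (s.θ 0 0 - s.θ 0 1)) * (a + s.θ 1 0 - s.θ 0 1) -
        (s.θ 1 1 - s.θ 1 0) * (α - β) * (a + (s.θ 0 0 - s.θ 0 1)) / (s.θ 0 0 - s.θ 0 1)) := by
  have hx' : x - y = s.θ 1 0 +
      (s.θ 1 1 - s.θ 1 0) * (a + (s.θ 0 0 - s.θ 0 1)) / (s.θ 0 0 - s.θ 0 1) := by
    rw [← hx]; ring
  have hF := fuchs_eq s
  have hκ : s.κ 2 = -(s.θ 0 0 + s.θ 0 1 + (s.θ 1 0 + s.θ 1 1) + s.κ 0 + s.κ 1) := by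
    linear_combination hF
  have htr : ((normalForm s x y α β).residue 0 + (normalForm s x y α β).residue 1).trace =
      -(s.κ 0 + s.κ 1 + s.κ 2) := by
    rw [normalForm_residue_add, trace_fin_three]
    simp
    linear_combination hF
  -- At z = -g - θ_1^2, and likewise at z = f - θ_1^2, the determinant acquires the factor f + g and
  -- becomes affine in β, respectively in α - β. This is why f and g are convenient coordinates.
  have eb : ((normalForm s x y α β).residue 0 + (normalForm s x y α β).residue 1 -
      (-(-b - s.θ 0 1)) • (1 : Matrix (Fin 3) (Fin 3) ℂ)).det =
      (a + b) * ((s.θ 1 1 - s.θ 1 0) * β - (b - s.θ 1 1) * (b - s.θ 1 0 + s.θ 0 1)) := by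
    rw [normalForm_residue_add, hx, hx', det_fin_three]
    simp [Matrix.one_apply]
    rw [hy]
    field_simp
    ring
  have ea : ((normalForm s x y α β).residue 0 + (normalForm s x y α β).residue 1 -
      (-(a - s.θ 0 1)) • (1 : Matrix (Fin 3) (Fin 3) ℂ)).det =
      (a + b) * ((a + (s.θ 0 0 - s.θ 0 1)) * (a + s.θ 1 0 - s.θ 0 1) -
        (s.θ 1 1 - s.θ 1 0) * (α - β) * (a + (s.θ 0 0 - s.θ 0 1)) / (s.θ 0 0 - s.θ 0 1)) := by
    rw [normalForm_residue_add, hx, hx', det_fin_three]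
    simp [Matrix.one_apply]
    rw [hy]
    field_simp
    ring
  have c : ∀ z, cubic s z = (z - s.θ 0 1 - s.κ 0) * (z - s.θ 0 1 - s.κ 1) *
      (z - s.θ 0 1 - s.κ 2) := by
    intro z
    rw [cubic]
    ring
  rw [← eb, ← ea, c, c]
  rw [Decomposition.IsOver, residueInfty_eq]
  constructor
  · rintro ⟨-, h⟩
    rw [charpoly_neg_iff] at h
    exact ⟨(h _).symm, (h _).symm⟩
  · rintro ⟨h1, h2⟩
    refine ⟨normalForm_C_mul_B s x y α β, charpoly_neg_of_two_values (u := a - s.θ 0 1)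
      (v := -b - s.θ 0 1) ?_ htr h2.symm h1.symm⟩
    -- The two evaluation points coincide exactly when a + b = 0, which is excluded.
    intro h
    apply hab
    linear_combination h

/-- Solves the definitions of the coordinates for x and y; the nonvanishing of x - y - θ_2^1 becomes
that of f + b₇. -/
lemma hasCoordinates_iff {a b : ℂ} (h7 : s.θ 0 0 - s.θ 0 1 ≠ 0) :
    HasCoordinates s p a b ↔ ∃ x y α β : ℂ, GaugeEquivalent p (normalForm s x y α β) ∧
      s.θ 1 1 - s.θ 1 0 ≠ 0 ∧ a + (s.θ 0 0 - s.θ 0 1) ≠ 0 ∧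
      x - y - s.θ 1 0 =
        (s.θ 1 1 - s.θ 1 0) * (a + (s.θ 0 0 - s.θ 0 1)) / (s.θ 0 0 - s.θ 0 1) ∧
      y = (a + (s.θ 0 0 - s.θ 0 1)) * (b - s.θ 1 1) / (s.θ 0 0 - s.θ 0 1) := by
  refine exists_congr fun x => exists_congr fun y => exists_congr fun α => exists_congr fun β =>
    and_congr_right fun _ => and_congr_right fun h5 => ?_
  constructor
  · rintro ⟨hz, ha, hb⟩
    have e1 : a + (s.θ 0 0 - s.θ 0 1) =
        (s.θ 0 0 - s.θ 0 1) * (x - y - s.θ 1 0) / (s.θ 1 1 - s.θ 1 0) := by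
      rw [ha]; field_simp; ring
    have e2 : b - s.θ 1 1 = (s.θ 1 1 - s.θ 1 0) * y / (x - y - s.θ 1 0) := by
      rw [hb]; field_simp; ring
    refine ⟨?_, ?_, ?_⟩
    · rw [e1]
      exact div_ne_zero (mul_ne_zero h7 hz) h5
    · rw [e1]; field_simp
    · rw [e1, e2]; field_simp
  · rintro ⟨hz, e1, e2⟩
    have hz' : x - y - s.θ 1 0 ≠ 0 := by
      rw [e1]
      exact div_ne_zero (mul_ne_zero h5 hz) h7
    refine ⟨hz', ?_, ?_⟩
    · have : x - y - s.θ 1 1 = (x - y - s.θ 1 0) - (s.θ 1 1 - s.θ 1 0) := by ring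
      rw [this, e1]
      field_simp
      ring
    · have : s.θ 1 1 * (x - s.θ 1 0) - s.θ 1 0 * y =
        (s.θ 1 1 - s.θ 1 0) * y + s.θ 1 1 * (x - y - s.θ 1 0) := by ring
      rw [this, add_div, mul_div_cancel_right₀ _ hz', e1, e2]
      field_simp
      ring

/-- The coordinates determine the system up to gauge equivalence. -/
lemma gaugeEquivalent_of_hasCoordinates {p' : Decomposition} {a b : ℂ} (hs : s.Regular)
    (hp : p.IsOver s) (hp' : p'.IsOver s) (hab : a + b ≠ 0)
    (h : HasCoordinates s p a b) (h' : HasCoordinates s p' a b) : GaugeEquivalent p p' := by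
  have h7 : s.θ 0 0 - s.θ 0 1 ≠ 0 := sub_ne_zero.2 (hs.2 0)
  rw [hasCoordinates_iff h7] at h h'
  obtain ⟨x, y, α, β, hg, h5, ha, hx, hy⟩ := h
  obtain ⟨x', y', α', β', hg', -, -, hx', hy'⟩ := h'
  have o := (normalForm_isOver_iff h5 h7 hab hx hy).1 (hg.isOver hp)
  have o' := (normalForm_isOver_iff h5 h7 hab hx' hy').1 (hg'.isOver hp')
  obtain rfl : y = y' := hy.trans hy'.symm
  obtain rfl : x = x' := by linear_combination hx - hx'
  have e1 := mul_left_cancel₀ hab (o.1.symm.trans o'.1)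
  have e2 := mul_left_cancel₀ hab (o.2.symm.trans o'.2)
  obtain rfl : β = β' := by
    apply mul_left_cancel₀ h5
    linear_combination e1
  obtain rfl : α = α' := by
    apply mul_left_cancel₀ h5
    field_simp at e2
    linear_combination -e2
  exact hg.trans hg'.symm

lemma HasCoordinates.of_gaugeEquivalent {a b : ℂ} (h : HasCoordinates s p a b)
    (hpq : GaugeEquivalent p q) : HasCoordinates s q a b := by
  obtain ⟨x, y, α, β, hg, h⟩ := h
  exact ⟨x, y, α, β, hpq.symm.trans hg, h⟩

/-- Coordinates from eigenvectors. -/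
lemma hasCoordinates_of_eigenvectors {a b y Z : ℂ} {E : Matrix (Fin 3) (Fin 3) ℂ} (hs : s.Regular)
    (hq : q.IsOver s) (hE : E.det ≠ 0) (h1 : q.residue 0 *ᵥ E.col 0 = s.θ 0 0 • E.col 0)
    (h2 : q.residue 0 *ᵥ E.col 1 = s.θ 0 1 • E.col 1)
    (h3 : q.residue 1 *ᵥ E.col 2 = s.θ 1 0 • E.col 2)
    (h4 : q.residue 1 *ᵥ (E.col 0 + E.col 1 + E.col 2) = s.θ 1 1 • (E.col 0 + E.col 1 + E.col 2))
    (h5 : q.residue 1 *ᵥ E.col 0 = -y • E.col 0 - y • E.col 1 + Z • E.col 2)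
    (ha : a + (s.θ 0 0 - s.θ 0 1) ≠ 0)
    (hZ : Z = (s.θ 1 1 - s.θ 1 0) * (a + (s.θ 0 0 - s.θ 0 1)) / (s.θ 0 0 - s.θ 0 1))
    (hy : y = (a + (s.θ 0 0 - s.θ 0 1)) * (b - s.θ 1 1) / (s.θ 0 0 - s.θ 0 1)) :
    HasCoordinates s q a b := by
  have h7 : s.θ 0 0 - s.θ 0 1 ≠ 0 := sub_ne_zero.2 (hs.2 0)
  have h6 : s.θ 1 1 - s.θ 1 0 ≠ 0 := sub_ne_zero.2 (hs.2 1).symm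
  have hu : IsUnit E.det := hE.isUnit
  have hEE := mul_nonsing_inv E hu
  have hEE' := nonsing_inv_mul E hu
  set P : GL (Fin 3) ℂ := ⟨E⁻¹, E, hEE', hEE⟩ with hP
  have colE : ∀ (A X : Matrix (Fin 3) (Fin 3) ℂ), (∀ j, A *ᵥ E.col j = E *ᵥ X.col j) →
      A * E = E * X := by
    intro A X h
    ext i j
    exact congrFun (h j) i
  set R := E⁻¹ * (q.residue 0 * E) with hR
  have hER : q.residue 0 * E = E * R := by rw [hR, ← Matrix.mul_assoc, hEE, Matrix.one_mul]
  have hcol : ∀ (v : Fin 3 → ℂ), E *ᵥ v = v 0 • E.col 0 + v 1 • E.col 1 + v 2 • E.col 2 := by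
    intro v
    ext i
    simp [mulVec, dotProduct, Fin.sum_univ_three, mul_comm]
  have hinj : ∀ v w : Fin 3 → ℂ, E *ᵥ v = E *ᵥ w → v = w := by
    intro v w h
    have := congrArg (fun u => E⁻¹ *ᵥ u) h
    simpa [mulVec_mulVec, hEE'] using this
  have hRcol : ∀ j, E *ᵥ R.col j = q.residue 0 *ᵥ E.col j := by
    intro j
    ext i
    exact (congrFun (congrFun hER i) j).symm
  have r0 : R.col 0 = ![s.θ 0 0, 0, 0] := hinj _ _ (by rw [hRcol, h1, hcol]; simp)
  have r1 : R.col 1 = ![0, s.θ 0 1, 0] := hinj _ _ (by rw [hRcol, h2, hcol]; simp)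
  have htr : R.trace = s.θ 0 0 + s.θ 0 1 := by
    rw [hR, trace_mul_comm, Matrix.mul_assoc, hEE, Matrix.mul_one, trace_residue hq]
  have e00 : R 0 0 = s.θ 0 0 := congrFun r0 0
  have e10 : R 1 0 = 0 := congrFun r0 1
  have e20 : R 2 0 = 0 := congrFun r0 2
  have e01 : R 0 1 = 0 := congrFun r1 0
  have e11 : R 1 1 = s.θ 0 1 := congrFun r1 1
  have e21 : R 2 1 = 0 := congrFun r1 2
  -- In the eigenbasis the first residue has the first two columns of a normal form; the trace
  -- forces the last diagonal entry, and R 0 2 and R 1 2 are the parameters α and β.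
  have e22 : R 2 2 = 0 := by
    rw [trace_fin_three, e00, e11] at htr
    linear_combination htr
  have hr0 : (normalForm s (y + Z + s.θ 1 0) y (R 0 2) (R 1 2)).residue 0 = R := by
    rw [normalForm_residue_zero]
    ext i j
    fin_cases i <;> fin_cases j <;> simp [e00, e10, e20, e01, e11, e21, e22]
  set r := normalForm s (y + Z + s.θ 1 0) y (R 0 2) (R 1 2) with hr
  have hres : ∀ i, q.residue i * E = E * r.residue i := by
    intro i
    fin_cases i
    · simp only [Fin.zero_eta, hr0]
      exact hER
    · refine colE _ _ fun j => ?_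
      rw [hcol]
      have c0 : (r.residue 1).col 0 = ![-y, -y, Z] := by
        rw [hr, normalForm_residue_one]
        ext i; fin_cases i <;> simp; ring
      have c1 : (r.residue 1).col 1 = ![y + s.θ 1 1, y + s.θ 1 1, s.θ 1 1 - (Z + s.θ 1 0)] := by
        rw [hr, normalForm_residue_one]
        ext i; fin_cases i <;> simp; ring
      have c2 : (r.residue 1).col 2 = ![0, 0, s.θ 1 0] := by
        rw [hr, normalForm_residue_one]
        ext i; fin_cases i <;> simp
      -- The second column is obtained by subtraction, since the action on the sum of the columns is
      -- known.
      have h6 : q.residue 1 *ᵥ E.col 1 = s.θ 1 1 • (E.col 0 + E.col 1 + E.col 2) -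
          (-y • E.col 0 - y • E.col 1 + Z • E.col 2) - s.θ 1 0 • E.col 2 := by
        rw [← h4, ← h5, ← h3, mulVec_add, mulVec_add]
        abel
      fin_cases j
      · simp only [Fin.zero_eta, Fin.mk_one, Fin.reduceFinMk, c0]
        rw [h5]
        simp
        module
      · simp only [Fin.zero_eta, Fin.mk_one, Fin.reduceFinMk, c1]
        rw [h6]
        simp
        module
      · simp only [Fin.zero_eta, Fin.mk_one, Fin.reduceFinMk, c2]
        rw [h3]
        simp
  have hres' : ∀ i, r.residue i * E⁻¹ = E⁻¹ * q.residue i := by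
    intro i
    calc r.residue i * E⁻¹ = E⁻¹ * (E * r.residue i) * E⁻¹ := by
          rw [← Matrix.mul_assoc, hEE', Matrix.one_mul]
      _ = E⁻¹ * q.residue i * (E * E⁻¹) := by rw [← hres]; simp only [Matrix.mul_assoc]
      _ = _ := by rw [hEE, Matrix.mul_one]
  have hro : r.IsOver s :=
    ⟨normalForm_C_mul_B s _ _ _ _,
      (charpoly_eq_of_mul_eq P (residueInfty_mul hres')).trans hq.2⟩
  rw [hasCoordinates_iff h7]
  refine ⟨_, _, _, _, gaugeEquivalent_of_residue hs hq hro P hres', h6, ha, ?_, hy⟩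
  rw [← hZ]
  ring

end

end SchlesingerA2

end

/-! ### Explicit eigenvectors of the system transformed by {2 1; 1 1}. -/

noncomputable section

namespace SchlesingerA2

open Matrix

/-! ### Explicit eigenvectors -/

/-- Parameters `b₅`, `b₆`, `b₇`, the index `t = θ_1^2`, the coordinates `f`, `g`, the first
coordinate `h` of the image under the standard map, and `k = ∏ (f - b_j) / ((f + g) (f + b₇))`. -/
structure Accessory where
  b₅ : ℂ
  b₆ : ℂ
  b₇ : ℂ
  t : ℂ
  f : ℂ
  g : ℂ
  h : ℂ
  k : ℂ

namespace Accessory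

variable (c : Accessory)

/-- `y` and `z` are the entries y and x - y - θ_2^1 of the normal form, as functions of f and g. -/
def y : ℂ := (c.f + c.b₇) * (c.g - c.b₆) / c.b₇

def z : ℂ := (c.b₆ - c.b₅) * (c.f + c.b₇) / c.b₇

/-- `β` and `α` solve the two linear equations of `normalForm_isOver_iff`, the values of the cubic
at -g and at f having been replaced by `h` and `k`. -/
def β : ℂ := (c.g - c.b₆) * (c.t - c.h * (c.g - c.b₅) / c.g) / (c.b₆ - c.b₅)

def α : ℂ := c.β + c.b₇ * (c.f + c.b₅ - c.t - c.k) / (c.b₆ - c.b₅)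

/-- The first residue. -/
def A₁ : Matrix (Fin 3) (Fin 3) ℂ := !![c.b₇ + c.t, 0, c.α; 0, c.t, c.β; 0, 0, 0]

/-- The sum of the residues. -/
def M : Matrix (Fin 3) (Fin 3) ℂ :=
  !![c.b₇ + c.t - c.y, c.y + c.b₆, c.α; -c.y, c.t + c.y + c.b₆, c.β;
    c.z, c.b₆ - c.b₅ - c.z, c.b₅]

/-- `n₁` and `n₂` come from the row c_2^1, divided by its pairing y + z with b_{1,1}, so that the
functional `n` takes the value 1 on the first basis vector. -/
def n₁ : ℂ := -1 - c.b₅ * c.b₇ / ((c.f + c.b₇) * (c.g - c.b₅))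

def n₂ : ℂ := c.b₅ * c.b₇ / ((c.f + c.b₇) * (c.g - c.b₅))

/-- The left eigenvector defining the projector. -/
def n (w : Fin 3 → ℂ) : ℂ := w 0 + c.n₁ * w 1 + c.n₂ * w 2

/-- The first residue of the transformed system. -/
def A₁' (w : Fin 3 → ℂ) : Fin 3 → ℂ :=
  c.A₁ *ᵥ w - c.n (c.A₁ *ᵥ w) • ![1, 0, 0] + c.n w • (c.M *ᵥ ![1, 0, 0] - (c.b₅ - 1) • ![1, 0, 0])

/-- The eigenvalue equation of `w₁₁` determines these numbers: the third component gives τ as the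
value of `n`, the second gives `v`, and the definition of `n` then gives `u`. -/
def τ : ℂ := (c.b₇ + c.t + 1) * c.b₇ / ((c.b₆ - c.b₅) * (c.f + c.b₇))

def v : ℂ := -(c.g - c.b₆) * (c.h * (c.g - c.b₅) / c.g + (c.b₇ + 1)) /
  ((c.b₇ + 1) * (c.b₆ - c.b₅))

def u : ℂ := c.τ - c.n₁ * c.v - c.n₂

/-- The parameter y of the normal form of the transformed system. -/
def y' : ℂ := (c.g - c.b₆) * (c.h + (c.b₇ + 1)) / (c.b₇ + 1)

/-- `w₁₁`, `w₁₂`, `w₁₃` are eigenvectors of the transformed first residue, for the eigenvalues θ_1^1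
+ 1, θ_1^2 and 0; the last two lie in the kernel of `n`. -/
def w₁₁ : Fin 3 → ℂ := ![c.u, c.v, 1]

def w₁₂ : Fin 3 → ℂ := ![-c.n₁, 1, 0]

def w₁₃ : Fin 3 → ℂ := ![c.n₁ * c.β / c.t - c.n₂, -c.β / c.t, 1]

/-- Chosen so that (1 + μ, 1, 1) is an eigenvector of the transformed second residue for θ_2^2; the
untransformed eigenvector is (1, 1, 1). -/
def μ : ℂ := (c.b₇ + c.t + c.α + c.n₁ * (c.t + c.β)) / (c.b₆ - c.b₅ + 1)

/-- The left eigenvector of the second transformed residue. -/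
def row : Fin 3 → ℂ := ![0, c.g * (c.b₆ - c.b₅), c.b₅ * (c.g - c.b₆)]

/-- `σ₁` and `σ₂` are chosen so that `row` annihilates w₁₁ + σ₁ w₁₃ and w₁₂ - σ₂ w₁₃. These
combinations are left unaltered by the second projector. -/
def σ₁ : ℂ := c.t * (c.h + (c.b₇ + 1)) / ((c.b₇ + 1) * (c.h - c.t))

def σ₂ : ℂ := c.g * (c.b₆ - c.b₅) * c.t / ((c.g - c.b₆) * (c.g - c.b₅) * (c.h - c.t))

/-- The discriminating denominator of the transformation. -/
def den : ℂ := (c.f + c.b₇) * (c.f + c.b₆ - c.t - c.k) - c.b₅ * c.t +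
  c.b₅ * c.h * (c.g - c.b₆) / c.g - (c.b₆ - c.b₅ + 1) * (c.b₇ + c.t + 1)

/-- The nonvanishing conditions. -/
structure Good : Prop where
  b₇ : c.b₇ ≠ 0
  b₇' : c.b₇ + 1 ≠ 0
  D : c.b₆ - c.b₅ ≠ 0
  D' : c.b₆ - c.b₅ + 1 ≠ 0
  t : c.t ≠ 0
  θ' : c.b₇ + c.t + 1 ≠ 0
  f : c.f + c.b₇ ≠ 0
  g : c.g ≠ 0
  g₅ : c.g - c.b₅ ≠ 0
  g₆ : c.g - c.b₆ ≠ 0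

variable {c}

lemma A₁_mulVec (w : Fin 3 → ℂ) :
    c.A₁ *ᵥ w = ![(c.b₇ + c.t) * w 0 + c.α * w 2, c.t * w 1 + c.β * w 2, 0] := by
  ext i
  fin_cases i <;> simp [A₁, mulVec, dotProduct, Fin.sum_univ_three]

lemma M_mulVec (w : Fin 3 → ℂ) :
    c.M *ᵥ w = ![(c.b₇ + c.t - c.y) * w 0 + (c.y + c.b₆) * w 1 + c.α * w 2,
      -c.y * w 0 + (c.t + c.y + c.b₆) * w 1 + c.β * w 2,
      c.z * w 0 + (c.b₆ - c.b₅ - c.z) * w 1 + c.b₅ * w 2] := by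
  ext i
  fin_cases i <;> simp [M, mulVec, dotProduct, Fin.sum_univ_three]

lemma A₁'_eq (w : Fin 3 → ℂ) :
    c.A₁' w = ![-c.n₁ * (c.t * w 1 + c.β * w 2) + c.n w * (c.b₇ + c.t - c.y - c.b₅ + 1),
      c.t * w 1 + c.β * w 2 - c.n w * c.y, c.n w * c.z] := by
  rw [A₁', A₁_mulVec, M_mulVec]
  generalize c.n w = m
  ext i
  fin_cases i <;> simp [n, -mul_eq_mul_left_iff] <;> ring

lemma n_w₁₁ : c.n c.w₁₁ = c.τ := by
  simp [n, w₁₁, u]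
  ring

lemma n_w₁₂ : c.n c.w₁₂ = 0 := by
  simp [n, w₁₂]

lemma n_w₁₃ : c.n c.w₁₃ = 0 := by
  simp [n, w₁₃]
  ring

lemma n_e : c.n ![1, 0, 0] = 1 := by
  simp [n]

lemma A₁'_e : c.A₁' ![1, 0, 0] = c.M *ᵥ ![1, 0, 0] - (c.b₅ - 1) • ![1, 0, 0] := by
  rw [A₁'_eq, n_e, M_mulVec]
  ext i
  fin_cases i <;> simp
  ring

lemma τ_mul_z (hc : c.Good) : c.τ * c.z = c.b₇ + c.t + 1 := by
  obtain ⟨h1, h2, h3, h4, h5, h6, h7, h8, h9, h10⟩ := hc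
  simp only [τ, z]
  field_simp

lemma v_mul (hc : c.Good) : c.v * (c.b₇ + 1) = c.β - c.y * c.τ := by
  obtain ⟨h1, h2, h3, h4, h5, h6, h7, h8, h9, h10⟩ := hc
  simp only [v, β, y, τ]
  field_simp
  ring

lemma A₁'_w₁₁ (hc : c.Good) : c.A₁' c.w₁₁ = (c.b₇ + c.t + 1) • c.w₁₁ := by
  have hv := v_mul hc
  have hz := τ_mul_z hc
  have hn : c.τ * (c.y + c.b₅ + c.n₁ * c.y) = (c.b₇ + c.t + 1) * c.n₂ := by
    obtain ⟨h1, h2, h3, h4, h5, h6, h7, h8, h9, h10⟩ := hc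
    simp only [τ, y, n₁, n₂]
    field_simp
    ring
  rw [A₁'_eq, n_w₁₁]
  ext i
  fin_cases i <;> simp [w₁₁]
  · simp only [u]
    linear_combination c.n₁ * hv - hn
  · linear_combination -hv
  · exact hz

lemma A₁'_w₁₂ : c.A₁' c.w₁₂ = c.t • c.w₁₂ := by
  rw [A₁'_eq, n_w₁₂]
  ext i
  fin_cases i <;> simp [w₁₂]
  ring

lemma A₁'_w₁₃ (hc : c.Good) : c.A₁' c.w₁₃ = 0 := by
  have := hc.t
  rw [A₁'_eq, n_w₁₃]
  have h0 : c.t * (-c.β / c.t) + c.β = 0 := by field_simp; ring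
  ext i
  fin_cases i <;> simp [w₁₃]
  · right
    linear_combination h0
  · linear_combination h0

lemma A₂'_w₂₂ (hc : c.Good) : c.M *ᵥ ![1 + c.μ, 1, 1] - c.A₁' ![1 + c.μ, 1, 1] =
    c.b₆ • ![1 + c.μ, 1, 1] := by
  have hD := hc.D'
  have hn : c.n ![1 + c.μ, 1, 1] = c.μ := by
    simp [n, n₁, n₂]
    ring
  have hμ : c.μ * (c.b₆ - c.b₅ + 1) = c.b₇ + c.t + c.α + c.n₁ * (c.t + c.β) := by
    rw [μ]; field_simp
  rw [A₁'_eq, M_mulVec, hn]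
  ext i
  fin_cases i <;> simp
  · linear_combination -hμ
  · ring
  · ring

lemma row_A₂' (hc : c.Good) (w : Fin 3 → ℂ) :
    c.row ⬝ᵥ (c.M *ᵥ w - c.A₁' w) = c.b₆ * (c.row ⬝ᵥ w) := by
  obtain ⟨h1, h2, h3, h4, h5, h6, h7, h8, h9, h10⟩ := hc
  rw [A₁'_eq, M_mulVec]
  simp [row, dotProduct, Fin.sum_univ_three]
  simp only [n, n₁, n₂, y, z]
  field_simp
  ring

lemma row_w₁₃ (hc : c.Good) :
    c.row ⬝ᵥ c.w₁₃ = (c.g - c.b₆) * (c.g - c.b₅) * (c.h - c.t) / c.t := by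
  obtain ⟨h1, h2, h3, h4, h5, h6, h7, h8, h9, h10⟩ := hc
  simp [row, w₁₃, dotProduct, Fin.sum_univ_three]
  simp only [β]
  field_simp
  ring

lemma row_w₁₁ (hc : c.Good) : c.row ⬝ᵥ c.w₁₁ =
    -((c.g - c.b₆) * (c.g - c.b₅) * (c.h + (c.b₇ + 1)) / (c.b₇ + 1)) := by
  obtain ⟨h1, h2, h3, h4, h5, h6, h7, h8, h9, h10⟩ := hc
  simp [row, w₁₁, dotProduct, Fin.sum_univ_three]
  simp only [v]
  field_simp
  ring

lemma row_M_e (hc : c.Good) : c.row ⬝ᵥ (c.M *ᵥ ![1, 0, 0]) =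
    -((c.f + c.b₇) * (c.b₆ - c.b₅) * (c.g - c.b₆) * (c.g - c.b₅) / c.b₇) := by
  have := hc.b₇
  rw [M_mulVec]
  simp [row, dotProduct, Fin.sum_univ_three]
  simp only [y, z]
  field_simp
  ring

lemma row_e : c.row ⬝ᵥ ![1, 0, 0] = 0 := by
  simp [row, dotProduct, Fin.sum_univ_three]

/-- The sum of the adjusted eigenvectors. -/
lemma sum_w (c : Accessory) : c.w₁₁ + (1 - c.v) • c.w₁₂ + (c.μ - c.τ) • ![1, 0, 0] =
    ![1 + c.μ, 1, 1] := by
  have : c.n₂ = -1 - c.n₁ := by simp only [n₁, n₂]; ring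
  ext i
  fin_cases i <;> simp [w₁₁, w₁₂, u, this]
  ring

/-- Up to nonzero factors `den` is μ - τ, the scale of the third vector of the new eigenbasis; its
vanishing is the degeneration of that basis. -/
lemma den_eq (hc : c.Good) : (c.μ - c.τ) * (c.b₆ - c.b₅ + 1) =
    c.den * c.b₇ / ((c.b₆ - c.b₅) * (c.f + c.b₇)) := by
  obtain ⟨h1, h2, h3, h4, h5, h6, h7, h8, h9, h10⟩ := hc
  simp only [μ, τ, den, n₁, α, β]
  field_simp
  ring

end Accessory

end SchlesingerA2

end

/-! ### Coordinates of the system after {2 1; 1 1}. -/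

noncomputable section

namespace SchlesingerA2

open Matrix

namespace Accessory

variable {c : Accessory}

/-- The matrix with given columns. -/
def cols (x y z : Fin 3 → ℂ) : Matrix (Fin 3) (Fin 3) ℂ := of fun i => ![x i, y i, z i]

@[simp] lemma cols_col_zero (x y z : Fin 3 → ℂ) : (cols x y z).col 0 = x := rfl

@[simp] lemma cols_col_one (x y z : Fin 3 → ℂ) : (cols x y z).col 1 = y := rfl

@[simp] lemma cols_col_two (x y z : Fin 3 → ℂ) : (cols x y z).col 2 = z := rfl

lemma n₁_eq (c : Accessory) : c.n₁ = -1 - c.n₂ := by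
  simp only [n₁, n₂]

lemma z_n₂ (hc : c.Good) : c.z * c.n₂ = (c.b₆ - c.b₅) * c.b₅ / (c.g - c.b₅) := by
  obtain ⟨h1, h2, h3, h4, h5, h6, h7, h8, h9, h10⟩ := hc
  simp only [z, n₂]
  field_simp

lemma y_n₁ (hc : c.Good) : c.y * (1 + c.n₁) + c.b₅ = c.z * c.n₂ := by
  obtain ⟨h1, h2, h3, h4, h5, h6, h7, h8, h9, h10⟩ := hc
  simp only [z, y, n₁, n₂]
  field_simp
  ring

/-- Since w₁₁ is an eigenvector of the first new residue, this difference is the second new residue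
applied to it. Its second and third components agree, and their common value yields the new
parameter y. -/
lemma M_w₁₁_two (hc : c.Good) : (c.M *ᵥ c.w₁₁ - (c.b₇ + c.t + 1) • c.w₁₁) 2 = -c.y' := by
  have hz := τ_mul_z hc
  have hn := z_n₂ hc
  have e : (c.M *ᵥ c.w₁₁ - (c.b₇ + c.t + 1) • c.w₁₁) 2 =
      c.z * c.n₂ * (c.v - 1) + (c.b₆ - c.b₅) * c.v + c.b₅ := by
    rw [M_mulVec]
    simp [w₁₁, u, n₁_eq c]
    linear_combination hz
  rw [e, hn]
  obtain ⟨h1, h2, h3, h4, h5, h6, h7, h8, h9, h10⟩ := hc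
  simp only [v, y']
  field_simp
  ring

lemma M_w₁₁_one (hc : c.Good) : (c.M *ᵥ c.w₁₁ - (c.b₇ + c.t + 1) • c.w₁₁) 1 = -c.y' := by
  rw [← M_w₁₁_two hc]
  have hz := τ_mul_z hc
  have hv := v_mul hc
  have hn := y_n₁ hc
  have hn' : c.y * c.n₂ = c.b₅ - c.z * c.n₂ := by
    have := n₁_eq c
    linear_combination -hn + c.y * this
  rw [M_mulVec]
  simp [w₁₁, u, n₁_eq c]
  linear_combination -hv - hz + (1 - c.v) * hn'

/-- The first coordinate of the image under `{2 1; 1 1}` enters through this identity. -/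
lemma M_w₁₁_zero (hc : c.Good) {f₁ : ℂ}
    (hf : c.den * (c.f - f₁) = (c.f - c.t - 1) *
      ((c.h + (c.b₇ + 1)) * (c.g - c.b₆) + (c.f + (c.b₇ + 1)) * (c.f + c.b₆)) -
      c.f * (c.f + c.b₇) * c.k) :
    (c.M *ᵥ c.w₁₁ - (c.b₇ + c.t + 1) • c.w₁₁) 0 + c.y' * (1 + c.τ) =
      (c.b₆ - c.b₅ + 1) * (f₁ + (c.b₇ + 1)) / (c.b₇ + 1) * (c.μ - c.τ) := by
  have hd := den_eq hc
  have e : (c.b₆ - c.b₅ + 1) * (f₁ + (c.b₇ + 1)) / (c.b₇ + 1) * (c.μ - c.τ) =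
      (c.den * (c.f + (c.b₇ + 1)) - ((c.f - c.t - 1) *
      ((c.h + (c.b₇ + 1)) * (c.g - c.b₆) + (c.f + (c.b₇ + 1)) * (c.f + c.b₆)) -
      c.f * (c.f + c.b₇) * c.k)) * c.b₇ /
        ((c.b₆ - c.b₅) * (c.f + c.b₇)) / (c.b₇ + 1) := by
    rw [← hf]
    linear_combination (f₁ + (c.b₇ + 1)) / (c.b₇ + 1) * hd
  rw [e, M_mulVec]
  obtain ⟨h1, h2, h3, h4, h5, h6, h7, h8, h9, h10⟩ := hc
  simp [w₁₁]
  simp only [u, v, τ, n₁, n₂, y, α, β, y', den]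
  field_simp
  ring

end Accessory

section
variable {s : RiemannScheme}

/-- The accessory data attached to a Riemann scheme. -/
def RiemannScheme.accessory (s : RiemannScheme) (a b h k : ℂ) : Accessory :=
  ⟨s.θ 1 0, s.θ 1 1, s.θ 0 0 - s.θ 0 1, s.θ 0 1, a, b, h, k⟩

/-- `hh` and `hk` say that the `α` and `β` computed from h and k satisfy the two equations for the
normal form to lie over s. The pairing of c_2^1 with b_{1,1} is y + z, nonzero under `Good`, so the
transformation is defined. -/
lemma exists_system {a b h k : ℂ} (hs : s.Regular) (hs' : (s.shift 1 0 0 0).Regular)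
    (hc : (s.accessory a b h k).Good) (hab : a + b ≠ 0)
    (hh : (a + b) * (h + b) * (b - s.θ 1 0) * (b - s.θ 1 1) = -b * cubic s (-b))
    (hk : cubic s a = (a + b) * (a + (s.θ 0 0 - s.θ 0 1)) * k) :
    ∃ p q, HasCoordinates s p a b ∧ (schlesinger 1 0 0 0).graph s p q ∧
      (∀ w, q.residue 0 *ᵥ w = (s.accessory a b h k).A₁' w) ∧
      q.residue 0 + q.residue 1 = (s.accessory a b h k).M := by
  set c := s.accessory a b h k with hcdef
  have h7 := hc.b₇
  have h5 := hc.D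
  have hg := hc.g
  have hf := hc.f
  have hg5 := hc.g₅
  simp only [hcdef, RiemannScheme.accessory] at h7 h5 hg hf hg5
  have hz : c.z = (s.θ 1 1 - s.θ 1 0) * (a + (s.θ 0 0 - s.θ 0 1)) / (s.θ 0 0 - s.θ 0 1) := rfl
  have hy : c.y = (a + (s.θ 0 0 - s.θ 0 1)) * (b - s.θ 1 1) / (s.θ 0 0 - s.θ 0 1) := rfl
  have hβ : c.β = (b - s.θ 1 1) * (s.θ 0 1 - h * (b - s.θ 1 0) / b) / (s.θ 1 1 - s.θ 1 0) := rfl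
  have hα : c.α = c.β + (s.θ 0 0 - s.θ 0 1) * (a + s.θ 1 0 - s.θ 0 1 - k) /
    (s.θ 1 1 - s.θ 1 0) := rfl
  have hx : c.y + c.z + s.θ 1 0 - c.y - s.θ 1 0 =
      (s.θ 1 1 - s.θ 1 0) * (a + (s.θ 0 0 - s.θ 0 1)) / (s.θ 0 0 - s.θ 0 1) := by
    rw [← hz]; ring
  set p := normalForm s (c.y + c.z + s.θ 1 0) c.y c.α c.β with hpdef
  have hp : p.IsOver s := by
    rw [hpdef, normalForm_isOver_iff h5 h7 hab hx hy]
    constructor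
    · apply mul_left_cancel₀ hg
      rw [hβ]
      field_simp
      linear_combination hh
    · rw [hk, hα]
      field_simp
      ring
  have hpc : HasCoordinates s p a b := by
    rw [hasCoordinates_iff h7]
    exact ⟨_, _, _, _, gaugeEquivalent_refl _, h5, hf, hx, hy⟩
  have hyz : c.y + c.z = (a + (s.θ 0 0 - s.θ 0 1)) * (b - s.θ 1 0) / (s.θ 0 0 - s.θ 0 1) := by
    rw [hy, hz]
    field_simp
    ring
  have hyz0 : c.y + c.z ≠ 0 := by
    rw [hyz]
    exact div_ne_zero (mul_ne_zero hf hg5) h7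
  have hdot : p.C 1 0 ⬝ᵥ (p.B 0).col 0 = c.y + c.z := by
    simp [hpdef, normalForm, dotProduct, Fin.sum_univ_three]
  have hA : p.residue 0 = c.A₁ := by
    rw [hpdef, normalForm_residue_zero, Accessory.A₁]
    congr 2
    simp [hcdef, RiemannScheme.accessory]
  have hM : p.residue 0 + p.residue 1 = c.M := by
    rw [hpdef, normalForm_residue_add, Accessory.M]
    ext i j
    fin_cases i <;> fin_cases j <;> simp [hcdef, RiemannScheme.accessory] <;> ring
  have hN : ∀ w, projector 1 0 0 0 p *ᵥ w = c.n w • ![1, 0, 0] := by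
    intro w
    rw [projector, hdot, smul_mulVec, vecMulVec_mulVec]
    have e1 : (p.B 0).col 0 = ![1, 0, 0] := by
      ext i; fin_cases i <;> simp [hpdef, normalForm]
    have e2 : (c.y + c.z)⁻¹ * (p.C 1 0 ⬝ᵥ w) = c.n w := by
      have n2 : c.n₂ = s.θ 1 0 / (c.y + c.z) := by
        rw [hyz, Accessory.n₂]
        simp only [hcdef, RiemannScheme.accessory]
        field_simp
      rw [Accessory.n, c.n₁_eq, n2]
      simp [hpdef, normalForm, dotProduct, Fin.sum_univ_three]
      field_simp
      ring
    rw [e1, ← e2]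
    simp [smul_smul]
  obtain ⟨q, hq⟩ := exists_schlesinger (α := 1) (β := 0) (by decide) 0 0 hs hs' hp
    (by rw [hdot]; exact hyz0)
  refine ⟨p, q, hpc, hq, ?_, ?_⟩
  · intro w
    have := ((schlesinger_graph_iff (by decide) 0 0).1 hq).2.2.2.eq.1
    rw [this, add_comm (p.residue 1), hM, hA, sub_mulVec, add_mulVec, smul_mulVec,
      ← mulVec_mulVec, ← mulVec_mulVec, sub_mulVec, one_mulVec, hN, hN, mulVec_smul,
      Accessory.A₁']
    have : c.b₅ = s.θ 1 0 := rfl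
    rw [this]
    module
  · have := ((schlesinger_graph_iff (by decide) 0 0).1 hq).2.2.2.2.1
    rw [← hM, add_comm, this, add_comm]

/-- The frame is w₁₁, (1 - v) w₁₂, (μ - τ) e₁, where e₁ has become an eigenvector at the second
pole. The scales are those for which the sum is (1 + μ, 1, 1). `v ≠ 1` and `den ≠ 0` make it a
basis, and applying the second residue to w₁₁ gives the coordinates. -/
lemma hasCoordinates_schlesinger {a b h k f₁ g₁ : ℂ} {q : Decomposition}
    (hs' : (s.shift 1 0 0 0).Regular) (hc : (s.accessory a b h k).Good)
    (hq : q.IsOver (s.shift 1 0 0 0))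
    (hA : ∀ w, q.residue 0 *ᵥ w = (s.accessory a b h k).A₁' w)
    (hM : q.residue 0 + q.residue 1 = (s.accessory a b h k).M)
    (hv : (s.accessory a b h k).v ≠ 1) (hd : (s.accessory a b h k).den ≠ 0)
    (h1 : f₁ + (s.θ 0 0 - s.θ 0 1 + 1) ≠ 0)
    (hf : (s.accessory a b h k).den * (a - f₁) = (a - s.θ 0 1 - 1) *
      ((h + (s.θ 0 0 - s.θ 0 1 + 1)) * (b - s.θ 1 1) +
        (a + (s.θ 0 0 - s.θ 0 1 + 1)) * (a + s.θ 1 1)) - a * (a + (s.θ 0 0 - s.θ 0 1)) * k)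
    (hg : (f₁ + (s.θ 0 0 - s.θ 0 1 + 1)) * (g₁ - s.θ 1 1) =
      (h + (s.θ 0 0 - s.θ 0 1 + 1)) * (b - s.θ 1 1)) :
    HasCoordinates (s.shift 1 0 0 0) q f₁ g₁ := by
  set c := s.accessory a b h k with hcdef
  have t00 : (s.shift 1 0 0 0).θ 0 0 = c.b₇ + c.t + 1 := by
    simp [RiemannScheme.shift, hcdef, RiemannScheme.accessory]
  have t01 : (s.shift 1 0 0 0).θ 0 1 = c.t := by
    simp [RiemannScheme.shift, hcdef, RiemannScheme.accessory]
  have t10 : (s.shift 1 0 0 0).θ 1 0 = c.b₅ - 1 := by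
    simp [RiemannScheme.shift, hcdef, RiemannScheme.accessory]
  have t11 : (s.shift 1 0 0 0).θ 1 1 = c.b₆ := by
    simp [RiemannScheme.shift, hcdef, RiemannScheme.accessory]
  have h7 : (s.shift 1 0 0 0).θ 0 0 - (s.shift 1 0 0 0).θ 0 1 = c.b₇ + 1 := by
    rw [t00, t01]; ring
  have hμτ : c.μ - c.τ ≠ 0 := by
    intro h0
    have := Accessory.den_eq hc
    rw [h0, zero_mul] at this
    exact div_ne_zero (mul_ne_zero hd hc.b₇) (mul_ne_zero hc.D hc.f) this.symm
  have hR : ∀ w, q.residue 1 *ᵥ w = c.M *ᵥ w - c.A₁' w := by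
    intro w
    rw [← hM, ← hA, add_mulVec]
    abel
  have hsum := Accessory.sum_w c
  have hb7 := hc.b₇'
  refine hasCoordinates_of_eigenvectors (y := c.y')
    (Z := (c.b₆ - c.b₅ + 1) * (f₁ + (c.b₇ + 1)) / (c.b₇ + 1))
    (E := Accessory.cols c.w₁₁ ((1 - c.v) • c.w₁₂) ((c.μ - c.τ) • ![1, 0, 0])) hs' hq
    ?_ ?_ ?_ ?_ ?_ ?_ ?_ ?_ ?_
  · have : (Accessory.cols c.w₁₁ ((1 - c.v) • c.w₁₂) ((c.μ - c.τ) • ![1, 0, 0])).det =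
        -(c.μ - c.τ) * (1 - c.v) := by
      rw [det_fin_three]
      simp [Accessory.cols, Accessory.w₁₁, Accessory.w₁₂]
      ring
    rw [this]
    exact mul_ne_zero (neg_ne_zero.2 hμτ) (sub_ne_zero.2 hv.symm)
  · rw [Accessory.cols_col_zero, hA, Accessory.A₁'_w₁₁ hc, t00]
  · rw [Accessory.cols_col_one, mulVec_smul, hA, Accessory.A₁'_w₁₂, t01, smul_comm]
  · rw [Accessory.cols_col_two, mulVec_smul, hR, Accessory.A₁'_e, t10, smul_comm]
    module
  · rw [Accessory.cols_col_zero, Accessory.cols_col_one, Accessory.cols_col_two, hsum, hR,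
      Accessory.A₂'_w₂₂ hc, t11]
  · rw [Accessory.cols_col_zero, Accessory.cols_col_one, Accessory.cols_col_two, hR,
      Accessory.A₁'_w₁₁ hc]
    have e0 := Accessory.M_w₁₁_zero hc (f₁ := f₁) hf
    have e1 := Accessory.M_w₁₁_one hc
    have e2 := Accessory.M_w₁₁_two hc
    have s0 := congrFun hsum 0
    have s1 := congrFun hsum 1
    have s2 := congrFun hsum 2
    generalize c.M *ᵥ c.w₁₁ - (c.b₇ + c.t + 1) • c.w₁₁ = W at *
    ext i
    fin_cases i
    · simp at s0 ⊢
      linear_combination e0 + c.y' * s0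
    · simp at s1 ⊢
      linear_combination e1 + c.y' * s1
    · simp at s2 ⊢
      linear_combination e2 + c.y' * s2
  · rw [h7]; exact h1
  · rw [h7, t10, t11]; ring
  · rw [h7, t11]
    have : c.y' = (b - s.θ 1 1) * (h + (s.θ 0 0 - s.θ 0 1 + 1)) / (s.θ 0 0 - s.θ 0 1 + 1) := rfl
    have e1 : c.b₇ = s.θ 0 0 - s.θ 0 1 := rfl
    have e2 : c.b₆ = s.θ 1 1 := rfl
    rw [this, e1, e2, hg]
    ring

end

end SchlesingerA2

end

/-! ### The remaining three factors of the composition. -/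

noncomputable section

namespace SchlesingerA2

open Matrix

namespace Accessory

variable {c : Accessory}

/-- The vectors e₁, w₁₁ + σ₁ w₁₃ and w₁₂ - σ₂ w₁₃ all lie in the plane annihilated by `row`, hence
are dependent. The relation identifies the second vector of the final frame as an eigenvector. -/
lemma w₁₁_add_w₁₃ (hc : c.Good) (ht : c.h - c.t ≠ 0) :
    c.τ • ![1, 0, 0] - (c.w₁₁ + c.σ₁ • c.w₁₃) =
      (c.h * (c.b₇ + c.t + 1) * (c.g - c.b₆) * (c.g - c.b₅) /
        ((c.b₇ + 1) * c.g * (c.b₆ - c.b₅) * c.t)) • (c.w₁₂ - c.σ₂ • c.w₁₃) := by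
  set r := c.h * (c.b₇ + c.t + 1) * (c.g - c.b₆) * (c.g - c.b₅) /
        ((c.b₇ + 1) * c.g * (c.b₆ - c.b₅) * c.t) with hr
  have h2 : -1 - c.σ₁ = -(r * c.σ₂) := by
    obtain ⟨h1, h2, h3, h4, h5, h6, h7, h8, h9, h10⟩ := hc
    rw [hr]
    simp only [σ₁, σ₂]
    field_simp
    ring
  have h1 : -c.v + c.σ₁ * (c.β / c.t) = r * (1 + c.σ₂ * (c.β / c.t)) := by
    have : -c.v - c.β / c.t = r := by
      obtain ⟨h1, h2, h3, h4, h5, h6, h7, h8, h9, h10⟩ := hc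
      rw [hr]
      simp only [v, β]
      field_simp
      ring
    linear_combination this - c.β / c.t * h2
  ext i
  fin_cases i
  · simp [w₁₁, w₁₂, w₁₃, u]
    linear_combination -c.n₁ * h1 - c.n₂ * h2
  · simp [w₁₁, w₁₂, w₁₃]
    linear_combination h1
  · simp [w₁₁, w₁₂, w₁₃]
    linear_combination h2

lemma M_w₁₃_two (hc : c.Good) (ht : c.h - c.t ≠ 0) : c.σ₁ * (c.M *ᵥ c.w₁₃) 2 = c.y' := by
  have e : (c.M *ᵥ c.w₁₃) 2 =
      -(c.z * c.n₂ * (c.β / c.t + 1)) - (c.b₆ - c.b₅) * (c.β / c.t) + c.b₅ := by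
    rw [M_mulVec]
    simp [w₁₃, n₁_eq c]
    ring
  rw [e, z_n₂ hc]
  obtain ⟨h1, h2, h3, h4, h5, h6, h7, h8, h9, h10⟩ := hc
  simp only [β, y', σ₁]
  field_simp
  ring

lemma M_w₁₃_one (hc : c.Good) (ht : c.h - c.t ≠ 0) : c.σ₁ * (c.M *ᵥ c.w₁₃) 1 = c.y' := by
  rw [← M_w₁₃_two hc ht]
  congr 1
  have hn := y_n₁ hc
  have hn' : c.y * c.n₂ = c.b₅ - c.z * c.n₂ := by
    have := n₁_eq c
    linear_combination -hn + c.y * this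
  have := hc.t
  have h0 : c.t * (c.β / c.t) = c.β := by field_simp
  rw [M_mulVec]
  simp [w₁₃, n₁_eq c]
  linear_combination (1 + c.β / c.t) * hn' - h0

/-- The second coordinate of the image under the standard map enters through this identity. -/
lemma M_w₁₃_zero (hc : c.Good) (ht : c.h - c.t ≠ 0) {g' : ℂ}
    (hg : (c.h + g') * (c.h + (c.b₇ + 1)) * (c.h - c.t) = c.h *
      ((c.h - c.f) * (c.h - (c.t - c.b₅ - c.b₆ - c.b₇) + c.f - c.g) + (c.f + c.b₇) * c.k +
        (c.h - c.f) * (c.g - c.b₅) * (c.g - c.b₆) / c.g)) :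
    (c.M *ᵥ c.w₁₁ - (c.b₇ + c.t + 1) • c.w₁₁) 0 + c.σ₁ * (c.M *ᵥ c.w₁₃) 0 =
      -(c.τ * ((c.h + (c.b₇ + 1)) * (g' - c.b₅ + 1) / (c.b₇ + 1))) := by
  have hX : (c.h + (c.b₇ + 1)) * (g' - c.b₅ + 1) = (c.h *
      ((c.h - c.f) * (c.h - (c.t - c.b₅ - c.b₆ - c.b₇) + c.f - c.g) + (c.f + c.b₇) * c.k +
        (c.h - c.f) * (c.g - c.b₅) * (c.g - c.b₆) / c.g) -
      (c.h + (c.b₇ + 1)) * (c.h - c.t) * (c.h + c.b₅ - 1)) / (c.h - c.t) := by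
    rw [← hg]
    field_simp
    ring
  rw [hX, M_mulVec, M_mulVec]
  obtain ⟨h1, h2, h3, h4, h5, h6, h7, h8, h9, h10⟩ := hc
  simp [w₁₁, w₁₃]
  simp only [u, v, τ, n₁, n₂, y, α, β, σ₁]
  field_simp
  ring

end Accessory

section
variable {s : RiemannScheme}

lemma composition_target_θ (s : RiemannScheme) :
    (composition.target s).θ 0 0 = s.θ 0 0 ∧ (composition.target s).θ 0 1 = s.θ 0 1 - 1 ∧
    (composition.target s).θ 1 0 = s.θ 1 0 - 1 ∧ (composition.target s).θ 1 1 = s.θ 1 1 - 1 := by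
  refine ⟨?_, ?_, ?_, ?_⟩ <;>
    simp [composition, Transformation.comp, exchange13, schlesinger, RiemannScheme.exchange,
      RiemannScheme.shift]
  ring

lemma composition_target_κ (s : RiemannScheme) (j : Fin 3) :
    (composition.target s).κ j = s.κ j + 1 := by
  simp [composition, Transformation.comp, exchange13, schlesinger, RiemannScheme.exchange,
    RiemannScheme.shift]
  ring

/-- All Riemann schemes occurring in the composition are regular. -/
structure RiemannScheme.CompositionRegular (s : RiemannScheme) : Prop where
  source : s.Regular
  first : (s.shift 1 0 0 0).Regular
  second : (s.shift 1 0 0 0).exchange.Regular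
  third : ((s.shift 1 0 0 0).exchange.shift 1 0 1 0).Regular
  target : (composition.target s).Regular

lemma functional_composition (hs : s.CompositionRegular) : composition.Functional s :=
  Transformation.Functional.comp
    (Transformation.Functional.comp
      (Transformation.Functional.comp (functional_schlesinger (by decide) 0 0 hs.first)
        (functional_exchange13 hs.first hs.second))
      (functional_schlesinger (by decide) 1 0 hs.third))
    (functional_exchange13 hs.third hs.target)

/-- The first exchange turns w₁₃, spanning the kernel of the first residue, into its first
eigenvector; so the second Schlesinger transformation uses the projector built from w₁₃ and `row`.
Correcting the earlier eigenvectors by multiples of w₁₃ gives those of the final residues, from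
which h and g' are read off. -/
lemma exists_composition {a b h k g' : ℂ} {q : Decomposition} (hs : s.CompositionRegular)
    (hc : (s.accessory a b h k).Good) (hq : q.IsOver (s.shift 1 0 0 0))
    (hA : ∀ w, q.residue 0 *ᵥ w = (s.accessory a b h k).A₁' w)
    (hM : q.residue 0 + q.residue 1 = (s.accessory a b h k).M)
    (ht : h - s.θ 0 1 ≠ 0) (h0 : h ≠ 0) (h1 : h + (s.θ 0 0 - s.θ 0 1 + 1) ≠ 0)
    (hg : (h + g') * (h + (s.θ 0 0 - s.θ 0 1 + 1)) * (h - s.θ 0 1) = h *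
      ((h - a) * (h - (s.θ 0 1 - s.θ 1 0 - s.θ 1 1 - (s.θ 0 0 - s.θ 0 1)) + a - b) +
        (a + (s.θ 0 0 - s.θ 0 1)) * k + (h - a) * (b - s.θ 1 0) * (b - s.θ 1 1) / b)) :
    ∃ r, (exchange13.comp ((schlesinger 1 0 1 0).comp exchange13)).graph (s.shift 1 0 0 0) q r ∧
      HasCoordinates (composition.target s) r h g' := by
  set c := s.accessory a b h k with hcdef
  have hR : ∀ w, q.residue 1 *ᵥ w = c.M *ᵥ w - c.A₁' w := by
    intro w
    rw [← hM, ← hA, add_mulVec]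
    abel
  have ht' : c.h - c.t ≠ 0 := ht
  have hg' := Accessory.M_w₁₃_zero hc ht' hg
  -- the first exchange
  set s₁ := s.shift 1 0 0 0 with hs₁
  have t00 : s₁.θ 0 0 = c.b₇ + c.t + 1 := by
    simp [hs₁, RiemannScheme.shift, hcdef, RiemannScheme.accessory]
  have o2 := isOver_exchange hs.first hq
  have r20 := residue_exchange_zero hs.first hq
  have r21 : (q.exchange s₁).residue 1 = q.residue 1 := rfl
  set s₂ := s₁.exchange with hs₂
  set q₂ := q.exchange s₁ with hq₂
  have u00 : s₂.θ 0 0 = -(c.b₇ + c.t + 1) := by rw [← t00]; rfl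
  have u11 : s₂.θ 1 1 = c.b₆ := by
    have : s₂.θ 1 1 = s₁.θ 1 1 := rfl
    rw [this]
    simp [hs₁, RiemannScheme.shift, hcdef, RiemannScheme.accessory]
  -- the second projector
  have hw13 : q₂.residue 0 *ᵥ c.w₁₃ = s₂.θ 0 0 • c.w₁₃ := by
    rw [r20, sub_mulVec, smul_mulVec, one_mulVec, hA, Accessory.A₁'_w₁₃ hc, t00, u00]
    module
  have hrow : c.row ᵥ* q₂.residue 1 = s₂.θ 1 1 • c.row := by
    have : ∀ w, (c.row ᵥ* q₂.residue 1) ⬝ᵥ w = (s₂.θ 1 1 • c.row) ⬝ᵥ w := by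
      intro w
      rw [← dotProduct_mulVec, r21, hR, Accessory.row_A₂' hc, u11, smul_dotProduct, smul_eq_mul]
    ext i
    have := this (Pi.single i 1)
    simpa using this
  obtain ⟨d, hd⟩ := eq_smul_col hs.second o2 hw13
  obtain ⟨e, he⟩ := eq_smul_row hs.second o2 hrow
  have hdot := Accessory.row_w₁₃ hc
  have hdot0 : c.row ⬝ᵥ c.w₁₃ ≠ 0 := by
    rw [hdot]
    exact div_ne_zero (mul_ne_zero (mul_ne_zero hc.g₆ hc.g₅) ht) hc.t
  have hde : c.row ⬝ᵥ c.w₁₃ = e * d * (q₂.C 1 1 ⬝ᵥ (q₂.B 0).col 0) := by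
    conv_lhs => rw [hd, he]
    rw [dotProduct_smul, smul_dotProduct, smul_eq_mul, smul_eq_mul]
    ring
  have hed : e * d ≠ 0 ∧ q₂.C 1 1 ⬝ᵥ (q₂.B 0).col 0 ≠ 0 := by
    rw [hde] at hdot0
    exact mul_ne_zero_iff.1 hdot0
  -- The scalars relating w₁₃ and `row` to the actual columns and rows of the decomposition cancel
  -- in the projector.
  have hN : ∀ w, projector 1 0 1 0 q₂ *ᵥ w = ((c.row ⬝ᵥ w) / (c.row ⬝ᵥ c.w₁₃)) • c.w₁₃ := by
    intro w
    have hr : c.row ⬝ᵥ w = e * (q₂.C 1 1 ⬝ᵥ w) := by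
      conv_lhs => rw [he]
      rw [smul_dotProduct, smul_eq_mul]
    have hd0 : d ≠ 0 := right_ne_zero_of_mul hed.1
    have he0 : e ≠ 0 := left_ne_zero_of_mul hed.1
    have hx0 := hed.2
    rw [projector, smul_mulVec, vecMulVec_mulVec, hde, hr]
    have hw : c.w₁₃ = d • (q₂.B 0).col 0 := hd
    rw [hw]
    ext i
    simp
    field_simp
  obtain ⟨q₃, hq₃⟩ := exists_schlesinger (α := 1) (β := 0) (by decide) 1 0 hs.second hs.third o2
    hed.2
  have rel := (schlesinger_graph_iff (by decide) 1 0).1 hq₃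
  have o3 := rel.2.1
  have r30 := rel.2.2.2.eq.1
  have r3s := rel.2.2.2.2.1
  have o4 := isOver_exchange hs.third o3
  have r40 := residue_exchange_zero hs.third o3
  set s₃ := s₂.shift 1 0 1 0 with hs₃
  set q₄ := q₃.exchange s₃ with hq₄
  have r41 : q₄.residue 1 = q₃.residue 1 := rfl
  have v00 : s₃.θ 0 0 = -(c.b₇ + c.t) := by
    have : s₃.θ 0 0 = s₂.θ 0 0 + 1 := by simp [hs₃, RiemannScheme.shift]
    rw [this, u00]
    ring
  -- The two exchanges shift the residue by -(θ_1^1 + 1) and by +θ_1^1; only -w remains of these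
  -- shifts.
  have hA4 : ∀ w, q₄.residue 0 *ᵥ w = c.A₁' w - w +
      ((c.row ⬝ᵥ w) / (c.row ⬝ᵥ c.w₁₃)) • (c.M *ᵥ c.w₁₃ - (c.b₆ - 1) • c.w₁₃) -
      ((c.row ⬝ᵥ c.A₁' w) / (c.row ⬝ᵥ c.w₁₃)) • c.w₁₃ := by
    intro w
    have hsum : q₂.residue 1 + q₂.residue 0 = c.M - (c.b₇ + c.t + 1) • 1 := by
      rw [r20, r21, t00, ← hM]
      abel
    have hA2 : q₂.residue 0 *ᵥ w = c.A₁' w - (c.b₇ + c.t + 1) • w := by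
      rw [r20, sub_mulVec, hA, smul_mulVec, one_mulVec, t00]
    rw [r40, r30, hsum, v00, u11]
    simp only [sub_mulVec, add_mulVec, smul_mulVec, one_mulVec, ← mulVec_mulVec]
    rw [hA2, hN, hN, mulVec_smul, dotProduct_sub, dotProduct_smul, smul_eq_mul, sub_div]
    module
  have hM4 : ∀ w, q₄.residue 1 *ᵥ w = c.M *ᵥ w - w - q₄.residue 0 *ᵥ w := by
    intro w
    have : q₄.residue 1 = c.M - 1 - q₄.residue 0 := by
      rw [r41, r40, v00]
      have h3 : q₃.residue 1 = q₂.residue 1 + q₂.residue 0 - q₃.residue 0 := by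
        rw [← r3s]; abel
      rw [h3, r20, r21, t00, ← hM]
      module
    rw [this, sub_mulVec, sub_mulVec, one_mulVec]
  -- the eigenvectors
  have hrE : c.row ⬝ᵥ (c.w₁₁ + c.σ₁ • c.w₁₃) = 0 := by
    have := hc.b₇'
    have := hc.t
    rw [dotProduct_add, dotProduct_smul, hdot, Accessory.row_w₁₁ hc, Accessory.σ₁, smul_eq_mul]
    field_simp
    ring
  have hre := Accessory.row_e (c := c)
  have hE1 := Accessory.w₁₁_add_w₁₃ hc ht'
  set r := c.h * (c.b₇ + c.t + 1) * (c.g - c.b₆) * (c.g - c.b₅) /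
    ((c.b₇ + 1) * c.g * (c.b₆ - c.b₅) * c.t) with hr
  have hr0 : r ≠ 0 := by
    rw [hr]
    exact div_ne_zero (mul_ne_zero (mul_ne_zero (mul_ne_zero h0 hc.θ') hc.g₆) hc.g₅)
      (mul_ne_zero (mul_ne_zero (mul_ne_zero hc.b₇' hc.g) hc.D) hc.t)
  have hτ0 : c.τ ≠ 0 :=
    div_ne_zero (mul_ne_zero hc.θ' hc.b₇) (mul_ne_zero hc.D hc.f)
  have A_add : ∀ x y, c.A₁' (x + y) = c.A₁' x + c.A₁' y := by
    intro x y
    rw [← hA, ← hA, ← hA, mulVec_add]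
  have A_smul : ∀ (z : ℂ) x, c.A₁' (z • x) = z • c.A₁' x := by
    intro z x
    rw [← hA, ← hA, mulVec_smul]
  have hAE : c.A₁' (c.w₁₁ + c.σ₁ • c.w₁₃) = (c.b₇ + c.t + 1) • c.w₁₁ := by
    rw [A_add, A_smul, Accessory.A₁'_w₁₁ hc, Accessory.A₁'_w₁₃ hc, smul_zero, add_zero]
  have hrw11 : c.row ⬝ᵥ c.w₁₁ = -c.σ₁ * (c.row ⬝ᵥ c.w₁₃) := by
    rw [dotProduct_add, dotProduct_smul, smul_eq_mul] at hrE
    linear_combination hrE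
  have hR0 : q₄.residue 0 *ᵥ (c.w₁₁ + c.σ₁ • c.w₁₃) =
      (c.b₇ + c.t) • (c.w₁₁ + c.σ₁ • c.w₁₃) := by
    rw [hA4, hrE, hAE, dotProduct_smul, smul_eq_mul, hrw11]
    have : (c.b₇ + c.t + 1) * (-c.σ₁ * (c.row ⬝ᵥ c.w₁₃)) / (c.row ⬝ᵥ c.w₁₃) =
        -((c.b₇ + c.t + 1) * c.σ₁) := by
      field_simp
    rw [this]
    module
  have hrw12 : c.row ⬝ᵥ (c.w₁₂ - c.σ₂ • c.w₁₃) = 0 := by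
    have h3 : r • (c.row ⬝ᵥ (c.w₁₂ - c.σ₂ • c.w₁₃)) = 0 := by
      rw [← dotProduct_smul, ← hE1, dotProduct_sub, hrE, dotProduct_smul, hre]
      simp
    exact (smul_eq_zero_iff_right hr0).1 h3
  have hR1 : q₄.residue 0 *ᵥ (c.w₁₂ - c.σ₂ • c.w₁₃) = (c.t - 1) • (c.w₁₂ - c.σ₂ • c.w₁₃) := by
    have h3 : c.A₁' (c.w₁₂ - c.σ₂ • c.w₁₃) = c.t • c.w₁₂ := by
      rw [sub_eq_add_neg, ← neg_smul, A_add, A_smul, Accessory.A₁'_w₁₂, Accessory.A₁'_w₁₃ hc,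
        smul_zero, add_zero]
    have h4 : c.row ⬝ᵥ c.w₁₂ = c.σ₂ * (c.row ⬝ᵥ c.w₁₃) := by
      rw [dotProduct_sub, dotProduct_smul, smul_eq_mul] at hrw12
      linear_combination hrw12
    rw [hA4, hrw12, h3, dotProduct_smul, smul_eq_mul, h4]
    have : c.t * (c.σ₂ * (c.row ⬝ᵥ c.w₁₃)) / (c.row ⬝ᵥ c.w₁₃) = c.t * c.σ₂ := by
      field_simp
    rw [this]
    module
  have hR2 : q₄.residue 1 *ᵥ c.w₁₃ = (c.b₆ - 1) • c.w₁₃ := by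
    rw [hM4, hA4, Accessory.A₁'_w₁₃ hc, dotProduct_zero, div_self hdot0]
    module
  -- On the span of e₁ and w₁₃ the final second residue is triangular with eigenvalues b₅ - 1 and b₆
  -- - 1; k' is the correction that turns e₁ into an eigenvector.
  set k' := (c.f + c.b₇) * c.t / (c.b₇ * (c.h - c.t)) with hk'
  have hk0 : k' ≠ 0 := div_ne_zero (mul_ne_zero hc.f hc.t) (mul_ne_zero hc.b₇ ht')
  have hR3 : q₄.residue 1 *ᵥ (![1, 0, 0] + k' • c.w₁₃) =
      (c.b₅ - 1) • (![1, 0, 0] + k' • c.w₁₃) := by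
    have h3 : (c.row ⬝ᵥ c.A₁' ![1, 0, 0]) / (c.row ⬝ᵥ c.w₁₃) = -((c.b₆ - c.b₅) * k') := by
      rw [Accessory.A₁'_e, dotProduct_sub, dotProduct_smul, hre, smul_zero, sub_zero,
        Accessory.row_M_e hc, hdot, hk']
      have := hc.b₇
      have := hc.t
      have := hc.g₅
      have := hc.g₆
      field_simp
    rw [mulVec_add, mulVec_smul, hR2, hM4, hA4, h3, hre, Accessory.A₁'_e]
    module
  have hfinal : c.M *ᵥ (c.w₁₁ + c.σ₁ • c.w₁₃) - (c.b₇ + c.t + 1) • (c.w₁₁ + c.σ₁ • c.w₁₃) =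
      -(c.τ * ((c.h + (c.b₇ + 1)) * (g' - c.b₅ + 1) / (c.b₇ + 1))) • ![1, 0, 0] -
        ((c.b₇ + c.t + 1) * c.σ₁) • c.w₁₃ := by
    have e1 := Accessory.M_w₁₁_one hc
    have e2 := Accessory.M_w₁₁_two hc
    have f1 := Accessory.M_w₁₃_one hc ht'
    have f2 := Accessory.M_w₁₃_two hc ht'
    rw [mulVec_add, mulVec_smul]
    have : ∀ W V : Fin 3 → ℂ, W + c.σ₁ • V - (c.b₇ + c.t + 1) • (c.w₁₁ + c.σ₁ • c.w₁₃) =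
      (W - (c.b₇ + c.t + 1) • c.w₁₁) + c.σ₁ • V - ((c.b₇ + c.t + 1) * c.σ₁) • c.w₁₃ := by
      intro W V
      module
    rw [this]
    congr 1
    generalize c.M *ᵥ c.w₁₁ - (c.b₇ + c.t + 1) • c.w₁₁ = W at *
    generalize c.M *ᵥ c.w₁₃ = V at *
    ext i
    fin_cases i
    · simp
      linear_combination hg'
    · simp
      linear_combination e1 + f1
    · simp
      linear_combination e2 + f2
  -- the coordinates
  obtain ⟨T00, T01, T10, T11⟩ := composition_target_θ s
  have T7 : (composition.target s).θ 0 0 - (composition.target s).θ 0 1 = c.b₇ + 1 := by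
    rw [T00, T01]
    simp only [hcdef, RiemannScheme.accessory]
    ring
  have hb7 := hc.b₇'
  refine ⟨q₄, ⟨q₃, ⟨q₂, ⟨hq, hs.first.1 0 0, hs.first.1 0 1, rfl⟩, hq₃⟩, o3, hs.third.1 0 0,
    hs.third.1 0 1, rfl⟩, ?_⟩
  -- The scales are chosen so that the three columns add up to a multiple of w₁₃, which is the
  -- eigenvector for θ_2^2 - 1.
  refine hasCoordinates_of_eigenvectors
    (y := (c.h + (c.b₇ + 1)) * (g' - c.b₆ + 1) / (c.b₇ + 1))
    (Z := (c.b₆ - c.b₅) * (c.h + (c.b₇ + 1)) / (c.b₇ + 1))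
    (E := Accessory.cols (c.w₁₁ + c.σ₁ • c.w₁₃) (c.τ • ![1, 0, 0] - (c.w₁₁ + c.σ₁ • c.w₁₃))
      (-c.τ • (![1, 0, 0] + k' • c.w₁₃))) hs.target o4 ?_ ?_ ?_ ?_ ?_ ?_ ?_ ?_ ?_
  · have hv : -c.v - c.β / c.t = r := by
      obtain ⟨h1, h2, h3, h4, h5, h6, h7, h8, h9, h10⟩ := hc
      rw [hr]
      simp only [Accessory.v, Accessory.β]
      field_simp
      ring
    have : (Accessory.cols (c.w₁₁ + c.σ₁ • c.w₁₃) (c.τ • ![1, 0, 0] - (c.w₁₁ + c.σ₁ • c.w₁₃))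
      (-c.τ • (![1, 0, 0] + k' • c.w₁₃))).det = -(c.τ ^ 2 * k' * r) := by
      rw [det_fin_three, ← hv]
      simp [Accessory.cols, Accessory.w₁₁, Accessory.w₁₃]
      ring
    rw [this]
    exact neg_ne_zero.2 (mul_ne_zero (mul_ne_zero (pow_ne_zero 2 hτ0) hk0) hr0)
  · rw [Accessory.cols_col_zero, hR0, T00]
    congr 1
    simp [hcdef, RiemannScheme.accessory]
  · rw [Accessory.cols_col_one, hE1, mulVec_smul, hR1, T01, smul_comm]
    rfl
  · rw [Accessory.cols_col_two, mulVec_smul, hR3, T10, smul_comm]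
    rfl
  · rw [Accessory.cols_col_zero, Accessory.cols_col_one, Accessory.cols_col_two]
    have : c.w₁₁ + c.σ₁ • c.w₁₃ + (c.τ • ![1, 0, 0] - (c.w₁₁ + c.σ₁ • c.w₁₃)) +
        -c.τ • (![1, 0, 0] + k' • c.w₁₃) = (-(c.τ * k')) • c.w₁₃ := by module
    rw [this, mulVec_smul, hR2, T11, smul_comm]
    rfl
  · rw [Accessory.cols_col_zero, Accessory.cols_col_one, Accessory.cols_col_two, hM4, hR0]
    have e3 : (c.b₆ - c.b₅) * (c.h + (c.b₇ + 1)) / (c.b₇ + 1) * (c.τ * k') =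
        (c.b₇ + c.t + 1) * c.σ₁ := by
      rw [hk']
      obtain ⟨h1, h2, h3, h4, h5, h6, h7, h8, h9, h10⟩ := hc
      simp only [Accessory.τ, Accessory.σ₁]
      field_simp
    linear_combination (norm := module) hfinal + e3 • c.w₁₃
  · rw [T7]; exact h1
  · rw [T7, T10, T11]
    simp only [hcdef, RiemannScheme.accessory]
    ring
  · rw [T7, T11]
    simp only [hcdef, RiemannScheme.accessory]
    ring

end

end SchlesingerA2

end

/-! ### Words of quadratic maps and the isomorphisms they define. -/

noncomputable section

namespace SchlesingerA2

/-! ### Isomorphisms of surfaces composed from quadratic maps -/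

/-- The birational map with pull-back `Ψ` lifts to an isomorphism between blow-ups at distinct
points, with push-forward `M`. -/
structure SurfaceIso (b b' : Fin 8 → ℂ) (Ψ : K ≃ₐ[ℂ] K) (M : Pic → Pic) : Prop where
  source : Function.Injective (center b)
  target : Function.Injective (center b')
  lifts : LiftsToIsomorphism b b' Ψ
  pushForward : HasPushForward b b' Ψ M

lemma SurfaceIso.trans {b b' b'' : Fin 8 → ℂ} {Ψ Ψ' : K ≃ₐ[ℂ] K} {M M' : Pic → Pic}
    (H : SurfaceIso b b' Ψ M) (H' : SurfaceIso b' b'' Ψ' M') :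
    SurfaceIso b b'' (Ψ'.trans Ψ) (fun D => M' (M D)) :=
  ⟨H.source, H'.target, H.lifts.trans H'.lifts,
    HasPushForward.trans H.lifts H.pushForward H'.pushForward⟩

lemma SurfaceIso.symm {b b' : Fin 8 → ℂ} {Ψ : K ≃ₐ[ℂ] K} {M M' : Pic → Pic}
    (H : SurfaceIso b b' Ψ M) (hM : ∀ D, M (M' D) = D) : SurfaceIso b' b Ψ.symm M' :=
  ⟨H.target, H.source, H.lifts.symm, H.pushForward.symm hM⟩

/-- The permutation preserves the three groups of centres. -/
def PreservesGroups (σ : Equiv.Perm (Fin 8)) : Prop :=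
  ∀ i, ((σ i).val < 4 ↔ i.val < 4) ∧ ((σ i).val < 6 ↔ i.val < 6)

instance (σ : Equiv.Perm (Fin 8)) : Decidable (PreservesGroups σ) := by
  unfold PreservesGroups
  infer_instance

lemma PreservesGroups.symm {σ : Equiv.Perm (Fin 8)} (h : PreservesGroups σ) :
    PreservesGroups σ.symm := by
  intro i
  have := h (σ.symm i)
  rw [Equiv.apply_symm_apply] at this
  exact ⟨this.1.symm, this.2.symm⟩

lemma center_eq_ite (b : Fin 8 → ℂ) (i : Fin 8) : center b i =
    if i.val < 4 then ((b i : OnePoint ℂ), ((-b i : ℂ) : OnePoint ℂ))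
    else if i.val < 6 then (OnePoint.infty, (b i : OnePoint ℂ))
    else (((-b i : ℂ) : OnePoint ℂ), OnePoint.infty) := by
  fin_cases i <;> rfl

/-- The action of a renaming of the centres on the Picard lattice. -/
def permAction (σ : Equiv.Perm (Fin 8)) (D : Pic) : Pic := (D.1, D.2.1, D.2.2 ∘ σ.symm)

lemma surfaceIso_perm {b : Fin 8 → ℂ} (hb : Function.Injective (center b))
    {σ : Equiv.Perm (Fin 8)} (hσ : PreservesGroups σ) :
    SurfaceIso b (b ∘ σ.symm) AlgEquiv.refl (permAction σ) := by
  obtain ⟨h1, h2, h3⟩ := permutation_isomorphism hb σ (fun i => by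
    rw [center_eq_ite, center_eq_ite]
    simp only [Function.comp_apply, Equiv.symm_apply_apply, (hσ i).1, (hσ i).2])
  exact ⟨hb, h1, h2, h3⟩

lemma surfaceIso_swap {b : Fin 8 → ℂ} (hb : Function.Injective (center b)) :
    SurfaceIso b (swapParameters b) swapEquiv swapAction :=
  ⟨hb, (swap_isomorphism hb).1, (swap_isomorphism hb).2.1, (swap_isomorphism hb).2.2⟩

lemma surfaceIso_shift (c : ℂ) {b : Fin 8 → ℂ} (hb : Function.Injective (center b)) :
    SurfaceIso b (shiftParameters c b) (shiftEquiv c) id :=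
  ⟨hb, (shift_isomorphism c hb).1, (shift_isomorphism c hb).2.1, (shift_isomorphism c hb).2.2⟩

/-- Relabelling conjugates the involution based at the first two centres into the one based at σ 0
and σ 1. The relabelling is the identity on functions but permutes the exceptional curves. -/
lemma surfaceIso_quad {b : Fin 8 → ℂ} {σ : Equiv.Perm (Fin 8)} (hσ : PreservesGroups σ)
    (h : QuadAdmissible (b ∘ σ)) :
    SurfaceIso b (quadParameters (b ∘ σ) ∘ σ.symm) (quadEquiv (b (σ 0)) (b (σ 1)))
      (fun D => permAction σ (quadAction (permAction σ.symm D))) := by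
  have hb : Function.Injective (center b) := by
    have := (surfaceIso_perm h.1.injective hσ).target
    rwa [Function.comp_assoc, Equiv.self_comp_symm, Function.comp_id] at this
  have h1 := surfaceIso_perm hb hσ.symm
  rw [Equiv.symm_symm] at h1
  have h2 := surfaceIso_perm h.quadParameters.1.injective hσ
  have h3 : SurfaceIso (b ∘ σ) (quadParameters (b ∘ σ)) (quadEquiv (b (σ 0)) (b (σ 1)))
      quadAction :=
    ⟨h.1.injective, h.quadParameters.1.injective, (quad_isomorphism h).1, (quad_isomorphism h).2⟩
  have e : (AlgEquiv.refl : K ≃ₐ[ℂ] K).trans ((quadEquiv (b (σ 0)) (b (σ 1))).trans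
      AlgEquiv.refl) = quadEquiv (b (σ 0)) (b (σ 1)) := AlgEquiv.ext fun _ => rfl
  have h4 := (h1.trans h3).trans h2
  rw [e] at h4
  exact h4

/-- A quadratic map fixing `f` or, if `dual`, fixing `g`, based at the points `σ 0`, `σ 1`. -/
structure QuadStep where
  dual : Bool
  σ : Equiv.Perm (Fin 8)
  preserves : PreservesGroups σ

namespace QuadStep

def params (q : QuadStep) (b : Fin 8 → ℂ) : Fin 8 → ℂ :=
  match q.dual with
  | false => quadParameters (b ∘ q.σ) ∘ q.σ.symm
  | true => swapParameters (quadParameters (swapParameters b ∘ q.σ) ∘ q.σ.symm)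

def equiv (q : QuadStep) (b : Fin 8 → ℂ) : K ≃ₐ[ℂ] K :=
  match q.dual with
  | false => quadEquiv (b (q.σ 0)) (b (q.σ 1))
  | true => swapEquiv.trans
      ((quadEquiv (swapParameters b (q.σ 0)) (swapParameters b (q.σ 1))).trans swapEquiv)

def action (q : QuadStep) (D : Pic) : Pic :=
  match q.dual with
  | false => permAction q.σ (quadAction (permAction q.σ.symm D))
  | true => swapAction (permAction q.σ (quadAction (permAction q.σ.symm (swapAction D))))

def Admissible (q : QuadStep) (b : Fin 8 → ℂ) : Prop :=
  match q.dual with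
  | false => QuadAdmissible (b ∘ q.σ)
  | true => QuadAdmissible (swapParameters b ∘ q.σ)

lemma surfaceIso (q : QuadStep) {b : Fin 8 → ℂ} (hb : Function.Injective (center b))
    (h : q.Admissible b) : SurfaceIso b (q.params b) (q.equiv b) q.action := by
  obtain ⟨d, σ, hσ⟩ := q
  cases d
  · exact surfaceIso_quad hσ h
  · have h1 := surfaceIso_swap hb
    have h2 := surfaceIso_quad hσ h
    exact (h1.trans h2).trans (surfaceIso_swap h2.target)

end QuadStep

/-- The parameters reached so far, with the composed map and its action. -/
structure Stage where
  params : Fin 8 → ℂ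
  equiv : K ≃ₐ[ℂ] K
  action : Pic → Pic

namespace Stage

def start (b : Fin 8 → ℂ) : Stage := ⟨b, AlgEquiv.refl, id⟩

def advance (S : Stage) (q : QuadStep) : Stage :=
  ⟨q.params S.params, (q.equiv S.params).trans S.equiv, fun D => q.action (S.action D)⟩

def Admissible : List QuadStep → (Fin 8 → ℂ) → Prop
  | [], _ => True
  | q :: w, b => q.Admissible b ∧ Admissible w (q.params b)

lemma surfaceIso_foldl {b : Fin 8 → ℂ} (w : List QuadStep) (S : Stage)
    (hS : SurfaceIso b S.params S.equiv S.action) (h : Admissible w S.params) :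
    SurfaceIso b (w.foldl advance S).params (w.foldl advance S).equiv
      (w.foldl advance S).action := by
  induction w generalizing S with
  | nil => exact hS
  | cons q w ih =>
    exact ih _ (hS.trans (q.surfaceIso hS.target h.1)) h.2

lemma surfaceIso_start {b : Fin 8 → ℂ} (hb : Function.Injective (center b)) :
    SurfaceIso b (start b).params (start b).equiv (start b).action := by
  have := surfaceIso_perm hb (σ := 1) (fun _ => ⟨Iff.rfl, Iff.rfl⟩)
  exact ⟨hb, hb, this.lifts, this.pushForward⟩

lemma add_ne_zero (S : Stage) : S.equiv f + S.equiv g ≠ 0 := by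
  rw [← map_add]
  exact fun h => f_add_g_ne_zero (S.equiv.injective (h.trans (map_zero _).symm))

/-- In functions pulled back to the initial plane, a step keeps one coordinate and changes the other
by a single product relation. Formulas for words are obtained by eliminating between such relations.
-/
lemma advance_false (S : Stage) {σ : Equiv.Perm (Fin 8)} (hσ : PreservesGroups σ) :
    (S.advance ⟨false, σ, hσ⟩).equiv f = S.equiv f ∧
    (S.equiv f + S.equiv g) * (S.equiv f + (S.advance ⟨false, σ, hσ⟩).equiv g) =
      (S.equiv f - const (S.params (σ 0))) * (S.equiv f - const (S.params (σ 1))) := by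
  have h := S.add_ne_zero
  simp only [advance, QuadStep.equiv, AlgEquiv.trans_apply, quadEquiv_f, quadEquiv_g, map_add,
    map_neg, map_div₀, map_mul, map_sub, map_const]
  refine ⟨trivial, ?_⟩
  field_simp
  ring

lemma advance_true (S : Stage) {σ : Equiv.Perm (Fin 8)} (hσ : PreservesGroups σ) :
    (S.advance ⟨true, σ, hσ⟩).equiv g = S.equiv g ∧
    (S.equiv f + S.equiv g) * ((S.advance ⟨true, σ, hσ⟩).equiv f + S.equiv g) =
      (S.equiv g - const (swapParameters S.params (σ 0))) *
        (S.equiv g - const (swapParameters S.params (σ 1))) := by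
  have h : S.equiv g + S.equiv f ≠ 0 := by
    rw [add_comm]
    exact S.add_ne_zero
  simp only [advance, QuadStep.equiv, AlgEquiv.trans_apply, quadEquiv_f, quadEquiv_g, map_add,
    map_neg, map_div₀, map_mul, map_sub, map_const, swapEquiv_f, swapEquiv_g]
  refine ⟨trivial, ?_⟩
  field_simp
  ring

end Stage

/-! ### Additivity on the Picard lattice -/

/-- Additive maps of the Picard lattice are determined on the basis. -/
lemma pic_ext {M M' : Pic → Pic} (h : ∀ D D', M (D + D') = M D + M D')
    (h' : ∀ D D', M' (D + D') = M' D + M' D') (hf : M Hf = M' Hf) (hg : M Hg = M' Hg)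
    (hE : ∀ i, M (E i) = M' (E i)) (D : Pic) : M D = M' D := by
  set φ : Pic →+ Pic := AddMonoidHom.mk' M h
  set φ' : Pic →+ Pic := AddMonoidHom.mk' M' h'
  have hD : D = D.1 • Hf + D.2.1 • Hg + ∑ i, D.2.2 i • E i := by
    refine Prod.ext ?_ (Prod.ext ?_ ?_)
    · simp [Hf, Hg, E, Prod.fst_sum]
    · simp [Hf, Hg, E, Prod.fst_sum, Prod.snd_sum]
    · funext j
      simp [Hf, Hg, E, Prod.snd_sum, Finset.sum_apply, Pi.single_apply]
  change φ D = φ' D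
  rw [hD]
  simp only [map_add, map_zsmul, map_sum]
  have e1 : φ Hf = φ' Hf := hf
  have e2 : φ Hg = φ' Hg := hg
  have e3 : ∀ i, φ (E i) = φ' (E i) := hE
  simp only [e1, e2, e3]

lemma permAction_add (σ : Equiv.Perm (Fin 8)) (D D' : Pic) :
    permAction σ (D + D') = permAction σ D + permAction σ D' :=
  Prod.ext rfl (Prod.ext rfl rfl)

lemma swapAction_add (D D' : Pic) : swapAction (D + D') = swapAction D + swapAction D' :=
  Prod.ext rfl (Prod.ext rfl rfl)

lemma quadAction_add (D D' : Pic) : quadAction (D + D') = quadAction D + quadAction D' := by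
  refine Prod.ext ?_ (Prod.ext rfl ?_)
  · simp [quadAction]
    ring
  · funext i
    fin_cases i <;> simp [quadAction] <;> ring

lemma QuadStep.action_add (q : QuadStep) (D D' : Pic) :
    q.action (D + D') = q.action D + q.action D' := by
  obtain ⟨d, σ, hσ⟩ := q
  cases d <;> simp [QuadStep.action, permAction_add, quadAction_add, swapAction_add]

lemma extend_add (hf hg : Pic) (e : Fin 8 → Pic) (D D' : Pic) :
    extend hf hg e (D + D') = extend hf hg e D + extend hf hg e D' := by
  simp only [extend, Prod.fst_add, Prod.snd_add, Pi.add_apply, add_smul, Finset.sum_add_distrib]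
  abel

end SchlesingerA2

end

/-! ### Concrete steps, and the standard map as a word of six. -/

noncomputable section

namespace SchlesingerA2

/-- The action of a word of quadratic maps on the Picard lattice. -/
def wordAction (w : List QuadStep) (D : Pic) : Pic := w.foldl (fun D q => q.action D) D

lemma Stage.foldl_action (w : List QuadStep) (S : Stage) (D : Pic) :
    (w.foldl Stage.advance S).action D = wordAction w (S.action D) := by
  induction w generalizing S with
  | nil => rfl
  | cons q w ih => exact ih (S.advance q)

lemma wordAction_add (w : List QuadStep) (D D' : Pic) :
    wordAction w (D + D') = wordAction w D + wordAction w D' := by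
  induction w generalizing D D' with
  | nil => rfl
  | cons q w ih =>
    change wordAction w (q.action (D + D')) = _
    rw [q.action_add, ih]
    rfl

/-- The final relabelling restores the order of the centres prescribed by b'; it is needed for the
parameters and the lattice action, not for the map itself. -/
lemma surfaceIso_word {b b' : Fin 8 → ℂ} (hb : Function.Injective (center b))
    {w : List QuadStep} (h : Stage.Admissible w b) {σ : Equiv.Perm (Fin 8)}
    (hσ : PreservesGroups σ) {M : Pic → Pic}
    (hp : (w.foldl Stage.advance (Stage.start b)).params ∘ σ.symm = b')
    (hM : ∀ D, permAction σ (wordAction w D) = M D) :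
    SurfaceIso b b' (w.foldl Stage.advance (Stage.start b)).equiv M := by
  have h1 := Stage.surfaceIso_foldl w (Stage.start b) (Stage.surfaceIso_start hb) h
  have h2 := h1.trans (surfaceIso_perm h1.target hσ)
  rw [hp] at h2
  have e : (fun D => permAction σ ((w.foldl Stage.advance (Stage.start b)).action D)) = M := by
    funext D
    rw [Stage.foldl_action]
    exact hM D
  rw [e] at h2
  exact h2

/-! ### The standard map -/

/-- The subscripts, counted from 1, are the centres that the permutation puts in the first two
places, where the quadratic map is based. Steps called `dual` below fix g, those called `quad` fix
f. -/
def perm₁₂ : Equiv.Perm (Fin 8) := Equiv.refl _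

def perm₁₃ : Equiv.Perm (Fin 8) :=
  ⟨![0, 2, 1, 3, 4, 5, 6, 7], ![0, 2, 1, 3, 4, 5, 6, 7], by decide, by decide⟩

def perm₁₄ : Equiv.Perm (Fin 8) :=
  ⟨![0, 3, 1, 2, 4, 5, 6, 7], ![0, 2, 3, 1, 4, 5, 6, 7], by decide, by decide⟩

def perm₂₃ : Equiv.Perm (Fin 8) :=
  ⟨![1, 2, 0, 3, 4, 5, 6, 7], ![2, 0, 1, 3, 4, 5, 6, 7], by decide, by decide⟩

def perm₂₄ : Equiv.Perm (Fin 8) :=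
  ⟨![1, 3, 0, 2, 4, 5, 6, 7], ![2, 0, 3, 1, 4, 5, 6, 7], by decide, by decide⟩

def perm₃₄ : Equiv.Perm (Fin 8) :=
  ⟨![2, 3, 0, 1, 4, 5, 6, 7], ![2, 3, 0, 1, 4, 5, 6, 7], by decide, by decide⟩

def dual₁₂ : QuadStep := ⟨true, perm₁₂, by decide⟩

lemma dual₁₂_params (b : Fin 8 → ℂ) : dual₁₂.params b =
    ![b 0, b 1, -b 4, -b 5, -b 2, -b 3, -b 0 - b 1 - b 6, -b 0 - b 1 - b 7] := by
  funext m
  fin_cases m <;> simp [dual₁₂, QuadStep.params, perm₁₂, quadParameters, swapParameters] <;> ring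

lemma dual₁₂_action (d e : ℤ) (c : Fin 8 → ℤ) : dual₁₂.action (d, e, c) =
    (d, d + e + c 0 + c 1, ![-d - c 0, -d - c 1, c 4, c 5, c 2, c 3, c 6, c 7]) := by
  refine Prod.ext ?_ (Prod.ext ?_ ?_)
  · simp [dual₁₂, QuadStep.action, perm₁₂, permAction, quadAction, swapAction, swapIndex]
  · simp [dual₁₂, QuadStep.action, perm₁₂, permAction, quadAction, swapAction, swapIndex]
    ring
  · funext m
    fin_cases m <;> simp [dual₁₂, QuadStep.action, perm₁₂, permAction, quadAction, swapAction,
        swapIndex]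

def quad₁₂ : QuadStep := ⟨false, perm₁₂, by decide⟩

lemma quad₁₂_params (b : Fin 8 → ℂ) : quad₁₂.params b =
    ![b 0, b 1, -b 6, -b 7, -b 0 - b 1 - b 4, -b 0 - b 1 - b 5, -b 2, -b 3] := by
  funext m
  fin_cases m <;> simp [quad₁₂, QuadStep.params, perm₁₂, quadParameters]

lemma quad₁₂_action (d e : ℤ) (c : Fin 8 → ℤ) : quad₁₂.action (d, e, c) =
    (d + e + c 0 + c 1, e, ![-e - c 0, -e - c 1, c 6, c 7, c 4, c 5, c 2, c 3]) := by
  refine Prod.ext ?_ (Prod.ext ?_ ?_)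
  · simp [quad₁₂, QuadStep.action, perm₁₂, permAction, quadAction]
  · simp [quad₁₂, QuadStep.action, perm₁₂, permAction, quadAction]
  · funext m
    fin_cases m <;> simp [quad₁₂, QuadStep.action, perm₁₂, permAction, quadAction]

def dual₃₄ : QuadStep := ⟨true, perm₃₄, by decide⟩

lemma dual₃₄_params (b : Fin 8 → ℂ) : dual₃₄.params b =
    ![-b 4, -b 5, b 2, b 3, -b 0, -b 1, -b 2 - b 3 - b 6, -b 2 - b 3 - b 7] := by
  funext m
  fin_cases m <;> simp [dual₃₄, QuadStep.params, perm₃₄, quadParameters, swapParameters] <;> ring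

lemma dual₃₄_action (d e : ℤ) (c : Fin 8 → ℤ) : dual₃₄.action (d, e, c) =
    (d, d + e + c 2 + c 3, ![c 4, c 5, -d - c 2, -d - c 3, c 0, c 1, c 6, c 7]) := by
  refine Prod.ext ?_ (Prod.ext ?_ ?_)
  · simp [dual₃₄, QuadStep.action, perm₃₄, permAction, quadAction, swapAction, swapIndex]
  · simp [dual₃₄, QuadStep.action, perm₃₄, permAction, quadAction, swapAction, swapIndex]
    ring
  · funext m
    fin_cases m <;> simp [dual₃₄, QuadStep.action, perm₃₄, permAction, quadAction, swapAction,
        swapIndex]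

def quad₃₄ : QuadStep := ⟨false, perm₃₄, by decide⟩

lemma quad₃₄_params (b : Fin 8 → ℂ) : quad₃₄.params b =
    ![-b 6, -b 7, b 2, b 3, -b 2 - b 3 - b 4, -b 2 - b 3 - b 5, -b 0, -b 1] := by
  funext m
  fin_cases m <;> simp [quad₃₄, QuadStep.params, perm₃₄, quadParameters]

lemma quad₃₄_action (d e : ℤ) (c : Fin 8 → ℤ) : quad₃₄.action (d, e, c) =
    (d + e + c 2 + c 3, e, ![c 6, c 7, -e - c 2, -e - c 3, c 4, c 5, c 0, c 1]) := by
  refine Prod.ext ?_ (Prod.ext ?_ ?_)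
  · simp [quad₃₄, QuadStep.action, perm₃₄, permAction, quadAction]
  · simp [quad₃₄, QuadStep.action, perm₃₄, permAction, quadAction]
  · funext m
    fin_cases m <;> simp [quad₃₄, QuadStep.action, perm₃₄, permAction, quadAction]

def quad₁₃ : QuadStep := ⟨false, perm₁₃, by decide⟩

lemma quad₁₃_params (b : Fin 8 → ℂ) : quad₁₃.params b =
    ![b 0, -b 6, b 2, -b 7, -b 0 - b 2 - b 4, -b 0 - b 2 - b 5, -b 1, -b 3] := by
  funext m
  fin_cases m <;> simp [quad₁₃, QuadStep.params, perm₁₃, quadParameters]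

lemma quad₁₃_action (d e : ℤ) (c : Fin 8 → ℤ) : quad₁₃.action (d, e, c) =
    (d + e + c 0 + c 2, e, ![-e - c 0, c 6, -e - c 2, c 7, c 4, c 5, c 1, c 3]) := by
  refine Prod.ext ?_ (Prod.ext ?_ ?_)
  · simp [quad₁₃, QuadStep.action, perm₁₃, permAction, quadAction]
  · simp [quad₁₃, QuadStep.action, perm₁₃, permAction, quadAction]
  · funext m
    fin_cases m <;> simp [quad₁₃, QuadStep.action, perm₁₃, permAction, quadAction]

def dual₁₄ : QuadStep := ⟨true, perm₁₄, by decide⟩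

lemma dual₁₄_params (b : Fin 8 → ℂ) : dual₁₄.params b =
    ![b 0, -b 4, -b 5, b 3, -b 1, -b 2, -b 0 - b 3 - b 6, -b 0 - b 3 - b 7] := by
  funext m
  fin_cases m <;> simp [dual₁₄, QuadStep.params, perm₁₄, quadParameters, swapParameters] <;> ring

lemma dual₁₄_action (d e : ℤ) (c : Fin 8 → ℤ) : dual₁₄.action (d, e, c) =
    (d, d + e + c 0 + c 3, ![-d - c 0, c 4, c 5, -d - c 3, c 1, c 2, c 6, c 7]) := by
  refine Prod.ext ?_ (Prod.ext ?_ ?_)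
  · simp [dual₁₄, QuadStep.action, perm₁₄, permAction, quadAction, swapAction, swapIndex]
  · simp [dual₁₄, QuadStep.action, perm₁₄, permAction, quadAction, swapAction, swapIndex]
    ring
  · funext m
    fin_cases m <;> simp [dual₁₄, QuadStep.action, perm₁₄, permAction, quadAction, swapAction,
        swapIndex]

def quad₂₃ : QuadStep := ⟨false, perm₂₃, by decide⟩

lemma quad₂₃_params (b : Fin 8 → ℂ) : quad₂₃.params b =
    ![-b 6, b 1, b 2, -b 7, -b 1 - b 2 - b 4, -b 1 - b 2 - b 5, -b 0, -b 3] := by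
  funext m
  fin_cases m <;> simp [quad₂₃, QuadStep.params, perm₂₃, quadParameters]

lemma quad₂₃_action (d e : ℤ) (c : Fin 8 → ℤ) : quad₂₃.action (d, e, c) =
    (d + e + c 1 + c 2, e, ![c 6, -e - c 1, -e - c 2, c 7, c 4, c 5, c 0, c 3]) := by
  refine Prod.ext ?_ (Prod.ext ?_ ?_)
  · simp [quad₂₃, QuadStep.action, perm₂₃, permAction, quadAction]
  · simp [quad₂₃, QuadStep.action, perm₂₃, permAction, quadAction]
  · funext m
    fin_cases m <;> simp [quad₂₃, QuadStep.action, perm₂₃, permAction, quadAction]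

def dual₂₄ : QuadStep := ⟨true, perm₂₄, by decide⟩

lemma dual₂₄_params (b : Fin 8 → ℂ) : dual₂₄.params b =
    ![-b 4, b 1, -b 5, b 3, -b 0, -b 2, -b 1 - b 3 - b 6, -b 1 - b 3 - b 7] := by
  funext m
  fin_cases m <;> simp [dual₂₄, QuadStep.params, perm₂₄, quadParameters, swapParameters] <;> ring

lemma dual₂₄_action (d e : ℤ) (c : Fin 8 → ℤ) : dual₂₄.action (d, e, c) =
    (d, d + e + c 1 + c 3, ![c 4, -d - c 1, c 5, -d - c 3, c 0, c 2, c 6, c 7]) := by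
  refine Prod.ext ?_ (Prod.ext ?_ ?_)
  · simp [dual₂₄, QuadStep.action, perm₂₄, permAction, quadAction, swapAction, swapIndex]
  · simp [dual₂₄, QuadStep.action, perm₂₄, permAction, quadAction, swapAction, swapIndex]
    ring
  · funext m
    fin_cases m <;> simp [dual₂₄, QuadStep.action, perm₂₄, permAction, quadAction, swapAction,
        swapIndex]

/-- The word of the standard map. -/
def standardWord : List QuadStep := [dual₁₂, dual₃₄, dual₁₂, quad₁₂, quad₃₄, quad₁₂]

/-- The exchange of the centres within the last two pairs. -/
def standardPerm : Equiv.Perm (Fin 8) :=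
  ⟨![0, 1, 2, 3, 5, 4, 7, 6], ![0, 1, 2, 3, 5, 4, 7, 6], by decide, by decide⟩

/-- The standard map. -/
def standardEquiv (b : Fin 8 → ℂ) : K ≃ₐ[ℂ] K :=
  (standardWord.foldl Stage.advance (Stage.start b)).equiv

/-- The parameters after the first half of the standard map. -/
lemma standard_params_half (b : Fin 8 → ℂ) :
    dual₁₂.params (dual₃₄.params (dual₁₂.params b)) =
      ![b 2, b 3, b 0, b 1, b 4, b 5, b 7 - delta b, b 6 - delta b] := by
  rw [dual₁₂_params, dual₃₄_params, dual₁₂_params]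
  ext i
  fin_cases i <;> simp [delta, Fin.sum_univ_eight] <;> ring

lemma standard_params (b : Fin 8 → ℂ) :
    (standardWord.foldl Stage.advance (Stage.start b)).params ∘ standardPerm.symm = evolve b := by
  change quad₁₂.params (quad₃₄.params (quad₁₂.params
    (dual₁₂.params (dual₃₄.params (dual₁₂.params b))))) ∘ standardPerm.symm = _
  rw [standard_params_half, quad₁₂_params, quad₃₄_params, quad₁₂_params]
  ext i
  fin_cases i <;> simp [evolve, delta, Fin.sum_univ_eight, standardPerm] <;> ring

lemma Hf_eq : Hf = (1, 0, ![0, 0, 0, 0, 0, 0, 0, 0]) := by decide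

lemma Hg_eq : Hg = (0, 1, ![0, 0, 0, 0, 0, 0, 0, 0]) := by decide

lemma E_eq (i : Fin 8) : E i = (0, 0, ![if i = 0 then 1 else 0, if i = 1 then 1 else 0,
    if i = 2 then 1 else 0, if i = 3 then 1 else 0, if i = 4 then 1 else 0,
    if i = 5 then 1 else 0, if i = 6 then 1 else 0, if i = 7 then 1 else 0]) := by
  revert i
  decide

lemma permAction_mk (σ : Equiv.Perm (Fin 8)) (d e : ℤ) (c : Fin 8 → ℤ) :
    permAction σ (d, e, c) = (d, e, ![c (σ.symm 0), c (σ.symm 1), c (σ.symm 2), c (σ.symm 3),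
      c (σ.symm 4), c (σ.symm 5), c (σ.symm 6), c (σ.symm 7)]) := by
  refine Prod.ext rfl (Prod.ext rfl ?_)
  funext i
  fin_cases i <;> rfl

lemma standardAction_add (D D' : Pic) :
    standardAction (D + D') = standardAction D + standardAction D' :=
  extend_add _ _ _ _ _

/-- Both sides are additive, so this is a check on ten basis elements. -/
lemma standard_action (D : Pic) : permAction standardPerm (wordAction standardWord D) =
    standardAction D := by
  refine pic_ext (M := fun D => permAction standardPerm (wordAction standardWord D))
    (M' := standardAction) (fun D D' => ?_) standardAction_add ?_ ?_ (fun i => ?_) D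
  · simp only [wordAction_add, permAction_add]
  · have : standardAction Hf = (6, 3, ![-2, -2, -2, -2, -1, -1, -3, -3]) := by decide
    rw [this, Hf_eq]
    simp [wordAction, standardWord, dual₁₂_action, dual₃₄_action, quad₁₂_action, quad₃₄_action,
      permAction_mk, standardPerm]
  · have : standardAction Hg = (3, 1, ![-1, -1, -1, -1, 0, 0, -1, -1]) := by decide
    rw [this, Hg_eq]
    simp [wordAction, standardWord, dual₁₂_action, dual₃₄_action, quad₁₂_action, quad₃₄_action,
      permAction_mk, standardPerm]
  · have : standardAction (E i) = ![(2, 1, ![0, -1, -1, -1, 0, 0, -1, -1]),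
        (2, 1, ![-1, 0, -1, -1, 0, 0, -1, -1]), (2, 1, ![-1, -1, 0, -1, 0, 0, -1, -1]),
        (2, 1, ![-1, -1, -1, 0, 0, 0, -1, -1]), (3, 1, ![-1, -1, -1, -1, 0, -1, -1, -1]),
        (3, 1, ![-1, -1, -1, -1, -1, 0, -1, -1]), (1, 0, ![0, 0, 0, 0, 0, 0, 0, -1]),
        (1, 0, ![0, 0, 0, 0, 0, 0, -1, 0])] i := by
      revert i
      decide
    rw [this, E_eq]
    fin_cases i <;>
      simp [wordAction, standardWord, dual₁₂_action, dual₃₄_action, quad₁₂_action, quad₃₄_action,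
        permAction_mk, standardPerm]

lemma standard_surfaceIso {b : Fin 8 → ℂ} (hb : Function.Injective (center b))
    (h : Stage.Admissible standardWord b) :
    SurfaceIso b (evolve b) (standardEquiv b) standardAction :=
  surfaceIso_word hb h (by decide) (standard_params b) standard_action

/-- With g fixed, the first three steps give (f + g)(F₁ + g), (F₁ + g)(F₂ + g) and (F₂ + g)(F₃ + g)
as products of two linear factors in g. Multiplying the first and third and dividing by the second
yields the formula for F₃ = f̄. The last three steps, with f̄ fixed, yield ḡ in the same way. -/
lemma standard_isStandardDP (b : Fin 8 → ℂ) : IsStandardDP b (standardEquiv b) := by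
  obtain ⟨S₀, hS₀⟩ : ∃ S, S = Stage.start b := ⟨_, rfl⟩
  obtain ⟨S₁, hS₁⟩ : ∃ S, S = S₀.advance dual₁₂ := ⟨_, rfl⟩
  obtain ⟨S₂, hS₂⟩ : ∃ S, S = S₁.advance dual₃₄ := ⟨_, rfl⟩
  obtain ⟨S₃, hS₃⟩ : ∃ S, S = S₂.advance dual₁₂ := ⟨_, rfl⟩
  obtain ⟨S₄, hS₄⟩ : ∃ S, S = S₃.advance quad₁₂ := ⟨_, rfl⟩
  obtain ⟨S₅, hS₅⟩ : ∃ S, S = S₄.advance quad₃₄ := ⟨_, rfl⟩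
  obtain ⟨S₆, hS₆⟩ : ∃ S, S = S₅.advance quad₁₂ := ⟨_, rfl⟩
  have hE : standardEquiv b = S₆.equiv := by
    rw [hS₆, hS₅, hS₄, hS₃, hS₂, hS₁, hS₀]
    rfl
  have hf0 : S₀.equiv f = f := by rw [hS₀]; rfl
  have hg0 : S₀.equiv g = g := by rw [hS₀]; rfl
  obtain ⟨g1, r1⟩ := S₀.advance_true dual₁₂.preserves
  obtain ⟨g2, r2⟩ := S₁.advance_true dual₃₄.preserves
  obtain ⟨g3, r3⟩ := S₂.advance_true dual₁₂.preserves
  obtain ⟨f4, r4⟩ := S₃.advance_false quad₁₂.preserves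
  obtain ⟨f5, r5⟩ := S₄.advance_false quad₃₄.preserves
  obtain ⟨f6, r6⟩ := S₅.advance_false quad₁₂.preserves
  change (S₀.advance dual₁₂).equiv g = _ at g1
  change (S₀.equiv f + S₀.equiv g) * ((S₀.advance dual₁₂).equiv f + S₀.equiv g) = _ at r1
  change (S₁.advance dual₃₄).equiv g = _ at g2
  change (S₁.equiv f + S₁.equiv g) * ((S₁.advance dual₃₄).equiv f + S₁.equiv g) = _ at r2
  change (S₂.advance dual₁₂).equiv g = _ at g3
  change (S₂.equiv f + S₂.equiv g) * ((S₂.advance dual₁₂).equiv f + S₂.equiv g) = _ at r3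
  change (S₃.advance quad₁₂).equiv f = _ at f4
  change (S₃.equiv f + S₃.equiv g) * (S₃.equiv f + (S₃.advance quad₁₂).equiv g) = _ at r4
  change (S₄.advance quad₃₄).equiv f = _ at f5
  change (S₄.equiv f + S₄.equiv g) * (S₄.equiv f + (S₄.advance quad₃₄).equiv g) = _ at r5
  change (S₅.advance quad₁₂).equiv f = _ at f6
  change (S₅.equiv f + S₅.equiv g) * (S₅.equiv f + (S₅.advance quad₁₂).equiv g) = _ at r6
  rw [← hS₁] at g1 r1
  rw [← hS₂] at g2 r2
  rw [← hS₃] at g3 r3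
  rw [← hS₄] at f4 r4
  rw [← hS₅] at f5 r5
  rw [← hS₆] at f6 r6
  have p0 : S₀.params = b := by rw [hS₀]; rfl
  have p1 : S₁.params = ![b 0, b 1, -b 4, -b 5, -b 2, -b 3, -b 0 - b 1 - b 6,
      -b 0 - b 1 - b 7] := by
    rw [hS₁, ← dual₁₂_params, ← p0]; rfl
  have p2 : S₂.params 0 = b 2 ∧ S₂.params 1 = b 3 := by
    have : S₂.params = dual₃₄.params S₁.params := by rw [hS₂]; rfl
    rw [this, dual₃₄_params, p1]
    simp
  have p3 : S₃.params = ![b 2, b 3, b 0, b 1, b 4, b 5, b 7 - delta b, b 6 - delta b] := by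
    rw [← standard_params_half, hS₃, hS₂, hS₁, hS₀]; rfl
  have p4 : S₄.params = ![b 2, b 3, -(b 7 - delta b), -(b 6 - delta b), -b 2 - b 3 - b 4,
      -b 2 - b 3 - b 5, -b 0, -b 1] := by
    have : S₄.params = quad₁₂.params S₃.params := by rw [hS₄]; rfl
    rw [this, quad₁₂_params, p3]
    simp
  have p5 : S₅.params 0 = b 0 ∧ S₅.params 1 = b 1 := by
    have : S₅.params = quad₃₄.params S₄.params := by rw [hS₅]; rfl
    rw [this, quad₃₄_params, p4]
    simp
  have n0 := S₀.add_ne_zero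
  have n1 := S₁.add_ne_zero
  have n2 := S₂.add_ne_zero
  have n3 := S₃.add_ne_zero
  have n4 := S₄.add_ne_zero
  have n5 := S₅.add_ne_zero
  have n6 := S₆.add_ne_zero
  simp only [p0, p1, p2, p3, p4, p5, hf0, hg0, dual₁₂, dual₃₄, quad₁₂, quad₃₄, perm₁₂, perm₃₄,
    swapParameters, Equiv.refl_apply, Equiv.coe_fn_mk, Matrix.cons_val, const_neg,
    sub_neg_eq_add, g1, g2, g3, f4, f5, f6] at r1 r2 r3 r4 r5 r6 n0 n1 n2 n3 n4 n5 n6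
  unfold IsStandardDP
  rw [hE, f6, f5, f4]
  have n4' : g + -const (b 4) ≠ 0 ∧ g + -const (b 5) ≠ 0 :=
    mul_ne_zero_iff.1 (r2 ▸ mul_ne_zero n1 n2)
  have n5' := mul_ne_zero_iff.1 (r5 ▸ mul_ne_zero n4 n5)
  rw [eq_div_iff (by simpa [sub_eq_add_neg] using n4'), eq_div_iff (by simpa using n5'.symm)]
  constructor
  -- Multiplying by the intermediate product lets the three step relations be substituted directly.
  · refine mul_left_cancel₀ (mul_ne_zero n1 n2) ?_
    calc _ = ((f + g) * (S₁.equiv f + g)) * ((S₂.equiv f + g) * (S₃.equiv f + g)) *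
          ((g + -const (b 4)) * (g + -const (b 5))) := by ring
      _ = _ := by
        rw [r1, r3, r2]
        ring
  · refine mul_left_cancel₀ (mul_ne_zero n4 n5) ?_
    calc _ = ((S₃.equiv f + g) * (S₃.equiv f + S₄.equiv g)) *
          ((S₃.equiv f + S₅.equiv g) * (S₃.equiv f + S₆.equiv g)) *
          ((S₃.equiv f + const (b 7 - delta b)) * (S₃.equiv f + const (b 6 - delta b))) := by ring
      _ = _ := by
        rw [r4, r6, r5]
        ring

end SchlesingerA2

end

/-! ### The transformation {2 1; 1 1} as a word of seven steps. -/

noncomputable section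

namespace SchlesingerA2

/-! ### The elementary Schlesinger transformation as a word -/

/-- The word of the elementary transformation `{2 1; 1 1}`, up to exchange of the factors. -/
def elementaryWord : List QuadStep := [dual₁₂, quad₁₃, dual₁₄, quad₂₃, dual₁₄, quad₃₄, dual₂₄]

/-- The permutation of the centres after the word. -/
def elementaryPerm : Equiv.Perm (Fin 8) :=
  ⟨![3, 1, 2, 0, 5, 4, 7, 6], ![3, 1, 2, 0, 5, 4, 7, 6], by decide, by decide⟩

/-- The translation of the coordinates after the word. -/
def elementaryShift (b : Fin 8 → ℂ) : ℂ := 3 * b 0 + b 1 + b 5 + b 7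

/-- The stage before the exchange of the factors. -/
def elementaryStage (b : Fin 8 → ℂ) : Stage := elementaryWord.foldl Stage.advance (Stage.start b)

/-- The birational map of the elementary transformation `{2 1; 1 1}`. -/
def elementaryEquiv (b : Fin 8 → ℂ) : K ≃ₐ[ℂ] K :=
  (shiftEquiv (elementaryShift b)).trans (swapEquiv.trans (elementaryStage b).equiv)

/-- The parameters after the elementary transformation `{2 1; 1 1}`. -/
def elementaryParameters (b : Fin 8 → ℂ) : Fin 8 → ℂ :=
  ![b 0, b 1, b 2, b 3, b 4 + delta b, b 5, b 6 - delta b, b 7]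

lemma elementary_params (b : Fin 8 → ℂ) :
    shiftParameters (elementaryShift b) (swapParameters (elementaryStage b).params) ∘
      elementaryPerm.symm = elementaryParameters b := by
  have : (elementaryStage b).params = dual₂₄.params (quad₃₄.params (dual₁₄.params
    (quad₂₃.params (dual₁₄.params (quad₁₃.params (dual₁₂.params b)))))) := rfl
  rw [this, dual₁₂_params, quad₁₃_params, dual₁₄_params, quad₂₃_params, dual₁₄_params,
    quad₃₄_params, dual₂₄_params]
  ext i
  fin_cases i <;> simp [elementaryPerm, shiftParameters, swapParameters, elementaryShift,
    elementaryParameters, delta, Fin.sum_univ_eight] <;> ring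

/-- The action of the elementary transformation `{2 1; 1 1}` on the Picard lattice. -/
def elementaryAction (D : Pic) : Pic :=
  permAction elementaryPerm (swapAction (wordAction elementaryWord D))

lemma elementaryAction_add (D D' : Pic) :
    elementaryAction (D + D') = elementaryAction D + elementaryAction D' := by
  rw [elementaryAction, wordAction_add, swapAction_add, permAction_add]
  rfl

lemma schlesingerAction_add (D D' : Pic) :
    schlesingerAction (D + D') = schlesingerAction D + schlesingerAction D' :=
  extend_add _ _ _ _ _

lemma swapAction_mk (d e : ℤ) (c : Fin 8 → ℤ) :
    swapAction (d, e, c) = (e, d, ![c 0, c 1, c 2, c 3, c 6, c 7, c 4, c 5]) := by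
  refine Prod.ext rfl (Prod.ext rfl ?_)
  funext i
  fin_cases i <;> rfl

/-- The word realises {2 1; 1 1}, the inverse of the transformation in question. This one-sided
inverse on the lattice is all that reversing an isomorphism requires. -/
lemma elementaryAction_schlesingerAction (D : Pic) :
    elementaryAction (schlesingerAction D) = D := by
  refine pic_ext (M := fun D => elementaryAction (schlesingerAction D)) (M' := fun D => D)
    (fun D D' => ?_) (fun _ _ => rfl) ?_ ?_ (fun i => ?_) D
  · rw [schlesingerAction_add, elementaryAction_add]
  · have : schlesingerAction Hf = (2, 3, ![-1, -1, -1, -1, -2, 0, 0, -2]) := by decide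
    rw [this, Hf_eq]
    simp [elementaryAction, wordAction, elementaryWord, dual₁₂_action, quad₁₃_action,
      dual₁₄_action, quad₂₃_action, quad₃₄_action, dual₂₄_action, permAction_mk, swapAction_mk,
      elementaryPerm]
  · have : schlesingerAction Hg = (3, 5, ![-2, -2, -2, -2, -3, -1, 0, -2]) := by decide
    rw [this, Hg_eq]
    simp [elementaryAction, wordAction, elementaryWord, dual₁₂_action, quad₁₃_action,
      dual₁₄_action, quad₂₃_action, quad₃₄_action, dual₂₄_action, permAction_mk, swapAction_mk,
      elementaryPerm]
  · have : schlesingerAction (E i) = ![(1, 2, ![0, -1, -1, -1, -1, 0, 0, -1]),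
        (1, 2, ![-1, 0, -1, -1, -1, 0, 0, -1]), (1, 2, ![-1, -1, 0, -1, -1, 0, 0, -1]),
        (1, 2, ![-1, -1, -1, 0, -1, 0, 0, -1]), (0, 0, ![0, 0, 0, 0, 0, 0, 1, 0]),
        (2, 2, ![-1, -1, -1, -1, -2, 0, 0, -1]), (2, 3, ![-1, -1, -1, -1, -2, -1, 0, -2]),
        (0, 1, ![0, 0, 0, 0, -1, 0, 0, 0])] i := by
      revert i
      decide
    rw [this, E_eq]
    fin_cases i <;>
      simp [elementaryAction, wordAction, elementaryWord, dual₁₂_action, quad₁₃_action,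
        dual₁₄_action, quad₂₃_action, quad₃₄_action, dual₂₄_action, permAction_mk, swapAction_mk,
        elementaryPerm]

lemma surfaceIso_word_swap {b b' : Fin 8 → ℂ} (hb : Function.Injective (center b))
    {w : List QuadStep} (h : Stage.Admissible w b) (c : ℂ) {σ : Equiv.Perm (Fin 8)}
    (hσ : PreservesGroups σ) (hp : shiftParameters c
      (swapParameters (w.foldl Stage.advance (Stage.start b)).params) ∘ σ.symm = b') :
    SurfaceIso b b' ((shiftEquiv c).trans (swapEquiv.trans
      (w.foldl Stage.advance (Stage.start b)).equiv))
      (fun D => permAction σ (swapAction (wordAction w D))) := by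
  have h1 := Stage.surfaceIso_foldl w (Stage.start b) (Stage.surfaceIso_start hb) h
  have h2 := h1.trans (surfaceIso_swap h1.target)
  have h3 := h2.trans (surfaceIso_shift c h2.target)
  have h4 := h3.trans (surfaceIso_perm h3.target hσ)
  rw [hp] at h4
  have e : (fun D => permAction σ (id (swapAction
      ((w.foldl Stage.advance (Stage.start b)).action D)))) =
      fun D => permAction σ (swapAction (wordAction w D)) := by
    funext D
    rw [Stage.foldl_action]
    rfl
  have e' : ∀ Ψ : K ≃ₐ[ℂ] K, (AlgEquiv.refl : K ≃ₐ[ℂ] K).trans Ψ = Ψ :=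
    fun Ψ => AlgEquiv.ext fun _ => rfl
  rw [e, e'] at h4
  exact h4

lemma elementary_surfaceIso {b : Fin 8 → ℂ} (hb : Function.Injective (center b))
    (h : Stage.Admissible elementaryWord b) :
    SurfaceIso b (elementaryParameters b) (elementaryEquiv b) elementaryAction := by
  have hp := elementary_params b
  rw [elementaryStage] at hp
  exact surfaceIso_word_swap hb h (elementaryShift b) (by decide) hp

lemma const_two : const 2 = 2 := map_ofNat (algebraMap ℂ K) 2

lemma const_three : const 3 = 3 := map_ofNat (algebraMap ℂ K) 3

/-- The intermediate coordinates of the word. -/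
structure ElementaryChain (b : Fin 8 → ℂ) (F₁ F₂ F₃ F₄ G₁ G₂ G₃ : K) : Prop where
  r₁ : (f + g) * (F₁ + g) = (g + const (b 0)) * (g + const (b 1))
  r₂ : (F₁ + g) * (F₁ + G₁) = (F₁ - const (b 0)) * (F₁ + const (b 4))
  r₃ : (F₁ + G₁) * (F₂ + G₁) = (G₁ + const (b 0)) * (G₁ + const (b 0 + b 1 + b 7))
  r₄ : (F₂ + G₁) * (F₂ + G₂) =
    (F₂ - const (b 0 - b 2 - b 4)) * (F₂ - const (b 0 - b 3 - b 4))
  r₅ : (F₂ + G₂) * (F₃ + G₂) =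
    (G₂ + const (2 * b 0 + b 7)) * (G₂ + const (2 * b 0 + b 1 + b 5 + b 7))
  r₆ : (F₃ + G₂) * (F₃ + G₃) =
    (F₃ - const (2 * b 0 - b 2 - b 3 - b 4)) * (F₃ - const (2 * b 0 + b 1 + b 5 + b 7))
  r₇ : (F₃ + G₃) * (F₄ + G₃) =
    (G₃ + const (3 * b 0 + b 5 + b 7)) * (G₃ + const (2 * b 0 + b 1 + b 5 + b 7))
  n₁ : F₁ + g ≠ 0
  n₂ : F₁ + G₁ ≠ 0
  n₃ : F₂ + G₁ ≠ 0
  n₄ : F₂ + G₂ ≠ 0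
  n₅ : F₃ + G₂ ≠ 0
  n₆ : F₃ + G₃ ≠ 0
  n₇ : F₄ + G₃ ≠ 0
  coord : IsCoord F₂ G₁
  f_eq : elementaryEquiv b f = G₃ + const (elementaryShift b)
  g_eq : elementaryEquiv b g = F₄ - const (elementaryShift b)

/-- At each of the seven steps one coordinate is carried over, so the word is a zigzag F₁, G₁, F₂,
G₂, F₃, G₃, F₄ with one product relation per step; exchange and translation then turn G₃ and F₄ into
the new f and g. -/
lemma exists_elementaryChain (b : Fin 8 → ℂ) :
    ∃ F₁ F₂ F₃ F₄ G₁ G₂ G₃, ElementaryChain b F₁ F₂ F₃ F₄ G₁ G₂ G₃ := by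
  obtain ⟨S₀, hS₀⟩ : ∃ S, S = Stage.start b := ⟨_, rfl⟩
  obtain ⟨S₁, hS₁⟩ : ∃ S, S = S₀.advance dual₁₂ := ⟨_, rfl⟩
  obtain ⟨S₂, hS₂⟩ : ∃ S, S = S₁.advance quad₁₃ := ⟨_, rfl⟩
  obtain ⟨S₃, hS₃⟩ : ∃ S, S = S₂.advance dual₁₄ := ⟨_, rfl⟩
  obtain ⟨S₄, hS₄⟩ : ∃ S, S = S₃.advance quad₂₃ := ⟨_, rfl⟩
  obtain ⟨S₅, hS₅⟩ : ∃ S, S = S₄.advance dual₁₄ := ⟨_, rfl⟩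
  obtain ⟨S₆, hS₆⟩ : ∃ S, S = S₅.advance quad₃₄ := ⟨_, rfl⟩
  obtain ⟨S₇, hS₇⟩ : ∃ S, S = S₆.advance dual₂₄ := ⟨_, rfl⟩
  have hE : (elementaryStage b).equiv = S₇.equiv := by
    rw [hS₇, hS₆, hS₅, hS₄, hS₃, hS₂, hS₁, hS₀]
    rfl
  have hf0 : S₀.equiv f = f := by rw [hS₀]; rfl
  have hg0 : S₀.equiv g = g := by rw [hS₀]; rfl
  obtain ⟨g1, r1⟩ := S₀.advance_true dual₁₂.preserves
  obtain ⟨f2, r2⟩ := S₁.advance_false quad₁₃.preserves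
  obtain ⟨g3, r3⟩ := S₂.advance_true dual₁₄.preserves
  obtain ⟨f4, r4⟩ := S₃.advance_false quad₂₃.preserves
  obtain ⟨g5, r5⟩ := S₄.advance_true dual₁₄.preserves
  obtain ⟨f6, r6⟩ := S₅.advance_false quad₃₄.preserves
  obtain ⟨g7, r7⟩ := S₆.advance_true dual₂₄.preserves
  change (S₀.advance dual₁₂).equiv g = _ at g1
  change (S₀.equiv f + S₀.equiv g) * ((S₀.advance dual₁₂).equiv f + S₀.equiv g) = _ at r1
  change (S₁.advance quad₁₃).equiv f = _ at f2
  change (S₁.equiv f + S₁.equiv g) * (S₁.equiv f + (S₁.advance quad₁₃).equiv g) = _ at r2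
  change (S₂.advance dual₁₄).equiv g = _ at g3
  change (S₂.equiv f + S₂.equiv g) * ((S₂.advance dual₁₄).equiv f + S₂.equiv g) = _ at r3
  change (S₃.advance quad₂₃).equiv f = _ at f4
  change (S₃.equiv f + S₃.equiv g) * (S₃.equiv f + (S₃.advance quad₂₃).equiv g) = _ at r4
  change (S₄.advance dual₁₄).equiv g = _ at g5
  change (S₄.equiv f + S₄.equiv g) * ((S₄.advance dual₁₄).equiv f + S₄.equiv g) = _ at r5
  change (S₅.advance quad₃₄).equiv f = _ at f6
  change (S₅.equiv f + S₅.equiv g) * (S₅.equiv f + (S₅.advance quad₃₄).equiv g) = _ at r6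
  change (S₆.advance dual₂₄).equiv g = _ at g7
  change (S₆.equiv f + S₆.equiv g) * ((S₆.advance dual₂₄).equiv f + S₆.equiv g) = _ at r7
  rw [← hS₁] at g1 r1
  rw [← hS₂] at f2 r2
  rw [← hS₃] at g3 r3
  rw [← hS₄] at f4 r4
  rw [← hS₅] at g5 r5
  rw [← hS₆] at f6 r6
  rw [← hS₇] at g7 r7
  have p0 : S₀.params = b := by rw [hS₀]; rfl
  have p1 : S₁.params = dual₁₂.params b := by rw [hS₁, ← p0]; rfl
  have p2 : S₂.params = quad₁₃.params S₁.params := by rw [hS₂]; rfl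
  have p3 : S₃.params = dual₁₄.params S₂.params := by rw [hS₃]; rfl
  have p4 : S₄.params = quad₂₃.params S₃.params := by rw [hS₄]; rfl
  have p5 : S₅.params = dual₁₄.params S₄.params := by rw [hS₅]; rfl
  have p6 : S₆.params = quad₃₄.params S₅.params := by rw [hS₆]; rfl
  rw [dual₁₂_params] at p1
  rw [p1, quad₁₃_params] at p2
  rw [p2, dual₁₄_params] at p3
  rw [p3, quad₂₃_params] at p4
  rw [p4, dual₁₄_params] at p5
  rw [p5, quad₃₄_params] at p6
  have n1 := S₁.add_ne_zero
  have n2 := S₂.add_ne_zero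
  have n3 := S₃.add_ne_zero
  have n4 := S₄.add_ne_zero
  have n5 := S₅.add_ne_zero
  have n6 := S₆.add_ne_zero
  have n7 := S₇.add_ne_zero
  refine ⟨S₁.equiv f, S₃.equiv f, S₅.equiv f, S₇.equiv f, S₂.equiv g, S₄.equiv g, S₆.equiv g, ?_⟩
  simp only [p0, p1, p2, p3, p4, p5, p6, hf0, hg0, dual₁₂, dual₁₄, dual₂₄, quad₁₃, quad₂₃, quad₃₄,
    perm₁₂, perm₁₃, perm₁₄, perm₂₃, perm₂₄, perm₃₄,
    swapParameters, Equiv.refl_apply, Equiv.coe_fn_mk, Matrix.cons_val, const_neg,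
    sub_neg_eq_add, g1, f2, g3, f4, g5, f6, g7] at r1 r2 r3 r4 r5 r6 r7 n1 n2 n3 n4 n5 n6 n7
  refine ⟨?_, ?_, ?_, ?_, ?_, ?_, ?_, n1, n2, n3, n4, n5, n6, n7, ?_, ?_, ?_⟩
  · exact r1
  · exact r2
  · simp only [const_add, const_sub, const_mul, const_neg, const_two, const_three] at r3 ⊢
    linear_combination r3
  · simp only [const_add, const_sub, const_mul, const_neg, const_two, const_three] at r4 ⊢
    linear_combination r4
  · simp only [const_add, const_sub, const_mul, const_neg, const_two, const_three] at r5 ⊢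
    linear_combination r5
  · simp only [const_add, const_sub, const_mul, const_neg, const_two, const_three] at r6 ⊢
    linear_combination r6
  · simp only [const_add, const_sub, const_mul, const_neg, const_two, const_three] at r7 ⊢
    linear_combination r7
  · rw [← g3]
    exact isCoord_map isCoord_f_g S₃.equiv
  · rw [elementaryEquiv, AlgEquiv.trans_apply, AlgEquiv.trans_apply, hE]
    simp [g7, map_const]
  · rw [elementaryEquiv, AlgEquiv.trans_apply, AlgEquiv.trans_apply, hE]
    simp [map_const]

end SchlesingerA2

end

/-! ### Eliminating the intermediate coordinates of the word. -/

noncomputable section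

namespace SchlesingerA2

/-! ### Relations between the coordinates before and after the elementary transformation -/

section
variable {k : Type*} [Field k]

/-- F₁ is eliminated from the first three steps. In the centred variables u = F₂ - (b₁ + b₂ + b₈)
and v = G₁ + (b₁ + b₂ + b₈) one has F₂ + G₁ = u + v, and both g and (f + g)(g - b₅) become rational
in u and v. -/
lemma chain_half_left {b₁ b₂ b₅ b₈ f g F₁ F₂ G₁ : k}
    (r₁ : (f + g) * (F₁ + g) = (g + b₁) * (g + b₂))
    (r₂ : (F₁ + g) * (F₁ + G₁) = (F₁ - b₁) * (F₁ + b₅))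
    (r₃ : (F₁ + G₁) * (F₂ + G₁) = (G₁ + b₁) * (G₁ + (b₁ + b₂ + b₈)))
    (n₁ : F₁ + g ≠ 0) (n₂ : F₁ + G₁ ≠ 0) (n₃ : F₂ + G₁ ≠ 0) :
    G₁ + (b₁ + b₂ + b₈) ≠ 0 ∧ F₂ - (b₁ + b₂ + b₈) ≠ 0 ∧
    g * (G₁ + (b₁ + b₂ + b₈)) = (F₂ - (b₁ + b₂ + b₈) - b₁) * (G₁ + (b₁ + b₂ + b₈)) -
      (F₂ - (b₁ + b₂ + b₈)) * (b₁ + b₂ + b₅ + b₈) ∧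
    (f + g) * (g - b₅) * (F₂ - (b₁ + b₂ + b₈)) = (g + b₁) * (g + b₂) * (F₂ + G₁) := by
  obtain ⟨u, hu⟩ : ∃ u, u = F₂ - (b₁ + b₂ + b₈) := ⟨_, rfl⟩
  obtain ⟨v, hv⟩ : ∃ v, v = G₁ + (b₁ + b₂ + b₈) := ⟨_, rfl⟩
  obtain ⟨w, hw⟩ : ∃ w, w = F₂ + G₁ := ⟨_, rfl⟩
  have hwuv : w = u + v := by rw [hw, hu, hv]; ring
  rw [← hu, ← hv, ← hw]
  rw [← hw, ← hv] at r₃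
  rw [← hw] at n₃
  have hm : (G₁ + b₁) * v ≠ 0 := r₃ ▸ mul_ne_zero n₂ n₃
  have hG : G₁ + b₁ ≠ 0 := left_ne_zero_of_mul hm
  have hv0 : v ≠ 0 := right_ne_zero_of_mul hm
  have h1 : (F₁ - b₁) * w = -(u * (G₁ + b₁)) := by
    have : F₁ * w = (G₁ + b₁) * v - G₁ * w := by linear_combination r₃
    rw [hwuv] at *
    linear_combination this
  have h2 : (F₁ + g) * v = -(u * (F₁ + b₅)) := by
    refine mul_left_cancel₀ hG ?_
    linear_combination w * r₂ - (F₁ + g) * r₃ + (F₁ + b₅) * h1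
  have hg : (g - b₅) * v = -((F₁ + b₅) * w) := by
    rw [hwuv]
    linear_combination h2
  have h3 : (F₁ + g) * w = u * (g - b₅) := by
    refine mul_left_cancel₀ hv0 ?_
    linear_combination w * h2 - u * hg
  have hu0 : u ≠ 0 := by
    intro h
    rw [h, zero_mul] at h3
    exact mul_ne_zero n₁ n₃ h3
  refine ⟨hv0, hu0, ?_, ?_⟩
  · have e : G₁ = v - (b₁ + b₂ + b₈) := by rw [hv]; ring
    rw [e] at h1
    rw [hwuv] at h1 hg
    linear_combination hg - h1
  · linear_combination w * r₁ - (f + g) * h3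

/-- The last three steps read backwards have the shape of the first three, after changing signs,
translating by 3b₁ + b₂ + b₆ + b₈ and putting b₇, b₆ in place of b₅, b₈. -/
lemma chain_half_right {b₁ b₂ b₃ b₄ b₅ b₆ b₇ b₈ F₂ F₃ F₄ G₂ G₃ : k}
    (hb : b₁ + b₂ + b₃ + b₄ + b₅ + b₆ + b₇ + b₈ = 0)
    (r₅ : (F₂ + G₂) * (F₃ + G₂) =
      (G₂ + (2 * b₁ + b₈)) * (G₂ + (2 * b₁ + b₂ + b₆ + b₈)))
    (r₆ : (F₃ + G₂) * (F₃ + G₃) =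
      (F₃ - (2 * b₁ - b₃ - b₄ - b₅)) * (F₃ - (2 * b₁ + b₂ + b₆ + b₈)))
    (r₇ : (F₃ + G₃) * (F₄ + G₃) =
      (G₃ + (3 * b₁ + b₆ + b₈)) * (G₃ + (2 * b₁ + b₂ + b₆ + b₈)))
    (n₄ : F₂ + G₂ ≠ 0) (n₅ : F₃ + G₂ ≠ 0) (n₆ : F₃ + G₃ ≠ 0) :
    G₂ + (2 * b₁ + b₈) ≠ 0 ∧ F₂ - (2 * b₁ + b₈) ≠ 0 ∧
    (G₃ + (3 * b₁ + b₂ + b₆ + b₈)) * (G₂ + (2 * b₁ + b₈)) =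
      (F₂ - (2 * b₁ + b₈) + b₁) * (G₂ + (2 * b₁ + b₈)) +
        (F₂ - (2 * b₁ + b₈)) * (b₁ + b₂ + b₆ + b₇) ∧
    (F₄ + G₃) * (G₃ + (3 * b₁ + b₂ + b₆ + b₈) + b₇) * (F₂ - (2 * b₁ + b₈)) =
      (G₃ + (3 * b₁ + b₂ + b₆ + b₈) - b₁) * (G₃ + (3 * b₁ + b₂ + b₆ + b₈) - b₂) * (F₂ + G₂) := by
  have h := chain_half_left (b₁ := b₁) (b₂ := b₂) (b₅ := b₇) (b₈ := b₆)
    (f := -(F₄ - (3 * b₁ + b₂ + b₆ + b₈))) (g := -(G₃ + (3 * b₁ + b₂ + b₆ + b₈)))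
    (F₁ := -(F₃ - (3 * b₁ + b₂ + b₆ + b₈))) (F₂ := -F₂ + (3 * b₁ + b₂ + b₆ + b₈))
    (G₁ := -(G₂ + (3 * b₁ + b₂ + b₆ + b₈)))
    (by linear_combination r₇)
    (by linear_combination r₆ + (F₃ - (2 * b₁ + b₂ + b₆ + b₈)) * hb)
    (by linear_combination r₅)
    (by intro h; apply n₆; linear_combination -h)
    (by intro h; apply n₅; linear_combination -h)
    (by intro h; apply n₄; linear_combination -h)
  obtain ⟨h1, h2, h3, h4⟩ := h
  refine ⟨?_, ?_, ?_, ?_⟩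
  · intro h
    apply h1
    linear_combination -h
  · intro h
    apply h2
    linear_combination -h
  · linear_combination h3
  · linear_combination -h4

/-- This and `chain_left_identity` bring the two sides of `chain_relation` to the same form in u, u
+ v and u' + v'; the middle step of the word then identifies them. -/
lemma chain_right_identity {b₁ b₂ b₆ b₇ u u' v' f₁ : k} (nv' : v' ≠ 0) (hu : u' = u + b₂ - b₁)
    (hf : f₁ = u' + b₁ + u' * (b₁ + b₂ + b₆ + b₇) / v') :
    (v' + b₁ + b₂ + b₆ + b₇) * (f₁ - b₂) * (u' + v') / v' - (f₁ + b₇) * (f₁ + b₆) =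
      u * (u' + v') - (u - b₁ - b₆) * (u - b₁ - b₇) := by
  subst hf hu
  field_simp
  ring

lemma chain_left_identity {b₁ b₂ b₃ b₄ b₅ b₆ b₇ b₈ u v w g : k}
    (hb : b₁ + b₂ + b₃ + b₄ + b₅ + b₆ + b₇ + b₈ = 0) (nv : v ≠ 0) (nw : w ≠ 0) (hw : w = u + v)
    (hg : g = u - b₁ - u * (b₁ + b₂ + b₅ + b₈) / v) :
    (g - b₆) * (b₇ - g) + (g + b₃) * (g + b₄) * u / w =
      u * ((u + b₂ + b₃ + b₅ + b₈) * (u + b₂ + b₄ + b₅ + b₈)) / w -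
        (u - b₁ - b₆) * (u - b₁ - b₇) := by
  obtain rfl : b₄ = -(b₁ + b₂ + b₃ + b₅ + b₆ + b₇ + b₈) := by linear_combination hb
  obtain rfl : v = w - u := by linear_combination -hw
  subst hg
  field_simp
  ring

/-- The left side is computed from the second half of the word, the right side from the first half.
Both equal u (u' + v') - (u - b₁ - b₆)(u - b₁ - b₇), once the relation `hw` of the middle step is
used. -/
lemma chain_relation {b₁ b₂ b₃ b₄ b₅ b₆ b₇ b₈ g h f₁ g₁ u v u' v' : k}
    (hb : b₁ + b₂ + b₃ + b₄ + b₅ + b₆ + b₇ + b₈ = 0) (hu : u' = u + b₂ - b₁)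
    (nv : v ≠ 0) (nv' : v' ≠ 0) (nu' : u' ≠ 0) (nw : u + v ≠ 0)
    (hg : g * v = (u - b₁) * v - u * (b₁ + b₂ + b₅ + b₈))
    (hf : f₁ * v' = (u' + b₁) * v' + u' * (b₁ + b₂ + b₆ + b₇))
    (hw : (u + v) * (u' + v') = (u + b₂ + b₃ + b₅ + b₈) * (u + b₂ + b₄ + b₅ + b₈))
    (hh : (h + g) * (g - b₆) * (u + v) = u * ((g + b₃) * (g + b₄)))
    (hg₁ : (g₁ + f₁) * (f₁ + b₇) * u' = (f₁ - b₁) * (f₁ - b₂) * (u' + v')) :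
    (f₁ + b₇) * (g₁ - b₆) = (h + b₇) * (g - b₆) := by
  have e1 := chain_right_identity (b₁ := b₁) (b₂ := b₂) (b₆ := b₆) (b₇ := b₇) (f₁ := f₁) nv' hu
    (by rw [← mul_left_inj' nv', hf]; field_simp)
  have e2 := chain_left_identity (b₁ := b₁) (b₂ := b₂) (b₃ := b₃) (b₄ := b₄) (b₅ := b₅) (b₆ := b₆)
    (b₇ := b₇) (b₈ := b₈) (g := g) hb nv nw rfl (by rw [← mul_left_inj' nv, hg]; field_simp)
  rw [← hw] at e2
  have e3 : (f₁ + b₇) * (g₁ - b₆) =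
      (v' + b₁ + b₂ + b₆ + b₇) * (f₁ - b₂) * (u' + v') / v' - (f₁ + b₇) * (f₁ + b₆) := by
    have : (g₁ + f₁) * (f₁ + b₇) = (v' + b₁ + b₂ + b₆ + b₇) * (f₁ - b₂) * (u' + v') / v' := by
      rw [eq_div_iff nv']
      refine mul_right_cancel₀ nu' ?_
      linear_combination v' * hg₁ + (f₁ - b₂) * (u' + v') * hf
    linear_combination this
  have e4 : (h + b₇) * (g - b₆) =
      (g - b₆) * (b₇ - g) + (g + b₃) * (g + b₄) * u / (u + v) := by
    have : (h + g) * (g - b₆) = (g + b₃) * (g + b₄) * u / (u + v) := by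
      rw [eq_div_iff nw]
      linear_combination hh
    linear_combination this
  rw [e3, e4, e1, e2]
  field_simp

end

/-- The relations that determine the elementary transformation. -/
lemma elementary_relations (b : Fin 8 → ℂ) {h k' : K}
    (hh : (f + g) * (h + g) * (g - const (b 4)) * (g - const (b 5)) =
      (g + const (b 0)) * (g + const (b 1)) * (g + const (b 2)) * (g + const (b 3)))
    (hk : (elementaryEquiv b f + elementaryEquiv b g) * (elementaryEquiv b f + k') *
      (elementaryEquiv b f + const (b 6 - delta b)) * (elementaryEquiv b f + const (b 7)) =
      (elementaryEquiv b f - const (b 0)) * (elementaryEquiv b f - const (b 1)) *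
        (elementaryEquiv b f - const (b 2)) * (elementaryEquiv b f - const (b 3))) :
    (elementaryEquiv b f + const (b 6 - delta b)) * (elementaryEquiv b g - const (b 5)) =
      (h + const (b 6 - delta b)) * (g - const (b 5)) ∧
    (f + const (b 7)) * (g - const (b 4)) =
      (elementaryEquiv b f + const (b 7)) * (k' - const (b 4)) ∧
    (b 0 + b 1 + b 4 + b 7 ≠ 0 → b 1 + b 2 + b 4 + b 7 ≠ 0 → b 1 + b 3 + b 4 + b 7 ≠ 0 →
      elementaryEquiv b f + g ≠ 0) := by
  obtain ⟨F₁, F₂, F₃, F₄, G₁, G₂, G₃, C⟩ := exists_elementaryChain b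
  -- With b₇ replaced by b₇ - δ the eight parameters sum to zero, as the elimination lemmas require.
  have hδ : const (b 0) + const (b 1) + const (b 2) + const (b 3) + const (b 4) + const (b 5) +
      const (b 6 - delta b) + const (b 7) = 0 := by
    rw [← const_add, ← const_add, ← const_add, ← const_add, ← const_add, ← const_add, ← const_add,
      ← const_zero]
    congr 1
    simp only [delta, Fin.sum_univ_eight]
    ring
  have hs : const (elementaryShift b) =
      3 * const (b 0) + const (b 1) + const (b 5) + const (b 7) := by
    simp only [elementaryShift, const_add, const_mul, const_three]
  have r₃ := C.r₃
  have r₄ := C.r₄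
  have r₅ := C.r₅
  have r₆ := C.r₆
  have r₇ := C.r₇
  simp only [const_add, const_sub, const_mul, const_two, const_three] at r₃ r₄ r₅ r₆ r₇
  obtain ⟨nv, nu, hg, hfg⟩ := chain_half_left C.r₁ C.r₂ r₃ C.n₁ C.n₂ C.n₃
  obtain ⟨nv', nu', hf, hfg'⟩ := chain_half_right hδ r₅ r₆ r₇ C.n₄ C.n₅ C.n₆
  rw [← hs, ← C.f_eq] at hf hfg'
  have hG₃ : G₃ = elementaryEquiv b f - const (elementaryShift b) := by rw [C.f_eq]; ring
  have hF₄ : F₄ = elementaryEquiv b g + const (elementaryShift b) := by rw [C.g_eq]; ring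
  rw [hG₃, hF₄] at hfg'
  have ne_f : ∀ c : ℂ, elementaryEquiv b f - const c ≠ 0 := fun c h0 =>
    f_sub_const_ne_zero c ((elementaryEquiv b).injective (by
      rw [map_sub, map_const, h0, map_zero]))
  have ne_g : ∀ c : ℂ, g + const c ≠ 0 := fun c => by
    have := lineParameter_ne_zero_g ((-c : ℂ) : OnePoint ℂ)
    simpa [const_neg] using this
  generalize elementaryEquiv b f = f₁ at *
  generalize elementaryEquiv b g = g₁ at *
  generalize elementaryShift b = c₀ at *
  obtain ⟨u, hu⟩ : ∃ u, u = F₂ - (const (b 0) + const (b 1) + const (b 7)) := ⟨_, rfl⟩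
  obtain ⟨v, hv⟩ : ∃ v, v = G₁ + (const (b 0) + const (b 1) + const (b 7)) := ⟨_, rfl⟩
  obtain ⟨u', hu'⟩ : ∃ u', u' = F₂ - (2 * const (b 0) + const (b 7)) := ⟨_, rfl⟩
  obtain ⟨v', hv'⟩ : ∃ v', v' = G₂ + (2 * const (b 0) + const (b 7)) := ⟨_, rfl⟩
  have huv : F₂ + G₁ = u + v := by rw [hu, hv]; ring
  have huv' : F₂ + G₂ = u' + v' := by rw [hu', hv']; ring
  have huu : u' = u + const (b 1) - const (b 0) := by rw [hu', hu]; ring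
  have nw := C.n₃
  have nw' := C.n₄
  rw [huv] at nw
  rw [huv'] at nw'
  rw [← hu, huv] at hfg
  rw [← hu, ← hv] at hg
  rw [← hv] at nv
  rw [← hu] at nu
  rw [← hu', huv'] at hfg'
  rw [← hu', ← hv'] at hf
  rw [← hv'] at nv'
  rw [← hu'] at nu'
  have hw : (u + v) * (u' + v') = (u + const (b 1) + const (b 2) + const (b 4) + const (b 7)) *
      (u + const (b 1) + const (b 3) + const (b 4) + const (b 7)) := by
    rw [← huv, ← huv', r₄, hu]
    ring
  have hh' : (h + g) * (g - const (b 5)) * (u + v) =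
      u * ((g + const (b 2)) * (g + const (b 3))) := by
    refine mul_left_cancel₀ (mul_ne_zero (ne_g (b 0)) (ne_g (b 1))) ?_
    linear_combination u * hh - (h + g) * (g - const (b 5)) * hfg
  have hk' : (f₁ + k') * (f₁ + const (b 7)) * (u' + v') =
      u' * ((f₁ - const (b 2)) * (f₁ - const (b 3))) := by
    refine mul_left_cancel₀ (mul_ne_zero (ne_f (b 0)) (ne_f (b 1))) ?_
    linear_combination u' * hk - (f₁ + k') * (f₁ + const (b 7)) * hfg'
  refine ⟨?_, ?_, ?_⟩
  · exact chain_relation hδ huu nv nv' nu' nw hg hf hw hh' (by linear_combination hfg')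
  -- The word is symmetric under reversal combined with a sign change, which exchanges b₅ with b₇ -
  -- δ and b₆ with b₈; the second relation is the first one for the reversed word.
  · have := chain_relation (b₁ := const (b 0)) (b₂ := const (b 1)) (b₃ := const (b 2))
      (b₄ := const (b 3)) (b₅ := const (b 6 - delta b)) (b₆ := const (b 7)) (b₇ := const (b 4))
      (b₈ := const (b 5)) (g := -f₁) (h := -k') (f₁ := -g) (g₁ := -f) (u := -u') (v := -v')
      (u' := -u) (v' := -v) (by linear_combination hδ) (by linear_combination huu)
      (neg_ne_zero.2 nv') (neg_ne_zero.2 nv) (neg_ne_zero.2 nu)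
      (by rw [← neg_add]; exact neg_ne_zero.2 nw') (by linear_combination hf)
      (by linear_combination hg)
      (by
        have e1 : -u' + const (b 1) + const (b 2) + const (b 6 - delta b) + const (b 5) =
          -(u + const (b 1) + const (b 3) + const (b 4) + const (b 7)) := by
          linear_combination hδ - huu
        have e2 : -u' + const (b 1) + const (b 3) + const (b 6 - delta b) + const (b 5) =
          -(u + const (b 1) + const (b 2) + const (b 4) + const (b 7)) := by
          linear_combination hδ - huu
        rw [e1, e2]
        linear_combination hw)
      (by linear_combination -hk') (by linear_combination -hfg)
    linear_combination this
  -- As F₂ and G₁ are independent, it suffices that the numerator Q of the new f plus g, written in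
  -- u and v, is a nonzero polynomial.
  · intro hσ hp hq h0
    set a := b 0 + b 1 + b 7
    set p := b 1 + b 2 + b 4 + b 7
    set q := b 1 + b 3 + b 4 + b 7
    set c := b 1 - b 0
    set U : MvPolynomial (Fin 2) ℂ := MvPolynomial.X 0 - MvPolynomial.C a with hU
    set V : MvPolynomial (Fin 2) ℂ := MvPolynomial.X 1 + MvPolynomial.C a with hV
    set W : MvPolynomial (Fin 2) ℂ := (U + MvPolynomial.C p) * (U + MvPolynomial.C q) -
      (U + MvPolynomial.C c) * (U + V) with hW
    set Q : MvPolynomial (Fin 2) ℂ := ((U + MvPolynomial.C (b 1)) * W + (U + MvPolynomial.C c) *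
      MvPolynomial.C (b 0 + b 1 + b 5 + (b 6 - delta b)) * (U + V)) * V +
      ((U - MvPolynomial.C (b 0)) * V - U * MvPolynomial.C (b 0 + b 1 + b 4 + b 7)) * W with hQ
    have hQ0 : Q ≠ 0 := by
      have key : ∀ x : ℂ, MvPolynomial.eval ![x + a, -a] Q =
          -(x * (b 0 + b 1 + b 4 + b 7) * ((x + p) * (x + q) - (x + c) * x)) := by
        intro x
        simp [hQ, hW, hU, hV]
      intro h
      -- On v = 0 a linear polynomial in u remains besides the factor u; if it vanished at both u =
      -- 1 and u = -1, its constant term p q would be zero.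
      have k1 := key 1
      have k2 := key (-1)
      rw [h] at k1 k2
      simp at k1 k2
      rcases k1 with k1 | k1
      · exact hσ k1
      rcases k2 with k2 | k2
      · exact hσ (by linear_combination -k2)
      · have : p * q = 0 := by linear_combination (k1 + k2) / 2
        exact mul_ne_zero hp hq this
    refine C.coord.aeval_ne_zero hQ0 ?_
    have hC : ∀ x, MvPolynomial.aeval ![F₂, G₁] (MvPolynomial.C x) = const x := by
      intro x
      rw [MvPolynomial.aeval_C]
      rfl
    have eU : MvPolynomial.aeval ![F₂, G₁] U = u := by
      rw [hU, map_sub, hC, hu]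
      simp [a, const_add]
    have eV : MvPolynomial.aeval ![F₂, G₁] V = v := by
      rw [hV, map_add, hC, hv]
      simp [a, const_add]
    have ec : u + const c = u' := by
      rw [huu]
      simp only [c, const_sub]
      ring
    have eW : MvPolynomial.aeval ![F₂, G₁] W = v' * (u + v) := by
      rw [hW]
      simp only [map_sub, map_add, map_mul, eU, eV, hC, ec]
      simp only [p, q, const_add]
      linear_combination -hw
    rw [hQ]
    simp only [map_sub, map_add, map_mul, eU, eV, eW, hC, ec]
    rw [const_sub] at hf
    linear_combination v * v' * (u + v) * h0 - v * (u + v) * hf - v' * (u + v) * hg -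
      v * v' * (u + v) * huu

end SchlesingerA2

end

/-! ### The new coordinates as scalar identities; values at general points. -/

noncomputable section

namespace SchlesingerA2

/-- The first coordinate after the elementary transformation. -/
lemma elementary_first_coordinate {k : Type*} [Field k]
    {b₁ b₂ b₃ b₅ b₆ b₇ t f g h κ f₁ g₁ k' : k} (hb : b₁ + b₂ + b₃ = t - b₅ - b₆ - b₇)
    (hh : (f + g) * (h + g) * (g - b₅) * (g - b₆) = g * ((g + b₁) * (g + b₂) * (g + b₃)))
    (hκ : (f - b₁) * (f - b₂) * (f - b₃) = (f + g) * (f + b₇) * κ)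
    (r₁ : (f₁ + (b₇ + 1)) * (g₁ - b₆) = (h + (b₇ + 1)) * (g - b₆))
    (r₂ : (f - t - 1) * (g - b₅) = (f₁ - t - 1) * (k' - b₅))
    (hk : (f₁ + g₁) * (f₁ + k') * (f₁ + (b₇ + 1)) * (f₁ - t - 1) =
      f₁ * ((f₁ - b₁) * (f₁ - b₂) * (f₁ - b₃)))
    (ng : g ≠ 0) (nfg : f + g ≠ 0) (nf₁g : f₁ + g ≠ 0) :
    ((f + b₇) * (f + b₆ - t - κ) - b₅ * t + b₅ * h * (g - b₆) / g -
        (b₆ - b₅ + 1) * (b₇ + t + 1)) * (f - f₁) =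
      (f - t - 1) * ((h + (b₇ + 1)) * (g - b₆) + (f + (b₇ + 1)) * (f + b₆)) -
        f * (f + b₇) * κ := by
  obtain ⟨e₂, he₂⟩ : ∃ e₂, e₂ = b₁ * b₂ + b₁ * b₃ + b₂ * b₃ := ⟨_, rfl⟩
  obtain ⟨e₃, he₃⟩ : ∃ e₃, e₃ = b₁ * b₂ * b₃ := ⟨_, rfl⟩
  have hP : ∀ z, (z - b₁) * (z - b₂) * (z - b₃) =
      z ^ 3 - (t - b₅ - b₆ - b₇) * z ^ 2 + e₂ * z - e₃ := by
    intro z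
    rw [← hb, he₂, he₃]
    ring
  have hPg : (g + b₁) * (g + b₂) * (g + b₃) =
      g ^ 3 + (t - b₅ - b₆ - b₇) * g ^ 2 + e₂ * g + e₃ := by
    rw [← hb, he₂, he₃]
    ring
  rw [hP] at hκ hk
  rw [hPg] at hh
  -- The constant term e₃ of the cubic is eliminated between the equations for h and κ, and the
  -- factor f + g cancels.
  have hE : g * (f + b₇) * κ + (h + g) * (g - b₅) * (g - b₆) =
      g * (f ^ 2 - f * g + g ^ 2 - (t - b₅ - b₆ - b₇) * (f - g) + e₂) := by
    refine mul_left_cancel₀ nfg ?_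
    linear_combination hh - g * hκ
  obtain ⟨S, hS⟩ : ∃ S, S = (f - t - 1) * (g - b₅) := ⟨_, rfl⟩
  obtain ⟨R, hR⟩ : ∃ R, R = (h + (b₇ + 1)) * (g - b₆) := ⟨_, rfl⟩
  -- In Q the terms of degree four and three cancel, the latter by the relation for b₁ + b₂ + b₃.
  -- The equation for h gives the root -g; the other relations give the root f₁. So Q(f) = q₂ (f +
  -- g)(f - f₁), and the leading coefficient q₂ is the denominator sought.
  obtain ⟨Q, hQ⟩ : ∃ Q : k → k, ∀ z, Q z = (S + (z - t - 1) * (z + b₅)) *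
      (R + (z + (b₇ + 1)) * (z + b₆)) -
      z * (z ^ 3 - (t - b₅ - b₆ - b₇) * z ^ 2 + e₂ * z - e₃) := ⟨_, fun _ => rfl⟩
  obtain ⟨q₂, hq₂⟩ : ∃ q₂, q₂ = S + R - (t + 1) * b₅ + (b₇ + 1) * b₆ +
      (b₅ - t - 1) * (b₇ + 1 + b₆) - e₂ := ⟨_, rfl⟩
  obtain ⟨q₁, hq₁⟩ : ∃ q₁, q₁ = (S - (t + 1) * b₅) * (b₇ + 1 + b₆) +
      (b₅ - t - 1) * (R + (b₇ + 1) * b₆) + e₃ := ⟨_, rfl⟩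
  obtain ⟨q₀, hq₀⟩ : ∃ q₀, q₀ = (S - (t + 1) * b₅) * (R + (b₇ + 1) * b₆) := ⟨_, rfl⟩
  have hQ' : ∀ z, Q z = q₂ * z ^ 2 + q₁ * z + q₀ := by
    intro z
    rw [hQ, hq₂, hq₁, hq₀]
    ring
  have z1 : Q (-g) = 0 := by
    rw [hQ, hS, hR]
    linear_combination hh
  have z2 : Q f₁ = 0 := by
    have eS : S = (f₁ - t - 1) * (k' - b₅) := hS.trans r₂
    have eR : R = (f₁ + (b₇ + 1)) * (g₁ - b₆) := hR.trans r₁.symm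
    rw [hQ, eS, eR]
    linear_combination hk
  have z3 : Q f = (f + g) * ((f - t - 1) * (R + (f + (b₇ + 1)) * (f + b₆)) -
      f * (f + b₇) * κ) := by
    rw [hQ, hS]
    linear_combination -f * hκ
  rw [hQ'] at z1 z2 z3
  have hq : q₁ = -q₂ * (f₁ - g) := by
    refine mul_left_cancel₀ nf₁g ?_
    linear_combination z2 - z1
  have hmain : q₂ * (f - f₁) =
      (f - t - 1) * (R + (f + (b₇ + 1)) * (f + b₆)) - f * (f + b₇) * κ := by
    refine mul_left_cancel₀ nfg ?_
    linear_combination z3 - z1 - (f + g) * hq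
  have hden : (f + b₇) * (f + b₆ - t - κ) - b₅ * t + b₅ * h * (g - b₆) / g -
        (b₆ - b₅ + 1) * (b₇ + t + 1) = q₂ := by
    refine mul_left_cancel₀ ng ?_
    have : g * ((f + b₇) * (f + b₆ - t - κ) - b₅ * t + b₅ * h * (g - b₆) / g -
        (b₆ - b₅ + 1) * (b₇ + t + 1)) = g * ((f + b₇) * (f + b₆ - t - κ) - b₅ * t -
        (b₆ - b₅ + 1) * (b₇ + t + 1)) + b₅ * h * (g - b₆) := by
      field_simp
      ring
    rw [this, hq₂, hS, hR]
    linear_combination -hE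
  rw [hden, hmain, hR]

/-- The second coordinate after the standard map. -/
lemma standard_second_coordinate {k : Type*} [Field k]
    {b₁ b₂ b₃ b₅ b₆ b₇ t f g h κ g' : k} (hb : b₁ + b₂ + b₃ = t - b₅ - b₆ - b₇)
    (hh : (f + g) * (h + g) * (g - b₅) * (g - b₆) = g * ((g + b₁) * (g + b₂) * (g + b₃)))
    (hκ : (f - b₁) * (f - b₂) * (f - b₃) = (f + g) * (f + b₇) * κ)
    (hg : (h + g) * (h + g') * ((h + (b₇ + 1)) * (h - t)) =
      (h - b₁) * (h - b₂) * (h - b₃) * h)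
    (ng : g ≠ 0) (nfg : f + g ≠ 0) (nhg : h + g ≠ 0) :
    (h + g') * (h + (b₇ + 1)) * (h - t) = h *
      ((h - f) * (h - (t - b₅ - b₆ - b₇) + f - g) + (f + b₇) * κ +
        (h - f) * (g - b₅) * (g - b₆) / g) := by
  obtain ⟨e₂, he₂⟩ : ∃ e₂, e₂ = b₁ * b₂ + b₁ * b₃ + b₂ * b₃ := ⟨_, rfl⟩
  obtain ⟨e₃, he₃⟩ : ∃ e₃, e₃ = b₁ * b₂ * b₃ := ⟨_, rfl⟩
  have hP : ∀ z, (z - b₁) * (z - b₂) * (z - b₃) =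
      z ^ 3 - (t - b₅ - b₆ - b₇) * z ^ 2 + e₂ * z - e₃ := by
    intro z
    rw [← hb, he₂, he₃]
    ring
  have hPg : (g + b₁) * (g + b₂) * (g + b₃) =
      g ^ 3 + (t - b₅ - b₆ - b₇) * g ^ 2 + e₂ * g + e₃ := by
    rw [← hb, he₂, he₃]
    ring
  rw [hP] at hκ hg
  rw [hPg] at hh
  have hE : g * (f + b₇) * κ + (h + g) * (g - b₅) * (g - b₆) =
      g * (f ^ 2 - f * g + g ^ 2 - (t - b₅ - b₆ - b₇) * (f - g) + e₂) := by
    refine mul_left_cancel₀ nfg ?_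
    linear_combination hh - g * hκ
  refine mul_left_cancel₀ ng (mul_left_cancel₀ nhg ?_)
  have : g * (h * ((h - f) * (h - (t - b₅ - b₆ - b₇) + f - g) + (f + b₇) * κ +
        (h - f) * (g - b₅) * (g - b₆) / g)) =
      h * (g * ((h - f) * (h - (t - b₅ - b₆ - b₇) + f - g) + (f + b₇) * κ) +
        (h - f) * (g - b₅) * (g - b₆)) := by
    field_simp
  rw [this]
  have hE3 : g * ((f + b₇) * κ) * (f + g) =
      g * (f ^ 3 - (t - b₅ - b₆ - b₇) * f ^ 2 + e₂ * f - e₃) := by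
    linear_combination -g * hκ
  -- The cubic at h, compared with the cubic at f, acquires the factor h + g, which can then be
  -- cancelled.
  have h3 : g * (h ^ 3 - (t - b₅ - b₆ - b₇) * h ^ 2 + e₂ * h - e₃) = (h + g) *
      (g * ((h - f) * (h - (t - b₅ - b₆ - b₇) + f - g) + (f + b₇) * κ) +
        (h - f) * (g - b₅) * (g - b₆)) := by
    linear_combination -hE3 - (h - f) * hE
  linear_combination g * hg + h * h3

/-! ### Values at general points -/

/-- The property holds at the general point `(a, b)` of the plane. -/
def GenericPoint (P : ℂ → ℂ → Prop) : Prop :=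
  ∃ N : MvPolynomial (Fin 2) ℂ, N ≠ 0 ∧ ∀ a b, MvPolynomial.eval ![a, b] N ≠ 0 → P a b

lemma GenericPoint.and {P Q : ℂ → ℂ → Prop} (hP : GenericPoint P) (hQ : GenericPoint Q) :
    GenericPoint fun a b => P a b ∧ Q a b := by
  obtain ⟨N, hN, h⟩ := hP
  obtain ⟨N', hN', h'⟩ := hQ
  refine ⟨N * N', mul_ne_zero hN hN', fun a b hab => ?_⟩
  rw [map_mul] at hab
  exact ⟨h a b (left_ne_zero_of_mul hab), h' a b (right_ne_zero_of_mul hab)⟩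

lemma GenericPoint.mono {P Q : ℂ → ℂ → Prop} (hP : GenericPoint P) (h : ∀ a b, P a b → Q a b) :
    GenericPoint Q := by
  obtain ⟨N, hN, hN'⟩ := hP
  exact ⟨N, hN, fun a b hab => h a b (hN' a b hab)⟩

lemma isCoord_sub_const (a b : ℂ) : IsCoord (f - const a) (g - const b) :=
  (generate_baseParameters ((a : OnePoint ℂ), (b : OnePoint ℂ))).isCoord

lemma hasValue_iff {h : K} {a b c : ℂ} :
    HasValue h a b c ↔ Val (f - const a) (g - const b) h c := by
  rw [HasValue, mem_localPower_one (isCoord_sub_const a b)]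
  constructor
  · intro H
    exact (H.add (val_const _ _ c)).cast (by ring) (by ring)
  · intro H
    exact (H.sub (val_const _ _ c)).cast rfl (by ring)

section
variable {a b c d : ℂ} {h h' : K}

lemma hasValue_f (a b : ℂ) : HasValue f a b a :=
  hasValue_iff.2 (((val_left _ _).add (val_const _ _ a)).cast (by ring) (by ring))

lemma hasValue_g (a b : ℂ) : HasValue g a b b :=
  hasValue_iff.2 (((val_right _ _).add (val_const _ _ b)).cast (by ring) (by ring))

lemma hasValue_const (a b c : ℂ) : HasValue (const c) a b c := hasValue_iff.2 (val_const _ _ c)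

lemma HasValue.add (H : HasValue h a b c) (H' : HasValue h' a b d) :
    HasValue (h + h') a b (c + d) :=
  hasValue_iff.2 ((hasValue_iff.1 H).add (hasValue_iff.1 H'))

lemma HasValue.sub (H : HasValue h a b c) (H' : HasValue h' a b d) :
    HasValue (h - h') a b (c - d) :=
  hasValue_iff.2 ((hasValue_iff.1 H).sub (hasValue_iff.1 H'))

lemma HasValue.mul (H : HasValue h a b c) (H' : HasValue h' a b d) :
    HasValue (h * h') a b (c * d) :=
  hasValue_iff.2 ((hasValue_iff.1 H).mul (hasValue_iff.1 H'))

lemma HasValue.div (H : HasValue h a b c) (H' : HasValue h' a b d) (hd : d ≠ 0) :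
    HasValue (h / h') a b (c / d) :=
  hasValue_iff.2 (Val.div (isCoord_sub_const a b) (hasValue_iff.1 H) (hasValue_iff.1 H') hd)

lemma HasValue.eq_of_eq (H : HasValue h a b c) (H' : HasValue h' a b d) (e : h = h') : c = d := by
  subst e
  exact Val.unique (isCoord_sub_const a b) (hasValue_iff.1 H) (hasValue_iff.1 H')

lemma hasValue_algebraMap (F : MvPolynomial (Fin 2) ℂ) (a b : ℂ) :
    HasValue (algebraMap (MvPolynomial (Fin 2) ℂ) K F) a b (MvPolynomial.eval ![a, b] F) := by
  rw [hasValue_iff, algebraMap_eq_aeval]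
  refine Val.aeval_eval (fun i => ?_) F
  fin_cases i
  · exact hasValue_iff.1 (hasValue_f a b)
  · exact hasValue_iff.1 (hasValue_g a b)

lemma genericPoint_value (h : K) : GenericPoint fun a b => ∃ c, HasValue h a b c := by
  obtain ⟨F, G, hG, rfl⟩ := IsFractionRing.div_surjective (A := MvPolynomial (Fin 2) ℂ) h
  exact ⟨G, nonZeroDivisors.ne_zero hG, fun a b hab =>
    ⟨_, (hasValue_algebraMap F a b).div (hasValue_algebraMap G a b) hab⟩⟩

lemma genericPoint_value_ne {h : K} (h0 : h ≠ 0) :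
    GenericPoint fun a b => ∀ c, HasValue h a b c → c ≠ 0 := by
  obtain ⟨F, G, hG, rfl⟩ := IsFractionRing.div_surjective (A := MvPolynomial (Fin 2) ℂ) h
  have hF : F ≠ 0 := by
    rintro rfl
    simp at h0
  refine ⟨F * G, mul_ne_zero hF (nonZeroDivisors.ne_zero hG), fun a b hab c hc => ?_⟩
  rw [map_mul] at hab
  have := hc.eq_of_eq ((hasValue_algebraMap F a b).div (hasValue_algebraMap G a b)
    (right_ne_zero_of_mul hab)) rfl
  rw [this]
  exact div_ne_zero (left_ne_zero_of_mul hab) (right_ne_zero_of_mul hab)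

/-- The value of a composition. -/
lemma HasValue.comp {Ψ : K ≃ₐ[ℂ] K} {a' b' : ℂ} (hf : HasValue (Ψ f) a b a')
    (hg : HasValue (Ψ g) a b b') (H : HasValue h a' b' c) : HasValue (Ψ h) a b c := by
  have H' := Val.map Ψ (hasValue_iff.1 H)
  rw [map_sub, map_sub, map_const, map_const] at H'
  refine hasValue_iff.2 (Val.trans (isCoord_sub_const a b) ?_ ?_ H')
  · exact (hasValue_iff.1 (hf.sub (hasValue_const a b a'))).cast rfl (by ring)
  · exact (hasValue_iff.1 (hg.sub (hasValue_const a b b'))).cast rfl (by ring)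

end

/-- A general point of the target is hit by a point off the exceptional locus N = 0, because N
pulled back by the inverse is a nonzero function; the composite being the identity fixes the values.
-/
lemma GenericPoint.symm {Θ : K ≃ₐ[ℂ] K} {R : ℂ → ℂ → ℂ → ℂ → Prop}
    (H : GenericPoint fun a b => ∃ a' b', HasValue (Θ f) a b a' ∧ HasValue (Θ g) a b b' ∧
      R a b a' b') :
    GenericPoint fun a' b' => ∃ a b, HasValue (Θ.symm f) a' b' a ∧ HasValue (Θ.symm g) a' b' b ∧
      R a b a' b' := by
  obtain ⟨N, hN, h⟩ := H
  have hN' : Θ.symm (algebraMap (MvPolynomial (Fin 2) ℂ) K N) ≠ 0 := by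
    intro h0
    apply hN
    apply algebraMap_K_injective
    apply Θ.symm.injective
    rw [h0, map_zero, map_zero]
  have G := ((genericPoint_value (Θ.symm f)).and (genericPoint_value (Θ.symm g))).and
    (genericPoint_value_ne hN')
  refine G.mono ?_
  rintro α β ⟨⟨⟨a, ha⟩, ⟨b, hb⟩⟩, hne⟩
  have hv := hne _ (HasValue.comp ha hb (hasValue_algebraMap N a b))
  obtain ⟨a', b', hf, hg, hR⟩ := h a b hv
  have e1 := (HasValue.comp ha hb hf).eq_of_eq (hasValue_f α β) (by simp)
  have e2 := (HasValue.comp ha hb hg).eq_of_eq (hasValue_g α β) (by simp)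
  subst e1 e2
  exact ⟨a, b, ha, hb, hR⟩

/-- A transformation is a birational map in coordinates if it is one on some systems. -/
lemma isCoordinateFormOf_of_exists {T : Transformation} {s : RiemannScheme} {Ψ : K ≃ₐ[ℂ] K}
    (hs : s.Regular) (hT : T.Functional s) (hover : ∀ p q, T.graph s p q → p.IsOver s)
    (H : GenericPoint fun a b => ∃ a' b', HasValue (Ψ f) a b a' ∧ HasValue (Ψ g) a b b' ∧
      ∃ p q, HasCoordinates s p a b ∧ T.graph s p q ∧ HasCoordinates (T.target s) q a' b') :
    IsCoordinateFormOf T s Ψ := by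
  refine (H.and (genericPoint_value_ne f_add_g_ne_zero)).mono ?_
  rintro a b ⟨⟨a', b', hf, hg, p, q, hp, hpq, hq⟩, hab⟩
  have hab' := hab _ ((hasValue_f a b).add (hasValue_g a b))
  refine ⟨⟨p, q, hp, hpq⟩, fun p' q' hp' hpq' => ?_⟩
  have hg1 := gaugeEquivalent_of_hasCoordinates hs (hover _ _ hpq) (hover _ _ hpq') hab' hp hp'
  exact ⟨a', b', hq.of_gaugeEquivalent (hT _ _ _ _ hg1 hpq hpq'), hf, hg⟩

end SchlesingerA2

end

/-! ### The rational maps realise the transformations over general points. -/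

noncomputable section

namespace SchlesingerA2

variable {s : RiemannScheme}

lemma f_add_const_ne_zero (c : ℂ) : f + const c ≠ 0 := by
  have := f_sub_const_ne_zero (-c)
  rwa [const_neg, sub_neg_eq_add] at this

lemma g_sub_const_ne_zero (c : ℂ) : g - const c ≠ 0 := by
  have h := hasValue_g 0 (c + 1)
  intro h0
  have := (h.sub (hasValue_const 0 (c + 1) c)).eq_of_eq (hasValue_const 0 (c + 1) 0)
    (h0.trans const_zero.symm)
  simp at this

lemma algEquiv_ne_zero (Ψ : K ≃ₐ[ℂ] K) {h : K} (h0 : h ≠ 0) : Ψ h ≠ 0 :=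
  fun e => h0 (Ψ.injective (e.trans (map_zero Ψ).symm))

lemma image_f_add_const_ne_zero (Ψ : K ≃ₐ[ℂ] K) (c : ℂ) : Ψ f + const c ≠ 0 := by
  have := algEquiv_ne_zero Ψ (f_add_const_ne_zero c)
  rwa [map_add, map_const] at this

lemma delta_parameters (s : RiemannScheme) : delta (parameters s) = -1 := by
  have := fuchs_eq s
  simp [delta, parameters, Fin.sum_univ_eight]
  linear_combination this

lemma hasValue_cubic {h : K} {a b c : ℂ} (H : HasValue h a b c) :
    HasValue ((h - const (parameters s 0)) * (h - const (parameters s 1)) *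
      (h - const (parameters s 2))) a b (cubic s c) :=
  ((H.sub (hasValue_const a b _)).mul (H.sub (hasValue_const a b _))).mul
    (H.sub (hasValue_const a b _))

lemma hasValue_cubic_neg {h : K} {a b c : ℂ} (H : HasValue h a b c) :
    HasValue ((h + const (parameters s 0)) * (h + const (parameters s 1)) *
      (h + const (parameters s 2))) a b (-cubic s (-c)) := by
  have := ((H.add (hasValue_const a b (parameters s 0))).mul
    (H.add (hasValue_const a b (parameters s 1)))).mul (H.add (hasValue_const a b (parameters s 2)))
  refine cast (congrArg _ ?_) this
  simp [cubic, parameters]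
  ring

/-- The first component of the standard map. -/
lemma standardEquiv_f (s : RiemannScheme) :
    (f + g) * (standardEquiv (parameters s) f + g) * (g - const (s.θ 1 0)) *
      (g - const (s.θ 1 1)) =
    g * ((g + const (parameters s 0)) * (g + const (parameters s 1)) *
      (g + const (parameters s 2))) := by
  have h := (standard_isStandardDP (parameters s)).1
  have h1 := g_sub_const_ne_zero (s.θ 1 0)
  have h2 := g_sub_const_ne_zero (s.θ 1 1)
  have e4 : parameters s 4 = s.θ 1 0 := rfl
  have e5 : parameters s 5 = s.θ 1 1 := rfl
  have e3 : const (parameters s 3) = 0 := const_zero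
  rw [e4, e5, e3, eq_div_iff (mul_ne_zero h1 h2)] at h
  linear_combination h

/-- The second component of the standard map. -/
lemma standardEquiv_g (s : RiemannScheme) :
    (standardEquiv (parameters s) f + g) *
      (standardEquiv (parameters s) f + standardEquiv (parameters s) g) *
      ((standardEquiv (parameters s) f + const (s.θ 0 0 - s.θ 0 1 + 1)) *
        (standardEquiv (parameters s) f - const (s.θ 0 1))) =
    (standardEquiv (parameters s) f - const (parameters s 0)) *
      (standardEquiv (parameters s) f - const (parameters s 1)) *
      (standardEquiv (parameters s) f - const (parameters s 2)) *
      standardEquiv (parameters s) f := by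
  have h := (standard_isStandardDP (parameters s)).2
  have e6 : parameters s 6 - delta (parameters s) = s.θ 0 0 - s.θ 0 1 + 1 := by
    rw [delta_parameters]
    simp [parameters]
  have e7 : parameters s 7 - delta (parameters s) = -s.θ 0 1 := by
    rw [delta_parameters]
    simp [parameters]
  have e3 : const (parameters s 3) = 0 := const_zero
  have h1 := image_f_add_const_ne_zero (standardEquiv (parameters s)) (s.θ 0 0 - s.θ 0 1 + 1)
  have h2 := image_f_add_const_ne_zero (standardEquiv (parameters s)) (-s.θ 0 1)
  rw [e6, e7, e3, eq_div_iff (mul_ne_zero h1 h2), const_neg] at h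
  linear_combination h

lemma standardEquiv_f_add_g_ne_zero (s : RiemannScheme) :
    standardEquiv (parameters s) f + g ≠ 0 := by
  intro h0
  have h := standardEquiv_f s
  rw [h0, mul_zero, zero_mul, zero_mul] at h
  have h' : ∀ c, g + const c ≠ 0 := fun c => by
    have := g_sub_const_ne_zero (-c)
    rwa [const_neg, sub_neg_eq_add] at this
  exact mul_ne_zero g_ne_zero (mul_ne_zero (mul_ne_zero (h' _) (h' _)) (h' _)) h.symm

/-- Over a general point there are accessory data. -/
lemma genericPoint_accessory (hs : s.Regular) (hs' : (s.shift 1 0 0 0).Regular) :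
    GenericPoint fun a b => a + b ≠ 0 ∧ ∃ h k,
      HasValue (standardEquiv (parameters s) f) a b h ∧
      (a + b) * (h + b) * (b - s.θ 1 0) * (b - s.θ 1 1) = -b * cubic s (-b) ∧
      cubic s a = (a + b) * (a + (s.θ 0 0 - s.θ 0 1)) * k ∧ (s.accessory a b h k).Good := by
  refine (((((genericPoint_value (standardEquiv (parameters s) f)).and
    (genericPoint_value_ne f_add_g_ne_zero)).and
    (genericPoint_value_ne (f_add_const_ne_zero (s.θ 0 0 - s.θ 0 1)))).and
    (genericPoint_value_ne g_ne_zero)).and ((genericPoint_value_ne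
    (g_sub_const_ne_zero (s.θ 1 0))).and (genericPoint_value_ne
    (g_sub_const_ne_zero (s.θ 1 1))))).mono ?_
  rintro a b ⟨⟨⟨⟨⟨h, hh⟩, n1⟩, n2⟩, n3⟩, n4, n5⟩
  have vf := hasValue_f a b
  have vg := hasValue_g a b
  have n1 := n1 _ (vf.add vg)
  have n2 := n2 _ (vf.add (hasValue_const a b _))
  have n3 := n3 _ vg
  have n4 := n4 _ (vg.sub (hasValue_const a b _))
  have n5 := n5 _ (vg.sub (hasValue_const a b _))
  refine ⟨n1, h, cubic s a / ((a + b) * (a + (s.θ 0 0 - s.θ 0 1))), hh, ?_, ?_, ?_⟩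
  · have := (((((vf.add vg).mul (hh.add vg)).mul (vg.sub (hasValue_const a b _))).mul
      (vg.sub (hasValue_const a b _)))).eq_of_eq (vg.mul (hasValue_cubic_neg vg))
      (standardEquiv_f s)
    rw [this]
    ring
  · field_simp
  · have r1 := hs.2 0
    have r2 := hs.2 1
    have r3 := hs.1 0 1
    have r4 := hs'.1 0 0
    have r5 := hs'.2 0
    have r6 := hs'.2 1
    simp [RiemannScheme.shift] at r4 r5 r6
    refine ⟨sub_ne_zero.2 r1, fun e => r5 ?_, sub_ne_zero.2 (Ne.symm r2), fun e => r6 ?_, r3,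
      fun e => r4 ?_, n2, n3, n4, n5⟩ <;> simp only [RiemannScheme.accessory] at e
    · linear_combination e
    · linear_combination -e
    · linear_combination e

/-- The standard map is the composition on some system over a general point. -/
lemma genericPoint_composition (hs : s.CompositionRegular) :
    GenericPoint fun a b => ∃ a' b', HasValue (standardEquiv (parameters s) f) a b a' ∧
      HasValue (standardEquiv (parameters s) g) a b b' ∧
      ∃ p q, HasCoordinates s p a b ∧ composition.graph s p q ∧
        HasCoordinates (composition.target s) q a' b' := by
  set Φ := standardEquiv (parameters s) with hΦ
  refine ((((genericPoint_accessory hs.source hs.first).and (genericPoint_value (Φ g))).and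
    (genericPoint_value_ne (standardEquiv_f_add_g_ne_zero s))).and
    (((genericPoint_value_ne (image_f_add_const_ne_zero Φ (-s.θ 0 1))).and
    (genericPoint_value_ne (image_f_add_const_ne_zero Φ 0))).and
    (genericPoint_value_ne (image_f_add_const_ne_zero Φ (s.θ 0 0 - s.θ 0 1 + 1))))).mono ?_
  rintro a b ⟨⟨⟨⟨n1, h, k, vh, hh, hk, hc⟩, b', vg'⟩, n2⟩, ⟨n3, n4⟩, n5⟩
  have vf := hasValue_f a b
  have vg := hasValue_g a b
  have n2 := n2 _ (vh.add vg)
  have n3 := n3 _ (vh.add (hasValue_const a b _))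
  have n4 := n4 _ (vh.add (hasValue_const a b _))
  have n5 := n5 _ (vh.add (hasValue_const a b _))
  rw [← sub_eq_add_neg] at n3
  rw [add_zero] at n4
  obtain ⟨p, q, hp, hpq, hA, hM⟩ := exists_system hs.source hs.first hc n1 hh hk
  have e := (((vh.add vg).mul (vh.add vg')).mul ((vh.add (hasValue_const a b _)).mul
    (vh.sub (hasValue_const a b _)))).eq_of_eq ((hasValue_cubic vh).mul vh) (standardEquiv_g s)
  have hb : (s.θ 0 1 + s.κ 0) + (s.θ 0 1 + s.κ 1) + (s.θ 0 1 + s.κ 2) =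
      s.θ 0 1 - s.θ 1 0 - s.θ 1 1 - (s.θ 0 0 - s.θ 0 1) := by
    linear_combination fuchs_eq s
  have hg := standard_second_coordinate hb (f := a) (g := b) (h := h) (κ := k) (g' := b')
    (by rw [hh, cubic]; ring) hk e hc.g n1 n2
  obtain ⟨r, hr, hr'⟩ := exists_composition hs hc hpq.2.1 hA hM n3 n4 n5 hg
  obtain ⟨q₂, ⟨q₁, h₁, h₂⟩, h₃⟩ := hr
  exact ⟨h, b', vh, vg', p, r, hp, ⟨q₂, ⟨q₁, ⟨q, hpq, h₁⟩, h₂⟩, h₃⟩, hr'⟩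

lemma elementaryParameters_parameters (s : RiemannScheme) :
    elementaryParameters (parameters s) = parameters (s.shift 1 0 0 0) := by
  rw [elementaryParameters, delta_parameters]
  funext i
  fin_cases i <;> simp [parameters, RiemannScheme.shift] <;> ring

/-- Conditions for the elementary transformation to be given by its rational expression. -/
structure RiemannScheme.ElementaryRegular (s : RiemannScheme) : Prop where
  source : s.Regular
  target : (s.shift 1 0 0 0).Regular
  cubic_ne : cubic s (-s.θ 1 0) ≠ 0
  sum₁ : parameters s 0 + parameters s 1 + parameters s 4 + parameters s 7 ≠ 0
  sum₂ : parameters s 1 + parameters s 2 + parameters s 4 + parameters s 7 ≠ 0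
  sum₃ : parameters s 1 + parameters s 3 + parameters s 4 + parameters s 7 ≠ 0

/-- Were the expression zero, the relation for f̄ would make g times the cubic in g divisible by g -
θ_2^1, contrary to its nonzero value at g = θ_2^1. It guarantees v ≠ 1, so that the second vector of
the new eigenbasis does not vanish. -/
lemma RiemannScheme.ElementaryRegular.discriminant_ne (hs : s.ElementaryRegular) :
    (g - const (s.θ 1 1)) * standardEquiv (parameters s) f + const (s.θ 0 0 - s.θ 0 1 + 1) * g
      ≠ 0 := by
  intro h0
  have h := standardEquiv_f s
  have key : g * ((g + const (parameters s 0)) * (g + const (parameters s 1)) *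
      (g + const (parameters s 2))) = (g - const (s.θ 1 0)) * ((f + g) * (g *
      (g - const (s.θ 1 1) - const (s.θ 0 0 - s.θ 0 1 + 1)))) := by
    linear_combination -h + (f + g) * (g - const (s.θ 1 0)) * h0
  have vf := hasValue_f 0 (s.θ 1 0)
  have vg := hasValue_g 0 (s.θ 1 0)
  have vc := hasValue_const 0 (s.θ 1 0)
  have e := (vg.mul (hasValue_cubic_neg vg)).eq_of_eq
    ((vg.sub (vc _)).mul ((vf.add vg).mul (vg.mul ((vg.sub (vc _)).sub (vc _))))) key
  rw [sub_self, zero_mul] at e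
  exact mul_ne_zero (hs.source.1 1 0) (neg_ne_zero.2 hs.cubic_ne) e

/-- The same divisibility argument at g = θ_2^1. As this numerator equals den · (f - f₁), its being
nonzero gives den ≠ 0 at general points. -/
lemma RiemannScheme.ElementaryRegular.numerator_ne (hs : s.ElementaryRegular) {κ : K}
    (hκ : (f - const (parameters s 0)) * (f - const (parameters s 1)) *
      (f - const (parameters s 2)) = (f + g) * (f + const (s.θ 0 0 - s.θ 0 1)) * κ) :
    (f - const (s.θ 0 1) - 1) * ((standardEquiv (parameters s) f +
      const (s.θ 0 0 - s.θ 0 1 + 1)) * (g - const (s.θ 1 1)) +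
      (f + const (s.θ 0 0 - s.θ 0 1 + 1)) * (f + const (s.θ 1 1))) -
      f * (f + const (s.θ 0 0 - s.θ 0 1)) * κ ≠ 0 := by
  intro h0
  have h := standardEquiv_f s
  have key : (f - const (s.θ 0 1) - const 1) * (g * ((g + const (parameters s 0)) *
      (g + const (parameters s 1)) * (g + const (parameters s 2)))) =
      (g - const (s.θ 1 0)) * (f * ((f - const (parameters s 0)) * (f - const (parameters s 1)) *
      (f - const (parameters s 2))) - (f - const (s.θ 0 1) - const 1) * ((f + g) *
      ((const (s.θ 0 0 - s.θ 0 1 + 1) - g) * (g - const (s.θ 1 1)) +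
      (f + const (s.θ 0 0 - s.θ 0 1 + 1)) * (f + const (s.θ 1 1))))) := by
    rw [const_one]
    linear_combination (f + g) * (g - const (s.θ 1 0)) * h0 - (f - const (s.θ 0 1) - 1) * h -
      f * (g - const (s.θ 1 0)) * hκ
  -- Here f = θ_1^2 + 2 makes the factor f - θ_1^2 - 1 equal to 1.
  have vf := hasValue_f (s.θ 0 1 + 2) (s.θ 1 0)
  have vg := hasValue_g (s.θ 0 1 + 2) (s.θ 1 0)
  have vc := hasValue_const (s.θ 0 1 + 2) (s.θ 1 0)
  have e := (((vf.sub (vc _)).sub (vc 1)).mul (vg.mul (hasValue_cubic_neg vg))).eq_of_eq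
    ((vg.sub (vc _)).mul ((vf.mul (hasValue_cubic vf)).sub (((vf.sub (vc _)).sub (vc 1)).mul
      ((vf.add vg).mul ((((vc _).sub vg).mul (vg.sub (vc _))).add
        ((vf.add (vc _)).mul (vf.add (vc _)))))))) key
  rw [sub_self, zero_mul] at e
  have : s.θ 0 1 + 2 - s.θ 0 1 - 1 = 1 := by ring
  rw [this, one_mul] at e
  exact mul_ne_zero (hs.source.1 1 0) (neg_ne_zero.2 hs.cubic_ne) e

/-- The elementary transformation `{2 1; 1 1}` on some system over a general point. -/
lemma genericPoint_elementary (hs : s.ElementaryRegular) :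
    GenericPoint fun a b => ∃ a' b', HasValue (elementaryEquiv (parameters s) f) a b a' ∧
      HasValue (elementaryEquiv (parameters s) g) a b b' ∧
      ∃ p q, HasCoordinates s p a b ∧ (schlesinger 1 0 0 0).graph s p q ∧
        HasCoordinates (s.shift 1 0 0 0) q a' b' := by
  obtain ⟨Θ, hΘ⟩ : ∃ Θ, Θ = elementaryEquiv (parameters s) := ⟨_, rfl⟩
  obtain ⟨Φ, hΦ⟩ : ∃ Φ, Φ = standardEquiv (parameters s) := ⟨_, rfl⟩
  have d6 : parameters s 6 - delta (parameters s) = s.θ 0 0 - s.θ 0 1 + 1 := by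
    rw [delta_parameters]
    simp [parameters]
  have e3 : const (parameters s 3) = 0 := const_zero
  have e4 : parameters s 4 = s.θ 1 0 := rfl
  have e5 : parameters s 5 = s.θ 1 1 := rfl
  have e7 : const (parameters s 7) = -const (s.θ 0 1) - const 1 := by
    rw [show parameters s 7 = -s.θ 0 1 - 1 from rfl, const_sub, const_neg]
  have m1 := image_f_add_const_ne_zero Θ (s.θ 0 0 - s.θ 0 1 + 1)
  have m2 := image_f_add_const_ne_zero Θ (parameters s 7)
  have m3 := algEquiv_ne_zero Θ f_add_g_ne_zero
  rw [map_add] at m3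
  have m4 : (f + g) * (f + const (s.θ 0 0 - s.θ 0 1)) ≠ 0 :=
    mul_ne_zero f_add_g_ne_zero (f_add_const_ne_zero _)
  obtain ⟨κ, hκ⟩ : ∃ κ, (f - const (parameters s 0)) * (f - const (parameters s 1)) *
      (f - const (parameters s 2)) = (f + g) * (f + const (s.θ 0 0 - s.θ 0 1)) * κ :=
    ⟨_, (mul_div_cancel₀ _ m4).symm⟩
  obtain ⟨k', hk'⟩ : ∃ k', (Θ f + Θ g) * (Θ f + k') * (Θ f + const (s.θ 0 0 - s.θ 0 1 + 1)) *
      (Θ f + const (parameters s 7)) = (Θ f - const (parameters s 0)) *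
        (Θ f - const (parameters s 1)) * (Θ f - const (parameters s 2)) *
        (Θ f - const (parameters s 3)) := by
    refine ⟨(Θ f - const (parameters s 0)) *
        (Θ f - const (parameters s 1)) * (Θ f - const (parameters s 2)) *
        (Θ f - const (parameters s 3)) / ((Θ f + Θ g) * (Θ f + const (s.θ 0 0 - s.θ 0 1 + 1)) *
      (Θ f + const (parameters s 7))) - Θ f, ?_⟩
    field_simp
    ring
  have hh := standardEquiv_f s
  rw [← hΦ] at hh
  obtain ⟨r₁, r₂, r₃⟩ := elementary_relations (parameters s) (h := Φ f) (k' := k')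
    (by rw [e3, e4, e5, hh]; ring) (by rw [d6, ← hΘ]; exact hk')
  have r₃ := r₃ hs.sum₁ hs.sum₂ hs.sum₃
  rw [← hΘ, d6, e5] at r₁
  rw [← hΘ, e4, e7] at r₂
  rw [← hΘ] at r₃ ⊢
  rw [e3, e7, sub_zero] at hk'
  have nn := hs.numerator_ne hκ
  have nd := hs.discriminant_ne
  rw [← hΦ] at nn nd
  refine ((((genericPoint_accessory hs.source hs.target).and
    ((genericPoint_value (Θ f)).and (genericPoint_value (Θ g)))).and
    ((genericPoint_value κ).and (genericPoint_value k'))).and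
    (((genericPoint_value_ne m1).and (genericPoint_value_ne r₃)).and
    ((genericPoint_value_ne nn).and (genericPoint_value_ne nd)))).mono ?_
  rintro a b ⟨⟨⟨⟨n1, h, k, vh, eh, ek, hc⟩, ⟨f₁, vf₁⟩, g₁, vg₁⟩, ⟨κ₀, vκ⟩, k₁, vk⟩,
    ⟨n2, n3⟩, n4, n5⟩
  rw [← hΦ] at vh
  have vf := hasValue_f a b
  have vg := hasValue_g a b
  have vc := hasValue_const a b
  have n2 := n2 _ (vf₁.add (vc _))
  have n3 := n3 _ (vf₁.add vg)
  have c1 : const 1 = 1 := const_one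
  rw [← c1] at n4
  have n4 := n4 _ ((((vf.sub (vc _)).sub (vc _)).mul (((vh.add (vc _)).mul (vg.sub (vc _))).add
    ((vf.add (vc _)).mul (vf.add (vc _))))).sub ((vf.mul (vf.add (vc _))).mul vκ))
  have n5 := n5 _ (((vg.sub (vc _)).mul vh).add ((vc _).mul vg))
  have q1 := ((vf₁.add (vc _)).mul (vg₁.sub (vc _))).eq_of_eq
    ((vh.add (vc _)).mul (vg.sub (vc _))) r₁
  have q2 := HasValue.eq_of_eq ((((vc (-s.θ 0 1)).sub (vc 1)).add vf).mul (vg.sub (vc (s.θ 1 0))))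
    ((((vc (-s.θ 0 1)).sub (vc 1)).add vf₁).mul (vk.sub (vc (s.θ 1 0))))
    (by rw [const_neg, add_comm, r₂]; ring)
  have q3 := HasValue.eq_of_eq ((((vf₁.add vg₁).mul (vf₁.add vk)).mul
    (vf₁.add (vc (s.θ 0 0 - s.θ 0 1 + 1)))).mul
    (((vc (-s.θ 0 1)).sub (vc 1)).add vf₁)) ((hasValue_cubic (s := s) vf₁).mul vf₁)
    (by rw [const_neg, add_comm _ (Θ f), hk'])
  have q4 := (hasValue_cubic vf).eq_of_eq (((vf.add vg).mul (vf.add (vc _))).mul vκ) hκ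
  -- The value of the function κ and the accessory number k solve the same equation with a nonzero
  -- coefficient.
  have hkk : κ₀ = k := by
    have := hc.f
    refine mul_left_cancel₀ (mul_ne_zero n1 this) ?_
    exact q4.symm.trans ek
  subst hkk
  have hb : (s.θ 0 1 + s.κ 0) + (s.θ 0 1 + s.κ 1) + (s.θ 0 1 + s.κ 2) =
      s.θ 0 1 - s.θ 1 0 - s.θ 1 1 - (s.θ 0 0 - s.θ 0 1) := by
    linear_combination fuchs_eq s
  have hden := elementary_first_coordinate hb (f := a) (g := b) (h := h) (κ := κ₀) (f₁ := f₁)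
    (g₁ := g₁) (k' := k₁) (by rw [eh, cubic]; ring) ek q1 (by linear_combination q2)
    (by rw [cubic] at q3; linear_combination q3) hc.g n1 n3
  obtain ⟨p, q, hp, hpq, hA, hM⟩ := exists_system hs.source hs.target hc n1 eh ek
  refine ⟨f₁, g₁, vf₁, vg₁, p, q, hp, hpq, ?_⟩
  refine hasCoordinates_schlesinger hs.target hc hpq.2.1 hA hM ?_ ?_ n2 hden q1
  · intro hv
    have x1 := hc.b₇'
    have x2 := hc.D
    have x3 := hc.g
    have x4 := hc.g₅
    simp only [Accessory.v, RiemannScheme.accessory] at hv x1 x2 x3 x4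
    rw [div_eq_iff (mul_ne_zero x1 x2)] at hv
    have : h * (b - s.θ 1 0) / b * b = h * (b - s.θ 1 0) := div_mul_cancel₀ _ x3
    refine mul_ne_zero n5 x4 ?_
    linear_combination -b * hv - (b - s.θ 1 1) * this
  · intro hd
    exact n4 (hden.symm.trans (mul_eq_zero_of_left hd _))

lemma isCoordinateFormOf_composition (hs : s.CompositionRegular) :
    IsCoordinateFormOf composition s (standardEquiv (parameters s)) :=
  isCoordinateFormOf_of_exists hs.source (functional_composition hs)
    (fun _ _ ⟨_, ⟨_, ⟨_, h, _⟩, _⟩, _⟩ => h.1) (genericPoint_composition hs)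

/-- {1 2; 1 1} out of s inverts {2 1; 1 1} out of the shifted scheme, so both the general-point
statement and the graph are read backwards. -/
lemma isCoordinateFormOf_schlesinger (hs : (s.shift 0 1 0 0).ElementaryRegular) :
    IsCoordinateFormOf (schlesinger 0 1 0 0) s
      (elementaryEquiv (parameters (s.shift 0 1 0 0))).symm := by
  have hback : (s.shift 0 1 0 0).shift 1 0 0 0 = s := shift_shift s 0 1 0 0
  have hr : s.Regular := hback ▸ hs.target
  refine isCoordinateFormOf_of_exists hr (functional_schlesinger (by decide) 0 0 hs.source)
    (fun _ _ h => h.1) ((genericPoint_elementary hs).symm.mono ?_)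
  rintro a' b' ⟨a, b, vf, vg, p, q, hp, hpq, hq⟩
  have h := schlesinger_graph_symm (by decide) 0 0 hs.source hs.target hpq
  rw [hback] at h hq
  exact ⟨a, b, vf, vg, q, p, hq, h, hp⟩

end SchlesingerA2

end

/-! ### Genericity reduced to a single sample scheme. -/

noncomputable section

namespace SchlesingerA2

/-! ### Generic Riemann schemes -/

/-- The function is a polynomial in the characteristic indices. -/
def IsPoly (φ : RiemannScheme → ℂ) : Prop :=
  ∃ P : MvPolynomial ((Fin 2 × Fin 2) ⊕ Fin 3) ℂ, ∀ s, MvPolynomial.eval s.indices P = φ s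

namespace IsPoly

variable {φ ψ : RiemannScheme → ℂ}

lemma const (c : ℂ) : IsPoly fun _ => c := ⟨MvPolynomial.C c, fun _ => by simp⟩

lemma θ (i j : Fin 2) : IsPoly fun s => s.θ i j :=
  ⟨MvPolynomial.X (Sum.inl (i, j)), fun s => by simp [RiemannScheme.indices]⟩

lemma κ (j : Fin 3) : IsPoly fun s => s.κ j :=
  ⟨MvPolynomial.X (Sum.inr j), fun s => by simp [RiemannScheme.indices]⟩

lemma add (h : IsPoly φ) (h' : IsPoly ψ) : IsPoly fun s => φ s + ψ s := by
  obtain ⟨P, hP⟩ := h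
  obtain ⟨Q, hQ⟩ := h'
  exact ⟨P + Q, fun s => by rw [map_add, hP, hQ]⟩

lemma mul (h : IsPoly φ) (h' : IsPoly ψ) : IsPoly fun s => φ s * ψ s := by
  obtain ⟨P, hP⟩ := h
  obtain ⟨Q, hQ⟩ := h'
  exact ⟨P * Q, fun s => by rw [map_mul, hP, hQ]⟩

lemma neg (h : IsPoly φ) : IsPoly fun s => -φ s := by
  obtain ⟨P, hP⟩ := h
  exact ⟨-P, fun s => by rw [map_neg, hP]⟩

lemma sub (h : IsPoly φ) (h' : IsPoly ψ) : IsPoly fun s => φ s - ψ s := by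
  simpa only [sub_eq_add_neg] using h.add h'.neg

end IsPoly

/-- `Q` holds on a Zariski neighbourhood of `s₀`. -/
def GenericAt (s₀ : RiemannScheme) (Q : RiemannScheme → Prop) : Prop :=
  ∃ P : MvPolynomial ((Fin 2 × Fin 2) ⊕ Fin 3) ℂ, MvPolynomial.eval s₀.indices P ≠ 0 ∧
    ∀ s : RiemannScheme, MvPolynomial.eval s.indices P ≠ 0 → Q s

section
variable {s₀ : RiemannScheme} {Q Q' : RiemannScheme → Prop}

lemma GenericAt.forGenericScheme (h : GenericAt s₀ Q) : ForGenericScheme Q := by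
  obtain ⟨P, h0, h⟩ := h
  exact ⟨P, ⟨s₀, h0⟩, h⟩

lemma GenericAt.mono (h : GenericAt s₀ Q) (H : ∀ s, Q s → Q' s) : GenericAt s₀ Q' := by
  obtain ⟨P, h0, h⟩ := h
  exact ⟨P, h0, fun s hs => H s (h s hs)⟩

lemma GenericAt.and (h : GenericAt s₀ Q) (h' : GenericAt s₀ Q') :
    GenericAt s₀ fun s => Q s ∧ Q' s := by
  obtain ⟨P, h0, h⟩ := h
  obtain ⟨P', h0', h'⟩ := h'
  refine ⟨P * P', ?_, fun s hs => ?_⟩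
  · rw [map_mul]
    exact mul_ne_zero h0 h0'
  · rw [map_mul] at hs
    exact ⟨h s (left_ne_zero_of_mul hs), h' s (right_ne_zero_of_mul hs)⟩

lemma GenericAt.all {n : ℕ} {R : Fin n → RiemannScheme → Prop} (h : ∀ i, GenericAt s₀ (R i)) :
    GenericAt s₀ fun s => ∀ i, R i s := by
  choose P h0 h using h
  refine ⟨∏ i, P i, ?_, fun s hs i => h i s ?_⟩
  · rw [map_prod]
    exact Finset.prod_ne_zero_iff.2 fun i _ => h0 i
  · rw [map_prod] at hs
    exact Finset.prod_ne_zero_iff.1 hs i (Finset.mem_univ i)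

lemma GenericAt.of_forall (h : ∀ s, Q s) : GenericAt s₀ Q := ⟨1, by simp, fun s _ => h s⟩

lemma IsPoly.genericAt_ne {φ ψ : RiemannScheme → ℂ} (h : IsPoly φ) (h' : IsPoly ψ)
    (h0 : φ s₀ ≠ ψ s₀) : GenericAt s₀ fun s => φ s ≠ ψ s := by
  obtain ⟨P, hP⟩ := h.sub h'
  exact ⟨P, by rwa [hP, sub_ne_zero], fun s hs => by rwa [hP, sub_ne_zero] at hs⟩

end

/-- The parameters are polynomials in the characteristic indices. -/
def PolyVec (v : RiemannScheme → Fin 8 → ℂ) : Prop := ∀ i, IsPoly fun s => v s i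

section
variable {s₀ : RiemannScheme} {v : RiemannScheme → Fin 8 → ℂ}

lemma PolyVec.perm (h : PolyVec v) (σ : Fin 8 → Fin 8) : PolyVec fun s => v s ∘ σ :=
  fun i => h (σ i)

lemma PolyVec.swapParameters (h : PolyVec v) : PolyVec fun s => swapParameters (v s) := by
  intro i
  fin_cases i
  exacts [(h 0).neg, (h 1).neg, (h 2).neg, (h 3).neg, (h 6).neg, (h 7).neg, (h 4).neg, (h 5).neg]

lemma PolyVec.quadParameters (h : PolyVec v) : PolyVec fun s => quadParameters (v s) := by
  intro i
  fin_cases i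
  exacts [h 0, h 1, (h 6).neg, (h 7).neg, (((h 0).neg).sub (h 1)).sub (h 4),
    (((h 0).neg).sub (h 1)).sub (h 5), (h 2).neg, (h 3).neg]

lemma PolyVec.params (h : PolyVec v) (q : QuadStep) : PolyVec fun s => q.params (v s) := by
  obtain ⟨d, σ, hσ⟩ := q
  cases d
  · exact (h.perm σ).quadParameters.perm σ.symm
  · exact ((h.swapParameters.perm σ).quadParameters.perm σ.symm).swapParameters

lemma PolyVec.genericAt_distinct (h : PolyVec v) (h0 : Distinct (v s₀)) :
    GenericAt s₀ fun s => Distinct (v s) := by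
  obtain ⟨⟨h01, h02, h03, h12, h13, h23⟩, h45, h67⟩ := h0
  have H := fun i j => (h i).genericAt_ne (s₀ := s₀) (h j)
  exact ((H _ _ h01).and ((H _ _ h02).and ((H _ _ h03).and ((H _ _ h12).and ((H _ _ h13).and
    (H _ _ h23)))))).and ((H _ _ h45).and (H _ _ h67))

lemma PolyVec.genericAt_quadAdmissible (h : PolyVec v) (h0 : QuadAdmissible (v s₀)) :
    GenericAt s₀ fun s => QuadAdmissible (v s) := by
  obtain ⟨h1, h06, h07, h16, h17⟩ := h0
  have H := fun i j => (h i).genericAt_ne (s₀ := s₀) (h j).neg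
  exact (h.genericAt_distinct h1).and ((H _ _ h06).and ((H _ _ h07).and ((H _ _ h16).and
    (H _ _ h17))))

lemma PolyVec.genericAt_step (h : PolyVec v) (q : QuadStep) (h0 : q.Admissible (v s₀)) :
    GenericAt s₀ fun s => q.Admissible (v s) := by
  obtain ⟨d, σ, hσ⟩ := q
  cases d
  · exact (h.perm σ).genericAt_quadAdmissible h0
  · exact (h.swapParameters.perm σ).genericAt_quadAdmissible h0

/-- Along a word the parameters stay polynomial in the indices, and admissibility of each step is a
finite list of inequations between them. So a single admissible scheme gives a nonempty Zariski open
set. -/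
lemma PolyVec.genericAt_admissible (h : PolyVec v) (w : List QuadStep)
    (h0 : Stage.Admissible w (v s₀)) : GenericAt s₀ fun s => Stage.Admissible w (v s) := by
  induction w generalizing v with
  | nil => exact GenericAt.of_forall fun _ => trivial
  | cons q w ih => exact (h.genericAt_step q h0.1).and (ih (h.params q) h0.2)

end

/-- The Riemann scheme depends polynomially on the given one. -/
structure PolyScheme (T : RiemannScheme → RiemannScheme) : Prop where
  θ : ∀ i j, IsPoly fun s => (T s).θ i j
  κ : ∀ j, IsPoly fun s => (T s).κ j

section
variable {s₀ : RiemannScheme} {T : RiemannScheme → RiemannScheme}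

lemma PolyScheme.id : PolyScheme fun s => s := ⟨IsPoly.θ, IsPoly.κ⟩

lemma PolyScheme.shift (h : PolyScheme T) (α β μ ν : Fin 2) :
    PolyScheme fun s => (T s).shift α β μ ν :=
  ⟨fun i j => ((h.θ i j).sub (IsPoly.const _)).add (IsPoly.const _), h.κ⟩

lemma PolyScheme.exchange (h : PolyScheme T) : PolyScheme fun s => (T s).exchange := by
  refine ⟨fun i j => ?_, fun j => (h.κ j).add (h.θ 0 0)⟩
  fin_cases i
  · fin_cases j
    exacts [(h.θ 0 0).neg, (h.θ 0 1).sub (h.θ 0 0)]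
  · exact h.θ 1 j

lemma PolyScheme.parameters (h : PolyScheme T) : PolyVec fun s => parameters (T s) := by
  intro i
  fin_cases i
  exacts [(h.θ 0 1).add (h.κ 0), (h.θ 0 1).add (h.κ 1), (h.θ 0 1).add (h.κ 2), IsPoly.const 0,
    h.θ 1 0, h.θ 1 1, (h.θ 0 0).sub (h.θ 0 1), (h.θ 0 1).neg.sub (IsPoly.const 1)]

lemma PolyScheme.genericAt_regular (h : PolyScheme T) (h0 : (T s₀).Regular) :
    GenericAt s₀ fun s => (T s).Regular := by
  obtain ⟨h1, h2⟩ := h0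
  exact (GenericAt.all fun i => GenericAt.all fun j =>
    (h.θ i j).genericAt_ne (IsPoly.const 0) (h1 i j)).and
      (GenericAt.all fun i => (h.θ i 0).genericAt_ne (h.θ i 1) (h2 i))

lemma genericAt_compositionRegular (h : s₀.CompositionRegular) :
    GenericAt s₀ RiemannScheme.CompositionRegular := by
  obtain ⟨h1, h2, h3, h4, h5⟩ := h
  have p2 := PolyScheme.id.shift 1 0 0 0
  have p4 := p2.exchange.shift 1 0 1 0
  exact ((PolyScheme.id.genericAt_regular h1).and ((p2.genericAt_regular h2).and
    ((p2.exchange.genericAt_regular h3).and ((p4.genericAt_regular h4).and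
      (p4.exchange.genericAt_regular h5))))).mono fun s ⟨a, b, c, d, e⟩ => ⟨a, b, c, d, e⟩

lemma genericAt_elementaryRegular (hT : PolyScheme T) (h : (T s₀).ElementaryRegular) :
    GenericAt s₀ fun s => (T s).ElementaryRegular := by
  obtain ⟨h1, h2, h3, h4, h5, h6⟩ := h
  have hp := hT.parameters
  have hc : IsPoly fun s => cubic (T s) (-(T s).θ 1 0) :=
    (((hT.θ 1 0).neg.sub (hp 0)).mul ((hT.θ 1 0).neg.sub (hp 1))).mul
      ((hT.θ 1 0).neg.sub (hp 2))
  have hsum : ∀ i j : Fin 8, parameters (T s₀) i + parameters (T s₀) j + parameters (T s₀) 4 +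
      parameters (T s₀) 7 ≠ 0 → GenericAt s₀ fun s => parameters (T s) i + parameters (T s) j +
      parameters (T s) 4 + parameters (T s) 7 ≠ 0 := fun i j h =>
    IsPoly.genericAt_ne ((((hp i).add (hp j)).add (hp 4)).add (hp 7)) (IsPoly.const 0) h
  exact ((hT.genericAt_regular h1).and (((hT.shift 1 0 0 0).genericAt_regular h2).and
    ((hc.genericAt_ne (IsPoly.const 0) h3).and ((hsum 0 1 h4).and ((hsum 1 2 h5).and
      (hsum 1 3 h6)))))).mono fun s ⟨a, b, c, d, e, k⟩ => ⟨a, b, c, d, e, k⟩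

end

/-- A Riemann scheme without resonances. -/
def sampleScheme : RiemannScheme where
  -- The indices have widely separated sizes to avoid accidental coincidences; the last one is
  -- forced by the Fuchs relation.
  θ := ![![10, 103], ![1009, 10007]]
  κ := ![100003, 1000003, -1111135]
  fuchs := by
    simp [Fin.sum_univ_two, Fin.sum_univ_three]
    norm_num

lemma parameters_sampleScheme : parameters sampleScheme =
    ![100106, 1000106, -1111032, 0, 1009, 10007, -93, -104] := by
  funext i
  fin_cases i <;> simp [parameters, sampleScheme] <;> norm_num

lemma parameters_sampleScheme_shift : parameters (sampleScheme.shift 0 1 0 0) =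
    ![100106, 1000106, -1111032, 0, 1010, 10007, -94, -104] := by
  funext i
  fin_cases i <;> simp [parameters, sampleScheme, RiemannScheme.shift] <;> norm_num

lemma distinct_sampleScheme : Distinct (parameters sampleScheme) := by
  rw [parameters_sampleScheme]
  simp [Distinct]
  norm_num

lemma distinct_sampleScheme_shift : Distinct (parameters (sampleScheme.shift 0 1 0 0)) := by
  rw [parameters_sampleScheme_shift]
  simp [Distinct]
  norm_num

lemma admissible_standard_sampleScheme :
    Stage.Admissible standardWord (parameters sampleScheme) := by
  rw [parameters_sampleScheme]
  simp only [standardWord, Stage.Admissible, dual₁₂_params, dual₃₄_params, quad₁₂_params,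
    quad₃₄_params]
  refine ⟨?_, ?_, ?_, ?_, ?_, ?_, trivial⟩ <;>
    simp [QuadStep.Admissible, dual₁₂, dual₃₄, quad₁₂, quad₃₄, perm₁₂, perm₃₄,
      QuadAdmissible, Distinct, swapParameters] <;> norm_num

lemma admissible_elementary_sampleScheme :
    Stage.Admissible elementaryWord (parameters (sampleScheme.shift 0 1 0 0)) := by
  rw [parameters_sampleScheme_shift]
  simp only [elementaryWord, Stage.Admissible, dual₁₂_params, quad₁₃_params, dual₁₄_params,
    quad₂₃_params, quad₃₄_params]
  refine ⟨?_, ?_, ?_, ?_, ?_, ?_, ?_, trivial⟩ <;>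
    simp [QuadStep.Admissible, dual₁₂, quad₁₃, dual₁₄, quad₂₃, quad₃₄, dual₂₄, perm₁₂, perm₁₃,
      perm₁₄, perm₂₃, perm₂₄, perm₃₄, QuadAdmissible, Distinct, swapParameters] <;> norm_num

lemma compositionRegular_sampleScheme : sampleScheme.CompositionRegular := by
  refine ⟨?_, ?_, ?_, ?_, ?_⟩ <;> constructor <;>
    norm_num [Fin.forall_fin_two, RiemannScheme.shift, RiemannScheme.exchange, sampleScheme,
      composition_target_θ]

lemma elementaryRegular_sampleScheme : (sampleScheme.shift 0 1 0 0).ElementaryRegular := by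
  refine ⟨?_, ?_, ?_, ?_, ?_, ?_⟩
  · constructor <;> norm_num [Fin.forall_fin_two, RiemannScheme.shift, sampleScheme]
  · rw [shift_shift]
    exact compositionRegular_sampleScheme.source
  · simp [cubic, RiemannScheme.shift, sampleScheme]
    norm_num
  all_goals
    rw [parameters_sampleScheme_shift]
    simp
    norm_num

end SchlesingerA2

end

/-! ### Local equations of the three anticanonical components. -/

noncomputable section

namespace SchlesingerA2

/-! ### The anticanonical divisor -/

section
variable {b : Fin 8 → ℂ} {x : SurfacePoint b}

lemma valAt_f_of_basePoint {c : ℂ} (h : (basePoint b x).1 = (c : OnePoint ℂ)) : ValAt b x f c := by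
  have := (valAt_baseParameters b x).1
  rw [baseParameters_fst, h, lineParameter_coe] at this
  exact (this.add (val_const _ _ c)).cast (by ring) (by ring)

lemma valAt_g_of_basePoint {c : ℂ} (h : (basePoint b x).2 = (c : OnePoint ℂ)) : ValAt b x g c := by
  have := (valAt_baseParameters b x).2
  rw [baseParameters_snd, h, lineParameter_coe] at this
  exact (this.add (val_const _ _ c)).cast (by ring) (by ring)

lemma valAt_inv_f_of_basePoint (h : (basePoint b x).1 = OnePoint.infty) : ValAt b x f⁻¹ 0 := by
  have := (valAt_baseParameters b x).1
  rwa [baseParameters_fst, h, lineParameter_infty] at this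

lemma valAt_inv_g_of_basePoint (h : (basePoint b x).2 = OnePoint.infty) : ValAt b x g⁻¹ 0 := by
  have := (valAt_baseParameters b x).2
  rwa [baseParameters_snd, h, lineParameter_infty] at this

lemma baseEquation_add (D D' : Pic) (q : OnePoint ℂ × OnePoint ℂ) :
    baseEquation (D + D') q = baseEquation D q * baseEquation D' q := by
  obtain ⟨p, q⟩ := q
  have hf := inv_ne_zero f_ne_zero
  have hg := inv_ne_zero g_ne_zero
  induction p using OnePoint.rec <;> induction q using OnePoint.rec <;>
    simp only [baseEquation, OnePoint.elim_infty, OnePoint.elim_some, Prod.fst_add, Prod.snd_add,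
      zpow_add₀ hf, zpow_add₀ hg] <;> ring

lemma localEquation_add (D D' : Pic) (x : SurfacePoint b) :
    localEquation b (D + D') x = localEquation b D x * localEquation b D' x := by
  refine surfacePoint_cases (P := fun x => localEquation b (D + D') x =
    localEquation b D x * localEquation b D' x) ?_ ?_ x
  · intro q h
    exact baseEquation_add D D' q
  · intro i t
    have h := exceptionalEquation_ne_zero (center b i) t
    rw [localEquation_pointOn, localEquation_pointOn, localEquation_pointOn, baseEquation_add]
    have : (D + D').2.2 i = D.2.2 i + D'.2.2 i := rfl
    rw [this, zpow_add₀ h]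
    ring

lemma localEquation_zero (x : SurfacePoint b) : localEquation b 0 x = 1 := by
  have h := localEquation_add 0 0 x
  rw [add_zero] at h
  exact (mul_eq_left₀ (localEquation_ne_zero b 0 x)).1 h.symm

end

/-- The curve `f + g = 0`. -/
def diagonalClass : Pic := (1, 1, ![-1, -1, -1, -1, 0, 0, 0, 0])

lemma diagonalClass_of_lt : ∀ i : Fin 8, i.val < 4 → diagonalClass.2.2 i = -1 := by decide

lemma diagonalClass_of_not_lt : ∀ i : Fin 8, ¬i.val < 4 → diagonalClass.2.2 i = 0 := by decide

/-- The curve `f = ∞`. -/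
def verticalClass : Pic := (1, 0, ![0, 0, 0, 0, -1, -1, 0, 0])

/-- The curve `g = ∞`. -/
def horizontalClass : Pic := (0, 1, ![0, 0, 0, 0, 0, 0, -1, -1])

section
variable {b : Fin 8 → ℂ}

/-- With the constant section 1 the local equation is computed chart by chart. Regularity makes it a
section, and the position of its zeros is used both for primality and for the intersections. -/
lemma exists_valAt_vertical (x : SurfacePoint b) :
    ∃ c, ValAt b x (localEquation b verticalClass x) c ∧
      (c = 0 → (basePoint b x).1 = OnePoint.infty) := by
  refine surfacePoint_cases (P := fun x => ∃ c, ValAt b x (localEquation b verticalClass x) c ∧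
      (c = 0 → (basePoint b x).1 = OnePoint.infty)) ?_ ?_ x
  · rintro ⟨p, q⟩ h
    induction p using OnePoint.rec with
    | infty =>
      refine ⟨0, (valAt_inv_f_of_basePoint rfl).cast ?_ rfl, fun _ => rfl⟩
      induction q using OnePoint.rec <;> simp [verticalClass, baseEquation]
    | coe a =>
      refine ⟨1, (val_one _ _).cast ?_ rfl, fun h => (one_ne_zero h).elim⟩
      induction q using OnePoint.rec <;> simp [verticalClass, baseEquation]
  · intro i t
    by_cases hi : i = 4 ∨ i = 5
    · have hc : (center b i).1 = OnePoint.infty := by rcases hi with rfl | rfl <;> rfl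
      obtain ⟨r, hr⟩ : ∃ r : ℂ, (center b i).2 = (r : OnePoint ℂ) := by
        rcases hi with rfl | rfl
        exacts [⟨_, rfl⟩, ⟨_, rfl⟩]
      have hD : verticalClass.2.2 i = -1 := by rcases hi with rfl | rfl <;> rfl
      have hn := f_ne_zero
      induction t using OnePoint.rec with
      | infty =>
        refine ⟨0, (val_left _ _).cast ?_ rfl, fun _ => hc⟩
        rw [localEquation_pointOn, hD]
        simp [hc, hr, verticalClass, baseEquation, div_eq_mul_inv]
      | coe t =>
        refine ⟨1, (val_one _ _).cast ?_ rfl, fun h => (one_ne_zero h).elim⟩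
        rw [localEquation_pointOn, hD]
        simp [hc, hr, verticalClass, baseEquation, hn]
    · refine ⟨1, (val_one _ _).cast ?_ rfl, fun h => (one_ne_zero h).elim⟩
      simp only [not_or] at hi
      fin_cases i <;> simp [verticalClass, baseEquation, center] at hi ⊢

lemma exists_valAt_horizontal (x : SurfacePoint b) :
    ∃ c, ValAt b x (localEquation b horizontalClass x) c ∧
      (c = 0 → (basePoint b x).2 = OnePoint.infty) := by
  refine surfacePoint_cases (P := fun x => ∃ c, ValAt b x (localEquation b horizontalClass x) c ∧
      (c = 0 → (basePoint b x).2 = OnePoint.infty)) ?_ ?_ x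
  · rintro ⟨p, q⟩ h
    induction q using OnePoint.rec with
    | infty =>
      refine ⟨0, (valAt_inv_g_of_basePoint rfl).cast ?_ rfl, fun _ => rfl⟩
      induction p using OnePoint.rec <;> simp [horizontalClass, baseEquation]
    | coe a =>
      refine ⟨1, (val_one _ _).cast ?_ rfl, fun h => (one_ne_zero h).elim⟩
      induction p using OnePoint.rec <;> simp [horizontalClass, baseEquation]
  · intro i t
    by_cases hi : i = 6 ∨ i = 7
    · have hc : (center b i).2 = OnePoint.infty := by rcases hi with rfl | rfl <;> rfl
      obtain ⟨r, hr⟩ : ∃ r : ℂ, (center b i).1 = (r : OnePoint ℂ) := by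
        rcases hi with rfl | rfl
        exacts [⟨_, rfl⟩, ⟨_, rfl⟩]
      have hD : horizontalClass.2.2 i = -1 := by rcases hi with rfl | rfl <;> rfl
      have hn := g_ne_zero
      induction t using OnePoint.rec with
      | infty =>
        refine ⟨1, (val_one _ _).cast ?_ rfl, fun h => (one_ne_zero h).elim⟩
        rw [localEquation_pointOn, hD]
        simp [hc, hr, horizontalClass, baseEquation, hn]
      | coe t =>
        refine ⟨t, ((val_right _ _).add (val_const _ _ t)).cast ?_ (zero_add t), fun _ => hc⟩
        rw [localEquation_pointOn, hD]
        simp [hc, hr, horizontalClass, baseEquation, div_eq_mul_inv]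
    · refine ⟨1, (val_one _ _).cast ?_ rfl, fun h => (one_ne_zero h).elim⟩
      simp only [not_or] at hi
      fin_cases i <;> simp [horizontalClass, baseEquation, center] at hi ⊢

/-- On an exceptional curve over a centre of f + g = 0 the value in a finite direction t is 1 + t,
so the strict transform meets it at t = -1. The direction 1 is therefore off the curve and serves as
a general point of E_i. -/
lemma exists_valAt_diagonal (x : SurfacePoint b) :
    ∃ c, ValAt b x ((f + g) * localEquation b diagonalClass x) c ∧
      (c = 0 → ((basePoint b x).1 = OnePoint.infty ↔ (basePoint b x).2 = OnePoint.infty) ∧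
        ∀ i, x ≠ pointOn b i ((1 : ℂ) : OnePoint ℂ)) := by
  have hf := f_ne_zero
  have hg := g_ne_zero
  have H : ∀ x : SurfacePoint b, ((basePoint b x).1 = OnePoint.infty ∧ ∃ r : ℂ,
      (basePoint b x).2 = (r : OnePoint ℂ)) → ValAt b x ((f + g) * f⁻¹) 1 := by
    rintro x ⟨h1, r, h2⟩
    refine ((val_one _ _).add ((valAt_g_of_basePoint h2).mul (valAt_inv_f_of_basePoint h1))).cast
      ?_ (by simp)
    field_simp
  have H' : ∀ x : SurfacePoint b, ((basePoint b x).2 = OnePoint.infty ∧ ∃ r : ℂ,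
      (basePoint b x).1 = (r : OnePoint ℂ)) → ValAt b x ((f + g) * g⁻¹) 1 := by
    rintro x ⟨h1, r, h2⟩
    refine (((valAt_f_of_basePoint h2).mul (valAt_inv_g_of_basePoint h1)).add (val_one _ _)).cast
      ?_ (by simp)
    field_simp
  refine surfacePoint_cases (P := fun x => ∃ c, ValAt b x ((f + g) *
      localEquation b diagonalClass x) c ∧
      (c = 0 → ((basePoint b x).1 = OnePoint.infty ↔ (basePoint b x).2 = OnePoint.infty) ∧
        ∀ i, x ≠ pointOn b i ((1 : ℂ) : OnePoint ℂ))) ?_ ?_ x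
  · rintro ⟨p, q⟩ h
    induction p using OnePoint.rec with
    | infty =>
      induction q using OnePoint.rec with
      | infty =>
        refine ⟨0, ((valAt_inv_g_of_basePoint rfl).add (valAt_inv_f_of_basePoint rfl)).cast ?_
          (by simp), fun _ => ⟨Iff.rfl, fun i => Sum.inl_ne_inr⟩⟩
        simp only [localEquation_pointOff, diagonalClass, baseEquation, OnePoint.elim_infty,
          zpow_one]
        field_simp
      | coe r =>
        refine ⟨1, (H _ ⟨rfl, r, rfl⟩).cast ?_ rfl, fun h => (one_ne_zero h).elim⟩
        simp [diagonalClass, baseEquation]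
    | coe a =>
      induction q using OnePoint.rec with
      | infty =>
        refine ⟨1, (H' _ ⟨rfl, a, rfl⟩).cast ?_ rfl, fun h => (one_ne_zero h).elim⟩
        simp [diagonalClass, baseEquation]
      | coe r =>
        refine ⟨a + r, ((valAt_f_of_basePoint rfl).add (valAt_g_of_basePoint rfl)).cast ?_ rfl,
          fun _ => ?_⟩
        · simp [diagonalClass, baseEquation]
        · exact ⟨by simp, fun i => Sum.inl_ne_inr⟩
  · intro i t
    by_cases h4 : i.val < 4
    · have hc : center b i = ((b i : OnePoint ℂ), ((-b i : ℂ) : OnePoint ℂ)) := by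
        rw [center_eq_ite, if_pos h4]
      have hD : diagonalClass.2.2 i = -1 := diagonalClass_of_lt i h4
      have n1 := lineParameter_ne_zero_f (b i : OnePoint ℂ)
      have n2 := lineParameter_ne_zero_g ((-b i : ℂ) : OnePoint ℂ)
      have hs := valAt_slope b i t
      rw [baseParameters_fst, baseParameters_snd, hc] at hs
      simp only [lineParameter_coe] at n1 n2 hs
      have e : f + g = (f - const (b i)) + (g - const (-b i)) := by
        rw [const_neg]
        ring
      induction t using OnePoint.rec with
      | infty =>
        refine ⟨1, (hs.add (val_one _ _)).cast ?_ (by simp), fun h => (one_ne_zero h).elim⟩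
        rw [localEquation_pointOn, hD, e, lineParameter_infty]
        simp [hc, diagonalClass, baseEquation]
        field_simp
      | coe t =>
        refine ⟨1 + t, ((val_one _ _).add (hs.add (val_const _ _ t))).cast ?_ (by simp),
          fun h => ⟨?_, fun j hj => ?_⟩⟩
        · rw [localEquation_pointOn, hD, e, lineParameter_coe]
          simp [hc, diagonalClass, baseEquation]
          field_simp
        · rw [basePoint_pointOn, hc]
          simp
        · have h1 : (t : OnePoint ℂ) = ((1 : ℂ) : OnePoint ℂ) :=
            congrArg Prod.snd (Sum.inr_injective hj)
          rw [OnePoint.coe_injective h1] at h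
          norm_num at h
    · by_cases h6 : i.val < 6
      · have hc : center b i = (OnePoint.infty, (b i : OnePoint ℂ)) := by
          rw [center_eq_ite, if_neg h4, if_pos h6]
        have hD : diagonalClass.2.2 i = 0 := diagonalClass_of_not_lt i h4
        refine ⟨1, (H (pointOn b i t) ⟨?_, b i, ?_⟩).cast ?_ rfl, fun h => (one_ne_zero h).elim⟩
        · rw [basePoint_pointOn, hc]
        · rw [basePoint_pointOn, hc]
        · rw [localEquation_pointOn, hD, hc]
          simp [diagonalClass, baseEquation]
      · have hc : center b i = (((-b i : ℂ) : OnePoint ℂ), OnePoint.infty) := by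
          rw [center_eq_ite, if_neg h4, if_neg h6]
        have hD : diagonalClass.2.2 i = 0 := diagonalClass_of_not_lt i h4
        refine ⟨1, (H' (pointOn b i t) ⟨?_, -b i, ?_⟩).cast ?_ rfl, fun h => (one_ne_zero h).elim⟩
        · rw [basePoint_pointOn, hc]
        · rw [basePoint_pointOn, hc]
        · rw [localEquation_pointOn, hD, hc]
          simp [diagonalClass, baseEquation]

end

end SchlesingerA2

end

/-! ### Effectivity and irreducibility of the three components. -/

noncomputable section

namespace SchlesingerA2

section
variable {b : Fin 8 → ℂ} {x : SurfacePoint b}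

/-- A negative power of a vanishing u, times a unit, would make u invertible in the local ring. -/
lemma nonneg_of_mul_zpow_mem {u h : K} {n : ℤ} (hu : ValAt b x u 0) (hu0 : u ≠ 0)
    (hh : IsUnitAt b x h) (H : h * u ^ n ∈ localRing b x) : 0 ≤ n := by
  by_contra! hn
  obtain ⟨c, hc⟩ := mem_localRing.1 H
  obtain ⟨d, -, hd⟩ := hh.inv
  obtain ⟨e, he, he'⟩ := hh
  have hx := isCoord_surfaceParameters b x
  have h0 := he'.ne_zero hx he
  obtain ⟨m, hm⟩ : ∃ m : ℕ, n = -((m + 1 : ℕ) : ℤ) := ⟨(-n - 1).toNat, by omega⟩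
  have H1 : ValAt b x 1 0 := by
    refine ((hc.mul hd).mul (hu.pow (m + 1))).cast ?_ (by simp)
    rw [hm, zpow_neg, zpow_natCast]
    field_simp
  exact zero_ne_one (H1.unique hx (val_one _ _))

end

/-- The multiplicities of the divisor of class `D` along the curves `f = ∞`, `g = ∞` and along the
exceptional curves are nonnegative. -/
structure Effective (D : Pic) : Prop where
  vertical : 0 ≤ D.1
  horizontal : 0 ≤ D.2.1
  exceptional : ∀ i, 0 ≤ D.2.2 i + if i.val < 4 then 0 else if i.val < 6 then D.1 else D.2.1

/-- A general point of one of the curves `f = ∞`, `g = ∞`, `E_i`. -/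
def IsTestPoint {b : Fin 8 → ℂ} (x : SurfacePoint b) : Prop :=
  ((basePoint b x).1 = OnePoint.infty ∧ (basePoint b x).2 ≠ OnePoint.infty) ∨
  ((basePoint b x).1 ≠ OnePoint.infty ∧ (basePoint b x).2 = OnePoint.infty) ∨
  ∃ i, x = pointOn b i ((1 : ℂ) : OnePoint ℂ)

/-- At a general point of each boundary or exceptional curve the local equation is a unit times a
power of the equation of that curve; regularity makes the exponent, the multiplicity of the curve,
nonnegative. -/
lemma effective_of_mem {b : Fin 8 → ℂ} {P : SurfacePoint b → K} {D : Pic}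
    (hP : ∀ x, IsTestPoint x → IsUnitAt b x (P x))
    (H : ∀ x, P x * localEquation b D x ∈ localRing b x) : Effective D := by
  have hf := inv_ne_zero f_ne_zero
  have hg := inv_ne_zero g_ne_zero
  refine ⟨?_, ?_, fun i => ?_⟩
  · obtain ⟨r, hr⟩ := Infinite.exists_notMem_finset ({b 4, b 5} : Finset ℂ)
    simp only [Finset.mem_insert, Finset.mem_singleton, not_or] at hr
    have hx := infty_coe_notMem b hr.1 hr.2
    have H1 := H (pointOff b _ hx)
    have hu := hP (pointOff b _ hx) (Or.inl ⟨rfl, OnePoint.coe_ne_infty r⟩)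
    refine nonneg_of_mul_zpow_mem (valAt_inv_f_of_basePoint rfl) hf hu ?_
    simpa [baseEquation] using H1
  · obtain ⟨r, hr⟩ := Infinite.exists_notMem_finset ({-b 6, -b 7} : Finset ℂ)
    simp only [Finset.mem_insert, Finset.mem_singleton, not_or] at hr
    have hx := coe_infty_notMem b hr.1 hr.2
    have H1 := H (pointOff b _ hx)
    have hu := hP (pointOff b _ hx) (Or.inr (Or.inl ⟨OnePoint.coe_ne_infty r, rfl⟩))
    refine nonneg_of_mul_zpow_mem (valAt_inv_g_of_basePoint rfl) hg hu ?_
    simpa [baseEquation] using H1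
  · obtain ⟨x, hx⟩ : ∃ x, x = pointOn b i ((1 : ℂ) : OnePoint ℂ) := ⟨_, rfl⟩
    have H1 := H x
    have hu := hP x (Or.inr (Or.inr ⟨i, hx⟩))
    have hs := valAt_slope b i ((1 : ℂ) : OnePoint ℂ)
    have hb := (valAt_baseParameters b x).1
    have n1 := (generate_baseParameters (center b i)).isCoord.left_ne_zero
    have n2 := (generate_baseParameters (center b i)).isCoord.right_ne_zero
    change ValAt b (pointOn b i ((1 : ℂ) : OnePoint ℂ)) _ 0 at hs
    rw [← hx] at hs
    have hbp : basePoint b x = center b i := by rw [hx, basePoint_pointOn]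
    have hl : localEquation b D x = baseEquation D (center b i) *
        (baseParameters (center b i)).1 ^ D.2.2 i := by
      rw [hx, localEquation_pointOn, exceptionalEquation_coe]
    rw [hbp] at hb
    rw [hl] at H1
    split_ifs with h4 h6
    · have hc : center b i = ((b i : OnePoint ℂ), ((-b i : ℂ) : OnePoint ℂ)) := by
        rw [center_eq_ite, if_pos h4]
      rw [add_zero]
      refine nonneg_of_mul_zpow_mem hb n1 hu ?_
      convert H1 using 2
      simp [hc, baseEquation]
    · have hc : center b i = (OnePoint.infty, (b i : OnePoint ℂ)) := by
        rw [center_eq_ite, if_neg h4, if_pos h6]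
      refine nonneg_of_mul_zpow_mem hb n1 hu ?_
      convert H1 using 2
      rw [hc, baseParameters_fst, lineParameter_infty, zpow_add₀ hf, mul_comm]
      simp [baseEquation]
    -- Here g⁻¹ is the second parameter while E_i is given by the first; in direction 1 their ratio
    -- is a unit, so the exponents can be added.
    · have hc : center b i = (((-b i : ℂ) : OnePoint ℂ), OnePoint.infty) := by
        rw [center_eq_ite, if_neg h4, if_neg h6]
      have hs1 : IsUnitAt b x ((baseParameters (center b i)).2 / (baseParameters (center b i)).1) :=
        ⟨1, one_ne_zero, (hs.add (val_const _ _ 1)).cast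
          (by rw [lineParameter_coe, sub_add_cancel]) (by simp)⟩
      refine nonneg_of_mul_zpow_mem hb n1 (hu.mul (hs1.zpow D.2.1)) ?_
      convert H1 using 1
      have : baseEquation D (center b i) = (baseParameters (center b i)).2 ^ D.2.1 := by
        rw [hc]
        simp [baseEquation]
      rw [this, zpow_add₀ n1, div_zpow]
      have := zpow_ne_zero D.2.1 n1
      field_simp

lemma Effective.eq_zero_of_add_eq_zero {D D' : Pic} (h : Effective D) (h' : Effective D')
    (e : D + D' = 0) : D = 0 := by
  obtain ⟨h1, h2, h3⟩ := h
  obtain ⟨h1', h2', h3'⟩ := h'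
  obtain ⟨d, e₁, c⟩ := D
  obtain ⟨d', e₁', c'⟩ := D'
  simp only [Prod.mk_add_mk, Prod.mk_eq_zero] at e h1 h2 h3 h1' h2' h3' ⊢
  refine ⟨by omega, by omega, ?_⟩
  funext i
  have := congrFun e.2.2 i
  have a := h3 i
  have a' := h3' i
  simp only [Pi.add_apply, Pi.zero_apply] at this ⊢
  split_ifs at a a' <;> omega

/-- The multiplicity along f = ∞ is one, so one summand has none. The multiplicities along g = ∞ and
all E_i sum to zero, hence vanish, and that summand is the zero class. -/
lemma Effective.eq_zero_of_add_eq_vertical {D D' : Pic} (h : Effective D) (h' : Effective D')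
    (e : D + D' = verticalClass) : D = 0 ∨ D' = 0 := by
  obtain ⟨h1, h2, h3⟩ := h
  obtain ⟨h1', h2', h3'⟩ := h'
  obtain ⟨d, e₁, c⟩ := D
  obtain ⟨d', e₁', c'⟩ := D'
  simp only [Prod.mk_add_mk, Prod.mk_eq_zero, verticalClass, Prod.mk.injEq]
    at e h1 h2 h3 h1' h2' h3' ⊢
  obtain ⟨e1, e2, e3⟩ := e
  have key : ∀ i, (d = 0 → c i = 0) ∧ (d' = 0 → c' i = 0) := by
    intro i
    have := congrFun e3 i
    have a := h3 i
    have a' := h3' i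
    fin_cases i <;> simp at this a a' ⊢ <;> omega
  rcases (by omega : d = 0 ∨ d' = 0) with hd | hd
  · exact Or.inl ⟨hd, by omega, funext fun i => (key i).1 hd⟩
  · exact Or.inr ⟨hd, by omega, funext fun i => (key i).2 hd⟩

lemma Effective.eq_zero_of_add_eq_horizontal {D D' : Pic} (h : Effective D) (h' : Effective D')
    (e : D + D' = horizontalClass) : D = 0 ∨ D' = 0 := by
  obtain ⟨h1, h2, h3⟩ := h
  obtain ⟨h1', h2', h3'⟩ := h'
  obtain ⟨d, e₁, c⟩ := D
  obtain ⟨d', e₁', c'⟩ := D'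
  simp only [Prod.mk_add_mk, Prod.mk_eq_zero, horizontalClass,
      Prod.mk.injEq] at e h1 h2 h3 h1' h2' h3' ⊢
  obtain ⟨e1, e2, e3⟩ := e
  have key : ∀ i, (e₁ = 0 → c i = 0) ∧ (e₁' = 0 → c' i = 0) := by
    intro i
    have := congrFun e3 i
    have a := h3 i
    have a' := h3' i
    fin_cases i <;> simp at this a a' ⊢ <;> omega
  rcases (by omega : e₁ = 0 ∨ e₁' = 0) with hd | hd
  · exact Or.inl ⟨by omega, hd, funext fun i => (key i).1 hd⟩
  · exact Or.inr ⟨by omega, hd, funext fun i => (key i).2 hd⟩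

section
variable {b : Fin 8 → ℂ}

lemma algebraMap_C (r : ℂ) :
    algebraMap (MvPolynomial (Fin 2) ℂ) K (MvPolynomial.C r) = const r := by
  rw [algebraMap_eq_aeval, MvPolynomial.aeval_C]
  rfl

lemma algebraMap_diagonal : algebraMap (MvPolynomial (Fin 2) ℂ) K
    (MvPolynomial.X 0 + MvPolynomial.X 1) = f + g := map_add _ _ _

lemma not_liesOn_zero {r : ℂ} (hr : r ≠ 0) (x : SurfacePoint b) :
    ¬LiesOn b 0 (MvPolynomial.C r) x := by
  intro h
  rw [LiesOn, mem_maximalIdeal, localEquation_zero, mul_one, algebraMap_C] at h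
  exact hr ((val_const _ _ r).unique (isCoord_surfaceParameters b x) h)

lemma effective_of_isSection_C {r : ℂ} (hr : r ≠ 0) {D : Pic}
    (h : IsSection b D (MvPolynomial.C r)) : Effective D := by
  refine effective_of_mem (b := b) (P := fun _ => const r) (fun x _ => ?_) (fun x => ?_)
  · exact ⟨r, hr, val_const _ _ r⟩
  · have := h x
    rwa [algebraMap_C] at this

/-- The equation of the curve f + g = 0 is a unit at the test points and can be divided out, which
leaves a divisor supported on the boundary and exceptional curves. -/
lemma effective_of_isSection_diagonal {r : ℂ} (hr : r ≠ 0) {D : Pic}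
    (h : IsSection b D (MvPolynomial.C r * (MvPolynomial.X 0 + MvPolynomial.X 1))) :
    Effective (D - diagonalClass) := by
  refine effective_of_mem (b := b)
    (P := fun x => const r * ((f + g) * localEquation b diagonalClass x)) (fun x hx => ?_)
    (fun x => ?_)
  · refine IsUnitAt.mul ⟨r, hr, val_const _ _ r⟩ ?_
    obtain ⟨c, hc, h0⟩ := exists_valAt_diagonal x
    refine ⟨c, fun hc0 => ?_, hc⟩
    obtain ⟨h1, h2⟩ := h0 hc0
    rcases hx with hx | hx | ⟨i, hi⟩
    · exact hx.2 (h1.1 hx.1)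
    · exact hx.1 (h1.2 hx.2)
    · exact h2 i hi
  · have := h x
    rw [map_mul, algebraMap_C, algebraMap_diagonal] at this
    convert this using 1
    conv_rhs => rw [← add_sub_cancel diagonalClass D, localEquation_add]
    ring

lemma eq_C_of_mul_eq_one {F G : MvPolynomial (Fin 2) ℂ} (h : F * G = 1) :
    ∃ r, r ≠ 0 ∧ F = MvPolynomial.C r := by
  obtain ⟨r, hr, e⟩ := MvPolynomial.isUnit_iff_eq_C_of_isReduced.1 (IsUnit.of_mul_eq_one G h)
  exact ⟨r, hr.ne_zero, e⟩

/-- The total degree is additive on products, and f + g has degree one. -/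
lemma eq_C_of_mul_eq_diagonal {F G : MvPolynomial (Fin 2) ℂ}
    (h : MvPolynomial.X 0 + MvPolynomial.X 1 = F * G) :
    (∃ r, r ≠ 0 ∧ F = MvPolynomial.C r) ∨ ∃ r, r ≠ 0 ∧ G = MvPolynomial.C r := by
  have h0 : (MvPolynomial.X 0 + MvPolynomial.X 1 : MvPolynomial (Fin 2) ℂ) ≠ 0 := by
    intro h
    have := congrArg (MvPolynomial.eval ![1, 0]) h
    simp at this
  have hF : F ≠ 0 := by
    rintro rfl
    exact h0 (by rw [h, zero_mul])
  have hG : G ≠ 0 := by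
    rintro rfl
    exact h0 (by rw [h, mul_zero])
  have hd : F.totalDegree + G.totalDegree ≤ 1 := by
    rw [← MvPolynomial.totalDegree_mul_of_isDomain hF hG, ← h]
    refine (MvPolynomial.totalDegree_add _ _).trans ?_
    simp
  have aux : ∀ H : MvPolynomial (Fin 2) ℂ, H ≠ 0 → H.totalDegree = 0 →
      ∃ r, r ≠ 0 ∧ H = MvPolynomial.C r := by
    intro H hH h
    rw [MvPolynomial.totalDegree_eq_zero_iff_eq_C] at h
    refine ⟨_, fun h' => hH ?_, h⟩
    rw [h, h', map_zero]
  rcases (by omega : F.totalDegree = 0 ∨ G.totalDegree = 0) with h1 | h1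
  · exact Or.inl (aux F hF h1)
  · exact Or.inr (aux G hG h1)

/-- The intersection of the three curves. -/
def tripleBasePoint (b : Fin 8 → ℂ) : SurfacePoint b :=
  pointOff b (OnePoint.infty, OnePoint.infty) (infty_infty_notMem b)

lemma eq_tripleBasePoint {x : SurfacePoint b} (h1 : (basePoint b x).1 = OnePoint.infty)
    (h2 : (basePoint b x).2 = OnePoint.infty) : x = tripleBasePoint b := by
  have h : basePoint b x = (OnePoint.infty, OnePoint.infty) := Prod.ext h1 h2
  rcases x with ⟨q, hq⟩ | ⟨i, t⟩
  · simp only [basePoint] at h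
    subst h
    rfl
  · exact (infty_infty_notMem b ⟨i, h⟩).elim

lemma liesOn_vertical {x : SurfacePoint b} (h : LiesOn b verticalClass 1 x) :
    (basePoint b x).1 = OnePoint.infty := by
  obtain ⟨c, hc, h0⟩ := exists_valAt_vertical x
  rw [LiesOn, mem_maximalIdeal, map_one, one_mul] at h
  exact h0 (hc.unique (isCoord_surfaceParameters b x) h)

lemma liesOn_horizontal {x : SurfacePoint b} (h : LiesOn b horizontalClass 1 x) :
    (basePoint b x).2 = OnePoint.infty := by
  obtain ⟨c, hc, h0⟩ := exists_valAt_horizontal x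
  rw [LiesOn, mem_maximalIdeal, map_one, one_mul] at h
  exact h0 (hc.unique (isCoord_surfaceParameters b x) h)

lemma liesOn_diagonal {x : SurfacePoint b}
    (h : LiesOn b diagonalClass (MvPolynomial.X 0 + MvPolynomial.X 1) x) :
    (basePoint b x).1 = OnePoint.infty ↔ (basePoint b x).2 = OnePoint.infty := by
  obtain ⟨c, hc, h0⟩ := exists_valAt_diagonal x
  rw [LiesOn, mem_maximalIdeal, algebraMap_diagonal] at h
  exact (h0 (hc.unique (isCoord_surfaceParameters b x) h)).1

lemma liesOn_vertical_tripleBasePoint : LiesOn b verticalClass 1 (tripleBasePoint b) := by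
  rw [LiesOn, mem_maximalIdeal, map_one, one_mul]
  refine Val.cast (valAt_inv_f_of_basePoint (x := tripleBasePoint b) rfl) ?_ rfl
  simp [tripleBasePoint, baseEquation, verticalClass]

lemma liesOn_horizontal_tripleBasePoint : LiesOn b horizontalClass 1 (tripleBasePoint b) := by
  rw [LiesOn, mem_maximalIdeal, map_one, one_mul]
  refine Val.cast (valAt_inv_g_of_basePoint (x := tripleBasePoint b) rfl) ?_ rfl
  simp [tripleBasePoint, baseEquation, horizontalClass]

lemma liesOn_diagonal_tripleBasePoint :
    LiesOn b diagonalClass (MvPolynomial.X 0 + MvPolynomial.X 1) (tripleBasePoint b) := by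
  rw [LiesOn, mem_maximalIdeal, algebraMap_diagonal]
  refine Val.cast ((valAt_inv_g_of_basePoint (x := tripleBasePoint b) rfl).add
    (valAt_inv_f_of_basePoint (x := tripleBasePoint b) rfl)) ?_ (by simp)
  have hf := f_ne_zero
  have hg := g_ne_zero
  simp only [tripleBasePoint, localEquation_pointOff, baseEquation, diagonalClass,
    OnePoint.elim_infty, zpow_one]
  field_simp

lemma isSection_vertical : IsSection b verticalClass 1 := by
  intro x
  obtain ⟨c, hc, -⟩ := exists_valAt_vertical x
  rw [map_one, one_mul]
  exact mem_localRing.2 ⟨c, hc⟩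

lemma isSection_horizontal : IsSection b horizontalClass 1 := by
  intro x
  obtain ⟨c, hc, -⟩ := exists_valAt_horizontal x
  rw [map_one, one_mul]
  exact mem_localRing.2 ⟨c, hc⟩

lemma isSection_diagonal :
    IsSection b diagonalClass (MvPolynomial.X 0 + MvPolynomial.X 1) := by
  intro x
  obtain ⟨c, hc, -⟩ := exists_valAt_diagonal x
  rw [algebraMap_diagonal]
  exact mem_localRing.2 ⟨c, hc⟩

lemma isPrimeCurve_vertical : IsPrimeCurve b verticalClass 1 := by
  refine ⟨one_ne_zero, isSection_vertical, ⟨_, liesOn_vertical_tripleBasePoint⟩, ?_⟩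
  intro D₁ D₂ F₁ F₂ hD hF h₁ h₂
  obtain ⟨r, hr, rfl⟩ := eq_C_of_mul_eq_one hF.symm
  obtain ⟨r', hr', rfl⟩ := eq_C_of_mul_eq_one (hF.trans (mul_comm _ _)).symm
  rcases (effective_of_isSection_C hr h₁).eq_zero_of_add_eq_vertical
    (effective_of_isSection_C hr' h₂) hD.symm with rfl | rfl
  · exact Or.inl (not_liesOn_zero hr)
  · exact Or.inr (not_liesOn_zero hr')

lemma isPrimeCurve_horizontal : IsPrimeCurve b horizontalClass 1 := by
  refine ⟨one_ne_zero, isSection_horizontal, ⟨_, liesOn_horizontal_tripleBasePoint⟩, ?_⟩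
  intro D₁ D₂ F₁ F₂ hD hF h₁ h₂
  obtain ⟨r, hr, rfl⟩ := eq_C_of_mul_eq_one hF.symm
  obtain ⟨r', hr', rfl⟩ := eq_C_of_mul_eq_one (hF.trans (mul_comm _ _)).symm
  rcases (effective_of_isSection_C hr h₁).eq_zero_of_add_eq_horizontal
    (effective_of_isSection_C hr' h₂) hD.symm with rfl | rfl
  · exact Or.inl (not_liesOn_zero hr)
  · exact Or.inr (not_liesOn_zero hr')

/-- A constant factor of the equation of the diagonal curve has no divisor. -/
lemma not_liesOn_of_mul_C {D₁ D₂ : Pic} {F : MvPolynomial (Fin 2) ℂ} {r : ℂ} (hr : r ≠ 0)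
    (hD : diagonalClass = D₁ + D₂)
    (hF : MvPolynomial.X 0 + MvPolynomial.X 1 = MvPolynomial.C r * F)
    (h₁ : IsSection b D₁ (MvPolynomial.C r)) (h₂ : IsSection b D₂ F) (x : SurfacePoint b) :
    ¬LiesOn b D₁ (MvPolynomial.C r) x := by
  have e : F = MvPolynomial.C r⁻¹ * (MvPolynomial.X 0 + MvPolynomial.X 1) := by
    rw [hF, ← mul_assoc, ← map_mul, inv_mul_cancel₀ hr, map_one, one_mul]
  rw [e] at h₂
  have h := (effective_of_isSection_C hr h₁).eq_zero_of_add_eq_zero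
    (effective_of_isSection_diagonal (inv_ne_zero hr) h₂) (by rw [hD]; abel)
  subst h
  exact not_liesOn_zero hr x

lemma isPrimeCurve_diagonal :
    IsPrimeCurve b diagonalClass (MvPolynomial.X 0 + MvPolynomial.X 1) := by
  refine ⟨fun h => ?_, isSection_diagonal, ⟨_, liesOn_diagonal_tripleBasePoint⟩, ?_⟩
  · have := congrArg (MvPolynomial.eval ![1, 0]) h
    simp at this
  · intro D₁ D₂ F₁ F₂ hD hF h₁ h₂
    rcases eq_C_of_mul_eq_diagonal hF with ⟨r, hr, rfl⟩ | ⟨r, hr, rfl⟩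
    · exact Or.inl (not_liesOn_of_mul_C hr hD hF h₁ h₂)
    · exact Or.inr (not_liesOn_of_mul_C hr (hD.trans (add_comm _ _)) (hF.trans (mul_comm _ _))
        h₂ h₁)

end

end SchlesingerA2

end

/-! ### Sections of -K: bidegree, conditions at the centres, uniqueness. -/

noncomputable section

namespace SchlesingerA2

/-! ### Uniqueness of the anticanonical divisor -/

/-- The exponent of the monomial `f ^ i g ^ j`. -/
def exponent (i j : ℕ) : Fin 2 →₀ ℕ := Finsupp.single 0 i + Finsupp.single 1 j

lemma exponent_apply (m : Fin 2 →₀ ℕ) : exponent (m 0) (m 1) = m := by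
  ext k
  fin_cases k <;> simp [exponent]

lemma exponent_injective {i j i' j' : ℕ} (h : exponent i j = exponent i' j') :
    i = i' ∧ j = j' := by
  have h0 := DFunLike.congr_fun h 0
  have h1 := DFunLike.congr_fun h 1
  simp [exponent] at h0 h1
  exact ⟨h0, h1⟩

lemma eq_sum_exponent {F : MvPolynomial (Fin 2) ℂ} {N : ℕ}
    (h : ∀ i j, F.coeff (exponent i j) ≠ 0 → i < N ∧ j < N) :
    F = ∑ i ∈ Finset.range N, ∑ j ∈ Finset.range N,
      MvPolynomial.monomial (exponent i j) (F.coeff (exponent i j)) := by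
  classical
  ext m
  simp only [MvPolynomial.coeff_sum, MvPolynomial.coeff_monomial]
  by_cases hm : F.coeff m = 0
  · rw [hm, Finset.sum_eq_zero]
    intro i _
    refine Finset.sum_eq_zero fun j _ => ?_
    split_ifs with e
    · rw [e, hm]
    · rfl
  · rw [← exponent_apply m] at hm ⊢
    have hN := h _ _ hm
    rw [Finset.sum_eq_single (m 0), Finset.sum_eq_single (m 1), if_pos rfl]
    · intro j _ hj
      exact if_neg fun e => hj (exponent_injective e).2
    · intro h'
      exact (h' (Finset.mem_range.2 hN.2)).elim
    · intro i _ hi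
      exact Finset.sum_eq_zero fun j _ => if_neg fun e => hi (exponent_injective e).1
    · intro h'
      exact (h' (Finset.mem_range.2 hN.1)).elim

lemma algebraMap_monomial_exponent (i j : ℕ) (c : ℂ) :
    algebraMap (MvPolynomial (Fin 2) ℂ) K (MvPolynomial.monomial (exponent i j) c) =
      const c * f ^ i * g ^ j := by
  have : MvPolynomial.monomial (exponent i j) c =
      MvPolynomial.C c * MvPolynomial.X 0 ^ i * MvPolynomial.X 1 ^ j := by
    rw [exponent, MvPolynomial.X_pow_eq_monomial, MvPolynomial.X_pow_eq_monomial,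
      MvPolynomial.C_mul_monomial, MvPolynomial.monomial_mul]
    simp
  rw [this, map_mul, map_mul, map_pow, map_pow, algebraMap_C]
  rfl

lemma exists_bound (F : MvPolynomial (Fin 2) ℂ) :
    ∃ N, ∀ i j, F.coeff (exponent i j) ≠ 0 → i < N ∧ j < N := by
  refine ⟨F.totalDegree + 1, fun i j h => ?_⟩
  have h1 := MvPolynomial.le_totalDegree (MvPolynomial.mem_support_iff.2 h)
  have : (exponent i j).sum (fun _ e => e) = i + j := by
    rw [Finsupp.sum_fintype _ _ (fun _ => rfl), Fin.sum_univ_two]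
    simp [exponent]
  rw [this] at h1
  omega

section
variable {u v : K}

lemma Val.sum {ι : Type*} {s : Finset ι} {h : ι → K} {c : ι → ℂ}
    (H : ∀ i ∈ s, Val u v (h i) (c i)) : Val u v (∑ i ∈ s, h i) (∑ i ∈ s, c i) := by
  classical
  induction s using Finset.induction_on with
  | empty => simpa using val_zero u v
  | insert i s hi ih =>
    rw [Finset.sum_insert hi, Finset.sum_insert hi]
    exact (H i (Finset.mem_insert_self _ _)).add
      (ih fun j hj => H j (Finset.mem_insert_of_mem hj))

lemma Val.polynomial_aeval {h : K} {c : ℂ} (H : Val u v h c) (p : Polynomial ℂ) :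
    Val u v (Polynomial.aeval h p) (p.eval c) := by
  induction p using Polynomial.induction_on' with
  | add p q hp hq => simpa using hp.add hq
  | monomial n a =>
    rw [Polynomial.aeval_monomial, Polynomial.eval_monomial]
    exact (val_const _ _ a).mul (H.pow n)

end

/-- A function with a double pole along `u = ∞` has degree at most two in `u`. -/
lemma coefficient_eq_zero {u v F : K} {A : ℕ → Polynomial ℂ} {N : ℕ} (hu : u ≠ 0)
    (hF : F = ∑ i ∈ Finset.range N, u ^ i * Polynomial.aeval v (A i))
    (H : {β : ℂ | ∃ U V, IsCoord U V ∧ Val U V u⁻¹ 0 ∧ Val U V v β ∧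
      ∃ c, Val U V (F * u⁻¹ ^ 2) c}.Infinite) : ∀ i < N, 3 ≤ i → A i = 0 := by
  induction N with
  | zero => exact fun i hi => absurd hi (Nat.not_lt_zero i)
  | succ N ih =>
    intro i hi h3
    -- Multiplied by u^(-N) with N > 2, F vanishes along u = ∞, while its expansion tends to the
    -- leading coefficient at v = β; so that coefficient has infinitely many roots.
    have hN : A N = 0 := by
      refine Polynomial.eq_zero_of_infinite_isRoot _ (H.mono ?_)
      rintro β ⟨U, V, hc, h0, hβ, c, hc'⟩
      have e1 := hc'.mul (h0.pow (N - 2))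
      rw [zero_pow (by omega), mul_zero] at e1
      have e2 := (Val.sum (s := Finset.range N) (h := fun i => u⁻¹ ^ (N - i) *
        Polynomial.aeval v (A i)) (c := fun i => 0 ^ (N - i) * (A i).eval β) (fun i _ =>
          (h0.pow (N - i)).mul (hβ.polynomial_aeval (A i)))).add (hβ.polynomial_aeval (A N))
      have e3 : ∑ i ∈ Finset.range N, (0 : ℂ) ^ (N - i) * (A i).eval β = 0 := by
        refine Finset.sum_eq_zero fun i hi => ?_
        have := Finset.mem_range.1 hi
        rw [zero_pow (by omega), zero_mul]
      rw [e3, zero_add] at e2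
      refine (e1.cast ?_ rfl).unique hc e2 |>.symm
      rw [hF, mul_assoc, ← pow_add, show 2 + (N - 2) = N by omega, Finset.sum_range_succ, add_mul,
        Finset.sum_mul]
      congr 1
      · refine Finset.sum_congr rfl fun i hi => ?_
        have hiN := Finset.mem_range.1 hi
        have e : u⁻¹ ^ N = u⁻¹ ^ i * u⁻¹ ^ (N - i) := by
          rw [← pow_add]
          congr 1
          omega
        have e' : u ^ i * u⁻¹ ^ i = 1 := by rw [← mul_pow, mul_inv_cancel₀ hu, one_pow]
        rw [e]
        linear_combination (u⁻¹ ^ (N - i) * Polynomial.aeval v (A i)) * e'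
      · have e' : u ^ N * u⁻¹ ^ N = 1 := by rw [← mul_pow, mul_inv_cancel₀ hu, one_pow]
        linear_combination Polynomial.aeval v (A N) * e'
    rcases (by omega : i = N ∨ i < N) with rfl | hi'
    · exact hN
    · refine ih ?_ i hi' h3
      rw [hF, Finset.sum_range_succ, hN, map_zero, mul_zero, add_zero]

lemma coeff_eq_zero_of_polynomial {N : ℕ} {c : ℕ → ℂ}
    (h : ∑ j ∈ Finset.range N, Polynomial.monomial j (c j) = 0) {j : ℕ} (hj : j < N) :
    c j = 0 := by
  have := congrArg (fun p => Polynomial.coeff p j) h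
  simp only [Polynomial.finsetSum_coeff, Polynomial.coeff_monomial, Polynomial.coeff_zero] at this
  rwa [Finset.sum_ite_eq' (Finset.range N) j c, if_pos (Finset.mem_range.2 hj)] at this

lemma antiCanonical_eq : antiCanonical = (2, 2, ![-1, -1, -1, -1, -1, -1, -1, -1]) := by decide

lemma antiCanonical_exceptional : ∀ i : Fin 8, antiCanonical.2.2 i = -1 := by decide

section
variable {b : Fin 8 → ℂ} {F : MvPolynomial (Fin 2) ℂ}

/-- Along f = ∞ and along g = ∞ a section of -K has at most double poles at all but two finite
points, so `coefficient_eq_zero` bounds the degree in each variable by two. -/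
lemma isSection_antiCanonical_degree (h : IsSection b antiCanonical F) :
    ∀ i j, F.coeff (exponent i j) ≠ 0 → i < 3 ∧ j < 3 := by
  obtain ⟨N, hN⟩ := exists_bound F
  have hsum : algebraMap (MvPolynomial (Fin 2) ℂ) K F = ∑ i ∈ Finset.range N,
      ∑ j ∈ Finset.range N, const (F.coeff (exponent i j)) * f ^ i * g ^ j := by
    conv_lhs => rw [eq_sum_exponent hN]
    simp only [map_sum, algebraMap_monomial_exponent]
  have hf : ∀ i < N, 3 ≤ i → ∑ j ∈ Finset.range N,
      Polynomial.monomial j (F.coeff (exponent i j)) = 0 := by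
    refine coefficient_eq_zero (u := f) (v := g) f_ne_zero (A := fun i => ∑ j ∈ Finset.range N,
      Polynomial.monomial j (F.coeff (exponent i j)))
      (F := algebraMap (MvPolynomial (Fin 2) ℂ) K F) ?_ ?_
    · rw [hsum]
      refine Finset.sum_congr rfl fun i _ => ?_
      rw [map_sum, Finset.mul_sum]
      refine Finset.sum_congr rfl fun j _ => ?_
      rw [Polynomial.aeval_monomial, ← const]
      ring
    · refine Set.Infinite.mono ?_ (Set.Finite.infinite_compl (Set.toFinite {b 4, b 5}))
      intro β hβ
      simp only [Set.mem_compl_iff, Set.mem_insert_iff, Set.mem_singleton_iff, not_or] at hβ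
      have hx := infty_coe_notMem b hβ.1 hβ.2
      obtain ⟨c, hc⟩ := mem_localRing.1 (h (pointOff b _ hx))
      refine ⟨_, _, isCoord_surfaceParameters b (pointOff b _ hx),
        valAt_inv_f_of_basePoint rfl, valAt_g_of_basePoint rfl, c, hc.cast ?_ rfl⟩
      rw [localEquation_pointOff, antiCanonical_eq]
      simp [baseEquation]
  have hg : ∀ j < N, 3 ≤ j → ∑ i ∈ Finset.range N,
      Polynomial.monomial i (F.coeff (exponent i j)) = 0 := by
    refine coefficient_eq_zero (u := g) (v := f) g_ne_zero (A := fun j => ∑ i ∈ Finset.range N,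
      Polynomial.monomial i (F.coeff (exponent i j)))
      (F := algebraMap (MvPolynomial (Fin 2) ℂ) K F) ?_ ?_
    · rw [hsum, Finset.sum_comm]
      refine Finset.sum_congr rfl fun i _ => ?_
      rw [map_sum, Finset.mul_sum]
      refine Finset.sum_congr rfl fun j _ => ?_
      rw [Polynomial.aeval_monomial, ← const]
      ring
    · refine Set.Infinite.mono ?_ (Set.Finite.infinite_compl (Set.toFinite {-b 6, -b 7}))
      intro β hβ
      simp only [Set.mem_compl_iff, Set.mem_insert_iff, Set.mem_singleton_iff, not_or] at hβ
      have hx := coe_infty_notMem b hβ.1 hβ.2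
      obtain ⟨c, hc⟩ := mem_localRing.1 (h (pointOff b _ hx))
      refine ⟨_, _, isCoord_surfaceParameters b (pointOff b _ hx),
        valAt_inv_g_of_basePoint rfl, valAt_f_of_basePoint rfl, c, hc.cast ?_ rfl⟩
      rw [localEquation_pointOff, antiCanonical_eq]
      simp [baseEquation]
  intro i j hij
  have hN' := hN i j hij
  constructor
  · by_contra! h3
    exact hij (coeff_eq_zero_of_polynomial (hf i hN'.1 h3) hN'.2)
  · by_contra! h3
    exact hij (coeff_eq_zero_of_polynomial (hg j hN'.2 h3) hN'.1)

/-- The section vanishes on each exceptional curve. -/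
lemma isSection_antiCanonical_valAt (h : IsSection b antiCanonical F) (i : Fin 8) :
    ValAt b (pointOn b i ((0 : ℂ) : OnePoint ℂ))
      (algebraMap (MvPolynomial (Fin 2) ℂ) K F * baseEquation antiCanonical (center b i)) 0 := by
  obtain ⟨c, hc⟩ := mem_localRing.1 (h (pointOn b i ((0 : ℂ) : OnePoint ℂ)))
  have hb := (valAt_baseParameters b (pointOn b i ((0 : ℂ) : OnePoint ℂ))).1
  rw [basePoint_pointOn] at hb
  have n1 := (generate_baseParameters (center b i)).isCoord.left_ne_zero
  refine (hc.mul hb).cast ?_ (mul_zero c)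
  rw [localEquation_pointOn, antiCanonical_exceptional, exceptionalEquation_coe, zpow_neg_one]
  field_simp

end

/-- A cubic with four distinct roots vanishes. -/
lemma cubic_eq_zero {c₀ c₁ c₂ c₃ : ℂ} {r : Fin 4 → ℂ} (hr : Function.Injective r)
    (h : ∀ i, c₃ * r i ^ 3 + c₂ * r i ^ 2 + c₁ * r i + c₀ = 0) :
    c₃ = 0 ∧ c₂ = 0 ∧ c₁ = 0 ∧ c₀ = 0 := by
  have hne : ∀ i j, i ≠ j → r i - r j ≠ 0 := fun i j hij => sub_ne_zero.2 fun e => hij (hr e)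
  have d1 : ∀ i, i ≠ 0 → c₃ * (r 0 ^ 2 + r 0 * r i + r i ^ 2) + c₂ * (r 0 + r i) + c₁ = 0 := by
    intro i hi
    refine mul_left_cancel₀ (hne 0 i hi.symm) ?_
    linear_combination h 0 - h i
  have d2 : ∀ i, i ≠ 0 → i ≠ 1 → c₃ * (r 0 + r 1 + r i) + c₂ = 0 := by
    intro i h0 h1
    refine mul_left_cancel₀ (hne 1 i h1.symm) ?_
    linear_combination d1 1 (by decide) - d1 i h0
  have e3 : c₃ = 0 := by
    refine mul_left_cancel₀ (hne 2 3 (by decide)) ?_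
    linear_combination d2 2 (by decide) (by decide) - d2 3 (by decide) (by decide)
  have e2 : c₂ = 0 := by
    linear_combination d2 2 (by decide) (by decide) - (r 0 + r 1 + r 2) * e3
  have e1 : c₁ = 0 := by
    linear_combination d1 1 (by decide) - (r 0 ^ 2 + r 0 * r 1 + r 1 ^ 2) * e3 - (r 0 + r 1) * e2
  exact ⟨e3, e2, e1, by linear_combination h 0 - r 0 ^ 3 * e3 - r 0 ^ 2 * e2 - r 0 * e1⟩

section
variable {b : Fin 8 → ℂ} {F : MvPolynomial (Fin 2) ℂ}

/-- A polynomial of bidegree (2, 2) is restricted to the three curves. On f = ∞ and g = ∞ the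
centres give both roots of a quadratic, on f + g = 0 all four roots of a quartic, always with
leading coefficient c 2 2. Comparing subleading coefficients gives c 2 2 · δ = 0; once c 2 2
vanishes, only multiples of f + g remain. -/
lemma eq_of_isSection_antiCanonical (hb : Function.Injective (center b)) (hδ : delta b ≠ 0)
    (h : IsSection b antiCanonical F) :
    ∃ c, F = MvPolynomial.C c * (MvPolynomial.X 0 + MvPolynomial.X 1) := by
  have hdeg := eq_sum_exponent (isSection_antiCanonical_degree h)
  obtain ⟨c, hc⟩ : ∃ c : ℕ → ℕ → ℂ, ∀ i j, F.coeff (exponent i j) = c i j := ⟨_, fun _ _ => rfl⟩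
  simp only [hc] at hdeg
  have hK : algebraMap (MvPolynomial (Fin 2) ℂ) K F =
      (const (c 0 0) + const (c 0 1) * g + const (c 0 2) * g ^ 2) +
      (const (c 1 0) + const (c 1 1) * g + const (c 1 2) * g ^ 2) * f +
      (const (c 2 0) + const (c 2 1) * g + const (c 2 2) * g ^ 2) * f ^ 2 := by
    rw [hdeg]
    simp only [map_sum, algebraMap_monomial_exponent]
    simp only [Finset.sum_range_succ, Finset.sum_range_zero]
    ring
  have hf := f_ne_zero
  have hg := g_ne_zero
  have hval := isSection_antiCanonical_valAt h
  have hx := fun i => isCoord_surfaceParameters b (pointOn b i ((0 : ℂ) : OnePoint ℂ))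
  have v4 : ∀ i : Fin 8, i.val < 4 → c 2 2 * b i ^ 4 + (c 1 2 - c 2 1) * b i ^ 3 +
      (c 0 2 - c 1 1 + c 2 0) * b i ^ 2 + (c 1 0 - c 0 1) * b i + c 0 0 = 0 := by
    intro i hi
    have hce : center b i = ((b i : OnePoint ℂ), ((-b i : ℂ) : OnePoint ℂ)) := by
      rw [center_eq_ite, if_pos hi]
    obtain ⟨x, hxe⟩ : ∃ x, x = pointOn b i ((0 : ℂ) : OnePoint ℂ) := ⟨_, rfl⟩
    have hxc : basePoint b x = center b i := by rw [hxe, basePoint_pointOn]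
    have vf : ValAt b x f (b i) := valAt_f_of_basePoint (by rw [hxc, hce])
    have vg : ValAt b x g (-b i) := valAt_g_of_basePoint (by rw [hxc, hce])
    have vc := val_const (surfaceParameters b x).1 (surfaceParameters b x).2
    have vi := hval i
    have hxi := hx i
    rw [← hxe, hce, antiCanonical_eq] at vi
    rw [← hxe] at hxi
    simp only [baseEquation, OnePoint.elim_some, mul_one] at vi
    rw [hK] at vi
    have := vi.unique hxi (((((vc (c 0 0)).add ((vc (c 0 1)).mul vg)).add
      ((vc (c 0 2)).mul (vg.pow 2))).add ((((vc (c 1 0)).add ((vc (c 1 1)).mul vg)).add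
      ((vc (c 1 2)).mul (vg.pow 2))).mul vf)).add ((((vc (c 2 0)).add ((vc (c 2 1)).mul vg)).add
      ((vc (c 2 2)).mul (vg.pow 2))).mul (vf.pow 2)))
    linear_combination -this
  have v6 : ∀ i : Fin 8, ¬i.val < 4 → i.val < 6 →
      c 2 2 * b i ^ 2 + c 2 1 * b i + c 2 0 = 0 := by
    intro i hi hi'
    have hce : center b i = (OnePoint.infty, (b i : OnePoint ℂ)) := by
      rw [center_eq_ite, if_neg hi, if_pos hi']
    obtain ⟨x, hxe⟩ : ∃ x, x = pointOn b i ((0 : ℂ) : OnePoint ℂ) := ⟨_, rfl⟩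
    have hxc : basePoint b x = center b i := by rw [hxe, basePoint_pointOn]
    have vf : ValAt b x f⁻¹ 0 := valAt_inv_f_of_basePoint (by rw [hxc, hce])
    have vg : ValAt b x g (b i) := valAt_g_of_basePoint (by rw [hxc, hce])
    have vc := val_const (surfaceParameters b x).1 (surfaceParameters b x).2
    have vi := hval i
    have hxi := hx i
    rw [← hxe, hce, antiCanonical_eq] at vi
    rw [← hxe] at hxi
    simp only [baseEquation, OnePoint.elim_some, OnePoint.elim_infty, mul_one] at vi
    rw [hK] at vi
    have := vi.unique hxi ((((((vc (c 0 0)).add ((vc (c 0 1)).mul vg)).add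
      ((vc (c 0 2)).mul (vg.pow 2))).mul (vf.pow 2)).add ((((vc (c 1 0)).add
      ((vc (c 1 1)).mul vg)).add ((vc (c 1 2)).mul (vg.pow 2))).mul vf)).add
      (((vc (c 2 0)).add ((vc (c 2 1)).mul vg)).add ((vc (c 2 2)).mul (vg.pow 2))) |>.cast
      (by rw [show (f⁻¹ : K) ^ (2 : ℤ) = f⁻¹ ^ 2 from zpow_natCast f⁻¹ 2]; field_simp) rfl)
    linear_combination -this
  have v8 : ∀ i : Fin 8, ¬i.val < 6 →
      c 2 2 * b i ^ 2 - c 1 2 * b i + c 0 2 = 0 := by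
    intro i hi'
    have hi : ¬i.val < 4 := by omega
    have hce : center b i = (((-b i : ℂ) : OnePoint ℂ), OnePoint.infty) := by
      rw [center_eq_ite, if_neg hi, if_neg hi']
    obtain ⟨x, hxe⟩ : ∃ x, x = pointOn b i ((0 : ℂ) : OnePoint ℂ) := ⟨_, rfl⟩
    have hxc : basePoint b x = center b i := by rw [hxe, basePoint_pointOn]
    have vf : ValAt b x f (-b i) := valAt_f_of_basePoint (by rw [hxc, hce])
    have vg : ValAt b x g⁻¹ 0 := valAt_inv_g_of_basePoint (by rw [hxc, hce])
    have vc := val_const (surfaceParameters b x).1 (surfaceParameters b x).2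
    have vi := hval i
    have hxi := hx i
    rw [← hxe, hce, antiCanonical_eq] at vi
    rw [← hxe] at hxi
    simp only [baseEquation, OnePoint.elim_some, OnePoint.elim_infty, one_mul] at vi
    rw [hK] at vi
    have := vi.unique hxi ((((((vc (c 0 0)).add ((vc (c 1 0)).mul vf)).add
      ((vc (c 2 0)).mul (vf.pow 2))).mul (vg.pow 2)).add ((((vc (c 0 1)).add
      ((vc (c 1 1)).mul vf)).add ((vc (c 2 1)).mul (vf.pow 2))).mul vg)).add
      (((vc (c 0 2)).add ((vc (c 1 2)).mul vf)).add ((vc (c 2 2)).mul (vf.pow 2))) |>.cast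
      (by rw [show (g⁻¹ : K) ^ (2 : ℤ) = g⁻¹ ^ 2 from zpow_natCast g⁻¹ 2]; field_simp; ring) rfl)
    linear_combination -this
  have n45 : b 4 - b 5 ≠ 0 := sub_ne_zero.2 fun e => absurd (hb (a₁ := 4) (a₂ := 5)
    (by simp [center, e])) (by decide)
  have n67 : b 6 - b 7 ≠ 0 := sub_ne_zero.2 fun e => absurd (hb (a₁ := 6) (a₂ := 7)
    (by simp [center, e])) (by decide)
  have e21 : c 2 1 = -c 2 2 * (b 4 + b 5) := by
    refine mul_left_cancel₀ n45 ?_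
    linear_combination v6 4 (by decide) (by decide) - v6 5 (by decide) (by decide)
  have e12 : c 1 2 = c 2 2 * (b 6 + b 7) := by
    refine mul_left_cancel₀ n67 ?_
    linear_combination -v8 6 (by decide) + v8 7 (by decide)
  obtain ⟨r, hr⟩ : ∃ r : Fin 4 → ℂ, r = ![b 0, b 1, b 2, b 3] := ⟨_, rfl⟩
  have hrb : ∀ i, r i = b (Fin.castLE (by decide) i) := by
    intro i
    fin_cases i <;> rw [hr] <;> rfl
  have hri : Function.Injective r := by
    intro i j hij
    rw [hrb, hrb] at hij
    have hi : (Fin.castLE (by decide : 4 ≤ 8) i).val < 4 := i.isLt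
    have hj : (Fin.castLE (by decide : 4 ≤ 8) j).val < 4 := j.isLt
    have := hb (a₁ := Fin.castLE (by decide) i) (a₂ := Fin.castLE (by decide) j) (by
      rw [center_eq_ite, center_eq_ite, if_pos hi, if_pos hj, hij])
    exact Fin.castLE_injective _ this
  -- Subtracting c 2 2 times the monic quartic with roots b 0, …, b 3 leaves a cubic with four
  -- roots.
  obtain ⟨z3, z2, z1, z0⟩ := cubic_eq_zero hri
    (c₃ := c 1 2 - c 2 1 + c 2 2 * (b 0 + b 1 + b 2 + b 3))
    (c₂ := c 0 2 - c 1 1 + c 2 0 - c 2 2 * (b 0 * b 1 + b 0 * b 2 + b 0 * b 3 + b 1 * b 2 +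
      b 1 * b 3 + b 2 * b 3))
    (c₁ := c 1 0 - c 0 1 + c 2 2 * (b 0 * b 1 * b 2 + b 0 * b 1 * b 3 + b 0 * b 2 * b 3 +
      b 1 * b 2 * b 3)) (c₀ := c 0 0 - c 2 2 * (b 0 * b 1 * b 2 * b 3)) (fun i => by
      have e : (r i - b 0) * (r i - b 1) * (r i - b 2) * (r i - b 3) = 0 := by
        rw [hr]
        fin_cases i <;> simp
      have := v4 (Fin.castLE (by decide) i) i.isLt
      rw [← hrb] at this
      linear_combination this - c 2 2 * e)
  -- Combining the three Vieta relations gives the sum of all eight parameters; this is the one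
  -- place where δ ≠ 0 enters.
  have e22 : c 2 2 = 0 := by
    refine (mul_eq_zero.1 ?_).resolve_right hδ
    simp only [delta, Fin.sum_univ_eight]
    linear_combination z3 - e12 + e21
  rw [e22] at e21 e12 z2 z1 z0
  have f20 : c 2 0 = 0 := by
    linear_combination v6 4 (by decide) (by decide) - b 4 ^ 2 * e22 - b 4 * e21
  have f02 : c 0 2 = 0 := by
    linear_combination v8 6 (by decide) - b 6 ^ 2 * e22 + b 6 * e12
  have f21 : c 2 1 = 0 := by linear_combination e21
  have f12 : c 1 2 = 0 := by linear_combination e12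
  have f11 : c 1 1 = 0 := by linear_combination f02 + f20 - z2
  have f01 : c 0 1 = c 1 0 := by linear_combination -z1
  have f00 : c 0 0 = 0 := by linear_combination z0
  refine ⟨c 1 0, algebraMap_K_injective ?_⟩
  rw [hK, map_mul, algebraMap_C, algebraMap_diagonal, e22, f20, f02, f21, f12, f11, f01, f00,
    const_zero]
  ring

/-- The surface has type `A₂⁽¹⁾*`. -/
theorem hasTypeA2Star (hb : Function.Injective (center b)) (hδ : delta b ≠ 0) :
    HasTypeA2Star b := by
  have hsum : ∑ k, (![diagonalClass, verticalClass, horizontalClass] : Fin 3 → Pic) k =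
      antiCanonical := by decide
  refine ⟨hb, ![diagonalClass, verticalClass, horizontalClass],
    ![MvPolynomial.X 0 + MvPolynomial.X 1, 1, 1], fun k => ?_, hsum, fun F => ?_, by decide,
    tripleBasePoint b, fun k l hkl x => ⟨fun hx => ?_, fun hx => ?_⟩⟩
  · fin_cases k
    exacts [isPrimeCurve_diagonal, isPrimeCurve_vertical, isPrimeCurve_horizontal]
  · have hp : ∏ k, (![MvPolynomial.X 0 + MvPolynomial.X 1, 1, 1] :
        Fin 3 → MvPolynomial (Fin 2) ℂ) k = MvPolynomial.X 0 + MvPolynomial.X 1 := by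
      simp [Fin.prod_univ_three]
    rw [hp]
    refine ⟨eq_of_isSection_antiCanonical hb hδ, ?_⟩
    rintro ⟨c, rfl⟩ x
    have e : antiCanonical = diagonalClass + (verticalClass + horizontalClass) := by decide
    have h1 := isSection_diagonal (b := b) x
    have h2 := isSection_vertical (b := b) x
    have h3 := isSection_horizontal (b := b) x
    rw [map_one, one_mul] at h2 h3
    rw [e, localEquation_add, localEquation_add, map_mul, algebraMap_C]
    have h0 : const c ∈ localRing b x := mem_localRing.2 ⟨c, val_const _ _ c⟩
    convert mul_mem_localRing h0 (mul_mem_localRing h1 (mul_mem_localRing h2 h3)) using 1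
    ring
  · obtain ⟨hk, hl⟩ := hx
    fin_cases k <;> fin_cases l
    · exact (hkl rfl).elim
    · exact eq_tripleBasePoint (liesOn_vertical hl) ((liesOn_diagonal hk).1 (liesOn_vertical hl))
    · exact eq_tripleBasePoint ((liesOn_diagonal hk).2 (liesOn_horizontal hl))
        (liesOn_horizontal hl)
    · exact eq_tripleBasePoint (liesOn_vertical hk) ((liesOn_diagonal hl).1 (liesOn_vertical hk))
    · exact (hkl rfl).elim
    · exact eq_tripleBasePoint (liesOn_vertical hk) (liesOn_horizontal hl)
    · exact eq_tripleBasePoint ((liesOn_diagonal hl).2 (liesOn_horizontal hk))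
        (liesOn_horizontal hk)
    · exact eq_tripleBasePoint (liesOn_vertical hl) (liesOn_horizontal hk)
    · exact (hkl rfl).elim
  · subst hx
    have H : ∀ k, LiesOn b ((![diagonalClass, verticalClass, horizontalClass] : Fin 3 → Pic) k)
        ((![MvPolynomial.X 0 + MvPolynomial.X 1, 1, 1] : Fin 3 → MvPolynomial (Fin 2) ℂ) k)
        (tripleBasePoint b) := by
      intro k
      fin_cases k
      exacts [liesOn_diagonal_tripleBasePoint, liesOn_vertical_tripleBasePoint,
        liesOn_horizontal_tripleBasePoint]
    exact ⟨H k, H l⟩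

end

end SchlesingerA2

end

/-! ### Assembly: parameters, translations, and inequivalence of the dynamics. -/

noncomputable section

namespace SchlesingerA2

/-! ### The two dynamics -/

lemma parameters_composition_target (s : RiemannScheme) :
    parameters (composition.target s) = evolve (parameters s) := by
  obtain ⟨h00, h01, h10, h11⟩ := composition_target_θ s
  have hκ := composition_target_κ s
  rw [evolve, delta_parameters]
  funext i
  fin_cases i <;> simp [parameters, h00, h01, h10, h11, hκ] <;> ring

/-- The pull-back of the elementary transformation `{1 2; 1 1}`. -/
def schlesingerEquiv (s : RiemannScheme) : K ≃ₐ[ℂ] K :=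
  (elementaryEquiv (parameters (s.shift 0 1 0 0))).symm

lemma schlesinger_surfaceIso {s : RiemannScheme}
    (hb : Distinct (parameters (s.shift 0 1 0 0)))
    (h : Stage.Admissible elementaryWord (parameters (s.shift 0 1 0 0))) :
    SurfaceIso (parameters s) (parameters (s.shift 0 1 0 0)) (schlesingerEquiv s)
      schlesingerAction := by
  have := (elementary_surfaceIso hb.injective h).symm elementaryAction_schlesingerAction
  rwa [elementaryParameters_parameters, shift_shift] at this

lemma hasTypeA2Star_parameters {s : RiemannScheme}
    (hb : Function.Injective (center (parameters s))) : HasTypeA2Star (parameters s) :=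
  hasTypeA2Star hb (by rw [delta_parameters]; norm_num)

lemma isTranslation_schlesingerAction :
    IsTranslation schlesingerAction ![0, 0, 0, -1, 1, 1, -1] := by
  unfold IsTranslation
  decide

lemma isTranslation_standardAction : IsTranslation standardAction ![0, 0, 0, 1, 0, -1, 0] := by
  unfold IsTranslation
  decide

lemma iterate_schlesinger_θ (Ψ : RiemannScheme → (K ≃ₐ[ℂ] K)) (m : ℕ) (s : RiemannScheme) :
    (DiscreteSystem.iterate (fun s => ((schlesinger 0 1 0 0).target s, Ψ s)) m s).1.θ 0 1 =
      s.θ 0 1 := by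
  induction m with
  | zero => rfl
  | succ m ih =>
    rw [← ih]
    simp [DiscreteSystem.iterate, schlesinger, RiemannScheme.shift]

lemma iterate_composition_θ (Φ : RiemannScheme → (K ≃ₐ[ℂ] K)) (n : ℕ) (s : RiemannScheme) :
    (DiscreteSystem.iterate (fun s => (composition.target s, Φ s)) n s).1.θ 0 1 =
      s.θ 0 1 - n := by
  induction n with
  | zero => simp [DiscreteSystem.iterate]
  | succ n ih =>
    rw [DiscreteSystem.iterate, (composition_target_θ _).2.1, ih]
    push_cast
    ring

/-- A conjugacy over fixed s requires equal targets, but θ_1^2 is unchanged by the first dynamics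
and lowered by n under n steps of the second. A single scheme in the open set suffices, whatever the
birational maps are. -/
lemma not_conjugate (Ψ Φ : RiemannScheme → (K ≃ₐ[ℂ] K)) (m : ℕ) {n : ℕ} (hn : 0 < n) :
    ¬ConjugateByCoordinateChange
      (DiscreteSystem.iterate (fun s => ((schlesinger 0 1 0 0).target s, Ψ s)) m)
      (DiscreteSystem.iterate (fun s => (composition.target s, Φ s)) n) := by
  rintro ⟨χ, P, ⟨s, hs⟩, h⟩
  have e := congrArg (fun z => z.1.θ 0 1) (h s hs)
  simp only [iterate_schlesinger_θ, iterate_composition_θ] at e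
  have : (n : ℂ) = 0 := by linear_combination e
  exact hn.ne' (Nat.cast_eq_zero.1 this)

lemma genericAt_schlesinger : GenericAt sampleScheme fun s =>
    Distinct (parameters (s.shift 0 1 0 0)) ∧
      Stage.Admissible elementaryWord (parameters (s.shift 0 1 0 0)) ∧
      (s.shift 0 1 0 0).ElementaryRegular :=
  have h := PolyScheme.id.shift 0 1 0 0
  (h.parameters.genericAt_distinct distinct_sampleScheme_shift).and
    ((h.parameters.genericAt_admissible _ admissible_elementary_sampleScheme).and
      (genericAt_elementaryRegular h elementaryRegular_sampleScheme))

lemma genericAt_composition : GenericAt sampleScheme fun s =>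
    Distinct (parameters s) ∧ Stage.Admissible standardWord (parameters s) ∧
      s.CompositionRegular :=
  (PolyScheme.id.parameters.genericAt_distinct distinct_sampleScheme).and
    ((PolyScheme.id.parameters.genericAt_admissible _ admissible_standard_sampleScheme).and
      (genericAt_compositionRegular compositionRegular_sampleScheme))

end SchlesingerA2

end

open SchlesingerA2 in
theorem mainTheorem4 :
    ∃ Ψ Φ : RiemannScheme → (K ≃ₐ[ℂ] K),
      -- the elementary Schlesinger transformation `{1 2; 1 1}` and its space of initial conditions
      (ForGenericScheme fun s =>
        IsCoordinateFormOf (schlesinger 0 1 0 0) s (Ψ s) ∧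
        HasTypeA2Star (parameters s) ∧
        HasTypeA2Star (parameters ((schlesinger 0 1 0 0).target s)) ∧
        LiftsToIsomorphism (parameters s) (parameters ((schlesinger 0 1 0 0).target s)) (Ψ s) ∧
        HasPushForward (parameters s) (parameters ((schlesinger 0 1 0 0).target s)) (Ψ s)
          schlesingerAction) ∧
      IsTranslation schlesingerAction ![0, 0, 0, -1, 1, 1, -1] ∧
      -- the standard equation is the composition
      (∀ s, delta (parameters s) = -1 ∧
        parameters (composition.target s) = evolve (parameters s)) ∧
      (ForGenericScheme fun s =>
        IsStandardDP (parameters s) (Φ s) ∧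
        IsCoordinateFormOf composition s (Φ s) ∧
        LiftsToIsomorphism (parameters s) (evolve (parameters s)) (Φ s) ∧
        HasPushForward (parameters s) (evolve (parameters s)) (Φ s) standardAction) ∧
      IsTranslation standardAction ![0, 0, 0, 1, 0, -1, 0] ∧
      -- no iterates of the two dynamics are conjugate by a change of coordinates
      (∀ m n : ℕ, 0 < m → 0 < n → ¬ ConjugateByCoordinateChange
        (DiscreteSystem.iterate (fun s => ((schlesinger 0 1 0 0).target s, Ψ s)) m)
        (DiscreteSystem.iterate (fun s => (composition.target s, Φ s)) n)) := by
  refine ⟨schlesingerEquiv, fun s => standardEquiv (parameters s), ?_,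
    isTranslation_schlesingerAction,
    fun s => ⟨delta_parameters s, parameters_composition_target s⟩, ?_,
    isTranslation_standardAction, fun m n _ hn => not_conjugate _ _ m hn⟩
  · refine (genericAt_schlesinger.mono ?_).forGenericScheme
    rintro s ⟨hd, ha, hr⟩
    have H := schlesinger_surfaceIso hd ha
    exact ⟨isCoordinateFormOf_schlesinger hr, hasTypeA2Star_parameters H.source,
      hasTypeA2Star_parameters H.target, H.lifts, H.pushForward⟩
  · refine (genericAt_composition.mono ?_).forGenericScheme
    rintro s ⟨hd, ha, hr⟩
    have H := standard_surfaceIso hd.injective ha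
    exact ⟨standard_isStandardDP _, isCoordinateFormOf_composition hr, H.lifts, H.pushForward⟩
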